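/- Let $\Omega\subset\mathbb{R}^d$ ($d\ge 1$) be a bounded Lipschitz domain, $J=(0,T)$ with $0<T<\infty$, and write $L^p(X)=L^p(J;X)$, $H^k(X)=H^k(J;X)$ for the Bochner and Sobolev–Bochner spaces (with weak time derivatives), and $H^{-1}(\Omega)=H^1_0(\Omega)'$, into which $L^2(\Omega)$ is embedded by the $L^2(\Omega)$ inner product. Let $J_h$ be the partition of $J$ into $N\geq 1$ intervals of equal length $h=T/N$, with nodes $t_k=kh$, and let $\Omega_h$ be an admissible partition of $\overline\Omega$ into finitely many $d$-simplices (no hanging nodes) that is uniform of mesh size $h$: for a fixed constant $\kappa>0$, each simplex has diameter at most $\kappa h$ and contains a ball of radius $h/\kappa$. Let $\mathcal S^1(\Omega_h)$ be the space of functions that are continuous on $\overline\Omega$ and affine on each simplex, let $\mathcal S^1_0(\Omega_h)$ be the subspace of those that vanish on $\partial\Omega$, and let $\Pi_h$, $\Pi_{0,h}$ be the $L^2(\Omega)$-orthogonal projections of $L^2(\Omega)$ onto $\mathcal S^1(\Omega_h)$, $\mathcal S^1_0(\Omega_h)$. For a subspace $V$ of $L^2(\Omega)$, let $\mathcal S^1(J_h;V)$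 be the space of continuous functions $\overline J\to V$ that are affine on each interval of $J_h$, and let $\mathcal I_h^\otimes$ be the piecewise affine interpolation in time at the nodes $t_k$. Define $\mathcal J_h^\otimes:=\mathcal I_h^\otimes\circ(\mathrm{Id}\otimes\Pi_h)$ and $\mathcal J_{0,h}^\otimes:=\mathcal I_h^\otimes\circ(\mathrm{Id}\otimes\Pi_{0,h})$ on $C(\overline J;L^2(\Omega))$. They map into $\mathcal S^1(J_h;\mathcal S^1(\Omega_h))$ and $\mathcal S^1(J_h;\mathcal S^1_0(\Omega_h))$, respectively, and there is a constant $C$ that depends only on $d,\Omega,T,\kappa$ (and not on $h$, the mesh, or $u$) such that for all $u\in C(\overline J;L^2(\Omega))$ $$\begin{aligned} \|u-\mathcal J_h^\otimes u\|_{L^2(L^2(\Omega))}&\le C h\,\bigl(\|u\|_{H^1(L^2(\Omega))}+\|u\|_{L^\infty(H^1(\Omega))}\bigr),\\ \|u-\mathcal J_h^\otimes u\|_{L^2(H^1(\Omega))}&\le C h\,\bigl(\|u\|_{H^1(H^1(\Omega))}+\|u\|_{L^\infty(H^2(\Omega))}\bigr),\\ \|u-\mathcal J_{0,h}^\otimes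 u\|_{L^2(H^1_0(\Omega))}&\le C h\,\bigl(\|u\|_{H^1(H^1_0(\Omega))}+\|u\|_{L^\infty(H^2(\Omega))}\bigr),\\ \|(u-\mathcal J_{0,h}^\otimes u)'\|_{L^2(H^{-1}(\Omega))}&\le C h\,\bigl(\|u\|_{H^2(H^{-1}(\Omega))}+\|u\|_{L^\infty(H^1_0(\Omega))}\bigr), \end{aligned}$$ and, if moreover $u(t)\in H^1_0(\Omega)$ for almost every $t\in J$, $$\|(u-\mathcal J_{0,h}^\otimes u)'\|_{L^2(L^2(\Omega))}\le C h\,\bigl(\|u\|_{H^2(L^2(\Omega))}+\|u\|_{L^\infty(H^2(\Omega))}\bigr).$$ Here a norm is $+\infty$ if $u$ does not belong to the corresponding space; whenever the right-hand side is finite, the function (or weak time derivative) on the left exists in the space named there. -/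

import Mathlib

open MeasureTheory Set
open scoped ENNReal NNReal ContDiff

noncomputable section

namespace SpaceTime

/-! ## The spatial domain -/

/-- The Euclidean space `ℝ^d`. -/
abbrev Sp (d : ℕ) : Type := EuclideanSpace ℝ (Fin d)

variable {d : ℕ}

/-- A bounded Lipschitz domain: open, connected, non-empty, bounded, and near each boundary point
the region strictly above the graph of a Lipschitz function, in a suitable direction `e`. The graph
function is evaluated at the projection of `y` onto the orthogonal complement of `e`. -/
structure IsBoundedLipschitzDomain (Ω : Set (Sp d)) : Prop where
  isOpen : IsOpen Ω
  isConnected : IsConnected Ω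
  isBounded : Bornology.IsBounded Ω
  lipschitz : ∀ x ∈ frontier Ω, ∃ r : ℝ, 0 < r ∧ ∃ e : Sp d, ‖e‖ = 1 ∧
    ∃ (K : ℝ≥0) (γ : Sp d → ℝ), LipschitzWith K γ ∧
      ∀ y ∈ Metric.ball x r, y ∈ Ω ↔ γ (y - inner ℝ e y • e) < inner ℝ e y

/-! ## Sobolev spaces on the spatial domain -/

/-- The space `L²(Ω)`. -/
abbrev L2 (Ω : Set (Sp d)) : Type := Lp ℝ 2 (volume.restrict Ω)

/-- Test functions, that is, elements of `C_c^∞(U)`. -/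
structure IsTest {E : Type*} [NormedAddCommGroup E] [NormedSpace ℝ E]
    (U : Set E) (φ : E → ℝ) : Prop where
  contDiff : ContDiff ℝ ∞ φ
  hasCompactSupport : HasCompactSupport φ
  tsupport_subset : tsupport φ ⊆ U

/-- The classical partial derivative in direction of the `i`-th coordinate. -/
def partialDeriv (i : Fin d) (φ : Sp d → ℝ) (x : Sp d) : ℝ :=
  fderiv ℝ φ x (EuclideanSpace.single i 1)

/-- `g` is the weak `i`-th partial derivative of `f` on `Ω`. -/
def IsWeakPartial (Ω : Set (Sp d)) (i : Fin d) (f g : L2 Ω) : Prop :=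
  ∀ φ : Sp d → ℝ, IsTest Ω φ →
    ∫ x in Ω, f x * partialDeriv i φ x = - ∫ x in Ω, g x * φ x

theorem IsTest.memLp {Ω : Set (Sp d)} {φ : Sp d → ℝ} (h : IsTest Ω φ) :
    MemLp φ 2 (volume.restrict Ω) :=
  (h.contDiff.continuous.memLp_of_hasCompactSupport h.hasCompactSupport).restrict Ω

theorem IsTest.memLp_partialDeriv {Ω : Set (Sp d)} {φ : Sp d → ℝ} (h : IsTest Ω φ) (i : Fin d) :
    MemLp (partialDeriv i φ) 2 (volume.restrict Ω) := by
  have hc : Continuous (partialDeriv i φ) :=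
    (h.contDiff.continuous_fderiv (by simp)).clm_apply continuous_const
  have hs : HasCompactSupport (partialDeriv i φ) := h.hasCompactSupport.fderiv_apply ℝ _
  exact (hc.memLp_of_hasCompactSupport hs).restrict Ω

theorem integral_mul_eq_inner {Ω : Set (Sp d)} {ψ : Sp d → ℝ}
    (h : MemLp ψ 2 (volume.restrict Ω)) (f : L2 Ω) :
    ∫ x in Ω, f x * ψ x = inner ℝ (h.toLp ψ) f := by
  rw [L2.inner_def]
  refine integral_congr_ae ?_
  filter_upwards [h.coeFn_toLp] with x hx
  simp [hx]

theorem isWeakPartial_iff {Ω : Set (Sp d)} {i : Fin d} {f g : L2 Ω} :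
    IsWeakPartial Ω i f g ↔ ∀ (φ : Sp d → ℝ) (h : IsTest Ω φ),
      (inner ℝ ((h.memLp_partialDeriv i).toLp _) f : ℝ) = - inner ℝ (h.memLp.toLp _) g := by
  refine forall_congr' fun φ => forall_congr' fun h => ?_
  rw [integral_mul_eq_inner (h.memLp_partialDeriv i), integral_mul_eq_inner h.memLp]

theorem IsWeakPartial.add {Ω : Set (Sp d)} {i : Fin d} {f g f' g' : L2 Ω}
    (h : IsWeakPartial Ω i f g) (h' : IsWeakPartial Ω i f' g') :
    IsWeakPartial Ω i (f + f') (g + g') := by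
  rw [isWeakPartial_iff] at *
  intro φ hφ
  rw [inner_add_right, inner_add_right, h φ hφ, h' φ hφ]
  ring

theorem IsWeakPartial.smul {Ω : Set (Sp d)} {i : Fin d} {f g : L2 Ω} (c : ℝ)
    (h : IsWeakPartial Ω i f g) : IsWeakPartial Ω i (c • f) (c • g) := by
  rw [isWeakPartial_iff] at *
  intro φ hφ
  rw [inner_smul_right, inner_smul_right, h φ hφ]
  ring

theorem IsWeakPartial.zero {Ω : Set (Sp d)} {i : Fin d} :
    IsWeakPartial Ω i (0 : L2 Ω) 0 := by
  rw [isWeakPartial_iff]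
  simp

/-- `H¹(Ω)`, as the space of pairs `(v, ∇v)` in `L²(Ω) × L²(Ω)^d`, with the norm
`(‖v‖² + ∑ᵢ ‖∂ᵢ v‖²)^{1/2}`. -/
def H1 (Ω : Set (Sp d)) : Submodule ℝ (WithLp 2 (L2 Ω × PiLp 2 (fun _ : Fin d => L2 Ω))) where
  carrier := {v | ∀ i, IsWeakPartial Ω i v.fst (v.snd i)}
  add_mem' := fun hv hw i => (hv i).add (hw i)
  zero_mem' := fun _ => IsWeakPartial.zero
  smul_mem' := fun c _ hv i => (hv i).smul c

/-- The embedding of `H¹(Ω)` into `L²(Ω)`. -/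
def H1.toL2 (Ω : Set (Sp d)) : H1 Ω →L[ℝ] L2 Ω :=
  (WithLp.fstL 2 ℝ (L2 Ω) (PiLp 2 (fun _ : Fin d => L2 Ω))).comp (H1 Ω).subtypeL

/-- The weak partial derivatives of an element of `H¹(Ω)`. -/
def H1.grad {Ω : Set (Sp d)} (v : H1 Ω) (i : Fin d) : L2 Ω := v.1.snd i

theorem isClosed_isWeakPartial {Z : Type*} [TopologicalSpace Z] {Ω : Set (Sp d)} {i : Fin d}
    {f g : Z → L2 Ω} (hf : Continuous f) (hg : Continuous g) :
    IsClosed {z | IsWeakPartial Ω i (f z) (g z)} := by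
  simp only [isWeakPartial_iff, ofPred_forall]
  exact isClosed_iInter fun φ => isClosed_iInter fun h =>
    isClosed_eq (continuous_const.inner hf) (continuous_const.inner hg).neg

instance H1.completeSpace (Ω : Set (Sp d)) : CompleteSpace (H1 Ω) := by
  have h : IsClosed (H1 Ω : Set (WithLp 2 (L2 Ω × PiLp 2 (fun _ : Fin d => L2 Ω)))) := by
    have e : (H1 Ω : Set (WithLp 2 (L2 Ω × PiLp 2 (fun _ : Fin d => L2 Ω)))) =
        ⋂ i, {v | IsWeakPartial Ω i v.fst (v.snd i)} := by
      ext v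
      exact (mem_iInter (s := fun i => {v : WithLp 2 (L2 Ω × PiLp 2 (fun _ : Fin d => L2 Ω)) |
        IsWeakPartial Ω i v.fst (v.snd i)})).symm
    rw [e]
    exact isClosed_iInter fun i => isClosed_isWeakPartial (by fun_prop) (by fun_prop)
  exact h.completeSpace_coe

/-- `H²(Ω)`, as the space of pairs `(v, D²v)` in `H¹(Ω) × L²(Ω)^{d×d}`, with the norm
`(‖v‖² + ∑ᵢ ‖∂ᵢ v‖² + ∑ᵢⱼ ‖∂ⱼ∂ᵢ v‖²)^{1/2}`. -/
def H2 (Ω : Set (Sp d)) :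
    Submodule ℝ (WithLp 2 (H1 Ω × PiLp 2 (fun _ : Fin d × Fin d => L2 Ω))) where
  carrier := {v | ∀ i j, IsWeakPartial Ω j (H1.grad v.fst i) (v.snd (i, j))}
  add_mem' := fun hv hw i j => (hv i j).add (hw i j)
  zero_mem' := fun _ _ => IsWeakPartial.zero
  smul_mem' := fun c _ hv i j => (hv i j).smul c

/-- The embedding of `H²(Ω)` into `L²(Ω)`. -/
def H2.toL2 (Ω : Set (Sp d)) : H2 Ω →L[ℝ] L2 Ω :=
  (H1.toL2 Ω).comp ((WithLp.fstL 2 ℝ (H1 Ω) (PiLp 2 (fun _ : Fin d × Fin d => L2 Ω))).comp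
    (H2 Ω).subtypeL)

/-- The elements of `H¹(Ω)` that are represented by a test function on `Ω`. -/
def testSubmodule (Ω : Set (Sp d)) : Submodule ℝ (H1 Ω) where
  carrier := {v | ∃ φ : Sp d → ℝ, IsTest Ω φ ∧ H1.toL2 Ω v =ᵐ[volume.restrict Ω] φ}
  add_mem' := by
    rintro v w ⟨φ, hφ, hv⟩ ⟨ψ, hψ, hw⟩
    refine ⟨φ + ψ, ⟨hφ.contDiff.add hψ.contDiff, hφ.hasCompactSupport.add hψ.hasCompactSupport,
      (tsupport_add φ ψ).trans (union_subset hφ.tsupport_subset hψ.tsupport_subset)⟩, ?_⟩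
    exact (Lp.coeFn_add (H1.toL2 Ω v) (H1.toL2 Ω w)).trans (hv.add hw)
  zero_mem' := ⟨0, ⟨contDiff_const, HasCompactSupport.zero, by simp [tsupport]⟩,
    Lp.coeFn_zero ℝ 2 (volume.restrict Ω)⟩
  smul_mem' := by
    rintro c v ⟨φ, hφ, hv⟩
    refine ⟨c • φ, ⟨hφ.contDiff.const_smul c, hφ.hasCompactSupport.smul_left (f := fun _ => c),
      (tsupport_smul_subset_right (fun _ => c) φ).trans hφ.tsupport_subset⟩, ?_⟩
    exact (Lp.coeFn_smul c (H1.toL2 Ω v)).trans (hv.const_smul c)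

/-- `H¹₀(Ω)`, the closure of `C_c^∞(Ω)` in `H¹(Ω)`, with the norm of `H¹(Ω)`. -/
def H10 (Ω : Set (Sp d)) : Submodule ℝ (H1 Ω) := (testSubmodule Ω).topologicalClosure

instance H10.completeSpace (Ω : Set (Sp d)) : CompleteSpace (H10 Ω) :=
  (testSubmodule Ω).isClosed_topologicalClosure.completeSpace_coe

/-- The embedding of `H¹₀(Ω)` into `L²(Ω)`. -/
def H10.toL2 (Ω : Set (Sp d)) : H10 Ω →L[ℝ] L2 Ω := (H1.toL2 Ω).comp (H10 Ω).subtypeL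

/-- `H⁻¹(Ω)`, the topological dual of `H¹₀(Ω)`, with the dual norm. -/
abbrev Hm1 (Ω : Set (Sp d)) : Type := H10 Ω →L[ℝ] ℝ

/-- The embedding of `L²(Ω)` into `H⁻¹(Ω)`, which sends `f` to `v ↦ ⟨f, v⟩_{L²(Ω)}`. -/
def toHm1 {Ω : Set (Sp d)} (f : L2 Ω) : Hm1 Ω := (innerSL ℝ f).comp (H10.toL2 Ω)

/-! ## Bochner and Sobolev–Bochner spaces on the time interval `J = (0, T)` -/

section Bochner

variable {X Y : Type*} [NormedAddCommGroup X] [NormedSpace ℝ X] [NormedAddCommGroup Y]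

/-- Lebesgue measure on `J = (0, T)`. -/
def timeMeasure (T : ℝ) : Measure ℝ := volume.restrict (Ioo 0 T)

/-- `g` is the weak time derivative of `f` on `(0, T)`, where `f, g ∈ L²(X)`. -/
structure IsWeakTimeDeriv (T : ℝ) (f g : ℝ → X) : Prop where
  memLp : MemLp f 2 (timeMeasure T)
  memLp_deriv : MemLp g 2 (timeMeasure T)
  integral_eq : ∀ φ : ℝ → ℝ, IsTest (Ioo 0 T) φ →
    ∫ t, φ t • g t ∂timeMeasure T = - ∫ t, deriv φ t • f t ∂timeMeasure T

/-- The extended norm of `u : J → Y` in `L^p(X)`, where `ι : X → Y` is an injection through which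
`X` is regarded as a subspace of `Y`: the `L^p` norm of the lift of `u` to an `X`-valued (strongly
measurable) function, and `∞` if there is no such lift in `L^p(X)`. Two lifts agree almost
everywhere, so the infimum is over one value. -/
def bochnerNorm (T : ℝ) (p : ℝ≥0∞) (ι : X → Y) (u : ℝ → Y) : ℝ≥0∞ :=
  ⨅ (w : ℝ → X) (_ : MemLp w p (timeMeasure T)) (_ : ∀ᵐ t ∂timeMeasure T, ι (w t) = u t),
    eLpNorm w p (timeMeasure T)

/-- The extended norm of `u : J → Y` in `H^k(X)`, where `X` is regarded as a subspace of `Y` through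
`ι`: the value is `(∑_{j ≤ k} ‖w⁽ʲ⁾‖²_{L²(X)})^{1/2}` for the lift `w` of `u` and its weak time
derivatives, and `∞` if the lift or one of these derivatives does not exist in `L²(X)`. -/
def sobolevBochnerNorm (T : ℝ) (k : ℕ) (ι : X → Y) (u : ℝ → Y) : ℝ≥0∞ :=
  ⨅ (w : ℕ → ℝ → X) (_ : ∀ j ≤ k, MemLp (w j) 2 (timeMeasure T))
    (_ : ∀ j < k, IsWeakTimeDeriv T (w j) (w (j + 1)))
    (_ : ∀ᵐ t ∂timeMeasure T, ι (w 0 t) = u t),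
    (∑ j ∈ Finset.range (k + 1), eLpNorm (w j) 2 (timeMeasure T) ^ 2) ^ (1 / 2 : ℝ)

/-- The extended norm `‖u'‖_{L²(X)}` of the weak time derivative of `u`; it is `∞` if `u` has no
weak time derivative in `L²(X)`. -/
def timeDerivNorm (T : ℝ) (u : ℝ → X) : ℝ≥0∞ :=
  ⨅ (g : ℝ → X) (_ : IsWeakTimeDeriv T u g), eLpNorm g 2 (timeMeasure T)

/-- The piecewise linear interpolant in time at the nodes `k * h`:
for `k * h ≤ t < (k + 1) * h` its value is
`(((k + 1) * h - t) * u (k * h) + (t - k * h) * u ((k + 1) * h)) / h`. -/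
def timeInterp (h : ℝ) (u : ℝ → X) (t : ℝ) : X :=
  (((⌊t / h⌋₊ + 1) * h - t) / h) • u (⌊t / h⌋₊ * h) +
    ((t - ⌊t / h⌋₊ * h) / h) • u ((⌊t / h⌋₊ + 1) * h)

/-- The space `S¹(J_h; V)` of continuous functions on `[0, N * h]` that have values in the subspace
`V` of `X` and are affine in time on each of the intervals `[k * h, (k + 1) * h]`, `k < N`. -/
def timeP1 (h : ℝ) (N : ℕ) (V : Submodule ℝ X) : Set (ℝ → X) :=
  {w | ContinuousOn w (Icc 0 (N * h)) ∧ (∀ t ∈ Icc 0 (N * h), w t ∈ V) ∧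
    ∀ k < N, ∃ a b : X, ∀ t ∈ Icc (k * h) ((k + 1) * h), w t = a + t • b}

end Bochner

/-! ## Simplicial meshes and finite element spaces -/

/-- An admissible simplicial mesh of `Ω`: finitely many non-degenerate `d`-simplices, given by their
vertex sets, which cover `closure Ω`, such that two of them meet in the convex hull of their common
vertices (no hanging nodes). -/
structure SimplicialMesh (Ω : Set (Sp d)) where
  cells : Finset (Finset (Sp d))
  card_eq : ∀ s ∈ cells, s.card = d + 1
  affineIndependent : ∀ s ∈ cells, AffineIndependent ℝ ((↑) : s → Sp d)
  inter_eq : ∀ s ∈ cells, ∀ t ∈ cells,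
    convexHull ℝ (s : Set (Sp d)) ∩ convexHull ℝ (t : Set (Sp d)) =
      convexHull ℝ ((s : Set (Sp d)) ∩ (t : Set (Sp d)))
  cover : ⋃ s ∈ cells, convexHull ℝ (s : Set (Sp d)) = closure Ω

variable {Ω : Set (Sp d)}

/-- The mesh is uniform with mesh size `h`: up to the factor `κ`, each simplex has diameter `h`,
and it is shape regular (it contains a ball of radius `h / κ`). -/
def SimplicialMesh.IsUniform (M : SimplicialMesh Ω) (h κ : ℝ) : Prop :=
  ∀ s ∈ M.cells, Metric.diam (convexHull ℝ (s : Set (Sp d))) ≤ κ * h ∧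
    ∃ c, Metric.ball c (h / κ) ⊆ convexHull ℝ (s : Set (Sp d))

/-- `S¹(Ω_h)` as a space of functions: continuous on `closure Ω` and affine on each simplex of the
mesh. The functions are normalized by the value `0` outside of `closure Ω`. -/
def SimplicialMesh.p1Fun (M : SimplicialMesh Ω) : Submodule ℝ (Sp d → ℝ) where
  carrier := {v | ContinuousOn v (closure Ω) ∧
    (∀ s ∈ M.cells, ∃ a : Sp d →ᵃ[ℝ] ℝ, EqOn v a (convexHull ℝ (s : Set (Sp d)))) ∧
    ∀ x ∉ closure Ω, v x = 0}
  add_mem' := by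
    rintro v w ⟨hv, hva, hv0⟩ ⟨hw, hwa, hw0⟩
    refine ⟨hv.add hw, fun s hs => ?_, fun x hx => by simp [hv0 x hx, hw0 x hx]⟩
    obtain ⟨a, ha⟩ := hva s hs
    obtain ⟨b, hb⟩ := hwa s hs
    exact ⟨a + b, fun x hx => by simp [ha hx, hb hx]⟩
  zero_mem' := ⟨continuousOn_const, fun _ _ => ⟨0, fun _ _ => rfl⟩, fun _ _ => rfl⟩
  smul_mem' := by
    rintro c v ⟨hv, hva, hv0⟩
    refine ⟨hv.const_smul c, fun s hs => ?_, fun x hx => by simp [hv0 x hx]⟩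
    obtain ⟨a, ha⟩ := hva s hs
    exact ⟨c • a, fun x hx => by simp [ha hx]⟩

/-- `S¹₀(Ω_h)` as a space of functions: the elements of `S¹(Ω_h)` that vanish on `∂Ω`. -/
def SimplicialMesh.p1Fun0 (M : SimplicialMesh Ω) : Submodule ℝ M.p1Fun where
  carrier := {v | ∀ x ∈ frontier Ω, v.1 x = 0}
  add_mem' := fun hv hw x hx => by simp [hv x hx, hw x hx]
  zero_mem' := fun _ _ => rfl
  smul_mem' := fun c v hv x hx => by simp [hv x hx]

theorem SimplicialMesh.isCompact_closure (M : SimplicialMesh Ω) : IsCompact (closure Ω) := by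
  rw [← M.cover]
  exact M.cells.isCompact_biUnion fun s _ => s.finite_toSet.isCompact_convexHull ℝ

theorem SimplicialMesh.memLp (M : SimplicialMesh Ω) (v : M.p1Fun) :
    MemLp v.1 2 (volume.restrict Ω) := by
  have hc := M.isCompact_closure
  have hf : IsFiniteMeasure (volume.restrict (closure Ω)) := ⟨by
    simpa using hc.measure_lt_top⟩
  obtain ⟨C, hC⟩ := hc.exists_bound_of_continuousOn v.2.1
  have h1 : MemLp v.1 2 (volume.restrict (closure Ω)) :=
    MemLp.of_bound (v.2.1.aestronglyMeasurable isClosed_closure.measurableSet) C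
      ((ae_restrict_iff' isClosed_closure.measurableSet).2 (ae_of_all _ hC))
  exact h1.mono_measure (Measure.restrict_mono subset_closure le_rfl)

/-- Passing from a finite element function to its class in `L²(Ω)`. -/
def SimplicialMesh.toL2 (M : SimplicialMesh Ω) : M.p1Fun →ₗ[ℝ] L2 Ω where
  toFun v := (M.memLp v).toLp v.1
  map_add' _ _ := rfl
  map_smul' _ _ := rfl

/-- `S¹(Ω_h)` as a subspace of `L²(Ω)`. -/
def SimplicialMesh.S1 (M : SimplicialMesh Ω) : Submodule ℝ (L2 Ω) :=
  (⊤ : Submodule ℝ M.p1Fun).map M.toL2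

/-- `S¹₀(Ω_h)` as a subspace of `L²(Ω)`. -/
def SimplicialMesh.S10 (M : SimplicialMesh Ω) : Submodule ℝ (L2 Ω) :=
  M.p1Fun0.map M.toL2

instance SimplicialMesh.finiteDimensional_p1Fun (M : SimplicialMesh Ω) :
    FiniteDimensional ℝ M.p1Fun := by
  classical
  let r : M.p1Fun →ₗ[ℝ] ({z // z ∈ Finset.biUnion M.cells id} → ℝ) :=
    { toFun := fun v z => v.1 z
      map_add' := fun _ _ => rfl
      map_smul' := fun _ _ => rfl }
  refine FiniteDimensional.of_injective r ?_
  rw [injective_iff_map_eq_zero]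
  rintro ⟨v, hv⟩ h
  ext x
  by_cases hx : x ∈ closure Ω
  · rw [← M.cover] at hx
    simp only [mem_iUnion] at hx
    obtain ⟨s, hs, hxs⟩ := hx
    obtain ⟨a, ha⟩ := hv.2.1 s hs
    have hsub : convexHull ℝ (s : Set (Sp d)) ⊆ a ⁻¹' {0} := by
      refine convexHull_min (fun z hz => ?_) (Convex.affine_preimage (𝕜 := ℝ) a (convex_singleton (0 : ℝ)))
      have := congrFun h ⟨z, Finset.mem_biUnion.2 ⟨s, hs, hz⟩⟩
      have h2 : v z = 0 := this
      simpa [← ha (subset_convexHull ℝ _ hz)] using h2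
    have h3 : a x = 0 := hsub hxs
    simpa [← ha hxs] using h3
  · simpa using hv.2.2 x hx

instance SimplicialMesh.finiteDimensional_S1 (M : SimplicialMesh Ω) :
    FiniteDimensional ℝ M.S1 := by
  unfold SimplicialMesh.S1
  infer_instance

instance SimplicialMesh.finiteDimensional_S10 (M : SimplicialMesh Ω) :
    FiniteDimensional ℝ M.S10 := by
  unfold SimplicialMesh.S10
  infer_instance

/-- The `L²(Ω)`-orthogonal projection onto `S¹(Ω_h)`. -/
def SimplicialMesh.proj (M : SimplicialMesh Ω) : L2 Ω →L[ℝ] L2 Ω := M.S1.starProjection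

/-- The `L²(Ω)`-orthogonal projection onto `S¹₀(Ω_h)`. -/
def SimplicialMesh.proj0 (M : SimplicialMesh Ω) : L2 Ω →L[ℝ] L2 Ω := M.S10.starProjection

/-- The operator `I_h ∘ (Id ⊗ Π_h)`. -/
def SimplicialMesh.tensorInterp (M : SimplicialMesh Ω) (h : ℝ) (u : ℝ → L2 Ω) : ℝ → L2 Ω :=
  timeInterp h (fun t => M.proj (u t))

/-- The operator `I_h ∘ (Id ⊗ Π_{0,h})`. -/
def SimplicialMesh.tensorInterp0 (M : SimplicialMesh Ω) (h : ℝ) (u : ℝ → L2 Ω) : ℝ → L2 Ω :=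
  timeInterp h (fun t => M.proj0 (u t))

end SpaceTime

end

namespace SpaceTime
open Filter Topology

/-! ## Preliminaries from functional analysis and measure theory -/

/-! The error splits as `u - I(Πu) = (u - Iu) + I(u - Πu)`, where `I` is interpolation in time and
`Π` a spatial projection. The first part is a question about functions of time with values in a
Banach space `X`. A function with weak derivative `g` in `L²(X)` has a continuous representative `c
+ ∫ g` (du Bois-Reymond), so its oscillation over distances at most `h` is bounded by the integral
of `‖g‖` over a window of length `2h`. Cauchy-Schwarz and Tonelli turn this pointwise bound into `2h
‖g‖` in `L²` (`eLpNorm_le_of_window`). The slope of the interpolant is the mean of `u'` over a time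
step, so the same argument applies to the derivative, with `u''` in place of `g`. In the second
part, `I` is a convex combination of nodal values, so that a bound of `u(t) - Πu(t)` uniform in `t`
suffices. For the time derivative a difference quotient costs a factor `2/h`; therefore the
projection error has to be of order `h²` there. This is available for `H²` functions in the `L²`
norm, and for `H¹₀` functions in the `H⁻¹` norm, by duality: the error is orthogonal to the discrete
space, so the test function may be replaced by its own projection error. The regularity of `u` holds
only for almost every `t`, while nodes are single times; weak compactness of balls carries the
bounds to every `t`.

The spatial errors rest on best approximation in `L²`, hence on one good discrete function `q`. It
is built without an extension operator and without point values of `v`. With a partition of unity,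
`v` is localized to sets in which balls pushed in a fixed direction `b` stay inside of the Lipschitz
domain (`IsBoundedLipschitzDomain.exists_inwardCone`). Mollification shifted along `b` reduces to
smooth functions. Their nodal values are replaced by the values of Taylor polynomials averaged over
the pushed balls; polynomials that belong to neighbouring points differ by a Taylor remainder
(`HasTaylor.jump_le`), which bounds the error cell by cell. The remainders of order `0` and `1` give
the results for `H¹` and `H²` by the same argument.

For zero boundary values, the boundary nodal values of `q` are set to zero. The change is controlled
by a trace estimate: each boundary vertex lies on a mesh facet contained in the boundary
(`SimplicialMesh.exists_boundary_facet`), and on the cell of that facet the divergence theorem for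
the radial field from the opposite vertex bounds the nodal value by the `H¹` error on the cell
(`IsSimplex.integral_sq_le`). Errors in `H¹` follow from errors of order `h²` in `L²` by comparison
with `q` and the inverse inequality. -/

/-- The image of a closed ball of a Hilbert space under a continuous linear map is sequentially
closed. -/
theorem exists_norm_le_of_tendsto {X Y : Type*} [NormedAddCommGroup X] [InnerProductSpace ℝ X]
    [CompleteSpace X] [NormedAddCommGroup Y] [InnerProductSpace ℝ Y] [CompleteSpace Y]
    (ι : X →L[ℝ] Y) {M : ℝ} {w : ℕ → X} (hw : ∀ n, ‖w n‖ ≤ M) {y : Y}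
    (hy : Tendsto (fun n => ι (w n)) atTop (𝓝 y)) : ∃ x, ‖x‖ ≤ M ∧ ι x = y := by
  -- By the Riesz identification and Banach-Alaoglu, the sequence has a weak cluster point. Its
  -- image is `y`, since both have the same inner product with each `η`, computed through the
  -- adjoint.
  have hK := WeakDual.isCompact_closedBall (𝕜 := ℝ) (0 : StrongDual ℝ X) M
  let v : ℕ → WeakDual ℝ X := fun n =>
    StrongDual.toWeakDual (InnerProductSpace.toDual ℝ X (w n))
  have hv : ∀ n, v n ∈ WeakDual.toStrongDual ⁻¹' Metric.closedBall (0 : StrongDual ℝ X) M := by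
    intro n
    have : ‖InnerProductSpace.toDual ℝ X (w n)‖ ≤ M := by simpa using hw n
    simpa [v] using this
  obtain ⟨ℓ, hℓ, hcl⟩ := hK.exists_mapClusterPt_of_frequently (f := v) (l := atTop)
    (Frequently.of_forall hv)
  let x := (InnerProductSpace.toDual ℝ X).symm (WeakDual.toStrongDual ℓ)
  refine ⟨x, ?_, ?_⟩
  · simpa [x] using hℓ
  · refine ext_inner_right ℝ fun η => ?_
    have h1 : inner ℝ (ι x) η = ℓ (ι.adjoint η) := by
      rw [← ContinuousLinearMap.adjoint_inner_right]
      exact InnerProductSpace.toDual_symm_apply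
    have h2 : MapClusterPt (ℓ (ι.adjoint η)) atTop (fun n => v n (ι.adjoint η)) :=
      hcl.tendsto_comp (f := fun ψ : WeakDual ℝ X => ψ (ι.adjoint η))
        ((WeakDual.eval_continuous _).tendsto _)
    have h3 : (fun n => v n (ι.adjoint η)) = fun n => inner ℝ (ι (w n)) η := by
      funext n
      rw [← ContinuousLinearMap.adjoint_inner_right]
      rfl
    rw [h3] at h2
    have h4 : Tendsto (fun n => inner ℝ (ι (w n)) η) atTop (𝓝 (inner ℝ y η)) :=
      hy.inner tendsto_const_nhds
    rw [h1]
    have : (𝓝 (ℓ (ι.adjoint η)) ⊓ 𝓝 (inner ℝ y η)).NeBot := ClusterPt.mono h2 h4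
    exact eq_of_nhds_neBot this

/-- A version of `exists_norm_le_of_tendsto` for closed subspaces. -/
theorem exists_mem_norm_le_of_tendsto {X Y : Type*} [NormedAddCommGroup X] [InnerProductSpace ℝ X]
    [CompleteSpace X] [NormedAddCommGroup Y] [InnerProductSpace ℝ Y] [CompleteSpace Y]
    (ι : X →L[ℝ] Y) (S : Submodule ℝ X) (hS : IsClosed (S : Set X)) {M : ℝ} {w : ℕ → X}
    (hwS : ∀ n, w n ∈ S) (hw : ∀ n, ‖w n‖ ≤ M) {y : Y}
    (hy : Tendsto (fun n => ι (w n)) atTop (𝓝 y)) : ∃ x ∈ S, ‖x‖ ≤ M ∧ ι x = y := by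
  have : CompleteSpace S := hS.completeSpace_coe
  obtain ⟨x, hx, hxy⟩ := exists_norm_le_of_tendsto (ι.comp S.subtypeL) (w := fun n => ⟨w n, hwS n⟩)
    hw hy
  exact ⟨x, x.2, hx, hxy⟩

theorem lintegral_sq_le {α : Type*} [MeasurableSpace α] (μ : Measure α) {f : α → ℝ≥0∞}
    (hf : AEMeasurable f μ) : (∫⁻ x, f x ∂μ) ^ 2 ≤ μ univ * ∫⁻ x, f x ^ 2 ∂μ := by
  have h := ENNReal.lintegral_mul_le_Lp_mul_Lq μ (Real.HolderConjugate.two_two) hf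
    (aemeasurable_const (b := (1 : ℝ≥0∞)))
  simp only [Pi.mul_apply, mul_one, ENNReal.rpow_ofNat, one_pow, lintegral_const, one_mul] at h
  calc (∫⁻ x, f x ∂μ) ^ 2 ≤ ((∫⁻ x, f x ^ 2 ∂μ) ^ (1 / 2 : ℝ) * μ univ ^ (1 / 2 : ℝ)) ^ 2 := by
        gcongr
    _ = μ univ * ∫⁻ x, f x ^ 2 ∂μ := by
        rw [mul_pow, ← ENNReal.rpow_natCast, ← ENNReal.rpow_natCast, ← ENNReal.rpow_mul,
          ← ENNReal.rpow_mul]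
        norm_num
        rw [mul_comm]

theorem enorm_integral_sq_le {α E : Type*} [MeasurableSpace α] [NormedAddCommGroup E]
    [NormedSpace ℝ E] (μ : Measure α) (f : α → E) :
    ‖∫ x, f x ∂μ‖ₑ ^ 2 ≤ μ univ * ∫⁻ x, ‖f x‖ₑ ^ 2 ∂μ := by
  by_cases hf : AEStronglyMeasurable f μ
  · calc ‖∫ x, f x ∂μ‖ₑ ^ 2 ≤ (∫⁻ x, ‖f x‖ₑ ∂μ) ^ 2 := by
          gcongr
          exact enorm_integral_le_lintegral_enorm f
      _ ≤ _ := lintegral_sq_le μ hf.enorm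
  -- Without measurability the integral is `0` by convention, so no assumption on `f` is needed.
  · have : ¬ Integrable f μ := fun h => hf h.1
    simp [integral_undef this]

/-- Integrating local integrals over balls of fixed radius. -/
theorem lintegral_lintegral_closedBall {E : Type*} [NormedAddCommGroup E] [NormedSpace ℝ E]
    [FiniteDimensional ℝ E]
    [MeasurableSpace E] [BorelSpace E] (μ : Measure E) [μ.IsAddHaarMeasure]
    (R : ℝ) {F : E → ℝ≥0∞} (hF : AEMeasurable F μ) :
    ∫⁻ y, ∫⁻ z in Metric.closedBall y R, F z ∂μ ∂μ =
      μ (Metric.closedBall 0 R) * ∫⁻ z, F z ∂μ := by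
  have hS : MeasurableSet {p : E × E | dist p.2 p.1 ≤ R} :=
    (isClosed_le (by fun_prop) continuous_const).measurableSet
  have h1 : ∀ y, ∫⁻ z in Metric.closedBall y R, F z ∂μ =
      ∫⁻ z, {p : E × E | dist p.2 p.1 ≤ R}.indicator (fun p => F p.2) (y, z) ∂μ := by
    intro y
    rw [← lintegral_indicator Metric.isClosed_closedBall.measurableSet]
    rfl
  simp_rw [h1]
  -- Tonelli: for fixed `z`, the centres `y` whose ball contains `z` again form a ball of radius
  -- `R`.
  rw [lintegral_lintegral_swap]
  · have h2 : ∀ z, ∫⁻ y, {p : E × E | dist p.2 p.1 ≤ R}.indicator (fun p => F p.2) (y, z) ∂μ =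
        μ (Metric.closedBall 0 R) * F z := by
      intro z
      rw [← Measure.addHaar_closedBall_center μ z R, mul_comm, ← setLIntegral_const,
        ← lintegral_indicator Metric.isClosed_closedBall.measurableSet]
      refine lintegral_congr fun y => ?_
      simp only [indicator, mem_ofPred_eq, Metric.mem_closedBall, dist_comm z y]
    simp_rw [h2]
    exact lintegral_const_mul' _ _ measure_closedBall_lt_top.ne
  · exact (hF.comp_snd.indicator hS)

end SpaceTime

noncomputable section
namespace SpaceTime
open Filter Topology
variable {d : ℕ} {Ω : Set (Sp d)}

/-! ## Simplices and barycentric coordinates -/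

/-- The vertex set of a non-degenerate `d`-simplex in `ℝ^d`. -/
structure IsSimplex (s : Finset (Sp d)) : Prop where
  card_eq : s.card = d + 1
  affineIndependent : AffineIndependent ℝ ((↑) : s → Sp d)

/-- The simplex spanned by a vertex set. -/
abbrev hull (s : Finset (Sp d)) : Set (Sp d) := convexHull ℝ (s : Set (Sp d))

theorem isClosed_hull (s : Finset (Sp d)) : IsClosed (hull s) :=
  (s.finite_toSet.isCompact_convexHull ℝ).isClosed

theorem isCompact_hull (s : Finset (Sp d)) : IsCompact (hull s) :=
  s.finite_toSet.isCompact_convexHull ℝ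

theorem convex_hull (s : Finset (Sp d)) : Convex ℝ (hull s) := convex_convexHull ℝ _

theorem mem_hull_of_mem {s : Finset (Sp d)} {z : Sp d} (hz : z ∈ s) : z ∈ hull s :=
  subset_convexHull ℝ _ hz

/-- Two affine functions that agree on a set agree on its convex hull. -/
theorem eqOn_convexHull {A : Set (Sp d)} {f g : Sp d →ᵃ[ℝ] ℝ} (h : EqOn f g A) :
    EqOn f g (convexHull ℝ A) := by
  intro x hx
  have hsub : convexHull ℝ A ⊆ (f - g) ⁻¹' {0} :=
    convexHull_min (fun z hz => by simp [h hz])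
      (Convex.affine_preimage (𝕜 := ℝ) (f - g) (convex_singleton (0 : ℝ)))
  have := hsub hx
  simpa [sub_eq_zero] using this

namespace IsSimplex

variable {s : Finset (Sp d)} (hs : IsSimplex s)
include hs

/-- The vertices of a simplex as an affine basis. -/
def basis : AffineBasis s ℝ (Sp d) where
  toFun := (↑)
  ind' := hs.affineIndependent
  tot' := by
    rw [hs.affineIndependent.affineSpan_eq_top_iff_card_eq_finrank_add_one]
    simp [hs.card_eq]

open Classical in
/-- The barycentric coordinate of the vertex `z`; it is `0` if `z` is not a vertex. -/
def bary (z : Sp d) : Sp d →ᵃ[ℝ] ℝ := if h : z ∈ s then hs.basis.coord ⟨z, h⟩ else 0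

theorem bary_of_mem {z : Sp d} (h : z ∈ s) : hs.bary z = hs.basis.coord ⟨z, h⟩ := by
  simp [bary, h]

theorem bary_of_notMem {z : Sp d} (h : z ∉ s) : hs.bary z = 0 := by
  simp [bary, h]

theorem range_basis : range hs.basis = (s : Set (Sp d)) := by
  ext x
  constructor
  · rintro ⟨i, rfl⟩
    exact i.2
  · exact fun hx => ⟨⟨x, hx⟩, rfl⟩

theorem mem_hull_iff {x : Sp d} : x ∈ hull s ↔ ∀ z, 0 ≤ hs.bary z x := by
  rw [hull, ← hs.range_basis, hs.basis.convexHull_eq_nonneg_coord]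
  constructor
  · intro h z
    by_cases hz : z ∈ s
    · rw [hs.bary_of_mem hz]
      exact h ⟨z, hz⟩
    · simp [hs.bary_of_notMem hz]
  · rintro h ⟨z, hz⟩
    rw [← hs.bary_of_mem hz]
    exact h z

theorem mem_interior_iff {x : Sp d} : x ∈ interior (hull s) ↔ ∀ z ∈ s, 0 < hs.bary z x := by
  rw [hull, ← hs.range_basis, hs.basis.interior_convexHull]
  constructor
  · intro h z hz
    rw [hs.bary_of_mem hz]
    exact h ⟨z, hz⟩
  · rintro h ⟨z, hz⟩
    rw [← hs.bary_of_mem hz]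
    exact h z hz

theorem sum_bary (x : Sp d) : ∑ z ∈ s, hs.bary z x = 1 := by
  rw [← hs.basis.sum_coord_apply_eq_one x, ← Finset.sum_coe_sort s]
  exact Finset.sum_congr rfl fun z _ => by rw [hs.bary_of_mem z.2]

theorem sum_bary_smul (x : Sp d) : ∑ z ∈ s, hs.bary z x • z = x := by
  conv_rhs => rw [← hs.basis.linear_combination_coord_eq_self x]
  rw [← Finset.sum_coe_sort s]
  exact Finset.sum_congr rfl fun z _ => by rw [hs.bary_of_mem z.2]; rfl

theorem bary_self {z : Sp d} (hz : z ∈ s) : hs.bary z z = 1 := by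
  rw [hs.bary_of_mem hz]
  exact hs.basis.coord_apply_eq ⟨z, hz⟩

theorem bary_ne {z z' : Sp d} (hz' : z' ∈ s) (h : z ≠ z') : hs.bary z z' = 0 := by
  by_cases hz : z ∈ s
  · rw [hs.bary_of_mem hz]
    exact hs.basis.coord_apply_ne (i := ⟨z, hz⟩) (j := ⟨z', hz'⟩) (fun e => h (by simpa using e))
  · simp [hs.bary_of_notMem hz]

theorem affine_eq_of_eqOn {f g : Sp d →ᵃ[ℝ] ℝ} (h : ∀ z ∈ s, f z = g z) : f = g := by
  have := hs.basis.tot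
  rw [hs.range_basis] at this
  exact AffineMap.ext_on this h

/-- The affine function with prescribed values at the vertices. -/
def interp (c : Sp d → ℝ) : Sp d →ᵃ[ℝ] ℝ := ∑ z ∈ s, c z • hs.bary z

theorem interp_apply (c : Sp d → ℝ) (x : Sp d) :
    hs.interp c x = ∑ z ∈ s, c z * hs.bary z x := by
  have h : ∀ t : Finset (Sp d), (∑ z ∈ t, c z • hs.bary z) x = ∑ z ∈ t, c z * hs.bary z x := by
    classical
    intro t
    induction t using Finset.induction_on with
    | empty => simp
    | insert a t ha ih => simp [Finset.sum_insert ha, ih]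
  exact h s

theorem interp_vertex (c : Sp d → ℝ) {z : Sp d} (hz : z ∈ s) : hs.interp c z = c z := by
  rw [hs.interp_apply, Finset.sum_eq_single z]
  · rw [hs.bary_self hz, mul_one]
  · intro b _ hb
    rw [hs.bary_ne hz hb, mul_zero]
  · exact fun h => (h hz).elim

theorem interp_affine (a : Sp d →ᵃ[ℝ] ℝ) : hs.interp a = a :=
  hs.affine_eq_of_eqOn fun _ hz => hs.interp_vertex a hz

theorem affine_apply (a : Sp d →ᵃ[ℝ] ℝ) (x : Sp d) : a x = ∑ z ∈ s, a z * hs.bary z x := by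
  conv_lhs => rw [← hs.interp_affine a]
  exact hs.interp_apply a x

theorem abs_affine_le {a : Sp d →ᵃ[ℝ] ℝ} {B : ℝ} (h : ∀ z ∈ s, |a z| ≤ B) {x : Sp d}
    (hx : x ∈ hull s) : |a x| ≤ B := by
  rw [hs.affine_apply a x]
  calc |∑ z ∈ s, a z * hs.bary z x| ≤ ∑ z ∈ s, |a z * hs.bary z x| :=
        Finset.abs_sum_le_sum_abs _ _
    _ ≤ ∑ z ∈ s, B * hs.bary z x := by
        refine Finset.sum_le_sum fun z hz => ?_
        rw [abs_mul, abs_of_nonneg (hs.mem_hull_iff.1 hx z)]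
        exact mul_le_mul_of_nonneg_right (h z hz) (hs.mem_hull_iff.1 hx z)
    _ = B := by rw [← Finset.mul_sum, hs.sum_bary, mul_one]

theorem bary_eq_zero_of_mem_convexHull {S : Set (Sp d)} (hS : S ⊆ s) {x z : Sp d}
    (hx : x ∈ convexHull ℝ S) (hz : z ∉ S) : hs.bary z x = 0 := by
  have : EqOn (hs.bary z) (0 : Sp d →ᵃ[ℝ] ℝ) S := fun y hy =>
    hs.bary_ne (hS hy) (fun e => hz (e ▸ hy))
  exact eqOn_convexHull this hx

theorem mem_convexHull_of_bary {S : Set (Sp d)} {x : Sp d} (hx : x ∈ hull s)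
    (h : ∀ z ∈ s, z ∉ S → hs.bary z x = 0) : x ∈ convexHull ℝ S := by
  classical
  have h1 : ∑ z ∈ s with z ∈ S, hs.bary z x • z = x := by
    conv_rhs => rw [← hs.sum_bary_smul x]
    refine Finset.sum_filter_of_ne fun z hz hne => ?_
    by_contra hzS
    exact hne (by rw [h z hz hzS, zero_smul])
  have h2 : ∑ z ∈ s with z ∈ S, hs.bary z x = 1 := by
    rw [← hs.sum_bary x]
    refine Finset.sum_filter_of_ne fun z hz hne => ?_
    by_contra hzS
    exact hne (h z hz hzS)
  rw [← h1]
  exact (convex_convexHull ℝ S).sum_mem (fun z _ => hs.mem_hull_iff.1 hx z) h2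
    fun z hz => subset_convexHull ℝ S (Finset.mem_filter.1 hz).2

theorem continuous_bary (z : Sp d) : Continuous (hs.bary z) :=
  (hs.bary z).continuous_of_finiteDimensional

end IsSimplex

/-- The affine span of at most `d` points is a null set. -/
theorem volume_affineSpan_eq_zero {S : Finset (Sp d)} (hS : S.card ≤ d) :
    volume (affineSpan ℝ (S : Set (Sp d)) : Set (Sp d)) = 0 := by
  classical
  refine Measure.addHaar_affineSubspace volume _ ?_
  rcases S.eq_empty_or_nonempty with rfl | hne
  · simp
  intro htop
  obtain ⟨n, hn⟩ : ∃ n, S.card = n + 1 := ⟨S.card - 1, by have := hne.card_pos; omega⟩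
  have h1 := finrank_vectorSpan_image_finset_le ℝ (id : Sp d → Sp d) S hn
  rw [Finset.image_id, ← direction_affineSpan, htop, AffineSubspace.direction_top, finrank_top] at h1
  simp at h1
  omega

namespace SimplicialMesh

variable (M : SimplicialMesh Ω)

theorem isSimplex {s : Finset (Sp d)} (hs : s ∈ M.cells) : IsSimplex s :=
  ⟨M.card_eq s hs, M.affineIndependent s hs⟩

theorem hull_subset {s : Finset (Sp d)} (hs : s ∈ M.cells) : hull s ⊆ closure Ω := by
  rw [← M.cover]
  exact subset_biUnion_of_mem (u := fun s : Finset (Sp d) => convexHull ℝ (s : Set (Sp d))) hs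

theorem exists_mem_hull {x : Sp d} (hx : x ∈ closure Ω) : ∃ s ∈ M.cells, x ∈ hull s := by
  rw [← M.cover] at hx
  simpa using hx

/-- Since there are no hanging nodes, `x` is in the hull of the common vertices. Both coordinates
are affine and agree at these vertices, and the coordinate of a vertex that is not common vanishes
for both cells. This makes the nodal basis functions well defined. -/
theorem bary_eq {s t : Finset (Sp d)} (hs : s ∈ M.cells) (ht : t ∈ M.cells) {x : Sp d}
    (hxs : x ∈ hull s) (hxt : x ∈ hull t) (z : Sp d) :
    (M.isSimplex hs).bary z x = (M.isSimplex ht).bary z x := by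
  have hx : x ∈ convexHull ℝ ((s : Set (Sp d)) ∩ (t : Set (Sp d))) := by
    rw [← M.inter_eq s hs t ht]
    exact ⟨hxs, hxt⟩
  by_cases hz : z ∈ (s : Set (Sp d)) ∩ (t : Set (Sp d))
  · refine eqOn_convexHull (fun y hy => ?_) hx
    by_cases h : z = y
    · rw [← h, IsSimplex.bary_self _ hz.1, IsSimplex.bary_self _ hz.2]
    · rw [IsSimplex.bary_ne _ hy.1 h, IsSimplex.bary_ne _ hy.2 h]
  · rw [IsSimplex.bary_eq_zero_of_mem_convexHull _ inter_subset_left hx hz,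
      IsSimplex.bary_eq_zero_of_mem_convexHull _ inter_subset_right hx hz]

open Classical in
/-- The nodal basis function of the vertex `z`. -/
def hat (z x : Sp d) : ℝ :=
  if h : ∃ s, s ∈ M.cells ∧ x ∈ hull s then (M.isSimplex h.choose_spec.1).bary z x else 0

theorem hat_eq {s : Finset (Sp d)} (hs : s ∈ M.cells) {x : Sp d} (hx : x ∈ hull s) (z : Sp d) :
    M.hat z x = (M.isSimplex hs).bary z x := by
  have h : ∃ s, s ∈ M.cells ∧ x ∈ hull s := ⟨s, hs, hx⟩
  rw [hat, dif_pos h]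
  exact M.bary_eq h.choose_spec.1 hs h.choose_spec.2 hx z

theorem hat_of_notMem {x : Sp d} (hx : x ∉ closure Ω) (z : Sp d) : M.hat z x = 0 := by
  rw [hat, dif_neg]
  rintro ⟨s, hs, hxs⟩
  exact hx (M.hull_subset hs hxs)

/-- A function with continuous restrictions to the cells is continuous on the closed domain. -/
theorem continuousOn_of_cells {v : Sp d → ℝ} (h : ∀ s ∈ M.cells, ContinuousOn v (hull s)) :
    ContinuousOn v (closure Ω) := by
  have hc : closure Ω = ⋃ s : M.cells, hull s.1 := by
    rw [← M.cover]
    ext x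
    simp
  rw [hc]
  exact (locallyFinite_of_finite _).continuousOn_iUnion (fun s => isClosed_hull _)
    fun s => h s s.2

theorem hat_mem (z : Sp d) : M.hat z ∈ M.p1Fun := by
  refine ⟨M.continuousOn_of_cells fun s hs => ?_, fun s hs => ⟨_, fun x hx => M.hat_eq hs hx z⟩,
    fun x hx => M.hat_of_notMem hx z⟩
  exact ((M.isSimplex hs).continuous_bary z).continuousOn.congr fun x hx => M.hat_eq hs hx z

/-- The vertices of the mesh. -/
def verts : Finset (Sp d) := by
  classical exact M.cells.biUnion id

theorem mem_verts {z : Sp d} : z ∈ M.verts ↔ ∃ s ∈ M.cells, z ∈ s := by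
  simp [verts]

/-- The finite element function with prescribed nodal values. -/
def nodal (c : Sp d → ℝ) : M.p1Fun := ∑ z ∈ M.verts, c z • ⟨M.hat z, M.hat_mem z⟩

theorem nodal_apply {s : Finset (Sp d)} (hs : s ∈ M.cells) {x : Sp d} (hx : x ∈ hull s)
    (c : Sp d → ℝ) : (M.nodal c).1 x = (M.isSimplex hs).interp c x := by
  rw [IsSimplex.interp_apply]
  have h1 : (M.nodal c).1 x = ∑ z ∈ M.verts, c z * M.hat z x := by
    simp [nodal, Finset.sum_apply]
  rw [h1]
  symm
  refine Finset.sum_subset_zero_on_sdiff (fun z hz => M.mem_verts.2 ⟨s, hs, hz⟩)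
    (fun z hz => ?_) (fun z _ => by rw [M.hat_eq hs hx])
  rw [M.hat_eq hs hx, IsSimplex.bary_of_notMem _ (Finset.mem_sdiff.1 hz).2]
  simp

/-- The restriction of a finite element function to a cell. -/
theorem exists_affine (v : M.p1Fun) {s : Finset (Sp d)} (hs : s ∈ M.cells) :
    ∃ a : Sp d →ᵃ[ℝ] ℝ, EqOn v.1 a (hull s) := v.2.2.1 s hs

/-- The set of cells that contain a point can be read off from the zeros of the nodal basis
functions there: if, in some cell, all coordinates outside of `t` vanish, the point is a convex
combination of vertices of `t`. -/
theorem mem_hull_iff {t : Finset (Sp d)} (ht : t ∈ M.cells) {x : Sp d} (hx : x ∈ closure Ω) :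
    x ∈ hull t ↔ ∀ z ∉ t, M.hat z x = 0 := by
  constructor
  · intro hxt z hz
    rw [M.hat_eq ht hxt, IsSimplex.bary_of_notMem _ hz]
    rfl
  · intro h
    obtain ⟨s, hs, hxs⟩ := M.exists_mem_hull hx
    refine (M.isSimplex hs).mem_convexHull_of_bary hxs fun z hz hzt => ?_
    rw [← M.hat_eq hs hxs]
    exact h z hzt

/-- Whether a point lies in the interior of the closed domain depends only on the face of the mesh
that it belongs to. -/
theorem mem_interior_closure_of_face {x x' : Sp d} (hx : x ∈ interior (closure Ω))
    (hx' : x' ∈ closure Ω) (h : ∀ z, M.hat z x = 0 ↔ M.hat z x' = 0) :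
    x' ∈ interior (closure Ω) := by
  have hxc := interior_subset hx
  -- Near `x` and near `x'` the mesh looks alike up to translation. A coordinate that vanishes at
  -- both points takes the same value at `x + w` and `x' + w`, namely its linear part at `w`; one
  -- that is positive at `x'` remains positive for small `w`; a cell that does not contain `x` does
  -- not contain `x + w` either.
  have key : ∀ t ∈ M.cells, ∀ᶠ w in 𝓝 (0 : Sp d), x + w ∈ hull t → x' + w ∈ hull t := by
    intro t ht
    by_cases hxt : x ∈ hull t
    · have hxt' : x' ∈ hull t := by
        rw [M.mem_hull_iff ht hx']
        exact fun z hz => (h z).1 ((M.mem_hull_iff ht hxc).1 hxt z hz)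
      have hev : ∀ z ∈ t, ∀ᶠ w in 𝓝 (0 : Sp d), 0 ≤ (M.isSimplex ht).bary z (x + w) →
          0 ≤ (M.isSimplex ht).bary z (x' + w) := by
        intro z hz
        by_cases h0 : M.hat z x = 0
        · have h0' := (h z).1 h0
          rw [M.hat_eq ht hxt] at h0
          rw [M.hat_eq ht hxt'] at h0'
          refine Eventually.of_forall fun w hw => ?_
          rw [add_comm, ← vadd_eq_add, AffineMap.map_vadd, h0] at hw
          rw [add_comm, ← vadd_eq_add, AffineMap.map_vadd, h0']
          exact hw
        · have h0' : M.hat z x' ≠ 0 := fun e => h0 ((h z).2 e)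
          rw [M.hat_eq ht hxt'] at h0'
          have hpos : 0 < (M.isSimplex ht).bary z (x' + 0) := by
            rw [add_zero]
            exact lt_of_le_of_ne ((M.isSimplex ht).mem_hull_iff.1 hxt' z) h0'.symm
          have hcont : Continuous fun w : Sp d => (M.isSimplex ht).bary z (x' + w) :=
            ((M.isSimplex ht).continuous_bary z).comp (by fun_prop)
          filter_upwards [hcont.continuousAt.eventually (lt_mem_nhds hpos)] with w hw _
          exact hw.le
      have hall : ∀ᶠ w in 𝓝 (0 : Sp d), ∀ z ∈ t, 0 ≤ (M.isSimplex ht).bary z (x + w) →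
          0 ≤ (M.isSimplex ht).bary z (x' + w) := (Finset.eventually_all t).2 hev
      filter_upwards [hall] with w hw hxw
      rw [(M.isSimplex ht).mem_hull_iff] at hxw ⊢
      intro z
      by_cases hz : z ∈ t
      · exact hw z hz (hxw z)
      · simp [IsSimplex.bary_of_notMem _ hz]
    · have : ∀ᶠ w in 𝓝 (0 : Sp d), x + w ∉ hull t := by
        have hc : ContinuousAt (fun w : Sp d => x + w) 0 := by fun_prop
        have hn : (hull t)ᶜ ∈ 𝓝 (x + 0) := by
          rw [add_zero]
          exact (isClosed_hull t).isOpen_compl.mem_nhds hxt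
        exact hc.eventually_mem hn
      filter_upwards [this] with w hw hxw
      exact (hw hxw).elim
  have hin : ∀ᶠ w in 𝓝 (0 : Sp d), x + w ∈ closure Ω := by
    have hc : ContinuousAt (fun w : Sp d => x + w) 0 := by fun_prop
    exact hc.eventually (by simpa using mem_interior_iff_mem_nhds.1 hx)
  have hall : ∀ᶠ w in 𝓝 (0 : Sp d), ∀ t ∈ M.cells, x + w ∈ hull t → x' + w ∈ hull t :=
    (Finset.eventually_all _).2 key
  have hfin : ∀ᶠ w in 𝓝 (0 : Sp d), x' + w ∈ closure Ω := by
    filter_upwards [hin, hall] with w h1 h2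
    obtain ⟨t, ht, hxt⟩ := M.exists_mem_hull h1
    exact M.hull_subset ht (h2 t ht hxt)
  rw [mem_interior_iff_mem_nhds]
  have hc : Tendsto (fun y : Sp d => y - x') (𝓝 x') (𝓝 0) := by
    have : ContinuousAt (fun y : Sp d => y - x') x' := by fun_prop
    simpa [ContinuousAt] using this
  filter_upwards [hc.eventually hfin] with y hy
  simpa using hy

/-- Different cells have at most `d` common vertices, and these span a null set. -/
theorem hull_inter_null {s t : Finset (Sp d)} (hs : s ∈ M.cells) (ht : t ∈ M.cells)
    (hst : s ≠ t) : volume (hull s ∩ hull t) = 0 := by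
  classical
  rw [hull, hull, M.inter_eq s hs t ht, ← Finset.coe_inter]
  refine measure_mono_null (convexHull_subset_affineSpan _) (volume_affineSpan_eq_zero ?_)
  have h1 : s ∩ t ⊂ s := by
    refine Finset.inter_subset_left.ssubset_of_ne fun e => hst ?_
    exact Finset.eq_of_subset_of_card_le (Finset.inter_eq_left.1 e)
      (by rw [M.card_eq s hs, M.card_eq t ht])
  have := Finset.card_lt_card h1
  rw [M.card_eq s hs] at this
  omega

/-- Almost every point of the domain lies in the interior of a cell. -/
theorem ae_mem_interior : ∀ᵐ x, x ∈ closure Ω → ∃ s ∈ M.cells, x ∈ interior (hull s) := by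
  have h : ∀ s ∈ M.cells, ∀ᵐ x, x ∉ frontier (hull s) := fun s _ =>
    measure_eq_zero_iff_ae_notMem.1 ((convex_hull s).addHaar_frontier volume)
  have h' : ∀ᵐ x, ∀ s ∈ M.cells, x ∉ frontier (hull s) :=
    (ae_ball_iff (Finset.countable_toSet _)).2 h
  filter_upwards [h'] with x hx hxc
  obtain ⟨s, hs, hxs⟩ := M.exists_mem_hull hxc
  refine ⟨s, hs, ?_⟩
  by_contra hni
  exact hx s hs ⟨subset_closure hxs, hni⟩

/-- Integrals over the domain are sums over the cells. -/
theorem lintegral_eq_sum (hreg : interior (closure Ω) = Ω) (F : Sp d → ℝ≥0∞) :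
    ∫⁻ x in Ω, F x = ∑ s ∈ M.cells, ∫⁻ x in hull s, F x := by
  rw [← lintegral_biUnion_finset₀ (s := M.cells) (t := hull)]
  · refine setLIntegral_congr ?_
    rw [show ⋃ s ∈ M.cells, hull s = closure Ω from M.cover]
    -- The boundary of the domain is a null set: the interiors of the cells are open subsets of
    -- `closure Ω`, so they lie in `interior (closure Ω) = Ω`.
    have : ∀ᵐ x, x ∈ closure Ω → x ∈ Ω := by
      filter_upwards [M.ae_mem_interior] with x hx hxc
      obtain ⟨s, hs, hxs⟩ := hx hxc
      rw [← hreg]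
      exact interior_mono (M.hull_subset hs) hxs
    filter_upwards [this] with x hx
    exact propext ⟨fun h => subset_closure h, fun h => hx h⟩
  · exact fun s hs t ht hst => M.hull_inter_null hs ht hst
  · exact fun s _ => (isClosed_hull s).measurableSet.nullMeasurableSet

/-- If a face of the mesh meets the domain, then its relative interior is contained in it. -/
theorem mem_of_face (hreg : interior (closure Ω) = Ω) {s : Finset (Sp d)} (hs : s ∈ M.cells)
    {x p : Sp d} (hxs : x ∈ hull s) (hps : p ∈ hull s) (hx : x ∈ Ω)
    (h : ∀ z, (M.isSimplex hs).bary z p = 0 → (M.isSimplex hs).bary z x = 0) : p ∈ Ω := by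
  have hopen : IsOpen Ω := hreg ▸ isOpen_interior
  have hc : ContinuousAt (fun t : ℝ => AffineMap.lineMap x p t) 0 :=
    (AffineMap.lineMap_continuous (R := ℝ)).continuousAt
  have hev : ∀ᶠ t in 𝓝[>] (0 : ℝ), AffineMap.lineMap x p t ∈ Ω :=
    (hc.eventually (by simpa using hopen.mem_nhds hx)).filter_mono nhdsWithin_le_nhds
  have hev2 : ∀ᶠ t in 𝓝[>] (0 : ℝ), t ∈ Ioo (0 : ℝ) 1 := Ioo_mem_nhdsGT one_pos
  obtain ⟨t, ht, ht0, ht1⟩ := (hev.and hev2).exists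
  -- The point moved slightly from `x` towards `p` is in `Ω` because `Ω` is open. As `t > 0`, its
  -- coordinates vanish exactly where those of `p` do, so it lies in the same face as `p`.
  have hts : AffineMap.lineMap x p t ∈ hull s :=
    (convex_hull s).lineMap_mem hxs hps ⟨ht0.le, ht1.le⟩
  rw [← hreg]
  refine M.mem_interior_closure_of_face (x := AffineMap.lineMap x p t) (by rwa [hreg])
    (M.hull_subset hs hps) fun z => ?_
  rw [M.hat_eq hs hts, M.hat_eq hs hps, AffineMap.apply_lineMap, AffineMap.lineMap_apply_ring']
  have h1 := (M.isSimplex hs).mem_hull_iff.1 hps z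
  have h2 := (M.isSimplex hs).mem_hull_iff.1 hxs z
  constructor
  · intro h3
    have : 0 ≤ (1 - t) * (M.isSimplex hs).bary z x := mul_nonneg (by linarith) h2
    nlinarith
  · intro h3
    simp [h3, h z h3]

/-- A vertex of the face of a boundary point is a boundary point. -/
theorem hat_eq_zero_of_notMem (hreg : interior (closure Ω) = Ω) {x z : Sp d} (hxc : x ∈ closure Ω)
    (hx : x ∉ Ω) (hz : z ∈ Ω) : M.hat z x = 0 := by
  by_contra hne
  obtain ⟨s, hs, hxs⟩ := M.exists_mem_hull hxc
  have hzs : z ∈ s := by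
    by_contra hzs
    exact hne ((M.mem_hull_iff hs hxc).1 hxs z hzs)
  refine hx (M.mem_of_face hreg hs (mem_hull_of_mem hzs) hxs hz fun z' h => ?_)
  by_cases hzz : z' = z
  · rw [M.hat_eq hs hxs, ← hzz] at hne
    exact (hne h).elim
  · exact (M.isSimplex hs).bary_ne hzs hzz

end SimplicialMesh

end SpaceTime
end

noncomputable section
namespace SpaceTime
open Filter Topology
variable {d : ℕ} {Ω : Set (Sp d)}

/-! ## Geometry of Lipschitz domains -/

/-- `Ω` is the region above a Lipschitz graph in the ball around `x`. -/
structure IsLipschitzChart (Ω : Set (Sp d)) (x : Sp d) (r : ℝ) (e : Sp d) (K : ℝ≥0)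
    (γ : Sp d → ℝ) : Prop where
  pos : 0 < r
  norm_eq : ‖e‖ = 1
  lipschitz : LipschitzWith K γ
  mem_iff : ∀ y ∈ Metric.ball x r, y ∈ Ω ↔ γ (y - inner ℝ e y • e) < inner ℝ e y

namespace IsLipschitzChart

variable {x e : Sp d} {r : ℝ} {K : ℝ≥0} {γ : Sp d → ℝ} (hc : IsLipschitzChart Ω x r e K γ)
include hc

theorem inner_self : inner ℝ e e = (1 : ℝ) := by
  rw [real_inner_self_eq_norm_sq, hc.norm_eq, one_pow]

theorem continuous_graph : Continuous fun y : Sp d => γ (y - inner ℝ e y • e) :=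
  hc.lipschitz.continuous.comp (by fun_prop)

theorem le_of_mem_closure {y : Sp d} (hy : y ∈ Metric.ball x r) (hyc : y ∈ closure Ω) :
    γ (y - inner ℝ e y • e) ≤ inner ℝ e y := by
  have h1 : y ∈ closure (Metric.ball x r ∩ Ω) := Metric.isOpen_ball.inter_closure ⟨hy, hyc⟩
  have h2 : IsClosed {y : Sp d | γ (y - inner ℝ e y • e) ≤ inner ℝ e y} :=
    isClosed_le hc.continuous_graph (by fun_prop)
  exact closure_minimal (fun z hz => ((hc.mem_iff z hz.1).1 hz.2).le) h2 h1

theorem proj_add (y : Sp d) (t : ℝ) :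
    (y + t • e) - (inner ℝ e (y + t • e) : ℝ) • e = y - inner ℝ e y • e := by
  rw [inner_add_right, inner_smul_right, hc.inner_self, mul_one, add_smul]
  abel

theorem inner_add (y : Sp d) (t : ℝ) : (inner ℝ e (y + t • e) : ℝ) = inner ℝ e y + t := by
  rw [inner_add_right, inner_smul_right, hc.inner_self, mul_one]

end IsLipschitzChart

theorem IsBoundedLipschitzDomain.exists_chart (hΩ : IsBoundedLipschitzDomain Ω) {x : Sp d}
    (hx : x ∈ frontier Ω) : ∃ r e K γ, IsLipschitzChart Ω x r e K γ := by
  obtain ⟨r, hr, e, he, K, γ, hγ, h⟩ := hΩ.lipschitz x hx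
  exact ⟨r, e, K, γ, hr, he, hγ, h⟩

/-- The domain is on one side of its boundary only: from a boundary point, a small step in direction
`-e` leads below the graph, hence out of `closure Ω`. -/
theorem IsBoundedLipschitzDomain.interior_closure (hΩ : IsBoundedLipschitzDomain Ω) :
    interior (closure Ω) = Ω := by
  refine Subset.antisymm (fun x hx => ?_) (interior_maximal subset_closure hΩ.isOpen)
  by_contra hxΩ
  have hxf : x ∈ frontier Ω := by
    rw [hΩ.isOpen.frontier_eq]
    exact ⟨interior_subset hx, hxΩ⟩
  obtain ⟨r, e, K, γ, hc⟩ := hΩ.exists_chart hxf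
  have hcont : ContinuousAt (fun t : ℝ => x + t • e) 0 := by fun_prop
  have h1 : ∀ᶠ t in 𝓝[<] (0 : ℝ), x + t • e ∈ interior (closure Ω) ∩ Metric.ball x r := by
    refine (hcont.eventually_mem ?_).filter_mono nhdsWithin_le_nhds
    rw [zero_smul, add_zero]
    exact (isOpen_interior.inter Metric.isOpen_ball).mem_nhds ⟨hx, Metric.mem_ball_self hc.pos⟩
  obtain ⟨t, ⟨ht1, ht2⟩, ht0⟩ := (h1.and self_mem_nhdsWithin).exists
  have h2 := hc.le_of_mem_closure ht2 (interior_subset ht1)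
  rw [hc.proj_add, hc.inner_add] at h2
  have h3 : ¬ γ (x - inner ℝ e x • e) < inner ℝ e x := fun h =>
    hxΩ ((hc.mem_iff x (Metric.mem_ball_self hc.pos)).2 h)
  have : t < 0 := ht0
  linarith

/-- Near `U`, the points of the closed domain see the balls `x + τ • (b + closedBall 0 1)`, for
small `τ`, inside of `Ω`. -/
def InwardCone (Ω : Set (Sp d)) (b : Sp d) (τ₀ : ℝ) (U : Set (Sp d)) : Prop :=
  ∀ x ∈ closure Ω, ∀ τ, 0 < τ → τ ≤ τ₀ → ∀ y : Sp d, ‖y‖ ≤ 1 →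
    x + τ • (b + y) ∈ U → x + τ • (b + y) ∈ Ω

/-- At a boundary point `b` is a large multiple of the graph direction `e`: a step `τ • (b + y)`
gains more height than the Lipschitz graph can. Near an interior point there is nothing to show, as
the conclusion is only required in `U`. -/
theorem IsBoundedLipschitzDomain.exists_inwardCone (hΩ : IsBoundedLipschitzDomain Ω) {p : Sp d}
    (hp : p ∈ closure Ω) :
    ∃ b : Sp d, ∃ τ₀ > 0, ∃ r > 0, InwardCone Ω b τ₀ (Metric.ball p r) := by
  by_cases hpΩ : p ∈ Ω
  · obtain ⟨r, hr, hball⟩ := Metric.isOpen_iff.1 hΩ.isOpen p hpΩ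
    exact ⟨0, 1, one_pos, r, hr, fun x _ τ _ _ y _ h => hball h⟩
  have hpf : p ∈ frontier Ω := by
    rw [hΩ.isOpen.frontier_eq]
    exact ⟨hp, hpΩ⟩
  obtain ⟨r, e, K, γ, hc⟩ := hΩ.exists_chart hpf
  have hr := hc.pos
  have hK : (0 : ℝ) ≤ K := K.2
  -- The height increases by at least `τ (a - 1)`, while the horizontal displacement is at most `2
  -- τ`, so that the graph rises by at most `2 K τ`; this choice leaves a margin `τ`.
  set a : ℝ := 2 * K + 2 with ha
  have ha0 : 0 < a := by positivity
  -- Steps have length at most `τ (a + 1) ≤ r / 2`. If the end point is in the ball of radius `r /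
  -- 2`, the starting point is still in the ball of the chart.
  refine ⟨a • e, r / (2 * (a + 1)), by positivity, r / 2, by positivity, ?_⟩
  intro x hx τ hτ hτ0 y hy hU
  have hnz : ‖τ • (a • e + y)‖ ≤ r / 2 := by
    rw [norm_smul, Real.norm_of_nonneg hτ.le]
    have : ‖a • e + y‖ ≤ a + 1 := by
      refine (norm_add_le _ _).trans ?_
      rw [norm_smul, hc.norm_eq, Real.norm_of_nonneg ha0.le]
      linarith
    calc τ * ‖a • e + y‖ ≤ r / (2 * (a + 1)) * (a + 1) := by gcongr
      _ = r / 2 := by field_simp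
  have hxz : x + τ • (a • e + y) ∈ Metric.ball p r := Metric.ball_subset_ball (by linarith) hU
  have hxr : x ∈ Metric.ball p r := by
    rw [Metric.mem_ball, dist_eq_norm] at hU ⊢
    have : x - p = (x + τ • (a • e + y) - p) - τ • (a • e + y) := by abel
    rw [this]
    exact (norm_sub_le _ _).trans_lt (by linarith)
  rw [hc.mem_iff _ hxz]
  have h1 := hc.le_of_mem_closure hxr hx
  set π : Sp d → Sp d := fun y => y - (inner ℝ e y : ℝ) • e with hπ
  have h2 : π (x + τ • (a • e + y)) = π x + τ • π y := by
    simp only [hπ, inner_add_right, inner_smul_right, hc.inner_self]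
    module
  have hin : |(inner ℝ e y : ℝ)| ≤ 1 := by
    refine (abs_real_inner_le_norm e y).trans ?_
    rw [hc.norm_eq, one_mul]
    exact hy
  have h3 : ‖π y‖ ≤ 2 := by
    refine (norm_sub_le _ _).trans ?_
    rw [norm_smul, hc.norm_eq, mul_one, Real.norm_eq_abs]
    linarith
  have h4 : γ (π x + τ • π y) ≤ γ (π x) + K * (τ * 2) := by
    have := hc.lipschitz.dist_le_mul (π x + τ • π y) (π x)
    rw [Real.dist_eq, dist_eq_norm, add_sub_cancel_left, norm_smul, Real.norm_of_nonneg hτ.le]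
      at this
    have h5 := (abs_le.1 this).2
    have h6 : (K : ℝ) * (τ * ‖π y‖) ≤ K * (τ * 2) := by gcongr
    linarith
  change γ (π (x + τ • (a • e + y))) < _
  have h7 : (inner ℝ e (x + τ • (a • e + y)) : ℝ) = inner ℝ e x + τ * (a + inner ℝ e y) := by
    simp only [inner_add_right, inner_smul_right, hc.inner_self]
    ring
  rw [h2, h7]
  have h8 : -1 ≤ (inner ℝ e y : ℝ) := (abs_le.1 hin).1
  have h9 : τ * (a - 1) ≤ τ * (a + inner ℝ e y) := by gcongr; linarith
  change γ (π x) ≤ _ at h1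
  have : τ * (a - 1) = K * (τ * 2) + τ := by rw [ha]; ring
  linarith

/-- Each boundary vertex of a mesh is a vertex of a facet that is contained in the boundary; the
facet is described by its cell `s` and its opposite vertex `z₀`. -/
theorem SimplicialMesh.exists_boundary_facet (M : SimplicialMesh Ω)
    (hΩ : IsBoundedLipschitzDomain Ω) {z : Sp d} (hz : z ∈ M.verts)
    (hzf : z ∈ frontier Ω) :
    ∃ (s : Finset (Sp d)) (hs : s ∈ M.cells), z ∈ s ∧ ∃ z₀ ∈ s, z₀ ≠ z ∧
      ∀ x ∈ hull s, (M.isSimplex hs).bary z₀ x = 0 → x ∉ Ω := by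
  classical
  -- A generic line in direction `e` near `z` meets the graph in a boundary point `p` close to `z`
  -- that avoids all faces with fewer than `d` vertices. The face whose relative interior contains
  -- `p` thus has at least `d` vertices. It has no more, since `p` is not interior to a cell, and it
  -- contains `z`, since the faces without `z` stay away from `z`. This is the facet.
  obtain ⟨r, e, K, γ, hc⟩ := hΩ.exists_chart hzf
  have hreg := hΩ.interior_closure
  obtain ⟨t, ht, hzt⟩ := M.mem_verts.1 hz
  have hzΩ : z ∉ Ω := fun h => by
    rw [hΩ.isOpen.frontier_eq] at hzf
    exact hzf.2 h
  have hzc : z ∈ closure Ω := frontier_subset_closure hzf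
  let F : Finset (Finset (Sp d)) := M.cells.biUnion fun s => s.powerset
  have hF : ∀ S, S ∈ F ↔ ∃ s ∈ M.cells, S ⊆ s := by simp [F]
  have hzhull : ∀ S ∈ F, z ∉ S → z ∉ hull S := by
    intro S hS hzS hzh
    obtain ⟨s, hs, hSs⟩ := (hF S).1 hS
    have h1 := (M.isSimplex hs).bary_eq_zero_of_mem_convexHull (Finset.coe_subset.2 hSs) hzh hzS
    have hzs : z ∈ hull s := convexHull_mono (Finset.coe_subset.2 hSs) hzh
    rw [← M.hat_eq hs hzs, M.hat_eq ht (mem_hull_of_mem hzt), IsSimplex.bary_self _ hzt] at h1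
    exact one_ne_zero h1
  have hnear : ∀ᶠ x in 𝓝 z, ∀ S ∈ F, z ∉ S → x ∉ hull S := by
    refine (Finset.eventually_all F).2 fun S hS => ?_
    by_cases hzS : z ∈ S
    · exact Eventually.of_forall fun x h => (h hzS).elim
    · filter_upwards [(isClosed_hull S).isOpen_compl.mem_nhds (hzhull S hS hzS)] with x hx _
      exact hx
  -- the union of the lines in direction `e` through the faces of codimension at least two
  let N : Set (Sp d) := ⋃ S ∈ F.filter (fun S => S.card < d), {x | ∃ τ : ℝ, x + τ • e ∈ hull S}
  have hN : volume N = 0 := by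
    refine (measure_biUnion_null_iff (Finset.countable_toSet _)).2 fun S hS => ?_
    have hSd := (Finset.mem_filter.1 hS).2
    rcases S.eq_empty_or_nonempty with rfl | ⟨q, hq⟩
    · simp [hull]
    -- Adjoining `q - e` to the vertices makes `e` a direction of their affine span; fewer than `d`
    -- vertices and one further point are at most `d` points.
    refine measure_mono_null ?_ (volume_affineSpan_eq_zero (S := insert (q - e) S)
      ((Finset.card_insert_le _ _).trans hSd))
    rintro x ⟨τ, hτ⟩
    have hsub : (S : Set (Sp d)) ⊆ (insert (q - e) S : Finset (Sp d)) := by simp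
    have h1 : x + τ • e ∈ affineSpan ℝ ((insert (q - e) S : Finset (Sp d)) : Set (Sp d)) :=
      affineSpan_mono ℝ hsub (convexHull_subset_affineSpan _ hτ)
    have h2 : (-τ) • e ∈ (affineSpan ℝ ((insert (q - e) S : Finset (Sp d)) : Set (Sp d))).direction := by
      refine Submodule.smul_mem _ _ ?_
      have h3 := AffineSubspace.vsub_mem_direction
        (subset_affineSpan ℝ _ (hsub hq)) (subset_affineSpan ℝ
          ((insert (q - e) S : Finset (Sp d)) : Set (Sp d)) (Finset.mem_insert_self (q - e) S))
      simpa using h3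
    have h4 := AffineSubspace.vadd_mem_of_mem_direction h2 h1
    have h5 : (-τ) • e +ᵥ (x + τ • e) = x := by
      rw [vadd_eq_add]
      module
    rwa [h5] at h4
  -- The projection onto the graph along `e`. It is continuous and fixes `z`, so it maps points near
  -- `z` to points near `z`.
  let P : Sp d → Sp d := fun x => x + (γ (x - (inner ℝ e x : ℝ) • e) - inner ℝ e x) • e
  have hPc : Continuous P := by
    exact continuous_id.add (((hc.continuous_graph).sub (by fun_prop)).smul continuous_const)
  have hPz : P z = z := by
    have h1 := hc.le_of_mem_closure (Metric.mem_ball_self hc.pos) hzc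
    have h2 : ¬ γ (z - inner ℝ e z • e) < inner ℝ e z := fun h =>
      hzΩ ((hc.mem_iff z (Metric.mem_ball_self hc.pos)).2 h)
    have h3 : γ (z - inner ℝ e z • e) - inner ℝ e z = 0 := by linarith
    simp only [P, h3, zero_smul, add_zero]
  have hgood : ∀ᶠ x in 𝓝 z, P x ∈ Metric.ball z r ∧ ∀ S ∈ F, z ∉ S → P x ∉ hull S := by
    have h1 : Tendsto P (𝓝 z) (𝓝 z) := by
      have := hPc.tendsto z
      rwa [hPz] at this
    have h2 : ∀ᶠ x in 𝓝 z, x ∈ Metric.ball z r :=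
      Metric.isOpen_ball.mem_nhds (Metric.mem_ball_self hc.pos)
    exact h1.eventually (h2.and hnear)
  obtain ⟨x, ⟨hxr, hxS⟩, hxN⟩ : ∃ x, (P x ∈ Metric.ball z r ∧ ∀ S ∈ F, z ∉ S → P x ∉ hull S) ∧
      x ∉ N := by
    by_contra hcon
    push Not at hcon
    have : volume {x | P x ∈ Metric.ball z r ∧ ∀ S ∈ F, z ∉ S → P x ∉ hull S} = 0 :=
      measure_mono_null (fun x hx => hcon x hx) hN
    exact (Measure.measure_pos_of_mem_nhds volume hgood).ne' this
  set p := P x with hp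
  have hpe : (inner ℝ e p : ℝ) = γ (p - (inner ℝ e p : ℝ) • e) := by
    simp only [hp, P]
    rw [hc.proj_add, hc.inner_add]
    ring
  have hpx : x + (γ (x - (inner ℝ e x : ℝ) • e) - inner ℝ e x) • e = p := rfl
  clear_value p
  have hpΩ : p ∉ Ω := fun h => by
    have := (hc.mem_iff p hxr).1 h
    rw [← hpe] at this
    exact lt_irrefl _ this
  have hpc : p ∈ closure Ω := by
    have hcont : ContinuousAt (fun t : ℝ => p + t • e) 0 := by fun_prop
    have h1 : ∀ᶠ t in 𝓝[>] (0 : ℝ), p + t • e ∈ Metric.ball z r := by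
      refine (hcont.eventually_mem ?_).filter_mono nhdsWithin_le_nhds
      rw [zero_smul, add_zero]
      exact Metric.isOpen_ball.mem_nhds hxr
    have h2 : ∀ᶠ t in 𝓝[>] (0 : ℝ), p + t • e ∈ Ω := by
      filter_upwards [h1, self_mem_nhdsWithin] with t ht ht0
      rw [hc.mem_iff _ ht, hc.proj_add, hc.inner_add, ← hpe]
      have : (0 : ℝ) < t := ht0
      linarith
    have h3 : Tendsto (fun t : ℝ => p + t • e) (𝓝[>] (0 : ℝ)) (𝓝 p) := by
      have := hcont.tendsto.mono_left (nhdsWithin_le_nhds (s := Ioi 0))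
      simpa using this
    exact mem_closure_of_tendsto h3 h2
  obtain ⟨s, hs, hps⟩ := M.exists_mem_hull hpc
  have hsx := M.isSimplex hs
  let S : Finset (Sp d) := s.filter fun v => hsx.bary v p ≠ 0
  have hSs : S ⊆ s := Finset.filter_subset _ _
  have hSF : S ∈ F := (hF S).2 ⟨s, hs, hSs⟩
  have hpS : p ∈ hull S := hsx.mem_convexHull_of_bary hps fun v hv hvS => by
    by_contra hne
    exact hvS (Finset.mem_coe.2 (Finset.mem_filter.2 ⟨hv, hne⟩))
  have hzS : z ∈ S := by
    by_contra h
    exact hxS S hSF h hpS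
  have hScard : d ≤ S.card := by
    by_contra h
    push Not at h
    refine hxN (mem_biUnion (Finset.mem_coe.2 (Finset.mem_filter.2 ⟨hSF, h⟩)) ?_)
    exact ⟨γ (x - (inner ℝ e x : ℝ) • e) - inner ℝ e x, by rwa [hpx]⟩
  have hSne : ∃ z₀ ∈ s, z₀ ∉ S := by
    by_contra h
    push Not at h
    apply hpΩ
    rw [← hreg]
    refine interior_mono (M.hull_subset hs) (hsx.mem_interior_iff.2 fun v hv => ?_)
    exact lt_of_le_of_ne (hsx.mem_hull_iff.1 hps v) (Finset.mem_filter.1 (h v hv)).2.symm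
  obtain ⟨z₀, hz₀s, hz₀S⟩ := hSne
  have hins : insert z₀ S = s := by
    refine Finset.eq_of_subset_of_card_le (Finset.insert_subset hz₀s hSs) ?_
    rw [Finset.card_insert_of_notMem hz₀S, M.card_eq s hs]
    omega
  -- The point `p` has nonzero coordinates at all vertices of the facet. By `mem_of_face`, a point
  -- of the facet in `Ω` would force `p ∈ Ω`.
  refine ⟨s, hs, hSs hzS, z₀, hz₀s, fun h => hz₀S (h ▸ hzS), fun y hy hy0 hyΩ => hpΩ ?_⟩
  refine M.mem_of_face hreg hs hy hps hyΩ fun v hv => ?_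
  by_cases hvs : v ∈ s
  · rw [← hins] at hvs
    rcases Finset.mem_insert.1 hvs with rfl | hvS
    · exact hy0
    · exact ((Finset.mem_filter.1 hvS).2 hv).elim
  · rw [IsSimplex.bary_of_notMem _ hvs]
    rfl

end SpaceTime
end

noncomputable section
namespace SpaceTime
open Filter Topology
variable {d : ℕ} {Ω : Set (Sp d)}

/-! ## Elements of the Sobolev spaces -/

instance H1.innerProductSpace (Ω : Set (Sp d)) : InnerProductSpace ℝ (H1 Ω) :=
  Submodule.innerProductSpace (H1 Ω)

/-- Convergence in `L²(Ω)` and a bound in `H¹(Ω)` are enough to stay in `H¹₀(Ω)`; convergence of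
gradients is not needed, as closed subspaces are weakly closed. -/
theorem H1.mem_H10_of_tendsto {M : ℝ} {w : ℕ → H1 Ω} (hw : ∀ n, ‖w n‖ ≤ M)
    (hw' : ∀ n, w n ∈ H10 Ω) {y : L2 Ω} (hy : Tendsto (fun n => H1.toL2 Ω (w n)) atTop (𝓝 y)) :
    ∃ x ∈ H10 Ω, ‖x‖ ≤ M ∧ H1.toL2 Ω x = y :=
  exists_mem_norm_le_of_tendsto (X := H1 Ω) (H1.toL2 Ω) (H10 Ω)
    (testSubmodule Ω).isClosed_topologicalClosure hw' hw hy

theorem H1.norm_le_of_tendsto {M : ℝ} {w : ℕ → H1 Ω} (hw : ∀ n, ‖w n‖ ≤ M) {y : L2 Ω}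
    (hy : Tendsto (fun n => H1.toL2 Ω (w n)) atTop (𝓝 y)) :
    ∃ x, ‖x‖ ≤ M ∧ H1.toL2 Ω x = y :=
  exists_norm_le_of_tendsto (X := H1 Ω) (H1.toL2 Ω) hw hy

theorem H1.norm_sq (v : H1 Ω) : ‖v‖ ^ 2 = ‖H1.toL2 Ω v‖ ^ 2 + ∑ i, ‖H1.grad v i‖ ^ 2 := by
  rw [Submodule.coe_norm, WithLp.prod_norm_sq_eq_of_L2, PiLp.norm_sq_eq_of_L2]
  rfl

theorem H1.norm_toL2_le (v : H1 Ω) : ‖H1.toL2 Ω v‖ ≤ ‖v‖ := by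
  refine le_of_sq_le_sq ?_ (norm_nonneg v)
  rw [H1.norm_sq]
  have : 0 ≤ ∑ i, ‖H1.grad v i‖ ^ 2 := by positivity
  linarith

theorem H1.norm_grad_le (v : H1 Ω) (i : Fin d) : ‖H1.grad v i‖ ≤ ‖v‖ := by
  refine le_of_sq_le_sq ?_ (norm_nonneg v)
  rw [H1.norm_sq]
  have := Finset.single_le_sum (f := fun i => ‖H1.grad v i‖ ^ 2) (fun i _ => by positivity)
    (Finset.mem_univ i)
  have h2 : 0 ≤ ‖H1.toL2 Ω v‖ ^ 2 := by positivity
  linarith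

theorem H1.norm_le (v : H1 Ω) : ‖v‖ ≤ ‖H1.toL2 Ω v‖ + ∑ i, ‖H1.grad v i‖ := by
  have h0 : 0 ≤ ∑ i, ‖H1.grad v i‖ := by positivity
  refine le_of_sq_le_sq ?_ (by positivity)
  rw [H1.norm_sq]
  have := Finset.sum_sq_le_sq_sum_of_nonneg (s := Finset.univ) (f := fun i => ‖H1.grad v i‖)
    (fun i _ => norm_nonneg _)
  have h2 := mul_nonneg (norm_nonneg (H1.toL2 Ω v)) h0
  nlinarith

theorem H1.grad_add (v w : H1 Ω) (i : Fin d) : H1.grad (v + w) i = H1.grad v i + H1.grad w i := rfl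
theorem H1.grad_sub (v w : H1 Ω) (i : Fin d) : H1.grad (v - w) i = H1.grad v i - H1.grad w i := rfl

theorem H1.grad_isWeakPartial (v : H1 Ω) (i : Fin d) :
    IsWeakPartial Ω i (H1.toL2 Ω v) (H1.grad v i) := v.2 i

/-- Weak derivatives are unique. -/
theorem IsWeakPartial.eq_zero (hΩ : IsOpen Ω) {i : Fin d} {g : L2 Ω}
    (h : IsWeakPartial Ω i 0 g) : g = 0 := by
  rw [Lp.eq_zero_iff_ae_eq_zero, EventuallyEq, ae_restrict_iff' hΩ.measurableSet]
  refine hΩ.ae_eq_zero_of_integral_contDiff_smul_eq_zero ?_ fun φ h1 h2 h3 => ?_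
  · have h2 : LocallyIntegrable g (volume.restrict Ω) :=
      (Lp.memLp g).locallyIntegrable (by norm_num)
    exact locallyIntegrableOn_of_locallyIntegrable_restrict h2
  · have h4 := h φ ⟨h1, h2, h3⟩
    have h5 : ∫ x in Ω, (0 : L2 Ω) x * partialDeriv i φ x = 0 := by
      have : ∀ᵐ x ∂volume.restrict Ω, (0 : L2 Ω) x * partialDeriv i φ x = 0 := by
        filter_upwards [Lp.coeFn_zero ℝ 2 (volume.restrict Ω)] with x hx
        rw [hx, Pi.zero_apply, zero_mul]
      rw [integral_congr_ae this]
      simp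
    rw [h5] at h4
    rw [← setIntegral_eq_integral_of_forall_compl_eq_zero (s := Ω)]
    · have : ∀ x, φ x • g x = g x * φ x := fun x => by rw [smul_eq_mul, mul_comm]
      simp_rw [this]
      linarith
    · intro x hx
      rw [image_eq_zero_of_notMem_tsupport fun h => hx (h3 h), zero_smul]

theorem H1.ext_grad {v w : H1 Ω} (h : H1.toL2 Ω v = H1.toL2 Ω w)
    (h' : ∀ i, H1.grad v i = H1.grad w i) : v = w := by
  rw [← sub_eq_zero, ← norm_eq_zero, ← sq_eq_zero_iff, H1.norm_sq, map_sub, h, sub_self]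
  simp [H1.grad_sub, h']

theorem H1.toL2_injective (hΩ : IsOpen Ω) : Function.Injective (H1.toL2 Ω) := by
  intro v w h
  refine H1.ext_grad h fun i => ?_
  have h1 := H1.grad_isWeakPartial (v - w) i
  rw [map_sub, h, sub_self] at h1
  rw [← sub_eq_zero]
  exact h1.eq_zero hΩ

/-- Functions on `ℝ^d` that are weakly differentiable on `Ω` with the classical partial
derivatives as weak derivatives. -/
structure IsH1Fun (Ω : Set (Sp d)) (F : Sp d → ℝ) : Prop where
  memLp : MemLp F 2 (volume.restrict Ω)
  memLp_partial : ∀ i, MemLp (partialDeriv i F) 2 (volume.restrict Ω)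
  weak : ∀ i φ, IsTest Ω φ →
    ∫ x in Ω, F x * partialDeriv i φ x = - ∫ x in Ω, partialDeriv i F x * φ x

theorem isWeakPartial_toLp {F G : Sp d → ℝ} (hF : MemLp F 2 (volume.restrict Ω))
    (hG : MemLp G 2 (volume.restrict Ω)) {i : Fin d}
    (h : ∀ φ, IsTest Ω φ → ∫ x in Ω, F x * partialDeriv i φ x = - ∫ x in Ω, G x * φ x) :
    IsWeakPartial Ω i (hF.toLp F) (hG.toLp G) := by
  intro φ hφ
  have h1 : ∫ x in Ω, hF.toLp F x * partialDeriv i φ x = ∫ x in Ω, F x * partialDeriv i φ x := by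
    refine integral_congr_ae ?_
    filter_upwards [hF.coeFn_toLp] with x hx
    rw [hx]
  have h2 : ∫ x in Ω, hG.toLp G x * φ x = ∫ x in Ω, G x * φ x := by
    refine integral_congr_ae ?_
    filter_upwards [hG.coeFn_toLp] with x hx
    rw [hx]
  rw [h1, h2, h φ hφ]

/-- The element of `H¹(Ω)` given by a function and its weak partial derivatives. -/
def H1.mk (f : L2 Ω) (g : Fin d → L2 Ω) (h : ∀ i, IsWeakPartial Ω i f (g i)) : H1 Ω :=
  ⟨WithLp.toLp 2 (f, WithLp.toLp 2 g), h⟩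

/-- The element of `H¹(Ω)` represented by a function. -/
def IsH1Fun.toH1 {F : Sp d → ℝ} (h : IsH1Fun Ω F) : H1 Ω :=
  H1.mk (h.memLp.toLp F) (fun i => (h.memLp_partial i).toLp _)
    fun i => isWeakPartial_toLp h.memLp (h.memLp_partial i) (h.weak i)

theorem IsH1Fun.toL2_toH1 {F : Sp d → ℝ} (h : IsH1Fun Ω F) :
    H1.toL2 Ω h.toH1 =ᵐ[volume.restrict Ω] F := h.memLp.coeFn_toLp

theorem IsH1Fun.grad_toH1 {F : Sp d → ℝ} (h : IsH1Fun Ω F) (i : Fin d) :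
    H1.grad h.toH1 i =ᵐ[volume.restrict Ω] partialDeriv i F := (h.memLp_partial i).coeFn_toLp

/-- Integration by parts against a test function, for a smooth function. -/
theorem IsTest.integral_mul_partialDeriv {φ : Sp d → ℝ} (h : IsTest Ω φ) (i : Fin d)
    {ψ : Sp d → ℝ} (hψ : ContDiff ℝ 1 ψ) :
    ∫ x in Ω, ψ x * partialDeriv i φ x = - ∫ x in Ω, partialDeriv i ψ x * φ x := by
  have hφ0 : ∀ x ∉ Ω, φ x = 0 := fun x hx =>
    image_eq_zero_of_notMem_tsupport fun hx' => hx (h.tsupport_subset hx')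
  have hφ1 : ∀ x ∉ Ω, partialDeriv i φ x = 0 := fun x hx => by
    have : fderiv ℝ φ x = 0 :=
      image_eq_zero_of_notMem_tsupport fun hx' => hx (h.tsupport_subset (tsupport_fderiv_subset ℝ hx'))
    simp [partialDeriv, this]
  have hdψ : Continuous (partialDeriv i ψ) :=
    (hψ.continuous_fderiv (by simp)).clm_apply continuous_const
  have hdφ : Continuous (partialDeriv i φ) :=
    (h.contDiff.continuous_fderiv (by simp)).clm_apply continuous_const
  have hcs : HasCompactSupport (partialDeriv i φ) := h.hasCompactSupport.fderiv_apply ℝ _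
  rw [setIntegral_eq_integral_of_forall_compl_eq_zero (fun x hx => by rw [hφ1 x hx, mul_zero]),
    setIntegral_eq_integral_of_forall_compl_eq_zero (fun x hx => by rw [hφ0 x hx, mul_zero])]
  refine integral_mul_fderiv_eq_neg_fderiv_mul_of_integrable ?_ ?_ ?_ ?_ ?_
  · exact (hdψ.mul h.contDiff.continuous).integrable_of_hasCompactSupport
      h.hasCompactSupport.mul_left
  · exact (hψ.continuous.mul hdφ).integrable_of_hasCompactSupport hcs.mul_left
  · exact (hψ.continuous.mul h.contDiff.continuous).integrable_of_hasCompactSupport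
      h.hasCompactSupport.mul_left
  · exact fun x _ => (hψ.differentiable one_ne_zero) x
  · exact fun x _ => (h.contDiff.differentiable (by simp)) x

theorem isH1Fun_of_contDiff {F : Sp d → ℝ} (hF : ContDiff ℝ 1 F) (hs : HasCompactSupport F) :
    IsH1Fun Ω F where
  memLp := (hF.continuous.memLp_of_hasCompactSupport hs).restrict Ω
  memLp_partial i := by
    have hc : Continuous (partialDeriv i F) :=
      (hF.continuous_fderiv (by simp)).clm_apply continuous_const
    have hs' : HasCompactSupport (partialDeriv i F) := hs.fderiv_apply ℝ _
    exact (hc.memLp_of_hasCompactSupport hs').restrict Ω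
  weak i φ hφ := hφ.integral_mul_partialDeriv i hF

theorem enorm_sq_L2 (f : L2 Ω) : ‖f‖ₑ ^ 2 = ∫⁻ x in Ω, ‖f x‖ₑ ^ 2 := by
  rw [Lp.enorm_def, eLpNorm_eq_lintegral_rpow_enorm_toReal (by norm_num) (by norm_num)]
  simp only [ENNReal.toReal_ofNat, ENNReal.rpow_ofNat, one_div]
  rw [← ENNReal.rpow_natCast, ← ENNReal.rpow_mul]
  norm_num

theorem enorm_sq_L2_of_ae {f : L2 Ω} {F : Sp d → ℝ} (h : f =ᵐ[volume.restrict Ω] F) :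
    ‖f‖ₑ ^ 2 = ∫⁻ x in Ω, ‖F x‖ₑ ^ 2 := by
  rw [enorm_sq_L2]
  refine lintegral_congr_ae ?_
  filter_upwards [h] with x hx
  rw [hx]

/-! ## Finite element functions as elements of the Sobolev spaces -/

namespace SimplicialMesh

variable (M : SimplicialMesh Ω)

/-- Along a ray, one either stays in a cell or leaves the closed domain for some time. -/
theorem ray_dichotomy (x w : Sp d) (t : ℝ) :
    (∃ s ∈ M.cells, ∃ t' > t, ∀ τ ∈ Icc t t', x + τ • w ∈ hull s) ∨
      ∃ t' > t, ∀ τ ∈ Ioo t t', x + τ • w ∉ closure Ω := by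
  -- There are finitely many cells. Either one of them is met at times arbitrarily close to `t`, and
  -- convexity fills in the times between, or all of them are avoided for a while.
  by_cases h : ∃ s ∈ M.cells, ∃ᶠ τ in 𝓝[>] t, x + τ • w ∈ hull s
  · left
    obtain ⟨s, hs, hf⟩ := h
    obtain ⟨t', ht', htt'⟩ := (hf.and_eventually self_mem_nhdsWithin).exists
    have hc : Continuous fun τ : ℝ => x + τ • w := by fun_prop
    have ht : x + t • w ∈ hull s := by
      refine (isClosed_hull s).mem_of_frequently_of_tendsto hf ?_
      exact (hc.tendsto t).mono_left nhdsWithin_le_nhds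
    refine ⟨s, hs, t', htt', fun τ hτ => ?_⟩
    have hlt : t < t' := htt'
    have h1 : x + τ • w = AffineMap.lineMap (x + t • w) (x + t' • w) ((τ - t) / (t' - t)) := by
      rw [AffineMap.lineMap_apply_module']
      have : t' - t ≠ 0 := by linarith
      have h2 : (x + t' • w) - (x + t • w) = (t' - t) • w := by module
      rw [h2, smul_smul, div_mul_cancel₀ _ this]
      module
    rw [h1]
    refine (convex_hull s).lineMap_mem ht ht' ⟨?_, ?_⟩
    · exact div_nonneg (by linarith [hτ.1]) (by linarith)
    · rw [div_le_one (by linarith)]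
      linarith [hτ.2]
  · right
    push Not at h
    have h1 : ∀ᶠ τ in 𝓝[>] t, ∀ s ∈ M.cells, x + τ • w ∉ hull s :=
      (Finset.eventually_all _).2 fun s hs => h s hs
    obtain ⟨t', ht', hsub⟩ := (mem_nhdsGT_iff_exists_Ioo_subset).1 h1
    refine ⟨t', ht', fun τ hτ hmem => ?_⟩
    obtain ⟨s, hs, hxs⟩ := M.exists_mem_hull hmem
    exact hsub hτ s hs hxs

/-- A continuous function that vanishes outside of the closed domain, and on each cell agrees with a
function with gradient bounded by `L`, is Lipschitz. -/
theorem lipschitzWith_of_cells {F : Sp d → ℝ} (hF : Continuous F) {L : ℝ≥0}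
    (h : ∀ s ∈ M.cells, ∃ G : Sp d → ℝ, Differentiable ℝ G ∧ EqOn F G (hull s) ∧
      ∀ x ∈ hull s, ‖fderiv ℝ G x‖ ≤ L)
    (h0 : ∀ x ∉ closure Ω, F x = 0) : LipschitzWith L F := by
  refine LipschitzWith.of_dist_le_mul fun y x => ?_
  set w := y - x with hw
  let g : ℝ → ℝ := fun τ => F (x + τ • w)
  have hgc : Continuous g := hF.comp (by fun_prop)
  -- Only right derivatives along the segment are needed for the mean value inequality, and by
  -- `ray_dichotomy` these always exist, also on the faces of the mesh.
  have hder : ∀ t : ℝ, ∃ g' : ℝ, HasDerivWithinAt g g' (Ici t) t ∧ ‖g'‖ ≤ L * ‖w‖ := by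
    intro t
    rcases M.ray_dichotomy x w t with ⟨s, hs, t', ht', hmem⟩ | ⟨t', ht', hmem⟩
    · obtain ⟨G, hG, hFG, hL⟩ := h s hs
      have hline : HasDerivAt (fun τ : ℝ => x + τ • w) w t := by
        simpa using ((hasDerivAt_id t).smul_const w).const_add x
      have h1 : HasDerivAt (fun τ : ℝ => G (x + τ • w)) (fderiv ℝ G (x + t • w) w) t :=
        (hG (x + t • w)).hasFDerivAt.comp_hasDerivAt t hline
      have htt : t ∈ Icc t t' := ⟨le_rfl, le_of_lt ht'⟩
      refine ⟨_, ?_, (ContinuousLinearMap.le_opNorm _ _).trans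
        (mul_le_mul_of_nonneg_right (hL _ (hmem t htt)) (norm_nonneg _))⟩
      refine (h1.hasDerivWithinAt.congr_of_eventuallyEq (s := Ici t) ?_ (hFG (hmem t htt)))
      filter_upwards [Icc_mem_nhdsGE ht'] with τ hτ
      exact hFG (hmem τ hτ)
    · refine ⟨0, ?_, by simp; positivity⟩
      have hz : ∀ τ ∈ Ioo t t', g τ = 0 := fun τ hτ => h0 _ (hmem τ hτ)
      have hzt : g t = 0 := by
        have h1 : Tendsto g (𝓝[>] t) (𝓝 (g t)) := (hgc.tendsto t).mono_left nhdsWithin_le_nhds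
        have h2 : Tendsto g (𝓝[>] t) (𝓝 0) := by
          refine tendsto_const_nhds.congr' ?_
          filter_upwards [Ioo_mem_nhdsGT ht'] with τ hτ
          exact (hz τ hτ).symm
        exact tendsto_nhds_unique h1 h2
      refine (hasDerivWithinAt_const t (Ici t) (0 : ℝ)).congr_of_eventuallyEq ?_ hzt
      filter_upwards [Ico_mem_nhdsGE ht'] with τ hτ
      rcases eq_or_lt_of_le hτ.1 with h1 | h1
      · rw [← h1, hzt]
      · exact hz τ ⟨h1, hτ.2⟩
  choose g' hg' hgL using hder
  have := norm_image_sub_le_of_norm_deriv_right_le_segment (a := 0) (b := 1) hgc.continuousOn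
    (fun t _ => hg' t) (fun t _ => hgL t) 1 ⟨zero_le_one, le_rfl⟩
  simpa [g, hw, dist_eq_norm] using this

theorem exists_bound_finset {ι : Type*} (S : Finset ι) {p : ι → ℝ → Prop}
    (hp : ∀ i ∈ S, ∃ B, p i B) (hmono : ∀ i B B', B ≤ B' → p i B → p i B') :
    ∃ B : ℝ≥0, ∀ i ∈ S, p i B := by
  classical
  induction S using Finset.induction_on with
  | empty => exact ⟨0, by simp⟩
  | insert a S ha ih =>
    obtain ⟨B, hB⟩ := ih fun i hi => hp i (Finset.mem_insert_of_mem hi)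
    obtain ⟨B', hB'⟩ := hp a (Finset.mem_insert_self a S)
    refine ⟨B + B'.toNNReal, fun i hi => ?_⟩
    rcases Finset.mem_insert.1 hi with rfl | hi
    · refine hmono _ B' _ ?_ hB'
      push_cast
      have := Real.le_coe_toNNReal B'
      have h2 := B.2
      linarith
    · refine hmono _ B _ ?_ (hB i hi)
      push_cast
      have := (B'.toNNReal).2
      linarith

theorem fderiv_affine (a : Sp d →ᵃ[ℝ] ℝ) (x : Sp d) :
    HasFDerivAt a (LinearMap.toContinuousLinearMap a.linear) x := by
  have h1 : (a : Sp d → ℝ) = fun y => a.linear y + a 0 := by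
    funext y
    exact congrFun a.decomp y
  rw [h1]
  exact (LinearMap.toContinuousLinearMap a.linear).hasFDerivAt.add_const _

theorem contDiff_affine (a : Sp d →ᵃ[ℝ] ℝ) {n : WithTop ℕ∞} : ContDiff ℝ n a := by
  have h1 : (a : Sp d → ℝ) = fun y => LinearMap.toContinuousLinearMap a.linear y + a 0 := by
    funext y
    exact congrFun a.decomp y
  rw [h1]
  exact (LinearMap.toContinuousLinearMap a.linear).contDiff.add contDiff_const

/-- In the interior of a cell, a finite element function has the gradient of its affine piece. -/
theorem hasFDerivAt_of_mem_interior {F : Sp d → ℝ} {s : Finset (Sp d)} {a : Sp d →ᵃ[ℝ] ℝ}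
    (ha : EqOn F a (hull s)) {x : Sp d} (hx : x ∈ interior (hull s)) :
    HasFDerivAt F (LinearMap.toContinuousLinearMap a.linear) x := by
  refine (fderiv_affine a x).congr_of_eventuallyEq ?_
  filter_upwards [mem_interior_iff_mem_nhds.1 hx] with y hy
  exact ha hy

theorem volume_lt_top {Ω : Set (Sp d)} (M : SimplicialMesh Ω) : volume Ω < ⊤ :=
  (measure_mono subset_closure).trans_lt M.isCompact_closure.measure_lt_top

/-- Off the null set of cell frontiers, the derivative takes one of finitely many constant values.
Whatever `fderiv` is on the frontiers does not matter. -/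
theorem memLp_partialDeriv (v : M.p1Fun) (i : Fin d) :
    MemLp (partialDeriv i v.1) 2 (volume.restrict Ω) := by
  have hfin : IsFiniteMeasure (volume.restrict Ω) := ⟨by simpa using M.volume_lt_top⟩
  obtain ⟨B, hB⟩ := exists_bound_finset M.cells
    (p := fun s B => ∀ x ∈ interior (hull s), ‖partialDeriv i v.1 x‖ ≤ B)
    (fun s hs => by
      obtain ⟨a, ha⟩ := M.exists_affine v hs
      refine ⟨‖a.linear (EuclideanSpace.single i 1)‖, fun x hx => ?_⟩
      rw [partialDeriv, (hasFDerivAt_of_mem_interior ha hx).fderiv]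
      simp)
    (fun s B B' hBB h x hx => (h x hx).trans hBB)
  refine MemLp.of_bound (measurable_fderiv_apply_const ℝ v.1 _).aestronglyMeasurable B ?_
  filter_upwards [ae_restrict_of_ae M.ae_mem_interior,
    ae_restrict_of_ae_restrict_of_subset subset_closure
      (ae_restrict_mem isClosed_closure.measurableSet)] with x hx hxΩ
  obtain ⟨s, hs, hxs⟩ := hx hxΩ
  exact hB s hs x hxs

/-- The product of `v` with a test function, continued by zero, is Lipschitz on all of `ℝ^d` with
compact support. Hence its directional derivative has integral zero, and almost everywhere the
product rule holds. No terms on the faces of the mesh have to be cancelled. -/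
theorem isH1Fun (hreg : interior (closure Ω) = Ω) (v : M.p1Fun) : IsH1Fun Ω v.1 where
  memLp := M.memLp v
  memLp_partial := M.memLp_partialDeriv v
  weak i φ hφ := by
    have hopen : IsOpen Ω := hreg ▸ isOpen_interior
    let F : Sp d → ℝ := fun x => v.1 x * φ x
    have hφ0 : ∀ x ∉ Ω, φ x = 0 := fun x hx =>
      image_eq_zero_of_notMem_tsupport fun hx' => hx (hφ.tsupport_subset hx')
    have hloc : ∀ x ∉ Ω, F =ᶠ[𝓝 x] 0 := fun x hx => by
      have : (tsupport φ)ᶜ ∈ 𝓝 x := (isClosed_tsupport φ).isOpen_compl.mem_nhds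
        fun hx' => hx (hφ.tsupport_subset hx')
      filter_upwards [this] with y hy
      simp [F, image_eq_zero_of_notMem_tsupport hy]
    have hFc : Continuous F := by
      rw [continuous_iff_continuousAt]
      intro x
      by_cases hx : x ∈ Ω
      · exact ((v.2.1.mono subset_closure).continuousAt (hopen.mem_nhds hx)).mul
          hφ.contDiff.continuous.continuousAt
      · exact (continuousAt_const (y := (0 : ℝ))).congr (hloc x hx).symm
    have hFs : HasCompactSupport F := hφ.hasCompactSupport.mul_left
    obtain ⟨L, hL⟩ := exists_bound_finset M.cells
      (p := fun s B => ∃ G : Sp d → ℝ, Differentiable ℝ G ∧ EqOn F G (hull s) ∧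
        ∀ x ∈ hull s, ‖fderiv ℝ G x‖ ≤ B)
      (fun s hs => by
        obtain ⟨a, ha⟩ := M.exists_affine v hs
        have hG : ContDiff ℝ ∞ fun x => a x * φ x := (contDiff_affine a).mul hφ.contDiff
        obtain ⟨B, hB⟩ := (isCompact_hull s).exists_bound_of_continuousOn
          (hG.continuous_fderiv (by simp)).continuousOn
        exact ⟨B, _, hG.differentiable (by simp), fun x hx => by simp [F, ha hx], hB⟩)
      (fun s B B' hBB ⟨G, h1, h2, h3⟩ => ⟨G, h1, h2, fun x hx => (h3 x hx).trans hBB⟩)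
    have hLip : LipschitzWith L F := M.lipschitzWith_of_cells hFc hL
      fun x hx => by simp [F, hφ0 x fun h => hx (subset_closure h)]
    have h1 : ∫ x, lineDeriv ℝ F x (EuclideanSpace.single i 1) = 0 := by
      -- Integration by parts against the constant `1`; the formula reverses the direction, hence
      -- the sign.
      have h2 := (LipschitzWith.const (1 : ℝ)).integral_lineDeriv_mul_eq (μ := volume) hLip hFs
        (-EuclideanSpace.single i 1)
      have h3 : ∀ x : Sp d, lineDeriv ℝ (fun _ : Sp d => (1 : ℝ)) x
          (-EuclideanSpace.single i (1 : ℝ)) = 0 := fun x => by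
        simp [lineDeriv]
      simp_rw [h3] at h2
      simpa using h2.symm
    have h2 : ∫ x in Ω, lineDeriv ℝ F x (EuclideanSpace.single i 1) = 0 := by
      rw [setIntegral_eq_integral_of_forall_compl_eq_zero, h1]
      intro x hx
      rw [(hloc x hx).lineDeriv_eq]
      simp [lineDeriv]
    have h3 : ∀ᵐ x ∂volume.restrict Ω, lineDeriv ℝ F x (EuclideanSpace.single i 1) =
        v.1 x * partialDeriv i φ x + partialDeriv i v.1 x * φ x := by
      filter_upwards [ae_restrict_of_ae M.ae_mem_interior,
        ae_restrict_mem hopen.measurableSet] with x hx hxΩ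
      obtain ⟨s, hs, hxs⟩ := hx (subset_closure hxΩ)
      obtain ⟨a, ha⟩ := M.exists_affine v hs
      have h4 := hasFDerivAt_of_mem_interior ha hxs
      have h5 := h4.differentiableAt.hasFDerivAt.mul
        (hφ.contDiff.differentiable (by simp) x).hasFDerivAt
      have h6 := (h5.hasLineDerivAt (EuclideanSpace.single i 1)).lineDeriv
      refine Eq.trans h6 ?_
      simp [partialDeriv, mul_comm]
    rw [integral_congr_ae h3, integral_add] at h2
    · linarith
    · exact (M.memLp v).integrable_mul (hφ.memLp_partialDeriv i)
    · exact (M.memLp_partialDeriv v i).integrable_mul hφ.memLp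

theorem toL2_toH1 (hreg : interior (closure Ω) = Ω) (v : M.p1Fun) :
    H1.toL2 Ω (M.isH1Fun hreg v).toH1 = M.toL2 v := rfl

end SimplicialMesh

end SpaceTime
end

/-! ### Conformity of the discrete space with zero boundary values. -/

noncomputable section
namespace SpaceTime
open Filter Topology
variable {d : ℕ} {Ω : Set (Sp d)}

theorem IsTest.toH1_mem {φ : Sp d → ℝ} (h : IsTest Ω φ) (h' : IsH1Fun Ω φ) : h'.toH1 ∈ H10 Ω :=
  Submodule.le_topologicalClosure _ ⟨φ, h, h'.toL2_toH1⟩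

theorem abs_partialDeriv_le_norm (i : Fin d) (F : Sp d → ℝ) (x : Sp d) :
    |partialDeriv i F x| ≤ ‖fderiv ℝ F x‖ := by
  have h := (fderiv ℝ F x).le_opNorm (EuclideanSpace.single i 1)
  rwa [PiLp.norm_single, norm_one, mul_one, Real.norm_eq_abs] at h

theorem abs_partialDeriv_le {F : Sp d → ℝ} {L : ℝ≥0} (hF : LipschitzWith L F) (i : Fin d)
    (x : Sp d) : |partialDeriv i F x| ≤ L :=
  (abs_partialDeriv_le_norm i F x).trans (norm_fderiv_le_of_lipschitz ℝ hF)

theorem norm_toLp_le_of_bound {A : Set (Sp d)} (hA : volume A < ⊤) {F : Sp d → ℝ}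
    (hF : MemLp F 2 (volume.restrict A)) {B : ℝ} (hB : 0 ≤ B) (h : ∀ x, |F x| ≤ B) :
    ‖hF.toLp F‖ ≤ (volume A).toReal ^ (1 / 2 : ℝ) * B := by
  have h1 : eLpNorm F 2 (volume.restrict A) ≤ volume A ^ (1 / 2 : ℝ) * ENNReal.ofReal B := by
    refine (eLpNorm_le_of_ae_bound (C := B) (ae_of_all _ h)).trans ?_
    simp
  rw [Lp.norm_toLp]
  refine (ENNReal.toReal_mono ?_ h1).trans ?_
  · exact ENNReal.mul_ne_top (ENNReal.rpow_ne_top_of_nonneg (by norm_num) hA.ne) ENNReal.ofReal_ne_top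
  · rw [ENNReal.toReal_mul, ENNReal.toReal_rpow, ENNReal.toReal_ofReal hB]

namespace SimplicialMesh

variable (M : SimplicialMesh Ω)

theorem continuous_of_mem_p1Fun0 (hreg : interior (closure Ω) = Ω) {v : M.p1Fun}
    (hv : v ∈ M.p1Fun0) : Continuous v.1 := by
  have hopen : IsOpen Ω := hreg ▸ isOpen_interior
  have h0 : ∀ x ∉ Ω, v.1 x = 0 := by
    intro x hx
    by_cases hxc : x ∈ closure Ω
    · exact hv x (by rw [hopen.frontier_eq]; exact ⟨hxc, hx⟩)
    · exact v.2.2.2 x hxc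
  have h1 : ContinuousOn v.1 (closure Ω ∪ Ωᶜ) :=
    v.2.1.union_of_isClosed (continuousOn_const.congr fun x hx => h0 x hx) isClosed_closure
      hopen.isClosed_compl
  have h2 : closure Ω ∪ Ωᶜ = univ := by
    refine eq_univ_of_forall fun x => ?_
    by_cases hx : x ∈ Ω
    · exact Or.inl (subset_closure hx)
    · exact Or.inr hx
  rwa [h2, continuousOn_univ] at h1

theorem exists_lipschitzWith (hreg : interior (closure Ω) = Ω) {v : M.p1Fun}
    (hv : v ∈ M.p1Fun0) : ∃ L, LipschitzWith L v.1 := by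
  obtain ⟨L, hL⟩ := exists_bound_finset M.cells
    (p := fun s B => ∃ G : Sp d → ℝ, Differentiable ℝ G ∧ EqOn v.1 G (hull s) ∧
      ∀ x ∈ hull s, ‖fderiv ℝ G x‖ ≤ B)
    (fun s hs => by
      obtain ⟨a, ha⟩ := M.exists_affine v hs
      exact ⟨_, a, fun x => (fderiv_affine a x).differentiableAt, ha,
        fun x _ => (congrArg norm (fderiv_affine a x).fderiv).le⟩)
    (fun s B B' hBB ⟨G, h1, h2, h3⟩ => ⟨G, h1, h2, fun x hx => (h3 x hx).trans hBB⟩)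
  exact ⟨L, M.lipschitzWith_of_cells (M.continuous_of_mem_p1Fun0 hreg hv) hL v.2.2.2⟩

/-- Finite element functions with zero boundary values are uniform limits of uniformly Lipschitz
test functions. -/
theorem exists_test_of_mem_p1Fun0 (hreg : interior (closure Ω) = Ω) {v : M.p1Fun}
    (hv : v ∈ M.p1Fun0) {L : ℝ≥0} (hL : LipschitzWith L v.1) {ε : ℝ} (hε : 0 < ε) :
    ∃ φ, IsTest Ω φ ∧ (∀ x, |φ x - v.1 x| ≤ ε) ∧ LipschitzWith (L + L) φ := by
  have hopen : IsOpen Ω := hreg ▸ isOpen_interior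
  have h0 : ∀ x ∉ Ω, v.1 x = 0 := by
    intro x hx
    by_cases hxc : x ∈ closure Ω
    · exact hv x (by rw [hopen.frontier_eq]; exact ⟨hxc, hx⟩)
    · exact v.2.2.2 x hxc
  set η : ℝ := ε / 2 with hη
  have hη0 : 0 < η := by positivity
  -- Values in `[-η, η]` are removed by truncation. The result is zero where `|v| < η`, so its
  -- support lies in a compact subset of `Ω`; it changes `v` by at most `η` and remains Lipschitz.
  let F : Sp d → ℝ := fun x => v.1 x - max (-η) (min η (v.1 x))
  have hFL : LipschitzWith (L + L) F := by
    have := (hL.const_min η).const_max (-η)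
    exact hL.sub this
  have hFv : ∀ x, |F x - v.1 x| ≤ η := by
    intro x
    have h1 : F x - v.1 x = - max (-η) (min η (v.1 x)) := by simp only [F]; ring
    rw [h1, abs_neg, abs_le]
    refine ⟨le_max_left _ _, max_le (by linarith) (min_le_left _ _)⟩
  let K : Set (Sp d) := {x | η ≤ |v.1 x|}
  have hKcl : IsClosed K := isClosed_le continuous_const hL.continuous.abs
  have hKΩ : K ⊆ Ω := by
    intro x hx
    by_contra hxΩ
    have : η ≤ |v.1 x| := hx
    rw [h0 x hxΩ, abs_zero] at this
    linarith
  have hKc : IsCompact K :=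
    M.isCompact_closure.of_isClosed_subset hKcl (hKΩ.trans subset_closure)
  have hFK : Function.support F ⊆ K := by
    intro x hx
    by_contra hxK
    have h1 : |v.1 x| < η := not_le.1 hxK
    rw [abs_lt] at h1
    apply hx
    have h2 : min η (v.1 x) = v.1 x := min_eq_right h1.2.le
    have h3 : max (-η) (v.1 x) = v.1 x := max_eq_right h1.1.le
    simp only [F]
    rw [h2, h3, sub_self]
  obtain ⟨δ, hδ, hδΩ⟩ := hKc.exists_cthickening_subset_open hopen hKΩ
  -- The mollification radius: at most `δ` to keep the support in `Ω`, and at most `η / (L + L + 1)`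
  -- so that the Lipschitz bound gives a further error of at most `η`, for a total of `ε = 2 η`.
  set ρ : ℝ := min δ (η / (L + L + 1)) with hρ
  have hρ0 : 0 < ρ := lt_min hδ (by positivity)
  let b : ContDiffBump (0 : Sp d) := ⟨ρ / 2, ρ, by positivity, by linarith⟩
  let φ : Sp d → ℝ := convolution (b.normed volume) F (ContinuousLinearMap.lsmul ℝ ℝ) volume
  have hFloc : LocallyIntegrable F volume := hFL.continuous.locallyIntegrable
  have hsupp : Function.support φ ⊆ Metric.cthickening δ K := by
    refine (support_convolution_subset _).trans ?_
    rintro _ ⟨y, hy, x, hx, rfl⟩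
    rw [b.support_normed_eq] at hy
    refine Metric.mem_cthickening_of_dist_le _ x δ K (hFK hx) ?_
    have h1 : ‖y‖ < ρ := by simpa using hy
    change dist (y + x) x ≤ δ
    rw [dist_eq_norm, add_sub_cancel_right]
    exact h1.le.trans (min_le_left _ _)
  have htsupp : tsupport φ ⊆ Metric.cthickening δ K :=
    closure_minimal hsupp Metric.isClosed_cthickening
  refine ⟨φ, ⟨?_, ?_, htsupp.trans hδΩ⟩, fun x => ?_, ?_⟩
  · exact b.hasCompactSupport_normed.contDiff_convolution_left _ b.contDiff_normed hFloc
  · exact HasCompactSupport.of_support_subset_isCompact hKc.cthickening hsupp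
  · have h1 : dist (φ x) (F x) ≤ η := by
      refine b.dist_normed_convolution_le hFL.continuous.aestronglyMeasurable fun y hy => ?_
      refine (hFL.dist_le_mul y x).trans ?_
      have h2 : dist y x ≤ η / (L + L + 1) := (Metric.mem_ball.1 hy).le.trans (min_le_right _ _)
      calc ((L + L : ℝ≥0) : ℝ) * dist y x ≤ (L + L) * (η / (L + L + 1)) := by
            push_cast
            gcongr
        _ ≤ η := by
            have hL0 := L.2
            rw [mul_div_assoc', div_le_iff₀ (by positivity)]
            nlinarith
    rw [Real.dist_eq] at h1
    have h2 : φ x - v.1 x = (φ x - F x) + (F x - v.1 x) := by ring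
    rw [h2]
    refine (abs_add_le _ _).trans ?_
    linarith [hFv x]
  · refine LipschitzWith.of_dist_le_mul fun x y => ?_
    have hint : ∀ x, Integrable (fun t => b.normed volume t * F (x - t)) volume := fun x =>
      (b.continuous_normed.mul (hFL.continuous.comp (by fun_prop))).integrable_of_hasCompactSupport
        b.hasCompactSupport_normed.mul_right
    have h1 : φ x - φ y = ∫ t, b.normed volume t * (F (x - t) - F (y - t)) := by
      have h2 : ∀ x, φ x = ∫ t, b.normed volume t * F (x - t) := fun x => rfl
      rw [h2, h2, ← integral_sub (hint x) (hint y)]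
      refine integral_congr_ae (ae_of_all _ fun t => ?_)
      simp only
      ring
    rw [Real.dist_eq, h1]
    have h3 : ∀ᵐ t, ‖b.normed volume t * (F (x - t) - F (y - t))‖ ≤
        b.normed volume t * (((L + L : ℝ≥0) : ℝ) * dist x y) := ae_of_all _ fun t => by
      rw [norm_mul, Real.norm_of_nonneg (b.nonneg_normed t)]
      refine mul_le_mul_of_nonneg_left ?_ (b.nonneg_normed t)
      have := hFL.dist_le_mul (x - t) (y - t)
      rwa [dist_sub_right] at this
    refine (norm_integral_le_of_norm_le (b.integrable_normed.mul_const _) h3).trans ?_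
    rw [integral_mul_const, b.integral_normed, one_mul]

/-- `S¹₀(Ω_h) ⊆ H¹₀(Ω)`. -/
theorem exists_H10_of_mem_p1Fun0 (hreg : interior (closure Ω) = Ω) {v : M.p1Fun}
    (hv : v ∈ M.p1Fun0) : ∃ w ∈ H10 Ω, H1.toL2 Ω w = M.toL2 v := by
  obtain ⟨L, hL⟩ := M.exists_lipschitzWith hreg hv
  have hfin := M.volume_lt_top
  obtain ⟨B, hB⟩ := M.isCompact_closure.exists_bound_of_continuousOn v.2.1
  have hB' : ∀ x, |v.1 x| ≤ max B 0 := by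
    intro x
    by_cases hx : x ∈ closure Ω
    · exact (hB x hx).trans (le_max_left _ _)
    · rw [v.2.2.2 x hx, abs_zero]
      exact le_max_right _ _
  choose φ hφ hφv hφL using fun n : ℕ =>
    M.exists_test_of_mem_p1Fun0 hreg hv hL (ε := 1 / (n + 1)) (by positivity)
  have hφ1 : ∀ n, IsH1Fun Ω (φ n) := fun n =>
    isH1Fun_of_contDiff ((hφ n).contDiff.of_le (by simp)) (hφ n).hasCompactSupport
  let w : ℕ → H1 Ω := fun n => (hφ1 n).toH1
  set V : ℝ := (volume Ω).toReal ^ (1 / 2 : ℝ) with hV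
  have hV0 : 0 ≤ V := by positivity
  have hbound : ∀ n, ‖w n‖ ≤ V * (max B 0 + 1) + ∑ _i : Fin d, V * ((L + L : ℝ≥0) : ℝ) := by
    intro n
    refine (H1.norm_le (hφ1 n).toH1).trans (add_le_add ?_ (Finset.sum_le_sum fun i _ => ?_))
    · refine norm_toLp_le_of_bound hfin (hφ1 n).memLp (by positivity) fun x => ?_
      have h1 := hφv n x
      have h2 : (1 : ℝ) / (n + 1) ≤ 1 := by
        rw [div_le_one (by positivity)]
        linarith [n.cast_nonneg (α := ℝ)]
      have h3 : φ n x = (φ n x - v.1 x) + v.1 x := by ring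
      rw [h3]
      refine (abs_add_le _ _).trans ?_
      linarith [hB' x]
    · refine norm_toLp_le_of_bound hfin ((hφ1 n).memLp_partial i) (by positivity) fun x => ?_
      exact abs_partialDeriv_le (hφL n) i x
  have hlim : Tendsto (fun n => H1.toL2 Ω (w n)) atTop (𝓝 (M.toL2 v)) := by
    rw [tendsto_iff_norm_sub_tendsto_zero]
    have h1 : ∀ n, ‖H1.toL2 Ω (w n) - M.toL2 v‖ ≤ V * (1 / (n + 1)) := by
      intro n
      exact norm_toLp_le_of_bound hfin ((hφ1 n).memLp.sub (M.memLp v)) (by positivity) (hφv n)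
    refine squeeze_zero (fun n => norm_nonneg _) h1 ?_
    have := tendsto_one_div_add_atTop_nhds_zero_nat (𝕜 := ℝ)
    simpa using this.const_mul V
  -- The test functions converge uniformly and have uniformly bounded gradients, which gives the
  -- limit in `L²(Ω)` and the bound in `H¹(Ω)`.
  obtain ⟨x, hx0, -, hx⟩ := H1.mem_H10_of_tendsto hbound
    (fun n => (hφ n).toH1_mem (hφ1 n)) hlim
  exact ⟨x, hx0, hx⟩

theorem toH1_mem_H10 (hreg : interior (closure Ω) = Ω) {v : M.p1Fun}
    (hv : v ∈ M.p1Fun0) : (M.isH1Fun hreg v).toH1 ∈ H10 Ω := by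
  obtain ⟨w, hw0, hw⟩ := M.exists_H10_of_mem_p1Fun0 hreg hv
  have : (M.isH1Fun hreg v).toH1 = w :=
    H1.toL2_injective (hreg ▸ isOpen_interior) hw.symm
  rw [this]
  exact hw0

end SimplicialMesh

/-! ## Estimates for affine functions on the cells -/

theorem volume_closedBall_mul (x : Sp d) {l : ℝ} (hl : 0 < l) (R : ℝ) :
    volume (Metric.closedBall x (l * R)) =
      ENNReal.ofReal (l ^ d) * volume (Metric.closedBall (0 : Sp d) R) := by
  rw [Measure.addHaar_closedBall_mul_of_pos volume x hl]
  simp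

theorem exists_unit_of_clm (G : Sp d →L[ℝ] ℝ) : ∃ u : Sp d, ‖u‖ ≤ 1 ∧ G u = ‖G‖ := by
  let g := (InnerProductSpace.toDual ℝ (Sp d)).symm G
  have hg : ∀ y, G y = inner ℝ g y := fun y => InnerProductSpace.toDual_symm_apply.symm
  have hn : ‖g‖ = ‖G‖ := by simp [g]
  by_cases h0 : ‖g‖ = 0
  · exact ⟨0, by simp, by rw [← hn, h0, map_zero]⟩
  · refine ⟨‖g‖⁻¹ • g, ?_, ?_⟩
    · rw [norm_smul, norm_inv, norm_norm, inv_mul_cancel₀ h0]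
    · rw [hg, inner_smul_right, real_inner_self_eq_norm_sq, ← hn, pow_two, inv_mul_cancel_left₀ h0]

/-- The affine function `x ↦ α + G (x - c)` is controlled by its `L²` norm over a ball around
`c`. -/
theorem affine_le_lintegral {a : Sp d → ℝ} {G : Sp d →L[ℝ] ℝ} {c : Sp d}
    (ha : ∀ x, a x = a c + G (x - c)) {ρ : ℝ} (hρ : 0 < ρ) {A : Set (Sp d)}
    (hA : Metric.ball c ρ ⊆ A) :
    ENNReal.ofReal ((|a c| + ‖G‖ * (ρ / 4)) ^ 2) * volume (Metric.closedBall (0 : Sp d) (ρ / 4)) ≤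
      ∫⁻ x in A, ‖a x‖ₑ ^ 2 := by
  obtain ⟨u, hu, hGu⟩ := exists_unit_of_clm G
  obtain ⟨σ, hσ, hσa⟩ : ∃ σ : ℝ, |σ| = 1 ∧ σ * a c = |a c| := by
    rcases le_total 0 (a c) with h | h
    · exact ⟨1, by simp, by rw [abs_of_nonneg h, one_mul]⟩
    · exact ⟨-1, by simp, by rw [abs_of_nonpos h]; ring⟩
  have hσσ : σ * σ = 1 := by rw [← abs_mul_abs_self, hσ, one_mul]
  -- The centre is moved in the direction in which `|a|` increases, with the sign `σ` of `a c`. On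
  -- the ball of radius `ρ / 4` about `c'`, `|a|` is at least `|a c| + ‖G‖ (ρ / 2 - ρ / 4)`, so the
  -- two terms do not cancel.
  set c' : Sp d := c + (σ * (ρ / 2)) • u with hc'
  have hsub : Metric.closedBall c' (ρ / 4) ⊆ A := by
    refine Subset.trans (fun x hx => ?_) hA
    rw [Metric.mem_closedBall, dist_eq_norm] at hx
    rw [Metric.mem_ball, dist_eq_norm]
    have h1 : x - c = (x - c') + (σ * (ρ / 2)) • u := by rw [hc']; abel
    rw [h1]
    have h2 : ‖(σ * (ρ / 2)) • u‖ ≤ ρ / 2 := by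
      rw [norm_smul, norm_mul, Real.norm_eq_abs, hσ, one_mul, Real.norm_of_nonneg (by positivity)]
      nlinarith
    exact (norm_add_le _ _).trans_lt (by linarith)
  have hval : ∀ x ∈ Metric.closedBall c' (ρ / 4),
      ENNReal.ofReal ((|a c| + ‖G‖ * (ρ / 4)) ^ 2) ≤ ‖a x‖ₑ ^ 2 := by
    intro x hx
    rw [Metric.mem_closedBall, dist_eq_norm] at hx
    have h1 : x - c = (x - c') + (σ * (ρ / 2)) • u := by rw [hc']; abel
    have h2 : σ * a x = |a c| + ‖G‖ * (ρ / 2) + σ * G (x - c') := by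
      rw [ha x, h1, map_add, map_smul, hGu, smul_eq_mul, mul_add, hσa, mul_add]
      have : σ * (σ * (ρ / 2) * ‖G‖) = (σ * σ) * (ρ / 2 * ‖G‖) := by ring
      rw [this, hσσ]
      ring
    have h3 : |σ * G (x - c')| ≤ ‖G‖ * (ρ / 4) := by
      rw [abs_mul, hσ, one_mul]
      exact (G.le_opNorm _).trans (by gcongr)
    have h4 : |a c| + ‖G‖ * (ρ / 4) ≤ |a x| := by
      have h5 : |σ * a x| = |a x| := by rw [abs_mul, hσ, one_mul]
      rw [← h5]
      refine le_trans ?_ (le_abs_self _)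
      rw [h2]
      have := (abs_le.1 h3).1
      linarith
    rw [← ofReal_norm, ← ENNReal.ofReal_pow (norm_nonneg _), Real.norm_eq_abs]
    gcongr
  calc _ = ∫⁻ _x in Metric.closedBall c' (ρ / 4),
        ENNReal.ofReal ((|a c| + ‖G‖ * (ρ / 4)) ^ 2) := by
        rw [setLIntegral_const, Measure.addHaar_closedBall_center volume c']
    _ ≤ ∫⁻ x in Metric.closedBall c' (ρ / 4), ‖a x‖ₑ ^ 2 :=
        setLIntegral_mono' Metric.isClosed_closedBall.measurableSet hval
    _ ≤ _ := lintegral_mono_set hsub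

end SpaceTime
end

noncomputable section
namespace SpaceTime
open Filter Topology
variable {d : ℕ} {Ω : Set (Sp d)}

/-- The linear part of an affine function, as a continuous linear map. -/
def slope (a : Sp d →ᵃ[ℝ] ℝ) : Sp d →L[ℝ] ℝ := LinearMap.toContinuousLinearMap a.linear

theorem affine_eq_add_slope (a : Sp d →ᵃ[ℝ] ℝ) (c x : Sp d) : a x = a c + slope a (x - c) := by
  have h := a.linearMap_vsub x c
  simp only [vsub_eq_sub] at h
  change a x = a c + a.linear (x - c)
  rw [h]
  ring

theorem hasFDerivAt_affine (a : Sp d →ᵃ[ℝ] ℝ) (x : Sp d) : HasFDerivAt a (slope a) x :=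
  SimplicialMesh.fderiv_affine a x

theorem enorm_sq_eq_ofReal {E : Type*} [NormedAddCommGroup E] (x : E) :
    ‖x‖ₑ ^ 2 = ENNReal.ofReal (‖x‖ ^ 2) := by
  rw [← ofReal_norm, ENNReal.ofReal_pow (norm_nonneg _)]

namespace SimplicialMesh

variable (M : SimplicialMesh Ω)

theorem IsUniform.exists_center {M : SimplicialMesh Ω} {h κ : ℝ} (hu : M.IsUniform h κ)
    (hh : 0 < h) (hκ : 0 < κ) {s : Finset (Sp d)} (hs : s ∈ M.cells) :
    ∃ c ∈ hull s, Metric.ball c (h / κ) ⊆ hull s ∧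
      ∀ x ∈ hull s, ∀ y ∈ hull s, dist x y ≤ κ * h := by
  obtain ⟨h1, c, hc⟩ := hu s hs
  refine ⟨c, hc (Metric.mem_ball_self (by positivity)), hc, fun x hx y hy => ?_⟩
  exact (Metric.dist_le_diam_of_mem (isCompact_hull s).isBounded hx hy).trans h1

/-- Compares a ball that contains a cell, of radius `κ h`, with the ball inside of it that
`affine_le_lintegral` provides, of radius `h / (4 κ)`. -/
theorem volume_ball_scale {κ h : ℝ} (hκ : 0 < κ) :
    volume (Metric.closedBall (0 : Sp d) (κ * h)) = ENNReal.ofReal ((4 * κ ^ 2) ^ d) *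
      volume (Metric.closedBall (0 : Sp d) (h / κ / 4)) := by
  rw [← volume_closedBall_mul 0 (by positivity)]
  congr 2
  field_simp

/-- On a cell, the values of an affine function are bounded by its `L²` norm. -/
theorem IsUniform.value_le {M : SimplicialMesh Ω} {h κ : ℝ} (hu : M.IsUniform h κ)
    (hh : 0 < h) (hκ : 0 < κ) {s : Finset (Sp d)} (hs : s ∈ M.cells) (a : Sp d →ᵃ[ℝ] ℝ)
    {z : Sp d} (hz : z ∈ hull s) :
    ‖a z‖ₑ ^ 2 * volume (Metric.closedBall (0 : Sp d) (κ * h)) ≤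
      ENNReal.ofReal ((1 + 4 * κ ^ 2) ^ 2 * (4 * κ ^ 2) ^ d) * ∫⁻ x in hull s, ‖a x‖ₑ ^ 2 := by
  obtain ⟨c, hc, hball, hdist⟩ := hu.exists_center hh hκ hs
  have h1 := affine_le_lintegral (fun x => affine_eq_add_slope a c x) (by positivity) hball
  have hz1 : |a z| ≤ (1 + 4 * κ ^ 2) * (|a c| + ‖slope a‖ * (h / κ / 4)) := by
    rw [affine_eq_add_slope a c z]
    have h2 : |slope a (z - c)| ≤ ‖slope a‖ * (κ * h) := by
      refine ((slope a).le_opNorm _).trans ?_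
      have := hdist z hz c hc
      rw [dist_eq_norm] at this
      gcongr
    refine (abs_add_le _ _).trans ?_
    have h3 : ‖slope a‖ * (κ * h) = 4 * κ ^ 2 * (‖slope a‖ * (h / κ / 4)) := by field_simp
    have h4 : 0 ≤ ‖slope a‖ * (h / κ / 4) := by positivity
    have h5 : 0 ≤ 4 * κ ^ 2 * |a c| := by positivity
    rw [h3] at h2
    nlinarith
  rw [volume_ball_scale hκ, enorm_sq_eq_ofReal, ENNReal.ofReal_mul (by positivity)]
  calc ENNReal.ofReal (‖a z‖ ^ 2) * (ENNReal.ofReal ((4 * κ ^ 2) ^ d) *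
        volume (Metric.closedBall (0 : Sp d) (h / κ / 4)))
      ≤ ENNReal.ofReal ((1 + 4 * κ ^ 2) ^ 2 * (|a c| + ‖slope a‖ * (h / κ / 4)) ^ 2) *
        (ENNReal.ofReal ((4 * κ ^ 2) ^ d) *
          volume (Metric.closedBall (0 : Sp d) (h / κ / 4))) := by
        rw [Real.norm_eq_abs, ← mul_pow]
        gcongr
    _ = ENNReal.ofReal ((1 + 4 * κ ^ 2) ^ 2) * ENNReal.ofReal ((4 * κ ^ 2) ^ d) *
        (ENNReal.ofReal ((|a c| + ‖slope a‖ * (h / κ / 4)) ^ 2) *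
          volume (Metric.closedBall (0 : Sp d) (h / κ / 4))) := by
        rw [ENNReal.ofReal_mul (by positivity)]
        ring
    _ ≤ _ := by gcongr

/-- The inverse inequality on a cell. -/
theorem IsUniform.slope_le {M : SimplicialMesh Ω} {h κ : ℝ} (hu : M.IsUniform h κ)
    (hh : 0 < h) (hκ : 0 < κ) {s : Finset (Sp d)} (hs : s ∈ M.cells) (a : Sp d →ᵃ[ℝ] ℝ) :
    ENNReal.ofReal (h ^ 2) * (‖slope a‖ₑ ^ 2 * volume (hull s)) ≤
      ENNReal.ofReal ((4 * κ) ^ 2 * (4 * κ ^ 2) ^ d) * ∫⁻ x in hull s, ‖a x‖ₑ ^ 2 := by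
  obtain ⟨c, hc, hball, hdist⟩ := hu.exists_center hh hκ hs
  have h1 := affine_le_lintegral (fun x => affine_eq_add_slope a c x) (by positivity) hball
  have hvol : volume (hull s) ≤ volume (Metric.closedBall (0 : Sp d) (κ * h)) := by
    rw [← Measure.addHaar_closedBall_center volume c]
    exact measure_mono fun x hx => hdist x hx c hc
  have h2 : h * ‖slope a‖ ≤ 4 * κ * (|a c| + ‖slope a‖ * (h / κ / 4)) := by
    have h3 : h * ‖slope a‖ = 4 * κ * (‖slope a‖ * (h / κ / 4)) := by field_simp
    have h5 : 0 ≤ 4 * κ * |a c| := by positivity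
    rw [h3]
    linarith
  calc ENNReal.ofReal (h ^ 2) * (‖slope a‖ₑ ^ 2 * volume (hull s))
      ≤ ENNReal.ofReal (h ^ 2) * (ENNReal.ofReal (‖slope a‖ ^ 2) * (ENNReal.ofReal ((4 * κ ^ 2) ^ d) *
        volume (Metric.closedBall (0 : Sp d) (h / κ / 4)))) := by
        rw [enorm_sq_eq_ofReal, ← volume_ball_scale hκ]
        gcongr
    _ = ENNReal.ofReal ((h * ‖slope a‖) ^ 2) * (ENNReal.ofReal ((4 * κ ^ 2) ^ d) *
        volume (Metric.closedBall (0 : Sp d) (h / κ / 4))) := by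
        rw [mul_pow h ‖slope a‖ 2, ENNReal.ofReal_mul (by positivity)]
        ring
    _ ≤ ENNReal.ofReal ((4 * κ) ^ 2 * (|a c| + ‖slope a‖ * (h / κ / 4)) ^ 2) *
        (ENNReal.ofReal ((4 * κ ^ 2) ^ d) *
          volume (Metric.closedBall (0 : Sp d) (h / κ / 4))) := by
        rw [← mul_pow]
        gcongr
    _ = ENNReal.ofReal ((4 * κ) ^ 2) * ENNReal.ofReal ((4 * κ ^ 2) ^ d) *
        (ENNReal.ofReal ((|a c| + ‖slope a‖ * (h / κ / 4)) ^ 2) *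
          volume (Metric.closedBall (0 : Sp d) (h / κ / 4))) := by
        rw [ENNReal.ofReal_mul (by positivity)]
        ring
    _ ≤ _ := by
        rw [ENNReal.ofReal_mul (by positivity)]
        gcongr

theorem fderiv_eq_slope {F : Sp d → ℝ} {s : Finset (Sp d)} {a : Sp d →ᵃ[ℝ] ℝ}
    (ha : EqOn F a (hull s)) {x : Sp d} (hx : x ∈ interior (hull s)) :
    fderiv ℝ F x = slope a := (hasFDerivAt_of_mem_interior ha hx).fderiv

theorem ae_hull_mem_interior (s : Finset (Sp d)) :
    ∀ᵐ x ∂volume.restrict (hull s), x ∈ interior (hull s) := by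
  have h : ∀ᵐ x, x ∉ frontier (hull s) :=
    measure_eq_zero_iff_ae_notMem.1 ((convex_hull s).addHaar_frontier volume)
  filter_upwards [ae_restrict_of_ae h, ae_restrict_mem (isClosed_hull s).measurableSet] with x h1 h2
  by_contra h3
  exact h1 ⟨subset_closure h2, h3⟩

/-- The global inverse inequality. -/
theorem IsUniform.inverse {M : SimplicialMesh Ω} {h κ : ℝ} (hu : M.IsUniform h κ)
    (hreg : interior (closure Ω) = Ω) (hh : 0 < h) (hκ : 0 < κ) (q : M.p1Fun) :
    ENNReal.ofReal (h ^ 2) * ∫⁻ x in Ω, ‖fderiv ℝ q.1 x‖ₑ ^ 2 ≤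
      ENNReal.ofReal ((4 * κ) ^ 2 * (4 * κ ^ 2) ^ d) * ∫⁻ x in Ω, ‖q.1 x‖ₑ ^ 2 := by
  rw [M.lintegral_eq_sum hreg, M.lintegral_eq_sum hreg, Finset.mul_sum, Finset.mul_sum]
  refine Finset.sum_le_sum fun s hs => ?_
  obtain ⟨a, ha⟩ := M.exists_affine q hs
  have h1 : ∫⁻ x in hull s, ‖fderiv ℝ q.1 x‖ₑ ^ 2 = ‖slope a‖ₑ ^ 2 * volume (hull s) := by
    rw [← setLIntegral_const]
    refine lintegral_congr_ae ?_
    filter_upwards [ae_hull_mem_interior s] with x hx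
    rw [fderiv_eq_slope ha hx]
  have h2 : ∫⁻ x in hull s, ‖q.1 x‖ₑ ^ 2 = ∫⁻ x in hull s, ‖a x‖ₑ ^ 2 :=
    setLIntegral_congr_fun (isClosed_hull s).measurableSet fun x hx => by
      simp only [ha hx]
  rw [h1, h2]
  exact hu.slope_le hh hκ hs a

theorem lintegral_hull_le (hreg : interior (closure Ω) = Ω) {s : Finset (Sp d)} (hs : s ∈ M.cells)
    {B : Set (Sp d)} (hB : hull s ⊆ B) (W : Sp d → ℝ≥0∞) :
    ∫⁻ x in hull s, W x ≤ ∫⁻ x in B ∩ Ω, W x := by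
  have h1 : ∫⁻ x in hull s, W x = ∫⁻ x in interior (hull s), W x := by
    refine setLIntegral_congr (Filter.EventuallyEq.symm ?_)
    exact interior_ae_eq_of_null_frontier ((convex_hull s).addHaar_frontier volume)
  rw [h1]
  refine lintegral_mono_set fun x hx => ⟨hB (interior_subset hx), ?_⟩
  rw [← hreg]
  exact interior_mono (M.hull_subset hs) hx

/-- Quantities that are bounded on each cell by local integrals are summable over the cells. -/
theorem IsUniform.sum_le {M : SimplicialMesh Ω} {h κ : ℝ} (hu : M.IsUniform h κ)
    (hreg : interior (closure Ω) = Ω) (hh : 0 < h) (hκ : 0 < κ) {l : ℝ} (hl : 0 < l)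
    {W : Sp d → ℝ≥0∞} (hW : AEMeasurable W (volume.restrict Ω)) {c : Finset (Sp d) → ℝ≥0∞}
    (hc : ∀ s ∈ M.cells, ∀ y ∈ hull s, c s ≤ ∫⁻ x in Metric.closedBall y (l * h) ∩ Ω, W x) :
    ∑ s ∈ M.cells, c s ≤ ENNReal.ofReal ((2 * l * κ) ^ d) * ∫⁻ x in Ω, W x := by
  have hopen : IsOpen Ω := hreg ▸ isOpen_interior
  set V := volume (Metric.closedBall (0 : Sp d) (h / (2 * κ))) with hV
  have hV0 : V ≠ 0 := (Metric.measure_closedBall_pos volume _ (by positivity)).ne'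
  have hV1 : V ≠ ⊤ := measure_closedBall_lt_top.ne
  have hvol : ∀ s ∈ M.cells, V ≤ volume (hull s) := by
    intro s hs
    obtain ⟨z, hz, hball, -⟩ := hu.exists_center hh hκ hs
    rw [hV, ← Measure.addHaar_closedBall_center volume z]
    refine measure_mono ((Metric.closedBall_subset_ball ?_).trans hball)
    rw [div_lt_div_iff_of_pos_left hh (by positivity) hκ]
    linarith
  -- The overlap of the balls is not counted. Each `c s` is averaged over the points `y` of its
  -- cell, whose volume is at least `V`; Tonelli evaluates the resulting integral over all `y`, and
  -- the constant is the ratio of the volumes of the balls of radius `l h` and `h / (2 κ)`.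
  have h1 : (∑ s ∈ M.cells, c s) * V ≤
      ∫⁻ y in Ω, ∫⁻ x in Metric.closedBall y (l * h), Ω.indicator W x := by
    rw [M.lintegral_eq_sum hreg, Finset.sum_mul]
    refine Finset.sum_le_sum fun s hs => ?_
    calc c s * V ≤ c s * volume (hull s) := by gcongr; exact hvol s hs
      _ = ∫⁻ _y in hull s, c s := by rw [setLIntegral_const]
      _ ≤ _ := by
        refine setLIntegral_mono' (isClosed_hull s).measurableSet fun y hy => ?_
        refine (hc s hs y hy).trans (le_of_eq ?_)
        rw [lintegral_indicator hopen.measurableSet, Measure.restrict_restrict hopen.measurableSet,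
          inter_comm]
  have h2 : ∫⁻ y in Ω, ∫⁻ x in Metric.closedBall y (l * h), Ω.indicator W x ≤
      volume (Metric.closedBall (0 : Sp d) (l * h)) * ∫⁻ x in Ω, W x := by
    rw [← lintegral_indicator hopen.measurableSet W]
    refine (setLIntegral_le_lintegral _ _).trans (le_of_eq ?_)
    exact lintegral_lintegral_closedBall volume (l * h)
      ((aemeasurable_indicator_iff hopen.measurableSet).2 hW)
  have h3 : volume (Metric.closedBall (0 : Sp d) (l * h)) = ENNReal.ofReal ((2 * l * κ) ^ d) * V := by
    rw [hV, ← volume_closedBall_mul 0 (by positivity)]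
    congr 2
    field_simp
  rw [h3] at h2
  have h4 := h1.trans h2
  rw [mul_right_comm] at h4
  exact (ENNReal.mul_le_mul_iff_left hV0 hV1).1 h4

end SimplicialMesh

/-! ## A trace estimate on simplices -/

namespace IsSimplex

variable {s : Finset (Sp d)} (hs : IsSimplex s)
include hs

theorem bary_ray {z₀ : Sp d} (hz₀ : z₀ ∈ s) (z y : Sp d) (σ : ℝ) :
    hs.bary z (z₀ + σ • y) = (if z = z₀ then 1 else 0) + σ * slope (hs.bary z) y := by
  rw [affine_eq_add_slope (hs.bary z) z₀, add_sub_cancel_left, map_smul, smul_eq_mul]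
  congr 1
  split_ifs with h
  · rw [h, hs.bary_self hz₀]
  · exact hs.bary_ne hz₀ h

/-- The divergence theorem for the vector fields `f(x) (x - z₀)` on a simplex, for functions `f` that
vanish on the facet opposite to the vertex `z₀`. -/
theorem integral_radial_eq_zero {z₀ : Sp d} (hz₀ : z₀ ∈ s) {f : Sp d → ℝ} (hf : ContDiff ℝ 1 f)
    (h0 : ∀ x ∈ hull s, hs.bary z₀ x = 0 → f x = 0) :
    ∫ x in hull s, (d * f x + fderiv ℝ f x (x - z₀)) = 0 := by
  set K := hull s with hK
  have hKm : MeasurableSet K := (isClosed_hull s).measurableSet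
  have hz₀K : z₀ ∈ K := mem_hull_of_mem hz₀
  obtain ⟨L', hL'⟩ := (isCompact_hull s).exists_bound_of_continuousOn
    (hf.continuous_fderiv (by simp)).continuousOn
  set L : ℝ≥0 := L'.toNNReal with hLdef
  have hL : ∀ x ∈ K, ‖fderiv ℝ f x‖ ≤ L := fun x hx => (hL' x hx).trans (Real.le_coe_toNNReal L')
  have hlip : ∀ x ∈ K, ∀ y ∈ K, |f x - f y| ≤ L * ‖x - y‖ := fun x hx y hy =>
    (convex_hull s).norm_image_sub_le_of_norm_fderiv_le
      (fun z _ => hf.differentiable (by simp) z) hL hy hx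
  obtain ⟨D, hD⟩ := (isCompact_hull s).isBounded.exists_norm_le
  have hD0 : 0 ≤ D := (norm_nonneg _).trans (hD z₀ hz₀K)
  -- The identity comes from differentiating `∫ F σ = σ^(-d) ∫ f` over `K` at `σ = 1`.
  -- Differentiation under the integral requires `F · y` to be Lipschitz. Across the facet opposite
  -- to `z₀`, where rays from `z₀` leave `K`, this holds because `f` vanishes there.
  let F : ℝ → Sp d → ℝ := fun σ y => K.indicator f (z₀ + σ • y)
  -- rays from the vertex
  have hstar : ∀ y : Sp d, ∀ σ₁ σ₂ : ℝ, 0 < σ₁ → σ₁ ≤ σ₂ → z₀ + σ₂ • y ∈ K → z₀ + σ₁ • y ∈ K := by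
    intro y σ₁ σ₂ h1 h2 h3
    have h4 : z₀ + σ₁ • y = AffineMap.lineMap z₀ (z₀ + σ₂ • y) (σ₁ / σ₂) := by
      rw [AffineMap.lineMap_apply_module', add_sub_cancel_left, smul_smul,
        div_mul_cancel₀ _ (by linarith : σ₂ ≠ 0)]
      exact add_comm _ _
    rw [h4]
    exact (convex_hull s).lineMap_mem hz₀K h3 ⟨div_nonneg h1.le (by linarith), (div_le_one (by linarith)).2 h2⟩
  have hray : ∀ y : Sp d, ∀ σ₁ σ₂ : ℝ, 0 < σ₁ → σ₁ ≤ σ₂ → |F σ₂ y - F σ₁ y| ≤ L * ‖y‖ * (σ₂ - σ₁) := by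
    intro y σ₁ σ₂ h1 h2
    have hnn : 0 ≤ L * ‖y‖ * (σ₂ - σ₁) := by
      have := sub_nonneg.2 h2
      positivity
    by_cases hm2 : z₀ + σ₂ • y ∈ K
    · have hm1 := hstar y σ₁ σ₂ h1 h2 hm2
      simp only [F, indicator_of_mem hm2, indicator_of_mem hm1]
      refine (hlip _ hm2 _ hm1).trans (le_of_eq ?_)
      rw [show z₀ + σ₂ • y - (z₀ + σ₁ • y) = (σ₂ - σ₁) • y by module, norm_smul,
        Real.norm_of_nonneg (sub_nonneg.2 h2)]
      ring
    by_cases hm1 : z₀ + σ₁ • y ∈ K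
    · have hb1 := hs.mem_hull_iff.1 hm1
      have hother : ∀ z, z ≠ z₀ → 0 ≤ slope (hs.bary z) y := by
        intro z hz
        have := hb1 z
        rw [hs.bary_ray hz₀, if_neg hz, zero_add] at this
        exact nonneg_of_mul_nonneg_right this h1
      have hb1' := hb1 z₀
      rw [hs.bary_ray hz₀, if_pos rfl] at hb1'
      set m : ℝ := slope (hs.bary z₀) y with hm
      -- Along the ray the coordinates of the other vertices do not decrease, so leaving `K` means
      -- that the coordinate of `z₀` has become negative. It vanishes at the intermediate time `σ₃ =
      -- -1 / m`, where the ray crosses the opposite facet; from there on `F` is zero.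
      have hb2 : 1 + σ₂ * m < 0 := by
        by_contra hcon
        push Not at hcon
        refine hm2 (hs.mem_hull_iff.2 fun z => ?_)
        rw [hs.bary_ray hz₀]
        split_ifs with hz
        · rw [hz]
          exact hcon
        · rw [zero_add]
          exact mul_nonneg (by linarith) (hother z hz)
      have hmneg : m < 0 := by
        by_contra hcon
        push Not at hcon
        nlinarith [mul_nonneg (by linarith : (0 : ℝ) ≤ σ₂) hcon]
      set σ₃ : ℝ := -1 / m with hσ₃
      have h31 : 1 + σ₃ * m = 0 := by
        rw [hσ₃, div_mul_cancel₀ _ hmneg.ne]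
        ring
      have h3a : σ₁ ≤ σ₃ := by
        by_contra hcon
        push Not at hcon
        nlinarith
      have h3b : σ₃ ≤ σ₂ := by
        by_contra hcon
        push Not at hcon
        nlinarith
      have hm3 : z₀ + σ₃ • y ∈ K := by
        refine hs.mem_hull_iff.2 fun z => ?_
        rw [hs.bary_ray hz₀]
        split_ifs with hz
        · rw [hz]
          exact h31.ge
        · rw [zero_add]
          exact mul_nonneg (by linarith) (hother z hz)
      have hf3 : f (z₀ + σ₃ • y) = 0 := h0 _ hm3 (by rw [hs.bary_ray hz₀, if_pos rfl]; exact h31)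
      simp only [F, indicator_of_notMem hm2, indicator_of_mem hm1]
      have h4 := hlip _ hm3 _ hm1
      rw [hf3] at h4
      refine h4.trans ?_
      rw [show z₀ + σ₃ • y - (z₀ + σ₁ • y) = (σ₃ - σ₁) • y by module, norm_smul,
        Real.norm_of_nonneg (sub_nonneg.2 h3a)]
      have : (L : ℝ) * ((σ₃ - σ₁) * ‖y‖) = L * ‖y‖ * (σ₃ - σ₁) := by ring
      rw [this]
      gcongr
    · simp only [F, indicator_of_notMem hm2, indicator_of_notMem hm1, sub_self, abs_zero]
      exact hnn
  have hbig : ∀ y : Sp d, y ∉ Metric.closedBall (0 : Sp d) (4 * D) → ∀ σ ∈ Ioo (1 / 2 : ℝ) (3 / 2),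
      F σ y = 0 := by
    intro y hy σ hσ
    simp only [F]
    refine indicator_of_notMem (fun hm => hy ?_) _
    have h1 := hD _ hm
    have h2 := hD _ hz₀K
    have h3 : ‖σ • y‖ ≤ 2 * D := by
      have : σ • y = (z₀ + σ • y) - z₀ := by abel
      rw [this]
      exact (norm_sub_le _ _).trans (by linarith)
    rw [norm_smul, Real.norm_of_nonneg (by linarith [hσ.1])] at h3
    rw [mem_closedBall_zero_iff]
    nlinarith [hσ.1, norm_nonneg y]
  -- For `σ > 1 / 2`, `z₀ + σ • y ∈ K` forces `‖y‖ ≤ 4 D`, so the Lipschitz constants are dominated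
  -- by a bounded function with compact support.
  let bound : Sp d → ℝ := (Metric.closedBall (0 : Sp d) (4 * D)).indicator fun _ => L * (4 * D)
  have hbound : Integrable bound volume :=
    (integrable_indicator_iff Metric.isClosed_closedBall.measurableSet).2
      (integrableOn_const measure_closedBall_lt_top.ne)
  have hlipF : ∀ y, LipschitzOnWith (Real.nnabs (bound y)) (fun σ => F σ y)
      (Ioo (1 / 2 : ℝ) (3 / 2)) := by
    intro y
    refine LipschitzOnWith.of_dist_le_mul fun σ hσ τ hτ => ?_
    rw [Real.coe_nnabs, Real.dist_eq, Real.dist_eq]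
    by_cases hy : y ∈ Metric.closedBall (0 : Sp d) (4 * D)
    · have hb : bound y = L * (4 * D) := indicator_of_mem hy _
      have hpos : (0 : ℝ) ≤ L * (4 * D) := mul_nonneg L.2 (by linarith)
      rw [hb, abs_of_nonneg hpos]
      have hyn : ‖y‖ ≤ 4 * D := by simpa using hy
      rcases le_total σ τ with hst | hst
      · rw [abs_sub_comm (F σ y), abs_sub_comm σ, abs_of_nonneg (sub_nonneg.2 hst)]
        have := sub_nonneg.2 hst
        refine (hray y σ τ (by linarith [hσ.1]) hst).trans ?_
        gcongr
      · rw [abs_of_nonneg (sub_nonneg.2 hst : 0 ≤ σ - τ)]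
        have := sub_nonneg.2 hst
        refine (hray y τ σ (by linarith [hτ.1]) hst).trans ?_
        gcongr
    · rw [hbig y hy σ hσ, hbig y hy τ hτ]
      simp
      positivity
  have hmeas : ∀ σ, AEStronglyMeasurable (F σ) volume := fun σ => by
    have h1 : Measurable (K.indicator f) := hf.continuous.measurable.indicator hKm
    exact (h1.comp (by fun_prop : Measurable fun y : Sp d => z₀ + σ • y)).aestronglyMeasurable
  have hFint : Integrable (K.indicator f) volume :=
    (integrable_indicator_iff hKm).2 (hf.continuous.continuousOn.integrableOn_compact
      (isCompact_hull s))
  have hF1 : ∀ y, F 1 y = K.indicator f (z₀ + y) := fun y => by simp [F]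
  let F' : Sp d → ℝ := fun y => K.indicator (fun x => fderiv ℝ f x (x - z₀)) (z₀ + y)
  have hF'm : Measurable (K.indicator (fun x => fderiv ℝ f x (x - z₀))) :=
    ((hf.continuous_fderiv (by simp)).clm_apply (by fun_prop)).measurable.indicator hKm
  have hdiff : ∀ᵐ y, HasDerivAt (fun σ => F σ y) (F' y) 1 := by
    have h1 : ∀ᵐ x, x ∉ frontier K :=
      measure_eq_zero_iff_ae_notMem.1 ((convex_hull s).addHaar_frontier volume)
    have h2 : ∀ᵐ y, z₀ + y ∉ frontier K :=
      (measurePreserving_add_left volume z₀).quasiMeasurePreserving.ae h1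
    filter_upwards [h2] with y hy
    have hline : HasDerivAt (fun σ : ℝ => z₀ + σ • y) y 1 := by
      simpa using ((hasDerivAt_id (1 : ℝ)).smul_const y).const_add z₀
    have hcont : ContinuousAt (fun σ : ℝ => z₀ + σ • y) 1 := by fun_prop
    by_cases hyK : z₀ + y ∈ K
    · have hint : z₀ + y ∈ interior K := by
        by_contra h3
        exact hy ⟨subset_closure hyK, h3⟩
      have h3 : HasDerivAt (fun σ : ℝ => f (z₀ + σ • y)) (fderiv ℝ f (z₀ + (1 : ℝ) • y) y) 1 :=
        (hf.differentiable (by simp) _).hasFDerivAt.comp_hasDerivAt 1 hline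
      have h4 : F' y = fderiv ℝ f (z₀ + (1 : ℝ) • y) y := by
        simp only [F', indicator_of_mem hyK, add_sub_cancel_left, one_smul]
      rw [h4]
      refine h3.congr_of_eventuallyEq ?_
      have h5 : ∀ᶠ σ in 𝓝 (1 : ℝ), z₀ + σ • y ∈ interior K :=
        hcont.eventually_mem (by rw [one_smul]; exact isOpen_interior.mem_nhds hint)
      filter_upwards [h5] with σ hσ
      simp only [F, indicator_of_mem (interior_subset hσ)]
    · have h4 : F' y = 0 := by simp only [F', indicator_of_notMem hyK]
      rw [h4]
      refine (hasDerivAt_const (1 : ℝ) (0 : ℝ)).congr_of_eventuallyEq ?_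
      have h5 : ∀ᶠ σ in 𝓝 (1 : ℝ), z₀ + σ • y ∈ Kᶜ :=
        hcont.eventually_mem (by rw [one_smul]; exact (isClosed_hull s).isOpen_compl.mem_nhds hyK)
      filter_upwards [h5] with σ hσ
      simp only [F, indicator_of_notMem hσ]
  have hderiv := (hasDerivAt_integral_of_dominated_loc_of_lip (μ := volume) (F := F) (F' := F')
    (x₀ := (1 : ℝ)) (s := Ioo (1 / 2 : ℝ) (3 / 2)) (bound := bound)
    (Ioo_mem_nhds (by norm_num) (by norm_num)) (Eventually.of_forall hmeas)
    (by
      have : F 1 = fun y => K.indicator f (z₀ + y) := funext hF1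
      rw [this]
      exact hFint.comp_add_left z₀)
    (hF'm.comp (by fun_prop : Measurable fun y : Sp d => z₀ + y)).aestronglyMeasurable
    (ae_of_all _ hlipF) hbound hdiff).2
  -- The substitution `x = z₀ + σ • y`.
  have hscale : ∀ σ : ℝ, 0 < σ → ∫ y, F σ y = (σ ^ d)⁻¹ * ∫ x in K, f x := by
    intro σ hσ
    have h1 := Measure.integral_comp_smul (volume : Measure (Sp d))
      (fun y => K.indicator f (z₀ + y)) σ
    rw [integral_add_left_eq_self (fun y => K.indicator f y) z₀, integral_indicator hKm] at h1
    simp only [finrank_euclideanSpace, Fintype.card_fin, smul_eq_mul] at h1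
    rw [abs_of_pos (by positivity)] at h1
    exact h1
  have hderiv2 : HasDerivAt (fun σ : ℝ => ∫ y, F σ y) (-(d : ℝ) * ∫ x in K, f x) 1 := by
    have h1 : HasDerivAt (fun σ : ℝ => (σ ^ d)⁻¹ * ∫ x in K, f x) (-(d : ℝ) * ∫ x in K, f x) 1 := by
      have h2 := ((hasDerivAt_pow d (1 : ℝ)).inv (by simp)).mul_const (∫ x in K, f x)
      simpa using h2
    refine h1.congr_of_eventuallyEq ?_
    filter_upwards [lt_mem_nhds (zero_lt_one (α := ℝ))] with σ hσ
    exact hscale σ hσ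
  have h1 := hderiv.unique hderiv2
  have h2 : ∫ y, F' y = ∫ x in K, fderiv ℝ f x (x - z₀) := by
    simp only [F']
    rw [integral_add_left_eq_self (fun y => K.indicator (fun x => fderiv ℝ f x (x - z₀)) y) z₀,
      integral_indicator hKm]
  rw [h2] at h1
  rw [integral_add, integral_const_mul, h1]
  · ring
  · exact (continuous_const.mul hf.continuous).continuousOn.integrableOn_compact (isCompact_hull s)
  · exact ((hf.continuous_fderiv (by simp)).clm_apply (by fun_prop)).continuousOn.integrableOn_compact
      (isCompact_hull s)

end IsSimplex

end SpaceTime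
end

/-! ### Control and removal of boundary nodal values. -/

noncomputable section
namespace SpaceTime
open Filter Topology
variable {d : ℕ} {Ω : Set (Sp d)}

/-- The density `|φ - q|² + h² |D(φ - q)|²`. -/
def errDensity (h : ℝ) (φ q : Sp d → ℝ) (x : Sp d) : ℝ≥0∞ :=
  ‖φ x - q x‖ₑ ^ 2 + ENNReal.ofReal (h ^ 2) * ‖fderiv ℝ φ x - fderiv ℝ q x‖ₑ ^ 2

theorem slope_sub (a b : Sp d →ᵃ[ℝ] ℝ) : slope (a - b) = slope a - slope b := rfl

/-- The affine function `p = a - a z₀ • b` agrees with `a` on the facet `b = 0` and vanishes at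
`z₀`, so that its radial derivative is `p` itself. The function `f = (φ - a + p) p` is zero on the
facet, and the divergence identity for it reads `∫ ((d + 2) p² + p r) = 0`, where `r` is the
function on the right-hand side. Young's inequality absorbs the mixed term. This replaces a trace
inequality and involves no surface measure. -/
theorem IsSimplex.integral_sq_le {s : Finset (Sp d)} (hs : IsSimplex s) {z₀ : Sp d} (hz₀ : z₀ ∈ s)
    {φ : Sp d → ℝ} (hφ : ContDiff ℝ 1 φ) (h0 : ∀ x ∈ hull s, hs.bary z₀ x = 0 → φ x = 0)
    (a : Sp d →ᵃ[ℝ] ℝ) :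
    ∫ x in hull s, ((a - a z₀ • hs.bary z₀) x) ^ 2 ≤
      ∫ x in hull s, ((d + 1) * (φ x - a x) + (fderiv ℝ φ x - slope a) (x - z₀)) ^ 2 := by
  set b := hs.bary z₀ with hb
  set p := a - a z₀ • b with hp
  have hpz : p z₀ = 0 := by simp [hp, hb, hs.bary_self hz₀]
  have hac : ContDiff ℝ 1 a := SimplicialMesh.contDiff_affine a
  have hbc : ContDiff ℝ 1 b := SimplicialMesh.contDiff_affine b
  have hpc : ContDiff ℝ 1 p := SimplicialMesh.contDiff_affine p
  have hpx : ∀ x, p x = a x - a z₀ * b x := fun x => by simp [hp]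
  have hpd : ∀ x, slope p (x - z₀) = p x := fun x => by
    rw [affine_eq_add_slope p z₀ x, hpz, zero_add]
  set f : Sp d → ℝ := fun x => ((φ x - a x) + p x) * p x with hf
  have hfc : ContDiff ℝ 1 f := ((hφ.sub hac).add hpc).mul hpc
  have hf0 : ∀ x ∈ hull s, b x = 0 → f x = 0 := fun x hx hbx => by
    simp only [hf, hpx, hbx, h0 x hx hbx]
    ring
  set r : Sp d → ℝ := fun x => (d + 1) * (φ x - a x) + (fderiv ℝ φ x - slope a) (x - z₀) with hr
  have hrc : Continuous r :=
    (continuous_const.mul (hφ.continuous.sub hac.continuous)).add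
      (((hφ.continuous_fderiv (by simp)).sub continuous_const).clm_apply (by fun_prop))
  have hkey := hs.integral_radial_eq_zero hz₀ hfc hf0
  have hfd : ∀ x, d * f x + fderiv ℝ f x (x - z₀) = (d + 2) * p x ^ 2 + p x * r x := by
    intro x
    have h1 : HasFDerivAt f (((φ x - a x) + p x) • slope p +
        p x • ((fderiv ℝ φ x - slope a) + slope p)) x :=
      (((hφ.differentiable (by simp) x).hasFDerivAt.sub (hasFDerivAt_affine a x)).add
        (hasFDerivAt_affine p x)).mul (hasFDerivAt_affine p x)
    rw [h1.fderiv]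
    simp only [hf, hr, add_apply, smul_apply, smul_eq_mul,
      hpd]
    ring
  simp only [hfd] at hkey
  have hint : ∀ {g : Sp d → ℝ}, Continuous g → IntegrableOn g (hull s) := fun hg =>
    hg.continuousOn.integrableOn_compact (isCompact_hull s)
  have hi1 : IntegrableOn (fun x => p x ^ 2) (hull s) := hint (hpc.continuous.pow 2)
  have hi2 : IntegrableOn (fun x => r x ^ 2) (hull s) := hint (hrc.pow 2)
  have hi3 : IntegrableOn (fun x => p x * r x) (hull s) := hint (hpc.continuous.mul hrc)
  rw [integral_add (hi1.const_mul _) hi3, integral_const_mul] at hkey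
  have h2 : -∫ x in hull s, p x * r x ≤
      (1 / 2) * (∫ x in hull s, p x ^ 2) + (1 / 2) * ∫ x in hull s, r x ^ 2 := by
    rw [← integral_neg, ← integral_const_mul, ← integral_const_mul,
      ← integral_add (hi1.const_mul _) (hi2.const_mul _)]
    refine integral_mono hi3.neg ((hi1.const_mul _).add (hi2.const_mul _)) fun x => ?_
    change -(p x * r x) ≤ 1 / 2 * p x ^ 2 + 1 / 2 * r x ^ 2
    nlinarith [sq_nonneg (p x + r x)]
  have h3 : 0 ≤ ∫ x in hull s, p x ^ 2 := integral_nonneg fun x => sq_nonneg _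
  have h4 : 0 ≤ (d : ℝ) * ∫ x in hull s, p x ^ 2 := by positivity
  change ∫ x in hull s, p x ^ 2 ≤ ∫ x in hull s, r x ^ 2
  have h5 : 0 ≤ ∫ x in hull s, r x ^ 2 := integral_nonneg fun x => sq_nonneg _
  nlinarith

namespace SimplicialMesh

variable {M : SimplicialMesh Ω} {h κ : ℝ}

/-- The constant in the estimate of the boundary values. -/
def traceConst (d : ℕ) (κ : ℝ) : ℝ :=
  (1 + 4 * κ ^ 2) ^ 2 * (4 * κ ^ 2) ^ d * (2 * (d + 1) ^ 2 + 2 * κ ^ 2)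

/-- The vertex belongs to a boundary facet of some cell, opposite to `z₀`. The function `p` of
`IsSimplex.integral_sq_le` has the value of `q` at `z`, because `z ≠ z₀`. Its `L²` norm over the
cell is bounded by the error there, and it bounds the nodal value. -/
theorem IsUniform.vertex_le (hu : M.IsUniform h κ) (hh : 0 < h) (hκ : 0 < κ)
    (hΩ : IsBoundedLipschitzDomain Ω) {φ : Sp d → ℝ} (hφ : ContDiff ℝ 1 φ)
    (hφ0 : ∀ x ∉ Ω, φ x = 0) (q : M.p1Fun) {z : Sp d} (hz : z ∈ M.verts) (hzΩ : z ∉ Ω) :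
    ∃ s ∈ M.cells, z ∈ s ∧ ‖q.1 z‖ₑ ^ 2 * volume (Metric.closedBall (0 : Sp d) (κ * h)) ≤
      ENNReal.ofReal (traceConst d κ) * ∫⁻ x in hull s, errDensity h φ q.1 x := by
  have hzf : z ∈ frontier Ω := by
    obtain ⟨s, hs, hzs⟩ := M.mem_verts.1 hz
    rw [hΩ.isOpen.frontier_eq]
    exact ⟨M.hull_subset hs (mem_hull_of_mem hzs), hzΩ⟩
  obtain ⟨s, hs, hzs, z₀, hz₀, hne, hfacet⟩ := M.exists_boundary_facet hΩ hz hzf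
  refine ⟨s, hs, hzs, ?_⟩
  have hS := M.isSimplex hs
  obtain ⟨a, ha⟩ := M.exists_affine q hs
  obtain ⟨c, hc, hball, hdist⟩ := hu.exists_center hh hκ hs
  have h1 := hS.integral_sq_le hz₀ hφ (fun x hx hb => hφ0 x (hfacet x hx hb)) a
  set p := a - a z₀ • hS.bary z₀ with hp
  have hpz : p z = q.1 z := by
    rw [ha (mem_hull_of_mem hzs)]
    simp [hp, hS.bary_ne hzs hne]
  set r : Sp d → ℝ := fun x => (d + 1) * (φ x - a x) + (fderiv ℝ φ x - slope a) (x - z₀) with hr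
  have hrc : Continuous r :=
    (continuous_const.mul (hφ.continuous.sub (contDiff_affine a (n := 1)).continuous)).add
      (((hφ.continuous_fderiv (by simp)).sub continuous_const).clm_apply (by fun_prop))
  have hpc : Continuous p := (contDiff_affine p (n := 1)).continuous
  have h2 : ∫⁻ x in hull s, ‖p x‖ₑ ^ 2 ≤ ∫⁻ x in hull s, ENNReal.ofReal (r x ^ 2) := by
    have e1 : ∫⁻ x in hull s, ‖p x‖ₑ ^ 2 = ∫⁻ x in hull s, ENNReal.ofReal (p x ^ 2) := by
      simp only [enorm_sq_eq_ofReal, Real.norm_eq_abs, sq_abs]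
    have hi1 : IntegrableOn (fun x => p x ^ 2) (hull s) :=
      (hpc.pow 2).continuousOn.integrableOn_compact (isCompact_hull s)
    have hi2 : IntegrableOn (fun x => r x ^ 2) (hull s) :=
      (hrc.pow 2).continuousOn.integrableOn_compact (isCompact_hull s)
    rw [e1, ← ofReal_integral_eq_lintegral_ofReal hi1 (ae_of_all _ fun x => sq_nonneg _),
      ← ofReal_integral_eq_lintegral_ofReal hi2 (ae_of_all _ fun x => sq_nonneg _)]
    exact ENNReal.ofReal_le_ofReal h1
  have h3 : ∫⁻ x in hull s, ENNReal.ofReal (r x ^ 2) ≤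
      ENNReal.ofReal (2 * (d + 1) ^ 2 + 2 * κ ^ 2) * ∫⁻ x in hull s, errDensity h φ q.1 x := by
    rw [← lintegral_const_mul' _ _ ENNReal.ofReal_ne_top]
    refine lintegral_mono_ae ?_
    filter_upwards [ae_hull_mem_interior s] with x hx
    have hxs := interior_subset hx
    rw [errDensity, fderiv_eq_slope ha hx, ha hxs, enorm_sq_eq_ofReal, enorm_sq_eq_ofReal,
      ← ENNReal.ofReal_mul (by positivity), ← ENNReal.ofReal_add (by positivity) (by positivity),
      ← ENNReal.ofReal_mul (by positivity)]
    refine ENNReal.ofReal_le_ofReal ?_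
    rw [Real.norm_eq_abs, sq_abs]
    set G := fderiv ℝ φ x - slope a
    have h4 : |G (x - z₀)| ≤ ‖G‖ * (κ * h) := by
      refine (G.le_opNorm _).trans ?_
      have := hdist x hxs z₀ (mem_hull_of_mem hz₀)
      rw [dist_eq_norm] at this
      gcongr
    have h5 : G (x - z₀) ^ 2 ≤ (‖G‖ * (κ * h)) ^ 2 := by
      rw [← sq_abs (G (x - z₀))]
      gcongr
    have h6 : r x ^ 2 ≤ 2 * ((d + 1) * (φ x - a x)) ^ 2 + 2 * G (x - z₀) ^ 2 := by
      simp only [hr]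
      nlinarith [sq_nonneg ((d + 1) * (φ x - a x) - G (x - z₀))]
    have h7 : 0 ≤ 2 * (d + 1 : ℝ) ^ 2 * (h ^ 2 * ‖G‖ ^ 2) := by positivity
    have h8 : 0 ≤ 2 * κ ^ 2 * (φ x - a x) ^ 2 := by positivity
    nlinarith
  have h4 := hu.value_le hh hκ hs p (mem_hull_of_mem hzs)
  rw [hpz] at h4
  refine h4.trans ?_
  have h5 : ENNReal.ofReal (traceConst d κ) = ENNReal.ofReal ((1 + 4 * κ ^ 2) ^ 2 * (4 * κ ^ 2) ^ d) *
      ENNReal.ofReal (2 * (d + 1) ^ 2 + 2 * κ ^ 2) := by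
    rw [traceConst, ENNReal.ofReal_mul (by positivity)]
  rw [h5, mul_assoc]
  exact mul_le_mul_right (h2.trans h3) _

/-- The finite element function with the same values at the interior vertices and zero values at the
boundary vertices. -/
def zeroBoundary (q : M.p1Fun) : M.p1Fun :=
  M.nodal (Ω.indicator q.1)

theorem zeroBoundary_mem (hreg : interior (closure Ω) = Ω) (q : M.p1Fun) :
    zeroBoundary q ∈ M.p1Fun0 := by
  intro x hx
  have hopen : IsOpen Ω := hreg ▸ isOpen_interior
  rw [hopen.frontier_eq] at hx
  obtain ⟨s, hs, hxs⟩ := M.exists_mem_hull hx.1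
  rw [zeroBoundary, M.nodal_apply hs hxs, IsSimplex.interp_apply]
  refine Finset.sum_eq_zero fun z _ => ?_
  by_cases hz : z ∈ Ω
  · rw [← M.hat_eq hs hxs, M.hat_eq_zero_of_notMem hreg hx.1 hx.2 hz, mul_zero]
  · rw [indicator_of_notMem hz, zero_mul]

/-- On a cell, `q` and `zeroBoundary q` differ only through the boundary vertices. By `vertex_le`,
each of these values is controlled by the error on a possibly different cell that contains the
vertex; two cell diameters, `2 κ h`, reach all of that cell from any point `y`. One factor `d + 1`
is the number of vertices, the other comes from the square of a sum. -/
theorem IsUniform.zeroBoundary_le (hu : M.IsUniform h κ) (hh : 0 < h) (hκ : 0 < κ)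
    (hΩ : IsBoundedLipschitzDomain Ω) {φ : Sp d → ℝ} (hφ : ContDiff ℝ 1 φ)
    (hφ0 : ∀ x ∉ Ω, φ x = 0) (q : M.p1Fun)
    (hW : AEMeasurable (errDensity h φ q.1) (volume.restrict Ω)) :
    ∫⁻ x in Ω, ‖q.1 x - (zeroBoundary q).1 x‖ₑ ^ 2 ≤
      ENNReal.ofReal ((2 * (2 * κ) * κ) ^ d * ((d + 1) ^ 2 * traceConst d κ)) *
        ∫⁻ x in Ω, errDensity h φ q.1 x := by
  have hreg := hΩ.interior_closure
  set B := volume (Metric.closedBall (0 : Sp d) (κ * h)) with hB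
  have htc : 0 ≤ traceConst d κ := by unfold traceConst; positivity
  rw [M.lintegral_eq_sum hreg, ENNReal.ofReal_mul (by positivity), mul_assoc,
    ← lintegral_const_mul' _ _ ENNReal.ofReal_ne_top]
  refine hu.sum_le hreg hh hκ (by positivity) (hW.const_mul _) fun s hs y hy => ?_
  have hS := M.isSimplex hs
  obtain ⟨c, hc, hball, hdist⟩ := hu.exists_center hh hκ hs
  obtain ⟨a, ha⟩ := M.exists_affine q hs
  set I := ∫⁻ x in Metric.closedBall y (2 * κ * h) ∩ Ω, errDensity h φ q.1 x with hI
  rw [lintegral_const_mul' _ _ ENNReal.ofReal_ne_top]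
  have hvert : ∀ z ∈ s, ‖q.1 z - Ω.indicator q.1 z‖ₑ ^ 2 * B ≤ ENNReal.ofReal (traceConst d κ) * I := by
    intro z hz
    by_cases hzΩ : z ∈ Ω
    · rw [indicator_of_mem hzΩ, sub_self]
      simp
    · rw [indicator_of_notMem hzΩ, sub_zero]
      obtain ⟨t, ht, hzt, hle⟩ := hu.vertex_le hh hκ hΩ hφ hφ0 q (M.mem_verts.2 ⟨s, hs, hz⟩) hzΩ
      refine hle.trans ?_
      gcongr
      refine M.lintegral_hull_le hreg ht (fun x hx => ?_) _
      obtain ⟨-, -, -, hdist'⟩ := hu.exists_center hh hκ ht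
      rw [Metric.mem_closedBall]
      have h1 := hdist' x hx z (mem_hull_of_mem hzt)
      have h2 := hdist z (mem_hull_of_mem hz) y hy
      linarith [dist_triangle x z y]
  have hvol : volume (hull s) ≤ B := by
    rw [hB, ← Measure.addHaar_closedBall_center volume c]
    exact measure_mono fun x hx => hdist x hx c hc
  have hpt : ∀ x ∈ hull s, ‖q.1 x - (zeroBoundary q).1 x‖ₑ ^ 2 ≤
      ENNReal.ofReal (d + 1) * ∑ z ∈ s, ‖q.1 z - Ω.indicator q.1 z‖ₑ ^ 2 := by
    intro x hx
    have h1 : q.1 x - (zeroBoundary q).1 x =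
        ∑ z ∈ s, (q.1 z - Ω.indicator q.1 z) * hS.bary z x := by
      rw [zeroBoundary, M.nodal_apply hs hx, ha hx, hS.affine_apply a x, IsSimplex.interp_apply,
        ← Finset.sum_sub_distrib]
      refine Finset.sum_congr rfl fun z hz => ?_
      rw [ha (mem_hull_of_mem hz)]
      ring
    have hb : ∀ z ∈ s, 0 ≤ hS.bary z x ∧ hS.bary z x ≤ 1 := by
      intro z hz
      refine ⟨hS.mem_hull_iff.1 hx z, ?_⟩
      rw [← hS.sum_bary x]
      exact Finset.single_le_sum (f := fun z => hS.bary z x)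
        (fun z _ => hS.mem_hull_iff.1 hx z) hz
    simp only [enorm_sq_eq_ofReal]
    rw [← ENNReal.ofReal_sum_of_nonneg (fun _ _ => by positivity),
      ← ENNReal.ofReal_mul (by positivity)]
    refine ENNReal.ofReal_le_ofReal ?_
    simp only [Real.norm_eq_abs, sq_abs]
    rw [h1]
    refine sq_sum_le_card_mul_sum_sq.trans ?_
    have hcard : (s.card : ℝ) = d + 1 := by
      rw [hS.card_eq]
      push_cast
      rfl
    rw [hcard]
    refine mul_le_mul_of_nonneg_left (Finset.sum_le_sum fun z hz => ?_) (by positivity)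
    rw [mul_pow]
    exact mul_le_of_le_one_right (sq_nonneg _) (pow_le_one₀ (hb z hz).1 (hb z hz).2)
  calc ∫⁻ x in hull s, ‖q.1 x - (zeroBoundary q).1 x‖ₑ ^ 2
      ≤ ∫⁻ _x in hull s, ENNReal.ofReal (d + 1) * ∑ z ∈ s, ‖q.1 z - Ω.indicator q.1 z‖ₑ ^ 2 :=
        setLIntegral_mono' (isClosed_hull s).measurableSet hpt
    _ ≤ ENNReal.ofReal (d + 1) * ∑ z ∈ s, ‖q.1 z - Ω.indicator q.1 z‖ₑ ^ 2 * B := by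
        rw [setLIntegral_const, mul_assoc, Finset.sum_mul]
        gcongr
    _ ≤ ENNReal.ofReal (d + 1) * ∑ _z ∈ s, ENNReal.ofReal (traceConst d κ) * I := by
        exact mul_le_mul_right (Finset.sum_le_sum hvert) _
    _ = _ := by
        rw [Finset.sum_const, hS.card_eq, nsmul_eq_mul, ENNReal.ofReal_mul (by positivity)]
        have : ((d + 1 : ℕ) : ℝ≥0∞) = ENNReal.ofReal (d + 1) := by
          rw [← ENNReal.ofReal_natCast]
          push_cast
          rfl
        rw [this, sq, ENNReal.ofReal_mul (by positivity)]
        ring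

end SimplicialMesh

end SpaceTime
end

noncomputable section
namespace SpaceTime
open Filter Topology
variable {d : ℕ} {Ω : Set (Sp d)}

/-! ## Taylor expansion along segments -/

theorem enorm_sub_le_lintegral_segment {E : Type*} [NormedAddCommGroup E] [NormedSpace ℝ E]
    [CompleteSpace E]
    {f : Sp d → E} (hf : ContDiff ℝ 1 f) (p v : Sp d) {θ₁ θ₂ : ℝ} (h0 : 0 ≤ θ₁) (h1 : θ₁ ≤ θ₂)
    (h2 : θ₂ ≤ 1) :
    ‖f (p + θ₂ • v) - f (p + θ₁ • v)‖ₑ ≤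
      ‖v‖ₑ * ∫⁻ θ in Icc (0 : ℝ) 1, ‖fderiv ℝ f (p + θ • v)‖ₑ := by
  have hd : ∀ θ : ℝ, HasDerivAt (fun θ : ℝ => f (p + θ • v)) (fderiv ℝ f (p + θ • v) v) θ := by
    intro θ
    have hline : HasDerivAt (fun σ : ℝ => p + σ • v) v θ := by
      simpa using ((hasDerivAt_id θ).smul_const v).const_add p
    exact (hf.differentiable (by simp) _).hasFDerivAt.comp_hasDerivAt θ hline
  have hc : Continuous fun θ : ℝ => fderiv ℝ f (p + θ • v) v :=
    ((hf.continuous_fderiv (by simp)).comp (by fun_prop)).clm_apply continuous_const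
  rw [← intervalIntegral.integral_eq_sub_of_hasDerivAt (fun θ _ => hd θ)
    (hc.intervalIntegrable _ _), intervalIntegral.integral_of_le h1]
  refine (enorm_integral_le_lintegral_enorm _).trans ?_
  rw [← lintegral_const_mul' _ _ enorm_ne_top]
  refine (lintegral_mono_set (t := Icc (0 : ℝ) 1)
    fun θ hθ => ⟨h0.trans hθ.1.le, hθ.2.trans h2⟩).trans ?_
  refine lintegral_mono fun θ => ?_
  rw [mul_comm]
  exact (fderiv ℝ f (p + θ • v)).le_opENorm v

/-- The measure `dθ + δ₀ + δ₁` on `[0, 1]`. -/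
def segMeasure : Measure ℝ := volume.restrict (Icc 0 1) + Measure.dirac 0 + Measure.dirac 1

theorem segMeasure_univ : segMeasure univ = 3 := by
  simp [segMeasure]
  norm_num

instance : IsFiniteMeasure segMeasure := ⟨by rw [segMeasure_univ]; simp⟩

theorem lintegral_segMeasure (F : ℝ → ℝ≥0∞) :
    ∫⁻ θ, F θ ∂segMeasure = (∫⁻ θ in Icc (0 : ℝ) 1, F θ) + F 0 + F 1 := by
  rw [segMeasure, lintegral_add_measure, lintegral_add_measure, lintegral_dirac, lintegral_dirac]

theorem ae_segMeasure : ∀ᵐ θ ∂segMeasure, θ ∈ Icc (0 : ℝ) 1 := by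
  rw [segMeasure, ae_add_measure_iff, ae_add_measure_iff]
  refine ⟨⟨ae_restrict_mem measurableSet_Icc, ?_⟩, ?_⟩ <;>
  · rw [ae_dirac_eq]
    simp

/-- The remainders of the Taylor expansion of `g` of order `m` are controlled by integrals of `F`
along segments. -/
structure HasTaylor (g : Sp d → ℝ) (F : Sp d → ℝ≥0∞) (m : ℕ) : Prop where
  value : ∀ p p', ‖g p - g p' - fderiv ℝ g p' (p - p')‖ₑ ≤
    ‖p' - p‖ₑ ^ (m + 1) * ∫⁻ θ, F (p + θ • (p' - p)) ∂segMeasure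
  grad : ∀ p p', ‖fderiv ℝ g p - fderiv ℝ g p'‖ₑ ≤
    ‖p' - p‖ₑ ^ m * ∫⁻ θ, F (p + θ • (p' - p)) ∂segMeasure

/-- Without second derivatives the gradient terms do not cancel; `Dg` at the two end points is
estimated by itself, which is what the Dirac masses in `segMeasure` are for. -/
theorem hasTaylor_zero {g : Sp d → ℝ} (hg : ContDiff ℝ 1 g) :
    HasTaylor g (fun x => ‖fderiv ℝ g x‖ₑ) 0 := by
  refine ⟨fun p p' => ?_, fun p p' => ?_⟩
  · rw [lintegral_segMeasure, zero_add, pow_one, mul_add, mul_add]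
    have h1 := enorm_sub_le_lintegral_segment hg p (p' - p) le_rfl zero_le_one le_rfl
    simp only [one_smul, zero_smul, add_zero, add_sub_cancel] at h1 ⊢
    rw [← enorm_neg, neg_sub] at h1
    refine enorm_sub_le.trans ?_
    refine add_le_add (h1.trans le_self_add) ?_
    rw [← enorm_neg (p' - p), neg_sub, mul_comm]
    exact (fderiv ℝ g p').le_opENorm _
  · rw [lintegral_segMeasure, pow_zero, one_mul]
    simp only [one_smul, zero_smul, add_zero, add_sub_cancel]
    refine enorm_sub_le.trans ?_
    rw [add_assoc]
    exact le_add_self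

/-- The gradient bound is the fundamental theorem for `Dg`. For the value it is applied twice, first
to `g - Dg(p')`, whose derivative at a point of the segment is an increment of `Dg`. -/
theorem hasTaylor_one {g : Sp d → ℝ} (hg : ContDiff ℝ 2 g) :
    HasTaylor g (fun x => ‖fderiv ℝ (fderiv ℝ g) x‖ₑ) 1 := by
  have hg1 : ContDiff ℝ 1 g := hg.of_le (by norm_num)
  have hg' : ContDiff ℝ 1 (fderiv ℝ g) := hg.fderiv_right (by norm_num)
  have hseg : ∀ p v : Sp d, ∫⁻ θ in Icc (0 : ℝ) 1, ‖fderiv ℝ (fderiv ℝ g) (p + θ • v)‖ₑ ≤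
      ∫⁻ θ, ‖fderiv ℝ (fderiv ℝ g) (p + θ • v)‖ₑ ∂segMeasure := by
    intro p v
    rw [lintegral_segMeasure, add_assoc]
    exact le_self_add
  refine ⟨fun p p' => ?_, fun p p' => ?_⟩
  · set f : Sp d → ℝ := fun x => g x - fderiv ℝ g p' x with hf
    have hfc : ContDiff ℝ 1 f := hg1.sub (fderiv ℝ g p').contDiff
    have hfd : ∀ x, fderiv ℝ f x = fderiv ℝ g x - fderiv ℝ g p' := fun x =>
      ((hg1.differentiable (by simp) x).hasFDerivAt.sub (fderiv ℝ g p').hasFDerivAt).fderiv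
    have h1 := enorm_sub_le_lintegral_segment hfc p (p' - p) le_rfl zero_le_one le_rfl
    simp only [one_smul, zero_smul, add_zero, add_sub_cancel] at h1
    have h2 : g p - g p' - fderiv ℝ g p' (p - p') = -(f p' - f p) := by
      simp only [hf, map_sub]
      ring
    rw [h2, enorm_neg]
    refine h1.trans ?_
    rw [pow_succ, pow_one, mul_assoc]
    refine mul_le_mul_right ?_ _
    have h3 : ∀ θ ∈ Icc (0 : ℝ) 1, ‖fderiv ℝ f (p + θ • (p' - p))‖ₑ ≤ ‖p' - p‖ₑ *
        ∫⁻ θ in Icc (0 : ℝ) 1, ‖fderiv ℝ (fderiv ℝ g) (p + θ • (p' - p))‖ₑ := by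
      intro θ hθ
      have h4 := enorm_sub_le_lintegral_segment hg' p (p' - p) hθ.1 hθ.2 le_rfl
      simp only [one_smul, add_sub_cancel] at h4
      rw [hfd, ← enorm_neg, neg_sub]
      exact h4
    refine (setLIntegral_mono' measurableSet_Icc h3).trans ?_
    rw [setLIntegral_const, Real.volume_Icc, sub_zero, ENNReal.ofReal_one, mul_one]
    exact mul_le_mul_right (hseg _ _) _
  · have h1 := enorm_sub_le_lintegral_segment hg' p (p' - p) le_rfl zero_le_one le_rfl
    simp only [one_smul, zero_smul, add_zero, add_sub_cancel] at h1
    rw [← enorm_neg, neg_sub, pow_one]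
    exact h1.trans (mul_le_mul_right (hseg _ _) _)

/-! ## Averaged Taylor polynomials -/

/-- The uniform probability measure on the ball of radius `h`. -/
def ballMeasure (d : ℕ) (h : ℝ) : Measure (Sp d) :=
  (volume (Metric.closedBall (0 : Sp d) h))⁻¹ • volume.restrict (Metric.closedBall 0 h)

theorem ballMeasure_univ {h : ℝ} (hh : 0 < h) : ballMeasure d h univ = 1 := by
  simp only [ballMeasure, Measure.smul_apply, Measure.restrict_apply_univ, smul_eq_mul]
  exact ENNReal.inv_mul_cancel (Metric.measure_closedBall_pos volume _ hh).ne'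
    measure_closedBall_lt_top.ne

theorem ae_ballMeasure (h : ℝ) : ∀ᵐ y ∂ballMeasure d h, ‖y‖ ≤ h := by
  refine Measure.ae_smul_measure ?_ _
  filter_upwards [ae_restrict_mem Metric.isClosed_closedBall.measurableSet] with y hy
  simpa using hy

theorem integrable_ballMeasure {E : Type*} [NormedAddCommGroup E] {h : ℝ} (hh : 0 < h)
    {f : Sp d → E} (hf : Continuous f) : Integrable f (ballMeasure d h) := by
  refine Integrable.smul_measure ?_ (ENNReal.inv_ne_top.2
    (Metric.measure_closedBall_pos volume _ hh).ne')
  exact hf.continuousOn.integrableOn_compact (isCompact_closedBall _ _)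

theorem mul_lintegral_ballMeasure {h : ℝ} (hh : 0 < h) (F : Sp d → ℝ≥0∞) (p : Sp d) :
    volume (Metric.closedBall (0 : Sp d) h) * ∫⁻ y, F (p + y) ∂ballMeasure d h =
      ∫⁻ y in Metric.closedBall p h, F y := by
  rw [ballMeasure, lintegral_smul_measure, smul_eq_mul, ← mul_assoc,
    ENNReal.mul_inv_cancel (Metric.measure_closedBall_pos volume _ hh).ne'
      measure_closedBall_lt_top.ne, one_mul,
    ← lintegral_indicator Metric.isClosed_closedBall.measurableSet,
    ← lintegral_indicator Metric.isClosed_closedBall.measurableSet,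
    ← lintegral_add_left_eq_self ((Metric.closedBall p h).indicator fun y => F y) p]
  refine lintegral_congr fun y => ?_
  by_cases hy : ‖y‖ ≤ h
  · rw [indicator_of_mem (by simpa using hy), indicator_of_mem (by simpa [dist_eq_norm] using hy)]
  · rw [indicator_of_notMem (by simpa using hy),
      indicator_of_notMem (by simpa [dist_eq_norm] using hy)]

variable {g : Sp d → ℝ} (b : Sp d) {h : ℝ}

/-- The value at `z` of the Taylor polynomial of `g` of degree one, averaged over the ball of radius
`h` about `x + h b`. -/
def avgVal (g : Sp d → ℝ) (b : Sp d) (h : ℝ) (x z : Sp d) : ℝ :=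
  ∫ y, (g (x + (h • b + y)) + fderiv ℝ g (x + (h • b + y)) (z - (x + (h • b + y)))) ∂ballMeasure d h

/-- The slope of the averaged Taylor polynomial. -/
def avgSlope (g : Sp d → ℝ) (b : Sp d) (h : ℝ) (x : Sp d) : Sp d →L[ℝ] ℝ :=
  ∫ y, fderiv ℝ g (x + (h • b + y)) ∂ballMeasure d h

theorem continuous_taylor (hg : ContDiff ℝ 1 g) (v x z : Sp d) :
    Continuous fun y => g (x + (v + y)) + fderiv ℝ g (x + (v + y)) (z - (x + (v + y))) :=
  (hg.continuous.comp (by fun_prop)).add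
    (((hg.continuous_fderiv (by simp)).comp (by fun_prop)).clm_apply (by fun_prop))

theorem continuous_fderiv_shift (hg : ContDiff ℝ 1 g) (v x : Sp d) :
    Continuous fun y => fderiv ℝ g (x + (v + y)) :=
  (hg.continuous_fderiv (by simp)).comp (by fun_prop)

theorem avgVal_eq (hh : 0 < h) (hg : ContDiff ℝ 1 g) (x z : Sp d) :
    avgVal g b h x z = avgVal g b h x x + avgSlope g b h x (z - x) := by
  rw [avgVal, avgVal, avgSlope, ContinuousLinearMap.integral_apply
    (integrable_ballMeasure hh (continuous_fderiv_shift hg _ _)), ← integral_add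
    (integrable_ballMeasure hh (continuous_taylor hg _ _ _))
    (integrable_ballMeasure hh ((continuous_fderiv_shift hg _ _).clm_apply continuous_const))]
  refine integral_congr_ae (ae_of_all _ fun y => ?_)
  simp only [map_sub, map_add]
  ring

theorem integral_const_sub_ballMeasure {E : Type*} [NormedAddCommGroup E] [NormedSpace ℝ E]
    [CompleteSpace E] (hh : 0 < h) {f : Sp d → E} (hf : Continuous f) (c : E) :
    c - ∫ y, f y ∂ballMeasure d h = ∫ y, (c - f y) ∂ballMeasure d h := by
  have : IsProbabilityMeasure (ballMeasure d h) := ⟨ballMeasure_univ hh⟩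
  rw [integral_sub (integrable_const c) (integrable_ballMeasure hh hf)]
  simp

theorem enorm_integral_ballMeasure_sq_le {E : Type*} [NormedAddCommGroup E] [NormedSpace ℝ E]
    (hh : 0 < h) (f : Sp d → E) :
    ‖∫ y, f y ∂ballMeasure d h‖ₑ ^ 2 ≤ ∫⁻ y, ‖f y‖ₑ ^ 2 ∂ballMeasure d h := by
  have := enorm_integral_sq_le (ballMeasure d h) f
  rwa [ballMeasure_univ hh, one_mul] at this

theorem lintegral_segMeasure_sq_le {F : ℝ → ℝ≥0∞} (hF : Measurable F) :
    (∫⁻ θ, F θ ∂segMeasure) ^ 2 ≤ 3 * ∫⁻ θ, F θ ^ 2 ∂segMeasure := by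
  have := lintegral_sq_le segMeasure hF.aemeasurable
  rwa [segMeasure_univ] at this

section estimates

variable {b} {F : Sp d → ℝ≥0∞} {m : ℕ} {τ₀ : ℝ} {U : Set (Sp d)}

/-- The points of the averaging segments that lie in `U` are in `Ω` by the cone condition, and
outside of `U` the density is zero. Only values of `F` on `Ω` enter, so no extension of the function
is needed. The start `θ = 0` is not covered by the cone, which has `τ > 0`. -/
theorem InwardCone.eq_indicator (hcone : InwardCone Ω b τ₀ U) (hFU : ∀ x ∉ U, F x = 0) (hh : 0 < h)
    (hhτ : h ≤ τ₀) {x y : Sp d} (hx : x ∈ closure Ω) (hy : ‖y‖ ≤ h) {θ : ℝ} (hθ : θ ∈ Icc (0 : ℝ) 1)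
    (hx' : θ = 0 → x ∈ Ω) :
    F (x + θ • (h • b + y)) = Ω.indicator F (x + θ • (h • b + y)) := by
  by_cases hU : x + θ • (h • b + y) ∈ U
  · rw [indicator_of_mem]
    rcases hθ.1.eq_or_lt with h0 | h0
    · rw [← h0, zero_smul, add_zero]
      exact hx' h0.symm
    · have e : x + θ • (h • b + y) = x + (θ * h) • (b + h⁻¹ • y) := by
        rw [smul_add, smul_add, smul_smul, smul_smul, mul_assoc, mul_inv_cancel₀ hh.ne', mul_one]
      rw [e] at hU ⊢
      refine hcone x hx (θ * h) (by positivity) ((mul_le_of_le_one_left hh.le hθ.2).trans hhτ) _ ?_ hU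
      rw [norm_smul, norm_inv, Real.norm_of_nonneg hh.le, inv_mul_le_iff₀ hh, mul_one]
      exact hy
  · rw [hFU _ hU, eq_comm, indicator_apply_eq_zero]
    exact fun _ => hFU _ hU

theorem enorm_shift_le (hh : 0 < h) {y : Sp d} (hy : ‖y‖ ≤ h) :
    ‖h • b + y‖ₑ ≤ ENNReal.ofReal ((‖b‖ + 1) * h) := by
  rw [← ofReal_norm]
  refine ENNReal.ofReal_le_ofReal ((norm_add_le _ _).trans ?_)
  rw [norm_smul, Real.norm_of_nonneg hh.le]
  linarith

/-- The local average of the squared density along the averaging segments. -/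
def avgSq (Ω : Set (Sp d)) (F : Sp d → ℝ≥0∞) (b : Sp d) (h : ℝ) (x : Sp d) : ℝ≥0∞ :=
  ∫⁻ y, ∫⁻ θ, Ω.indicator F (x + θ • (h • b + y)) ^ 2 ∂segMeasure ∂ballMeasure d h

instance sFinite_ballMeasure : SFinite (ballMeasure d h) := by
  unfold ballMeasure
  infer_instance

theorem measurable_avgSq (hΩ : IsOpen Ω) (hF : Measurable F) : Measurable (avgSq Ω F b h) := by
  have h1 : Measurable (Ω.indicator F) := hF.indicator hΩ.measurableSet
  have h2 : Measurable fun p : (Sp d × Sp d) × ℝ =>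
      Ω.indicator F (p.1.1 + p.2 • (h • b + p.1.2)) ^ 2 :=
    (h1.comp (by fun_prop)).pow_const 2
  exact (h2.lintegral_prod_right' (ν := segMeasure)).lintegral_prod_right' (ν := ballMeasure d h)

/-- For fixed `y` and `θ` the map `x ↦ x + θ • (h • b + y)` is a translation, so integrating in `x`
first yields no Jacobian that could degenerate at `θ = 0`. The factor `3` is the mass of
`segMeasure`. -/
theorem lintegral_avgSq_le (hΩ : IsOpen Ω) (hF : Measurable F) (hh : 0 < h) :
    ∫⁻ x in Ω, avgSq Ω F b h x ≤ 3 * ∫⁻ x in Ω, F x ^ 2 := by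
  have h1 : Measurable (Ω.indicator F) := hF.indicator hΩ.measurableSet
  have h2 : Measurable fun p : (Sp d × Sp d) × ℝ =>
      Ω.indicator F (p.1.1 + p.2 • (h • b + p.1.2)) ^ 2 :=
    (h1.comp (by fun_prop)).pow_const 2
  have h3 : ∀ v : Sp d, ∫⁻ x, Ω.indicator F (x + v) ^ 2 = ∫⁻ x in Ω, F x ^ 2 := by
    intro v
    rw [lintegral_add_right_eq_self (fun x => Ω.indicator F x ^ 2),
      ← lintegral_indicator hΩ.measurableSet]
    refine lintegral_congr fun x => ?_
    by_cases hx : x ∈ Ω <;> simp [hx]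
  refine (setLIntegral_le_lintegral _ _).trans ?_
  have h4 : ∫⁻ x, avgSq Ω F b h x =
      ∫⁻ y, ∫⁻ θ, (∫⁻ x, Ω.indicator F (x + θ • (h • b + y)) ^ 2) ∂segMeasure ∂ballMeasure d h := by
    unfold avgSq
    rw [lintegral_lintegral_swap]
    · refine lintegral_congr fun y => ?_
      rw [lintegral_lintegral_swap]
      have h5 : Measurable fun p : Sp d × ℝ => ((p.1, y), p.2) := by fun_prop
      exact (h2.comp h5).aemeasurable
    · exact (h2.lintegral_prod_right' (ν := segMeasure)).aemeasurable
  rw [h4]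
  simp only [h3, lintegral_const, segMeasure_univ, ballMeasure_univ hh, mul_one]
  rw [mul_comm]

/-- Taylor's formula between `x` and each point of the pushed ball, averaged with Cauchy-Schwarz.
Distances are at most `(‖b‖ + 1) h`, and the constant `6` is `3`, from `lintegral_segMeasure_sq_le`,
for each of the two terms. -/
theorem HasTaylor.error_le (hT : HasTaylor g F m) (hg : ContDiff ℝ 1 g) (hF : Measurable F)
    (hcone : InwardCone Ω b τ₀ U) (hFU : ∀ x ∉ U, F x = 0) (hh : 0 < h) (hhτ : h ≤ τ₀) {x : Sp d}
    (hx : x ∈ Ω) :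
    ‖g x - avgVal g b h x x‖ₑ ^ 2 + ENNReal.ofReal (h ^ 2) * ‖fderiv ℝ g x - avgSlope g b h x‖ₑ ^ 2 ≤
      ENNReal.ofReal (6 * ((‖b‖ + 1) * h) ^ (2 * (m + 1))) * avgSq Ω F b h x := by
  set β := ENNReal.ofReal ((‖b‖ + 1) * h) with hβ
  have hI : ∀ᵐ y ∂ballMeasure d h, (∫⁻ θ, F (x + θ • (x + (h • b + y) - x)) ∂segMeasure) ^ 2 ≤
      3 * ∫⁻ θ, Ω.indicator F (x + θ • (h • b + y)) ^ 2 ∂segMeasure := by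
    filter_upwards [ae_ballMeasure h] with y hy
    simp only [add_sub_cancel_left]
    refine (lintegral_segMeasure_sq_le (hF.comp (by fun_prop))).trans (mul_le_mul_right ?_ _)
    refine lintegral_mono_ae ?_
    filter_upwards [ae_segMeasure] with θ hθ
    rw [Function.comp_apply, hcone.eq_indicator hFU hh hhτ (subset_closure hx) hy hθ fun _ => hx]
  have h1 : ‖g x - avgVal g b h x x‖ₑ ^ 2 ≤ β ^ (2 * (m + 1)) * (3 * avgSq Ω F b h x) := by
    rw [avgVal, integral_const_sub_ballMeasure hh (continuous_taylor hg _ _ _)]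
    refine (enorm_integral_ballMeasure_sq_le hh _).trans ?_
    rw [avgSq, ← lintegral_const_mul' _ _ (by simp), ← lintegral_const_mul' _ _ (by simp [hβ])]
    refine lintegral_mono_ae ?_
    filter_upwards [ae_ballMeasure h, hI] with y hy hIy
    have h2 := hT.value x (x + (h • b + y))
    rw [← sub_sub]
    refine (pow_le_pow_left' h2 2).trans ?_
    rw [mul_pow, ← pow_mul, mul_comm (m + 1) 2]
    refine mul_le_mul' (pow_le_pow_left' ?_ _) hIy
    rw [add_sub_cancel_left]
    exact enorm_shift_le hh hy
  have h2 : ENNReal.ofReal (h ^ 2) * ‖fderiv ℝ g x - avgSlope g b h x‖ₑ ^ 2 ≤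
      β ^ (2 * (m + 1)) * (3 * avgSq Ω F b h x) := by
    have h3 : ‖fderiv ℝ g x - avgSlope g b h x‖ₑ ^ 2 ≤ β ^ (2 * m) * (3 * avgSq Ω F b h x) := by
      rw [avgSlope, integral_const_sub_ballMeasure hh (continuous_fderiv_shift hg _ _)]
      refine (enorm_integral_ballMeasure_sq_le hh _).trans ?_
      rw [avgSq, ← lintegral_const_mul' _ _ (by simp), ← lintegral_const_mul' _ _ (by simp [hβ])]
      refine lintegral_mono_ae ?_
      filter_upwards [ae_ballMeasure h, hI] with y hy hIy
      have h2 := hT.grad x (x + (h • b + y))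
      refine (pow_le_pow_left' h2 2).trans ?_
      rw [mul_pow, ← pow_mul, mul_comm m 2]
      refine mul_le_mul' (pow_le_pow_left' ?_ _) hIy
      rw [add_sub_cancel_left]
      exact enorm_shift_le hh hy
    have h4 : ENNReal.ofReal (h ^ 2) ≤ β ^ 2 := by
      rw [hβ, ← ENNReal.ofReal_pow (by positivity)]
      refine ENNReal.ofReal_le_ofReal (pow_le_pow_left₀ hh.le ?_ 2)
      nlinarith [norm_nonneg b]
    refine (mul_le_mul' h4 h3).trans (le_of_eq ?_)
    ring
  refine (add_le_add h1 h2).trans (le_of_eq ?_)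
  rw [ENNReal.ofReal_mul (by norm_num), ENNReal.ofReal_pow (by positivity), ← hβ]
  have : ENNReal.ofReal 6 = 6 := by simp
  rw [this]
  ring

end estimates

end SpaceTime
end

/-! ### Quasi-interpolation with averaged Taylor polynomials. -/

noncomputable section
namespace SpaceTime
open Filter Topology
variable {d : ℕ} {Ω : Set (Sp d)}
variable {g : Sp d → ℝ} {b : Sp d} {h κ : ℝ} {F : Sp d → ℝ≥0∞} {m : ℕ} {τ₀ : ℝ} {U : Set (Sp d)}

theorem lintegral_indicator_sq (hΩ : IsOpen Ω) (F : Sp d → ℝ≥0∞) (A : Set (Sp d)) :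
    ∫⁻ x in A, Ω.indicator F x ^ 2 = ∫⁻ x in A ∩ Ω, F x ^ 2 := by
  rw [inter_comm, ← Measure.restrict_restrict hΩ.measurableSet,
    ← lintegral_indicator hΩ.measurableSet]
  refine lintegral_congr fun x => ?_
  by_cases hx : x ∈ Ω <;> simp [hx]

/-- For each `y`, the Taylor polynomials about `ξ' = z + h • b + y` and `ξ = x + h • b + y` are
compared at `z`. The difference is the remainder of `g` at `ξ'` plus the difference of the gradients
applied to `z - ξ'`. The segment from `ξ'` to `ξ` is a translate of a segment in the convex set `A`;
averaging over the translation gives integrals over balls. The constant is `36 = 2² · 3 · 3`: two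
terms squared, Cauchy-Schwarz, and the mass of `segMeasure`. -/
theorem HasTaylor.jump_le (hT : HasTaylor g F m) (hg : ContDiff ℝ 1 g) (hF : Measurable F)
    (hΩ : IsOpen Ω) (hcone : InwardCone Ω b τ₀ U) (hFU : ∀ x ∉ U, F x = 0) (hh : 0 < h)
    (hhτ : h ≤ τ₀) (hκ : 0 < κ) {x z y₀ : Sp d} {A : Set (Sp d)} (hA : Convex ℝ A)
    (hAΩ : A ⊆ closure Ω) (hAd : ∀ p ∈ A, ∀ q ∈ A, dist p q ≤ κ * h) (hx : x ∈ A) (hz : z ∈ A)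
    (hy₀ : y₀ ∈ A) :
    volume (Metric.closedBall (0 : Sp d) h) * ‖avgVal g b h z z - avgVal g b h x z‖ₑ ^ 2 ≤
      ENNReal.ofReal (36 * ((κ + ‖b‖ + 1) * h) ^ (2 * (m + 1))) *
        ∫⁻ y in Metric.closedBall y₀ ((κ + ‖b‖ + 1) * h) ∩ Ω, F y ^ 2 := by
  set ρ := ENNReal.ofReal ((κ + ‖b‖ + 1) * h) with hρ
  have hFΩ : Measurable (Ω.indicator F) := hF.indicator hΩ.measurableSet
  have hseg : ∀ θ ∈ Icc (0 : ℝ) 1, z + θ • (x - z) ∈ A := fun θ hθ =>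
    hA.add_smul_sub_mem hz hx hθ
  have h1 : ‖avgVal g b h z z - avgVal g b h x z‖ₑ ^ 2 ≤
      4 * ρ ^ (2 * (m + 1)) * (3 * ∫⁻ y, ∫⁻ θ, Ω.indicator F (z + θ • (x - z) + h • b + y) ^ 2
        ∂segMeasure ∂ballMeasure d h) := by
    rw [avgVal, avgVal, ← integral_sub (integrable_ballMeasure hh (continuous_taylor hg _ _ _))
      (integrable_ballMeasure hh (continuous_taylor hg _ _ _))]
    refine (enorm_integral_ballMeasure_sq_le hh _).trans ?_
    rw [← lintegral_const_mul' _ _ (by simp),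
      ← lintegral_const_mul' _ _ (ENNReal.mul_ne_top (by simp) (by simp [hρ]))]
    refine lintegral_mono_ae ?_
    filter_upwards [ae_ballMeasure h] with y hy
    set ξ' := z + (h • b + y) with hξ'
    set ξ := x + (h • b + y) with hξ
    have hd : ξ - ξ' = x - z := by simp [hξ, hξ']
    set I := ∫⁻ θ, F (ξ' + θ • (ξ - ξ')) ∂segMeasure with hI
    have hIle : I ^ 2 ≤ 3 * ∫⁻ θ, Ω.indicator F (z + θ • (x - z) + h • b + y) ^ 2 ∂segMeasure := by
      refine (lintegral_segMeasure_sq_le (hF.comp (by fun_prop))).trans (mul_le_mul_right ?_ _)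
      refine lintegral_mono_ae ?_
      filter_upwards [ae_segMeasure] with θ hθ
      have e := hcone.eq_indicator hFU hh hhτ (hAΩ (hseg θ hθ)) hy
        (θ := 1) ⟨zero_le_one, le_rfl⟩ (fun h => absurd h one_ne_zero)
      rw [one_smul] at e
      have e2 : ξ' + θ • (ξ - ξ') = z + θ • (x - z) + (h • b + y) := by
        rw [hd, hξ']
        abel
      rw [Function.comp_apply, e2, e, ← add_assoc]
    have hle1 : ‖x - z‖ₑ ≤ ρ := by
      rw [← ofReal_norm, hρ, ← dist_eq_norm]
      refine ENNReal.ofReal_le_ofReal ((hAd x hx z hz).trans ?_)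
      nlinarith [norm_nonneg b]
    have hle2 : ‖z - ξ'‖ₑ ≤ ρ := by
      rw [hξ', sub_add_cancel_left, enorm_neg]
      refine (enorm_shift_le hh hy).trans (ENNReal.ofReal_le_ofReal ?_)
      nlinarith [norm_nonneg b]
    have hsplit : g ξ' + fderiv ℝ g ξ' (z - ξ') - (g ξ + fderiv ℝ g ξ (z - ξ)) =
        (g ξ' - g ξ - fderiv ℝ g ξ (ξ' - ξ)) + (fderiv ℝ g ξ' - fderiv ℝ g ξ) (z - ξ') := by
      simp only [map_sub, sub_apply]
      ring
    rw [hsplit]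
    have hv := hT.value ξ' ξ
    have hgr := hT.grad ξ' ξ
    rw [hd] at hv hgr
    rw [← hd, ← hI] at hv hgr
    rw [hd] at hv hgr
    have h2 : ‖(g ξ' - g ξ - fderiv ℝ g ξ (ξ' - ξ)) +
        (fderiv ℝ g ξ' - fderiv ℝ g ξ) (z - ξ')‖ₑ ≤ 2 * ρ ^ (m + 1) * I := by
      refine (enorm_add_le _ _).trans ?_
      have h3 : ‖g ξ' - g ξ - fderiv ℝ g ξ (ξ' - ξ)‖ₑ ≤ ρ ^ (m + 1) * I :=
        hv.trans (mul_le_mul_left (pow_le_pow_left' hle1 _) _)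
      have h4 : ‖(fderiv ℝ g ξ' - fderiv ℝ g ξ) (z - ξ')‖ₑ ≤ ρ ^ m * I * ρ := by
        refine ((fderiv ℝ g ξ' - fderiv ℝ g ξ).le_opENorm _).trans (mul_le_mul' ?_ hle2)
        exact hgr.trans (mul_le_mul_left (pow_le_pow_left' hle1 _) _)
      refine (add_le_add h3 h4).trans (le_of_eq ?_)
      ring
    refine (pow_le_pow_left' h2 2).trans ?_
    rw [mul_pow, mul_pow, ← pow_mul, mul_comm (m + 1) 2]
    refine mul_le_mul' (le_of_eq ?_) hIle
    norm_num
  have h2 : volume (Metric.closedBall (0 : Sp d) h) *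
      ∫⁻ y, ∫⁻ θ, Ω.indicator F (z + θ • (x - z) + h • b + y) ^ 2 ∂segMeasure ∂ballMeasure d h ≤
      3 * ∫⁻ y in Metric.closedBall y₀ ((κ + ‖b‖ + 1) * h) ∩ Ω, F y ^ 2 := by
    rw [lintegral_lintegral_swap, ← lintegral_const_mul' _ _ measure_closedBall_lt_top.ne]
    · rw [← segMeasure_univ, mul_comm (segMeasure univ), ← lintegral_const]
      refine lintegral_mono_ae ?_
      filter_upwards [ae_segMeasure] with θ hθ
      rw [mul_lintegral_ballMeasure hh (fun y => Ω.indicator F y ^ 2),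
        ← lintegral_indicator_sq hΩ]
      refine lintegral_mono_set (Metric.closedBall_subset_closedBall' ?_)
      have h3 := hAd _ (hseg θ hθ) y₀ hy₀
      have h4 : dist (z + θ • (x - z) + h • b) (z + θ • (x - z)) = h * ‖b‖ := by
        rw [dist_eq_norm, add_sub_cancel_left, norm_smul, Real.norm_of_nonneg hh.le]
      have h5 := dist_triangle (z + θ • (x - z) + h • b) (z + θ • (x - z)) y₀
      nlinarith
    · refine Measurable.aemeasurable ?_
      exact (hFΩ.comp (by fun_prop : Measurable fun p : Sp d × ℝ =>
        z + p.2 • (x - z) + h • b + p.1)).pow_const 2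
  refine (mul_le_mul_right h1 _).trans ?_
  calc _ = 12 * ρ ^ (2 * (m + 1)) * (volume (Metric.closedBall (0 : Sp d) h) *
        ∫⁻ y, ∫⁻ θ, Ω.indicator F (z + θ • (x - z) + h • b + y) ^ 2
          ∂segMeasure ∂ballMeasure d h) := by ring
    _ ≤ 12 * ρ ^ (2 * (m + 1)) *
        (3 * ∫⁻ y in Metric.closedBall y₀ ((κ + ‖b‖ + 1) * h) ∩ Ω, F y ^ 2) :=
      mul_le_mul_right h2 _
    _ = _ := by
      rw [ENNReal.ofReal_mul (by norm_num), ENNReal.ofReal_pow (by positivity), ← hρ]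
      have : ENNReal.ofReal 36 = 36 := by simp
      rw [this]
      ring

namespace SimplicialMesh

variable {M : SimplicialMesh Ω}

/-- An affine function and its slope are bounded by the values at the vertices. -/
theorem IsUniform.affine_le_vertices (hu : M.IsUniform h κ) (hh : 0 < h) (hκ : 0 < κ)
    {s : Finset (Sp d)} (hs : s ∈ M.cells) (e : Sp d →ᵃ[ℝ] ℝ) {x : Sp d} (hx : x ∈ hull s) :
    ‖e x‖ₑ ^ 2 + ENNReal.ofReal (h ^ 2) * ‖slope e‖ₑ ^ 2 ≤
      ENNReal.ofReal (1 + (4 * κ) ^ 2) * ∑ z ∈ s, ‖e z‖ₑ ^ 2 := by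
  have hS := M.isSimplex hs
  obtain ⟨c, hc, hball, hdist⟩ := hu.exists_center hh hκ hs
  set S := ∑ z ∈ s, ‖e z‖ ^ 2 with hSdef
  have hS0 : 0 ≤ S := Finset.sum_nonneg fun _ _ => by positivity
  set δ := Real.sqrt S with hδ
  have hδ0 : 0 ≤ δ := Real.sqrt_nonneg _
  have hδ2 : δ ^ 2 = S := Real.sq_sqrt hS0
  have hv : ∀ z ∈ s, |e z| ≤ δ := by
    intro z hz
    refine Real.le_sqrt_of_sq_le ?_
    exact Finset.single_le_sum (f := fun z => ‖e z‖ ^ 2) (fun _ _ => by positivity) hz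
  have hbd : ∀ y ∈ hull s, |e y| ≤ δ := fun y hy => hS.abs_affine_le hv hy
  obtain ⟨u, hu1, hu2⟩ := exists_unit_of_clm (slope e)
  have hmem : c + (h / κ / 2) • u ∈ hull s := by
    refine hball ?_
    rw [Metric.mem_ball, dist_eq_norm, add_sub_cancel_left, norm_smul,
      Real.norm_of_nonneg (by positivity)]
    have : 0 < h / κ := by positivity
    nlinarith
  have h1 := hbd _ hmem
  have h2 := hbd _ hc
  rw [affine_eq_add_slope e c, add_sub_cancel_left, map_smul, hu2, smul_eq_mul] at h1
  have h3 : h / κ / 2 * ‖slope e‖ ≤ 2 * δ := by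
    have := abs_le.1 h1
    have := abs_le.1 h2
    linarith
  have h4 : h * ‖slope e‖ ≤ 4 * κ * δ := by
    have : h * ‖slope e‖ = 2 * κ * (h / κ / 2 * ‖slope e‖) := by field_simp
    rw [this]
    nlinarith
  simp only [enorm_sq_eq_ofReal]
  rw [← ENNReal.ofReal_sum_of_nonneg (fun _ _ => by positivity), ← hSdef, ← hδ2,
    ← ENNReal.ofReal_mul (by positivity), ← ENNReal.ofReal_mul (by positivity),
    ← ENNReal.ofReal_add (by positivity) (by positivity)]
  refine ENNReal.ofReal_le_ofReal ?_
  have h5 : ‖e x‖ ^ 2 ≤ δ ^ 2 := pow_le_pow_left₀ (norm_nonneg _) (hbd x hx) 2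
  have h6 : (h * ‖slope e‖) ^ 2 ≤ (4 * κ * δ) ^ 2 := pow_le_pow_left₀ (by positivity) h4 2
  nlinarith

theorem add_enorm_sq_le {E : Type*} [NormedAddCommGroup E] (x y : E) :
    ‖x + y‖ₑ ^ 2 ≤ 2 * ‖x‖ₑ ^ 2 + 2 * ‖y‖ₑ ^ 2 := by
  simp only [enorm_sq_eq_ofReal]
  rw [show (2 : ℝ≥0∞) = ENNReal.ofReal 2 by simp, ← ENNReal.ofReal_mul (by norm_num),
    ← ENNReal.ofReal_mul (by norm_num), ← ENNReal.ofReal_add (by positivity) (by positivity)]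
  refine ENNReal.ofReal_le_ofReal ?_
  have := pow_le_pow_left₀ (norm_nonneg _) (norm_add_le x y) 2
  nlinarith [sq_nonneg (‖x‖ - ‖y‖)]

/-- The constant in the local approximation estimate. -/
def approxConst (d : ℕ) (κ β : ℝ) (m : ℕ) : ℝ :=
  36 * (β + 1) ^ (2 * (m + 1)) + 2 * ((2 * (κ + β + 1) * κ) ^ d *
    (κ ^ d * ((1 + (4 * κ) ^ 2) * ((d + 1) * (36 * (κ + β + 1) ^ (2 * (m + 1)))))))

theorem approxConst_nonneg (hκ : 0 < κ) {β : ℝ} (hβ : 0 ≤ β) : 0 ≤ approxConst d κ β m := by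
  unfold approxConst
  positivity

/-- Approximation of smooth functions with support near a boundary point. -/
theorem IsUniform.exists_approx (hu : M.IsUniform h κ) (hreg : interior (closure Ω) = Ω)
    (hT : HasTaylor g F m) (hg : ContDiff ℝ 1 g) (hF : Measurable F)
    (hcone : InwardCone Ω b τ₀ U) (hFU : ∀ x ∉ U, F x = 0) (hh : 0 < h)
    (hhτ : h ≤ τ₀) (hκ : 0 < κ) :
    ∃ q : M.p1Fun, ∫⁻ x in Ω, errDensity h g q.1 x ≤
      ENNReal.ofReal (approxConst d κ ‖b‖ m * h ^ (2 * (m + 1))) * ∫⁻ x in Ω, F x ^ 2 := by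
  have hΩ : IsOpen Ω := hreg ▸ isOpen_interior
  -- With `Q_x` the averaged polynomial of the point `x`, the nodal values are `Q_z(z)`. The error
  -- at `x` splits into `g - Q_x`, bounded by `error_le`, and `Q_x - q`. The latter is affine on the
  -- cell and has the jumps `Q_x(z) - Q_z(z)` as vertex values.
  set q := M.nodal fun z => avgVal g b h z z with hq
  refine ⟨q, ?_⟩
  set R := κ + ‖b‖ + 1 with hR
  have hR0 : 0 < R := by positivity
  set c₁ := ENNReal.ofReal (6 * ((‖b‖ + 1) * h) ^ (2 * (m + 1))) with hc₁
  set V := volume (Metric.closedBall (0 : Sp d) h) with hV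
  set c₂ := ENNReal.ofReal (κ ^ d * ((1 + (4 * κ) ^ 2) * ((d + 1) * (36 * (R * h) ^ (2 * (m + 1))))))
    with hc₂
  -- The supremum over `x ∈ interior (hull s)` acts as an indicator: it is zero at points of the
  -- frontier, where `fderiv` of `q` need not be the slope on the cell.
  have hcell : ∀ s ∈ M.cells, ∀ y ∈ hull s,
      ∫⁻ x in hull s, ⨆ _ : x ∈ interior (hull s),
        (‖avgVal g b h x x - q.1 x‖ₑ ^ 2 + ENNReal.ofReal (h ^ 2) *
          ‖avgSlope g b h x - fderiv ℝ q.1 x‖ₑ ^ 2) ≤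
      ∫⁻ x in Metric.closedBall y (R * h) ∩ Ω, c₂ * F x ^ 2 := by
    intro s hs y hy
    have hS := M.isSimplex hs
    obtain ⟨c, hc, hball, hdist⟩ := hu.exists_center hh hκ hs
    obtain ⟨a, ha⟩ := M.exists_affine q hs
    set I := ∫⁻ x in Metric.closedBall y (R * h) ∩ Ω, F x ^ 2 with hI
    have hpt : ∀ x ∈ hull s, (⨆ _ : x ∈ interior (hull s),
        (‖avgVal g b h x x - q.1 x‖ₑ ^ 2 + ENNReal.ofReal (h ^ 2) *
          ‖avgSlope g b h x - fderiv ℝ q.1 x‖ₑ ^ 2)) ≤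
        V⁻¹ * (ENNReal.ofReal ((1 + (4 * κ) ^ 2) * ((d + 1) * (36 * (R * h) ^ (2 * (m + 1))))) * I) := by
      intro x hx
      refine iSup_le fun hxi => ?_
      rw [fderiv_eq_slope ha hxi, ha hx]
      -- `Q_x` as an affine map, to which `affine_le_vertices` applies after subtraction of `q`.
      set P : Sp d →ᵃ[ℝ] ℝ := (avgSlope g b h x : Sp d →ₗ[ℝ] ℝ).toAffineMap +
        AffineMap.const ℝ (Sp d) (avgVal g b h x x - avgSlope g b h x x) with hP
      have hPz : ∀ z, P z = avgVal g b h x z := by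
        intro z
        rw [avgVal_eq b hh hg x z, map_sub]
        simp [hP]
        ring
      have hPs : slope P = avgSlope g b h x := by
        ext v
        simp [hP, slope]
      have h1 := hu.affine_le_vertices hh hκ hs (P - a) hx
      rw [slope_sub, hPs] at h1
      have h2 : (P - a) x = avgVal g b h x x - a x := by
        rw [← hPz]
        rfl
      rw [h2] at h1
      refine h1.trans ?_
      have h3 : ∀ z ∈ s, ‖(P - a) z‖ₑ ^ 2 ≤
          V⁻¹ * (ENNReal.ofReal (36 * (R * h) ^ (2 * (m + 1))) * I) := by
        intro z hz
        have h4 : (P - a) z = -(avgVal g b h z z - avgVal g b h x z) := by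
          have h5 : a z = avgVal g b h z z := by
            rw [← ha (mem_hull_of_mem hz), hq, M.nodal_apply hs (mem_hull_of_mem hz),
              hS.interp_vertex _ hz]
          have h6 : (P - a) z = P z - a z := rfl
          rw [h6, hPz, h5]
          ring
        rw [h4, enorm_neg, ← ENNReal.mul_le_iff_le_inv
          (Metric.measure_closedBall_pos volume _ hh).ne' measure_closedBall_lt_top.ne]
        exact hT.jump_le hg hF hΩ hcone hFU hh hhτ hκ (convex_hull s) (M.hull_subset hs) hdist hx
          (mem_hull_of_mem hz) hy
      refine (mul_le_mul_right (Finset.sum_le_sum h3) _).trans (le_of_eq ?_)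
      have h5 : ENNReal.ofReal ((1 + (4 * κ) ^ 2) * ((d + 1) * (36 * (R * h) ^ (2 * (m + 1))))) =
          ENNReal.ofReal (1 + (4 * κ) ^ 2) * (ENNReal.ofReal (d + 1) *
            ENNReal.ofReal (36 * (R * h) ^ (2 * (m + 1)))) := by
        rw [ENNReal.ofReal_mul (by positivity), ENNReal.ofReal_mul (by positivity)]
      rw [Finset.sum_const, hS.card_eq, nsmul_eq_mul, h5]
      have : ((d + 1 : ℕ) : ℝ≥0∞) = ENNReal.ofReal (d + 1) := by
        rw [← ENNReal.ofReal_natCast]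
        push_cast
        rfl
      rw [this]
      ring
    have hvol : volume (hull s) ≤ ENNReal.ofReal (κ ^ d) * V := by
      rw [hV, ← volume_closedBall_mul c hκ]
      exact measure_mono fun x hx => hdist x hx c hc
    refine (setLIntegral_mono' (isClosed_hull s).measurableSet hpt).trans ?_
    rw [setLIntegral_const, lintegral_const_mul' _ _ ENNReal.ofReal_ne_top, ← hI,
      ENNReal.ofReal_mul (p := κ ^ d) (by positivity)]
    refine (mul_le_mul_right hvol _).trans (le_of_eq ?_)
    have hVV : V⁻¹ * V = 1 := ENNReal.inv_mul_cancel
      (Metric.measure_closedBall_pos volume _ hh).ne' measure_closedBall_lt_top.ne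
    calc _ = (V⁻¹ * V) * (ENNReal.ofReal (κ ^ d) * ENNReal.ofReal ((1 + (4 * κ) ^ 2) *
          ((d + 1) * (36 * (R * h) ^ (2 * (m + 1))))) * I) := by ring
      _ = _ := by rw [hVV, one_mul]
  have hsum := hu.sum_le hreg hh hκ hR0 ((hF.pow_const 2).const_mul c₂).aemeasurable hcell
  have hpt : ∀ s ∈ M.cells, ∫⁻ x in hull s, errDensity h g q.1 x ≤
      (∫⁻ x in hull s, 2 * (c₁ * avgSq Ω F b h x)) +
      2 * ∫⁻ x in hull s, ⨆ _ : x ∈ interior (hull s),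
        (‖avgVal g b h x x - q.1 x‖ₑ ^ 2 + ENNReal.ofReal (h ^ 2) *
          ‖avgSlope g b h x - fderiv ℝ q.1 x‖ₑ ^ 2) := by
    intro s hs
    rw [← lintegral_const_mul' _ _ (by simp), ← lintegral_add_left
      (((measurable_avgSq hΩ hF).const_mul _).const_mul _)]
    refine lintegral_mono_ae ?_
    filter_upwards [ae_hull_mem_interior s] with x hxi
    have hxΩ : x ∈ Ω := by
      rw [← hreg]
      exact interior_mono (M.hull_subset hs) hxi
    rw [iSup_pos hxi, errDensity]
    have h1 := hT.error_le hg hF hcone hFU hh hhτ hxΩ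
    have h2 := add_enorm_sq_le (g x - avgVal g b h x x) (avgVal g b h x x - q.1 x)
    have h3 := add_enorm_sq_le (fderiv ℝ g x - avgSlope g b h x)
      (avgSlope g b h x - fderiv ℝ q.1 x)
    rw [sub_add_sub_cancel] at h2 h3
    refine (add_le_add h2 (mul_le_mul_right h3 _)).trans ?_
    refine le_trans (le_of_eq ?_) (add_le_add_left (mul_le_mul_right h1 2) _)
    ring
  rw [M.lintegral_eq_sum hreg]
  refine (Finset.sum_le_sum hpt).trans ?_
  rw [Finset.sum_add_distrib, ← M.lintegral_eq_sum hreg, ← Finset.mul_sum]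
  rw [lintegral_const_mul' _ _ (by simp), lintegral_const_mul' _ _ ENNReal.ofReal_ne_top]
  rw [lintegral_const_mul' _ _ ENNReal.ofReal_ne_top] at hsum
  have h1 := lintegral_avgSq_le (b := b) hΩ hF hh
  refine (add_le_add (mul_le_mul_right (mul_le_mul_right h1 _) _)
    (mul_le_mul_right hsum _)).trans (le_of_eq ?_)
  set J := ∫⁻ x in Ω, F x ^ 2
  have h36 : 2 * (c₁ * (3 * J)) = ENNReal.ofReal (36 * ((‖b‖ + 1) * h) ^ (2 * (m + 1))) * J := by
    rw [hc₁, ENNReal.ofReal_mul (by norm_num), ENNReal.ofReal_mul (p := 36) (by norm_num)]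
    have e1 : ENNReal.ofReal 36 = 36 := by simp
    have e2 : ENNReal.ofReal 6 = 6 := by simp
    rw [e1, e2]
    ring
  have h2 : 2 * (ENNReal.ofReal ((2 * R * κ) ^ d) * (c₂ * J)) =
      ENNReal.ofReal (2 * ((2 * R * κ) ^ d * (κ ^ d * ((1 + (4 * κ) ^ 2) *
        ((d + 1) * (36 * (R * h) ^ (2 * (m + 1)))))))) * J := by
    rw [hc₂, ENNReal.ofReal_mul (p := 2) (by norm_num),
      ENNReal.ofReal_mul (p := (2 * R * κ) ^ d) (by positivity)]
    have e1 : ENNReal.ofReal 2 = 2 := by simp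
    rw [e1]
    ring
  rw [h36, h2, ← add_mul, ← ENNReal.ofReal_add (by positivity) (by positivity)]
  congr 2
  rw [approxConst, ← hR, mul_pow R h, mul_pow (‖b‖ + 1) h]
  ring

end SimplicialMesh

end SpaceTime
end

noncomputable section
namespace SpaceTime
open Filter Topology
variable {d : ℕ} {Ω : Set (Sp d)}

/-! ## Mollification -/

theorem enorm_sq_Lp {μ : Measure (Sp d)} (f : Lp ℝ 2 μ) :
    ‖f‖ₑ ^ 2 = ∫⁻ x, ‖f x‖ₑ ^ 2 ∂μ := by
  rw [Lp.enorm_def, ← ENNReal.rpow_natCast,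
    eLpNorm_eq_lintegral_rpow_enorm_toReal (by norm_num) (by norm_num), ← ENNReal.rpow_mul]
  norm_num

/-- Continuity of translations in `L²`. -/
theorem exists_translate_le {F : Sp d → ℝ} (hF : MemLp F 2 volume) {ε : ℝ≥0∞} (hε : ε ≠ 0) :
    ∃ δ > 0, ∀ v : Sp d, ‖v‖ ≤ δ → ∫⁻ x, ‖F x - F (x + v)‖ₑ ^ 2 ≤ ε := by
  have hfact : Fact ((2 : ℝ≥0∞) ≠ ⊤) := ⟨by norm_num⟩
  set f := hF.toLp F with hf
  have hc : Continuous fun v : Sp d => f - (DomAddAct.mk v +ᵥ f) :=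
    continuous_const.sub (DomAddAct.continuous_mk.vadd continuous_const)
  have hc0 : ContinuousAt (fun v : Sp d => ‖f - (DomAddAct.mk v +ᵥ f)‖ₑ ^ 2) 0 := by
    exact ((ENNReal.continuous_pow 2).comp hc.enorm).continuousAt
  have h0 : f - (DomAddAct.mk (0 : Sp d) +ᵥ f) = 0 := by
    rw [DomAddAct.mk_zero, zero_vadd, sub_self]
  have hev : ∀ᶠ v : Sp d in 𝓝 0, ‖f - (DomAddAct.mk v +ᵥ f)‖ₑ ^ 2 < ε := by
    refine hc0.eventually_lt continuousAt_const ?_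
    rw [h0]
    simpa using pos_iff_ne_zero.2 hε
  obtain ⟨δ, hδ, hball⟩ := Metric.eventually_nhds_iff.1 hev
  refine ⟨δ / 2, by positivity, fun v hv => ?_⟩
  have h1 := (hball (y := v) (by rw [dist_zero_right]; linarith)).le
  rw [enorm_sq_Lp] at h1
  refine (le_of_eq ?_).trans h1
  refine lintegral_congr_ae ?_
  have h2 : (DomAddAct.mk v +ᵥ f : Lp ℝ 2 volume) =ᵐ[volume] fun x => F (v + x) := by
    rw [hf, DomAddAct.mk_vadd_toLp]
    exact MemLp.coeFn_toLp _
  filter_upwards [Lp.coeFn_sub f (DomAddAct.mk v +ᵥ f), h2, hF.coeFn_toLp] with x hx hx2 hx3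
  rw [hx, Pi.sub_apply, hx2, hf, hx3, add_comm]

/-- A smooth bump function with support in the ball of radius `1 / (n + 1)`. -/
def bump (d n : ℕ) : ContDiffBump (0 : Sp d) where
  rIn := 1 / (n + 1) / 2
  rOut := 1 / (n + 1)
  rIn_pos := by positivity
  rIn_lt_rOut := half_lt_self (by positivity)

theorem bump_rOut (n : ℕ) : (bump d n).rOut = 1 / (n + 1) := rfl

/-- The kernel of the mollification. -/
def kernel (d n : ℕ) : Sp d → ℝ := (bump d n).normed volume

theorem kernel_eq_zero {n : ℕ} {z : Sp d} (hz : 1 / (n + 1 : ℝ) < ‖z‖) : kernel d n z = 0 := by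
  have h := (bump d n).support_normed_eq (μ := volume)
  by_contra h1
  have h2 : z ∈ Function.support ((bump d n).normed volume) := h1
  rw [h, bump_rOut, Metric.mem_ball, dist_zero_right] at h2
  linarith

theorem contDiff_kernel {n : ℕ} : ContDiff ℝ ∞ (kernel d n) := (bump d n).contDiff_normed

theorem hasCompactSupport_kernel {n : ℕ} : HasCompactSupport (kernel d n) :=
  (bump d n).hasCompactSupport_normed

/-- The mollification of `F`, shifted in the direction `b`. -/
def mollify (b : Sp d) (n : ℕ) (F : Sp d → ℝ) (x : Sp d) : ℝ :=
  convolution (kernel d n) F (ContinuousLinearMap.lsmul ℝ ℝ) volume (x + (1 / (n + 1) : ℝ) • b)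

variable {b : Sp d} {n : ℕ} {F : Sp d → ℝ}

theorem mollify_eq (b : Sp d) (n : ℕ) (F : Sp d → ℝ) (x : Sp d) :
    mollify b n F x = ∫ z, kernel d n z • F (x + ((1 / (n + 1) : ℝ) • b - z)) := by
  rw [mollify, convolution_lsmul]
  simp only [add_sub_assoc]

theorem contDiff_mollify (hF : LocallyIntegrable F volume) : ContDiff ℝ ∞ (mollify b n F) :=
  (hasCompactSupport_kernel.contDiff_convolution_left (ContinuousLinearMap.lsmul ℝ ℝ)
    contDiff_kernel hF).comp (contDiff_id.add contDiff_const)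

theorem support_mollify_subset {K : Set (Sp d)} (hFK : ∀ x ∉ K, F x = 0) :
    Function.support (mollify b n F) ⊆ Metric.cthickening ((1 + ‖b‖) * (1 / (n + 1))) K := by
  intro x hx
  by_contra hcon
  refine hx ?_
  rw [mollify_eq]
  refine integral_eq_zero_of_ae (ae_of_all _ fun z => ?_)
  by_cases hz : 1 / (n + 1 : ℝ) < ‖z‖
  · simp [kernel_eq_zero hz]
  · push Not at hz
    have : F (x + ((1 / (n + 1) : ℝ) • b - z)) = 0 := by
      refine hFK _ fun hK => hcon (Metric.mem_cthickening_of_dist_le _ _ _ _ hK ?_)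
      rw [dist_eq_norm, sub_add_cancel_left, norm_neg]
      refine (norm_sub_le _ _).trans ?_
      rw [norm_smul, Real.norm_of_nonneg (by positivity)]
      linarith
    simp only [this, smul_zero, Pi.zero_apply]

/-- The kernel is a probability density, so the squared error at `x` is at most the average of the
squared differences of `F` and its translates. Tonelli then reduces the claim to the translates that
occur, whose length is at most `(1 + ‖b‖) / (n + 1)`. -/
theorem mollify_error_le (hFm : Measurable F) (hF : LocallyIntegrable F volume) {ε : ℝ≥0∞}
    (h : ∀ v : Sp d, ‖v‖ ≤ (1 + ‖b‖) * (1 / (n + 1)) → ∫⁻ x, ‖F x - F (x + v)‖ₑ ^ 2 ≤ ε) :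
    ∫⁻ x, ‖F x - mollify b n F x‖ₑ ^ 2 ≤ ε := by
  set v := (1 / (n + 1) : ℝ) • b with hv
  have hkc : Continuous (kernel d n) := contDiff_kernel.continuous
  have hk0 : ∀ z, 0 ≤ kernel d n z := fun z => (bump d n).nonneg_normed z
  have hk1 : ∫ z, kernel d n z = 1 := (bump d n).integral_normed
  have hki : Integrable (kernel d n) volume := hkc.integrable_of_hasCompactSupport
    hasCompactSupport_kernel
  set μ := volume.withDensity fun z => ENNReal.ofReal (kernel d n z) with hμ
  have hμ1 : μ univ = 1 := by
    rw [hμ, withDensity_apply _ MeasurableSet.univ, setLIntegral_univ,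
      ← ofReal_integral_eq_lintegral_ofReal hki (ae_of_all _ hk0), hk1, ENNReal.ofReal_one]
  have hkm : Measurable fun z => (kernel d n z).toNNReal := hkc.measurable.real_toNNReal
  have hint : ∀ G : Sp d → ℝ, ∫ z, G z ∂μ = ∫ z, kernel d n z • G z := by
    intro G
    have := integral_withDensity_eq_integral_smul (μ := (volume : Measure (Sp d))) hkm G
    rw [hμ]
    refine this.trans (integral_congr_ae (ae_of_all _ fun z => ?_))
    simp only [NNReal.smul_def, Real.coe_toNNReal _ (hk0 z)]
  have hpt : ∀ x, ‖F x - mollify b n F x‖ₑ ^ 2 ≤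
      ∫⁻ z, ENNReal.ofReal (kernel d n z) * ‖F x - F (x + (v - z))‖ₑ ^ 2 := by
    intro x
    have hcv := hasCompactSupport_kernel.convolutionExists_left
      (ContinuousLinearMap.lsmul ℝ ℝ) hkc hF (x + v)
    have h1 : F x - mollify b n F x = ∫ z, (F x - F (x + (v - z))) ∂μ := by
      rw [hint, mollify_eq]
      simp only [smul_sub]
      rw [integral_sub]
      · simp only [smul_eq_mul]
        rw [integral_mul_const, hk1, one_mul]
      · exact hki.mul_const _
      · have h2 : Integrable (fun z => kernel d n z • F (x + v - z)) := hcv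
        simpa only [add_sub_assoc] using h2
    rw [h1]
    refine (enorm_integral_sq_le μ _).trans ?_
    rw [hμ1, one_mul, hμ, lintegral_withDensity_eq_lintegral_mul₀]
    · exact le_rfl
    · exact hkc.measurable.ennreal_ofReal.aemeasurable
    · exact ((measurable_const.sub (hFm.comp (by fun_prop))).enorm.pow_const 2).aemeasurable
  refine (lintegral_mono hpt).trans ?_
  rw [lintegral_lintegral_swap]
  · have h2 : ∀ z, ∫⁻ x, ENNReal.ofReal (kernel d n z) * ‖F x - F (x + (v - z))‖ₑ ^ 2 ≤
        ENNReal.ofReal (kernel d n z) * ε := by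
      intro z
      rw [lintegral_const_mul' _ _ ENNReal.ofReal_ne_top]
      by_cases hz : 1 / (n + 1 : ℝ) < ‖z‖
      · rw [kernel_eq_zero hz]
        simp
      · push Not at hz
        refine mul_le_mul_right (h _ ?_) _
        refine (norm_sub_le _ _).trans ?_
        rw [hv, norm_smul, Real.norm_of_nonneg (by positivity)]
        linarith
    refine (lintegral_mono h2).trans ?_
    rw [lintegral_mul_const _ hkc.measurable.ennreal_ofReal,
      ← ofReal_integral_eq_lintegral_ofReal hki (ae_of_all _ hk0), hk1, ENNReal.ofReal_one, one_mul]
  · refine Measurable.aemeasurable ?_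
    refine Measurable.mul ?_ (Measurable.pow_const (Measurable.enorm (Measurable.sub ?_ ?_)) 2)
    · exact (hkc.measurable.comp measurable_snd).ennreal_ofReal
    · exact hFm.comp measurable_fst
    · exact hFm.comp (by fun_prop)

/-- The weak derivative of `F` on `Ω`, for test functions whose support is contained in `Ω` only up
to the complement of `K`. -/
def LocWeak (Ω K : Set (Sp d)) (i : Fin d) (F F' : Sp d → ℝ) : Prop :=
  ∀ ψ : Sp d → ℝ, ContDiff ℝ ∞ ψ → HasCompactSupport ψ → K ∩ tsupport ψ ⊆ Ω →
    ∫ x in Ω, F x * partialDeriv i ψ x = - ∫ x in Ω, F' x * ψ x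

/-- The derivative falls on the kernel. As a function of `y`, the reflected kernel is a test
function, its derivative having the opposite sign, and the hypothesis on `x` says that, on `K`, its
support lies in `Ω`. So the weak derivative can be inserted. -/
theorem partialDeriv_mollify {K : Set (Sp d)} {i : Fin d} {F' : Sp d → ℝ}
    (hF : LocallyIntegrable F volume) (hFΩ : ∀ x ∉ Ω, F x = 0) (hFΩ' : ∀ x ∉ Ω, F' x = 0)
    (hw : LocWeak Ω K i F F') {x : Sp d}
    (hx : K ∩ Metric.closedBall (x + (1 / (n + 1) : ℝ) • b) (1 / (n + 1)) ⊆ Ω) :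
    partialDeriv i (mollify b n F) x = mollify b n F' x := by
  set p := x + (1 / (n + 1) : ℝ) • b with hp
  have hk1 : ContDiff ℝ 1 (kernel d n) := contDiff_kernel.of_le (by simp)
  have h1 := hasCompactSupport_kernel.hasFDerivAt_convolution_left
    (ContinuousLinearMap.lsmul ℝ ℝ) hk1 hF p
  have h2 : HasFDerivAt (mollify b n F) _ x :=
    h1.comp x ((hasFDerivAt_id x).add_const ((1 / (n + 1) : ℝ) • b))
  have hex := (hasCompactSupport_kernel.fderiv ℝ).convolutionExists_left
    (ContinuousLinearMap.precompL (Sp d) (ContinuousLinearMap.lsmul ℝ ℝ))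
    (hk1.continuous_fderiv (by simp)) hF p
  set ψ : Sp d → ℝ := fun y => kernel d n (p - y) with hψ
  have hψc : ContDiff ℝ ∞ ψ := contDiff_kernel.comp (contDiff_const.sub contDiff_id)
  have hψd : ∀ y, partialDeriv i ψ y = -(fderiv ℝ (kernel d n) (p - y) (EuclideanSpace.single i 1)) := by
    intro y
    have h3 : HasFDerivAt ψ _ y :=
      ((hk1.differentiable (by simp) (p - y)).hasFDerivAt).comp y ((hasFDerivAt_id y).const_sub p)
    rw [partialDeriv, h3.fderiv]
    simp
  have hψs : tsupport ψ ⊆ Metric.closedBall p (1 / (n + 1)) := by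
    refine closure_minimal (fun y hy => ?_) Metric.isClosed_closedBall
    rw [Metric.mem_closedBall, dist_comm, dist_eq_norm]
    by_contra hcon
    push Not at hcon
    exact hy (kernel_eq_zero hcon)
  have hψk : HasCompactSupport ψ := HasCompactSupport.of_support_subset_isCompact
    (isCompact_closedBall p (1 / (n + 1))) (subset_closure.trans hψs)
  have h3 := hw ψ hψc hψk ((inter_subset_inter_right _ hψs).trans hx)
  rw [partialDeriv, h2.fderiv]
  simp only [ContinuousLinearMap.comp_apply, ContinuousLinearMap.id_apply]
  rw [convolution_def, ContinuousLinearMap.integral_apply hex]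
  simp only [ContinuousLinearMap.precompL_apply, ContinuousLinearMap.lsmul_apply, smul_eq_mul]
  rw [← integral_sub_left_eq_self _ volume p]
  simp only [sub_sub_cancel]
  rw [mollify, convolution_lsmul_swap]
  simp only [smul_eq_mul]
  rw [setIntegral_eq_integral_of_forall_compl_eq_zero (fun y hy => by rw [hFΩ y hy, zero_mul]),
    setIntegral_eq_integral_of_forall_compl_eq_zero (fun y hy => by rw [hFΩ' y hy, zero_mul])] at h3
  simp only [hψd] at h3
  have e1 : ∫ y, F y * -(fderiv ℝ (kernel d n) (p - y)) (EuclideanSpace.single i 1) =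
      -∫ y, (fderiv ℝ (kernel d n) (p - y)) (EuclideanSpace.single i 1) * F y := by
    rw [← integral_neg]
    exact integral_congr_ae (ae_of_all _ fun y => by simp only; ring)
  rw [e1, neg_inj] at h3
  rw [h3]
  exact integral_congr_ae (ae_of_all _ fun y => by simp only [hψ]; ring)

end SpaceTime
end

noncomputable section
namespace SpaceTime
open Filter Topology
variable {d : ℕ} {Ω : Set (Sp d)}

/-! ## Multiplication by cutoff functions -/

theorem IsTest.partialDeriv {U : Set (Sp d)} {χ : Sp d → ℝ} (h : IsTest U χ) (i : Fin d) :
    IsTest U (partialDeriv i χ) where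
  contDiff := (h.contDiff.fderiv_right (m := ∞) (by simp)).clm_apply contDiff_const
  hasCompactSupport := h.hasCompactSupport.fderiv_apply ℝ _
  tsupport_subset := by
    refine (closure_mono fun x hx => ?_).trans ((tsupport_fderiv_subset ℝ (f := χ)).trans
      h.tsupport_subset)
    intro h0
    exact hx (by simp [SpaceTime.partialDeriv, h0])

theorem tsupport_partialDeriv_subset {χ : Sp d → ℝ} (i : Fin d) :
    tsupport (partialDeriv i χ) ⊆ tsupport χ := by
  refine (closure_minimal (fun x hx => ?_) (isClosed_tsupport _)).trans
    (tsupport_fderiv_subset ℝ (f := χ))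
  refine subset_closure fun h0 => hx ?_
  simp [partialDeriv, h0]

namespace IsTest

variable {U : Set (Sp d)} {χ : Sp d → ℝ} (hχ : IsTest U χ)
include hχ

theorem exists_bound : ∃ B, 0 ≤ B ∧ ∀ x, ‖χ x‖ ≤ B := by
  obtain ⟨B, hB⟩ := hχ.hasCompactSupport.exists_bound_of_continuous hχ.contDiff.continuous
  exact ⟨B, (norm_nonneg _).trans (hB 0), hB⟩

theorem memLp_mul (f : L2 Ω) : MemLp (fun x => χ x * f x) 2 (volume.restrict Ω) := by
  obtain ⟨B, hB0, hB⟩ := hχ.exists_bound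
  refine (Lp.memLp f).of_le_mul (c := B)
    (hχ.contDiff.continuous.aestronglyMeasurable.mul (Lp.memLp f).1) (ae_of_all _ fun x => ?_)
  rw [norm_mul]
  exact mul_le_mul_of_nonneg_right (hB x) (norm_nonneg _)

/-- Multiplication of an `L²` function by a smooth function with compact support. -/
def mul (f : L2 Ω) : L2 Ω := (hχ.memLp_mul f).toLp _

theorem coeFn_mul (f : L2 Ω) : hχ.mul f =ᵐ[volume.restrict Ω] fun x => χ x * f x :=
  MemLp.coeFn_toLp _

theorem exists_norm_mul_le : ∃ B, 0 ≤ B ∧ ∀ f : L2 Ω, ‖hχ.mul f‖ ≤ B * ‖f‖ := by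
  obtain ⟨B, hB0, hB⟩ := hχ.exists_bound
  refine ⟨B, hB0, fun f => Lp.norm_le_mul_norm_of_ae_le_mul ?_⟩
  filter_upwards [hχ.coeFn_mul f] with x hx
  rw [hx, norm_mul]
  exact mul_le_mul_of_nonneg_right (hB x) (norm_nonneg _)

theorem mul_zero' : hχ.mul (0 : L2 Ω) = 0 := by
  obtain ⟨B, -, hB⟩ := hχ.exists_norm_mul_le (Ω := Ω)
  have := hB 0
  rw [norm_zero, mul_zero] at this
  exact norm_le_zero_iff.1 this

end IsTest

theorem integrable_mul_memLp (f : L2 Ω) {ψ : Sp d → ℝ} (hψ : Continuous ψ)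
    (hs : HasCompactSupport ψ) : Integrable (fun x => f x * ψ x) (volume.restrict Ω) :=
  (Lp.memLp f).integrable_mul ((hψ.memLp_of_hasCompactSupport hs (p := 2)).restrict Ω)

theorem LocWeak.add {K : Set (Sp d)} {i : Fin d} {f f' g g' : L2 Ω} (h : LocWeak Ω K i f f')
    (h' : LocWeak Ω K i g g') : LocWeak Ω K i (f + g : L2 Ω) (f' + g' : L2 Ω) := by
  intro ψ hψ hs hK
  have hc := hψ.continuous
  have hc' : Continuous (partialDeriv i ψ) :=
    (hψ.continuous_fderiv (by simp)).clm_apply continuous_const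
  have hs' : HasCompactSupport (partialDeriv i ψ) := hs.fderiv_apply ℝ _
  have e1 : ∫ x in Ω, (f + g : L2 Ω) x * partialDeriv i ψ x =
      (∫ x in Ω, f x * partialDeriv i ψ x) + ∫ x in Ω, g x * partialDeriv i ψ x := by
    rw [← integral_add (integrable_mul_memLp f hc' hs') (integrable_mul_memLp g hc' hs')]
    refine integral_congr_ae ?_
    filter_upwards [Lp.coeFn_add f g] with x hx
    rw [hx, Pi.add_apply, add_mul]
  have e2 : ∫ x in Ω, (f' + g' : L2 Ω) x * ψ x =
      (∫ x in Ω, f' x * ψ x) + ∫ x in Ω, g' x * ψ x := by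
    rw [← integral_add (integrable_mul_memLp f' hc hs) (integrable_mul_memLp g' hc hs)]
    refine integral_congr_ae ?_
    filter_upwards [Lp.coeFn_add f' g'] with x hx
    rw [hx, Pi.add_apply, add_mul]
  rw [e1, e2, h ψ hψ hs hK, h' ψ hψ hs hK, neg_add]

/-- `χ ψ` is a test function on `Ω` although `ψ` itself need not be, because the support of `χ` is
in `K`. The derivative of `χ` is moved to the other side. -/
theorem IsTest.locWeak {U K : Set (Sp d)} {χ : Sp d → ℝ} (hχ : IsTest U χ) (hK : tsupport χ ⊆ K)
    {i : Fin d} {f f' : L2 Ω} (h : IsWeakPartial Ω i f f') :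
    LocWeak Ω K i (hχ.mul f) (hχ.mul f' + (hχ.partialDeriv i).mul f : L2 Ω) := by
  intro ψ hψ hs hKψ
  have htest : IsTest Ω (fun x => χ x * ψ x) := by
    refine ⟨hχ.contDiff.mul hψ, hs.mul_left (f := χ), ?_⟩
    have h1 : tsupport (fun x => χ x * ψ x) ⊆ tsupport χ := tsupport_mul_subset_left
    have h2 : tsupport (fun x => χ x * ψ x) ⊆ tsupport ψ := tsupport_mul_subset_right
    exact fun x hx => hKψ ⟨hK (h1 hx), h2 hx⟩
  have h1 := h _ htest
  have hχd := hχ.contDiff.differentiable (by simp)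
  have hψd := hψ.differentiable (by simp)
  have hpd : ∀ x, SpaceTime.partialDeriv i (fun x => χ x * ψ x) x =
      χ x * SpaceTime.partialDeriv i ψ x + SpaceTime.partialDeriv i χ x * ψ x := by
    intro x
    simp only [SpaceTime.partialDeriv]
    have h2 : HasFDerivAt (fun x => χ x * ψ x) _ x :=
      (hχd x).hasFDerivAt.mul (hψd x).hasFDerivAt
    rw [h2.fderiv]
    simp
    ring
  simp only [hpd] at h1
  have hc' : Continuous (SpaceTime.partialDeriv i ψ) :=
    (hψ.continuous_fderiv (by simp)).clm_apply continuous_const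
  have hs' : HasCompactSupport (SpaceTime.partialDeriv i ψ) := hs.fderiv_apply ℝ _
  have i1 : Integrable (fun x => f x * (χ x * SpaceTime.partialDeriv i ψ x)) (volume.restrict Ω) :=
    integrable_mul_memLp f (hχ.contDiff.continuous.mul hc') (hs'.mul_left (f := χ))
  have i2 : Integrable (fun x => f x * (SpaceTime.partialDeriv i χ x * ψ x)) (volume.restrict Ω) :=
    integrable_mul_memLp f ((hχ.partialDeriv i).contDiff.continuous.mul hψ.continuous)
      (hs.mul_left (f := SpaceTime.partialDeriv i χ))
  have i3 : Integrable (fun x => f' x * (χ x * ψ x)) (volume.restrict Ω) :=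
    integrable_mul_memLp f' (hχ.contDiff.continuous.mul hψ.continuous) (hs.mul_left (f := χ))
  simp only [mul_add] at h1
  rw [integral_add i1 i2] at h1
  have e1 : ∫ x in Ω, (hχ.mul f) x * SpaceTime.partialDeriv i ψ x =
      ∫ x in Ω, f x * (χ x * SpaceTime.partialDeriv i ψ x) := by
    refine integral_congr_ae ?_
    filter_upwards [hχ.coeFn_mul f] with x hx
    rw [hx]
    ring
  have e2 : ∫ x in Ω, (hχ.mul f' + (hχ.partialDeriv i).mul f : L2 Ω) x * ψ x =
      (∫ x in Ω, f' x * (χ x * ψ x)) + ∫ x in Ω, f x * (SpaceTime.partialDeriv i χ x * ψ x) := by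
    rw [← integral_add i3 i2]
    refine integral_congr_ae ?_
    filter_upwards [Lp.coeFn_add (hχ.mul f') ((hχ.partialDeriv i).mul f), hχ.coeFn_mul f',
      (hχ.partialDeriv i).coeFn_mul f] with x hx hx1 hx2
    rw [hx, Pi.add_apply, hx1, hx2]
    ring
  rw [e1, e2]
  linarith

/-! ## Approximation by smooth functions -/

/-- `f` vanishes almost everywhere outside of `K`. -/
def SuppIn (K : Set (Sp d)) (f : L2 Ω) : Prop := ∀ᵐ x ∂volume.restrict Ω, x ∉ K → f x = 0

theorem SuppIn.add {K : Set (Sp d)} {f g : L2 Ω} (hf : SuppIn K f) (hg : SuppIn K g) :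
    SuppIn K (f + g) := by
  filter_upwards [hf, hg, Lp.coeFn_add f g] with x h1 h2 h3 hx
  rw [h3, Pi.add_apply, h1 hx, h2 hx, add_zero]

theorem IsTest.suppIn {U K : Set (Sp d)} {χ : Sp d → ℝ} (hχ : IsTest U χ) (hK : tsupport χ ⊆ K)
    (f : L2 Ω) : SuppIn K (hχ.mul f) := by
  filter_upwards [hχ.coeFn_mul f] with x hx hxK
  rw [hx, image_eq_zero_of_notMem_tsupport fun h => hxK (hK h), zero_mul]

/-- The extension by zero, with values normalized to zero outside of `K`. -/
def extend (K : Set (Sp d)) (f : L2 Ω) : Sp d → ℝ := Ω.indicator (K.indicator f)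

theorem extend_ae {K : Set (Sp d)} (hΩ : IsOpen Ω) {f : L2 Ω} (hf : SuppIn K f) :
    extend K f =ᵐ[volume.restrict Ω] f := by
  filter_upwards [hf, ae_restrict_mem hΩ.measurableSet] with x hx hxΩ
  rw [extend, indicator_of_mem hxΩ]
  by_cases hK : x ∈ K
  · rw [indicator_of_mem hK]
  · rw [indicator_of_notMem hK, hx hK]

theorem measurable_extend {K : Set (Sp d)} (hΩ : IsOpen Ω) (hK : IsCompact K) (f : L2 Ω) :
    Measurable (extend K f) :=
  ((Lp.stronglyMeasurable f).measurable.indicator hK.measurableSet).indicator hΩ.measurableSet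

theorem memLp_extend {K : Set (Sp d)} (hΩ : IsOpen Ω) (hK : IsCompact K) (f : L2 Ω) :
    MemLp (extend K f) 2 volume :=
  (memLp_indicator_iff_restrict hΩ.measurableSet).2 ((Lp.memLp f).indicator hK.measurableSet)

/-- Simultaneous mollification of finitely many functions. -/
theorem exists_mollify {ι : Type*} [Finite ι] (hΩ : IsOpen Ω) {K U : Set (Sp d)} (hK : IsCompact K)
    (hU : IsOpen U) (hKU : K ⊆ U) {b : Sp d} {τ₀ : ℝ} (hτ : 0 < τ₀) (hcone : InwardCone Ω b τ₀ U)
    (G : ι → L2 Ω) (hG : ∀ i, SuppIn K (G i)) {ε : ℝ≥0∞} (hε : ε ≠ 0) :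
    ∃ g : ι → Sp d → ℝ, (∀ i, ContDiff ℝ ∞ (g i)) ∧ (∀ i, tsupport (g i) ⊆ U) ∧
      (∀ i, ∫⁻ x in Ω, ‖g i x - G i x‖ₑ ^ 2 ≤ ε) ∧
      ∀ i i' j, LocWeak Ω K j (G i) (G i') → ∀ x ∈ Ω, partialDeriv j (g i) x = g i' x := by
  have hloc : ∀ i, LocallyIntegrable (extend K (G i)) volume := fun i =>
    (memLp_extend hΩ hK (G i)).locallyIntegrable (by norm_num)
  have hlim : Tendsto (fun n : ℕ => (1 + ‖b‖) * (1 / (n + 1 : ℝ))) atTop (𝓝 0) := by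
    simpa using (tendsto_one_div_add_atTop_nhds_zero_nat (𝕜 := ℝ)).const_mul (1 + ‖b‖)
  -- Three conditions on the mollification parameter: the supports remain in `U`, the shift is
  -- within the range of the cone, and the `L²` errors are below `ε`.
  obtain ⟨δ₀, hδ₀, hsub⟩ := hK.exists_cthickening_subset_open hU hKU
  have hev1 : ∀ᶠ n : ℕ in atTop, (1 + ‖b‖) * (1 / (n + 1 : ℝ)) < δ₀ := hlim.eventually_lt_const hδ₀
  have hev2 : ∀ᶠ n : ℕ in atTop, 1 / (n + 1 : ℝ) < τ₀ :=
    (tendsto_one_div_add_atTop_nhds_zero_nat (𝕜 := ℝ)).eventually_lt_const hτ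
  have hev3 : ∀ᶠ n : ℕ in atTop, ∀ i,
      ∫⁻ x, ‖extend K (G i) x - mollify b n (extend K (G i)) x‖ₑ ^ 2 ≤ ε := by
    rw [eventually_all]
    intro i
    obtain ⟨δ, hδ, hle⟩ := exists_translate_le (memLp_extend hΩ hK (G i)) hε
    filter_upwards [hlim.eventually_lt_const hδ] with n hn
    exact mollify_error_le (measurable_extend hΩ hK _) (hloc i) fun v hv => hle v (hv.trans hn.le)
  obtain ⟨n, h1, h2, h3⟩ := (hev1.and (hev2.and hev3)).exists
  refine ⟨fun i => mollify b n (extend K (G i)), fun i => contDiff_mollify (hloc i), fun i => ?_,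
    fun i => ?_, fun i i' j hw x hx => ?_⟩
  · refine Subset.trans ?_ hsub
    refine closure_minimal ((support_mollify_subset (K := K) fun x hx => ?_).trans
      (Metric.cthickening_mono h1.le _)) Metric.isClosed_cthickening
    rw [extend, indicator_apply_eq_zero]
    exact fun _ => indicator_of_notMem hx _
  · refine le_trans (le_of_eq ?_) ((setLIntegral_le_lintegral Ω _).trans (h3 i))
    refine lintegral_congr_ae ?_
    filter_upwards [extend_ae hΩ (hG i)] with x hx
    rw [hx, ← enorm_neg, neg_sub]
  · refine partialDeriv_mollify (Ω := Ω) (K := K) (F' := extend K (G i')) (hloc i) (fun x hx => indicator_of_notMem hx _)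
      (fun x hx => indicator_of_notMem hx _) ?_ ?_
    · intro ψ hψ hs hKψ
      have := hw ψ hψ hs hKψ
      have e1 : ∫ x in Ω, extend K (G i) x * partialDeriv j ψ x =
          ∫ x in Ω, G i x * partialDeriv j ψ x := by
        refine integral_congr_ae ?_
        filter_upwards [extend_ae hΩ (hG i)] with x hx
        rw [hx]
      have e2 : ∫ x in Ω, extend K (G i') x * ψ x = ∫ x in Ω, G i' x * ψ x := by
        refine integral_congr_ae ?_
        filter_upwards [extend_ae hΩ (hG i')] with x hx
        rw [hx]
      rw [e1, e2, this]
    -- With `τ = 1 / (n + 1)`, the ball of radius `τ` about the shifted point consists of the points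
    -- `x + τ • (b + y')` with `‖y'‖ ≤ 1`, so the cone condition applies to those in `K ⊆ U`.
    · rintro y ⟨hyK, hy⟩
      have hs : (0 : ℝ) < 1 / (n + 1) := by positivity
      rw [Metric.mem_closedBall, dist_eq_norm] at hy
      have e : y = x + (1 / (n + 1) : ℝ) • (b + (1 / (n + 1) : ℝ)⁻¹ •
          (y - (x + (1 / (n + 1) : ℝ) • b))) := by
        rw [smul_add, smul_smul, mul_inv_cancel₀ hs.ne', one_smul]
        abel
      rw [e]
      refine hcone x (subset_closure hx) _ hs h2.le _ ?_ ?_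
      · rw [norm_smul, norm_inv, Real.norm_of_nonneg hs.le, inv_mul_le_iff₀ hs, mul_one]
        exact hy
      · rw [← e]
        exact hKU hyK

end SpaceTime
end

noncomputable section
namespace SpaceTime
open Filter Topology
variable {d : ℕ} {Ω : Set (Sp d)}

/-! ## Local approximation of Sobolev functions -/

theorem clm_norm_le_sum {E : Type*} [NormedAddCommGroup E] [NormedSpace ℝ E] (L : Sp d →L[ℝ] E) :
    ‖L‖ ≤ ∑ i, ‖L (EuclideanSpace.single i 1)‖ := by
  refine L.opNorm_le_bound (Finset.sum_nonneg fun _ _ => norm_nonneg _) fun x => ?_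
  have hx : x = ∑ i, x i • (EuclideanSpace.single i (1 : ℝ) : Sp d) := by
    ext j
    simp [Pi.single_apply]
  conv_lhs => rw [hx, map_sum]
  rw [Finset.sum_mul]
  refine (norm_sum_le _ _).trans (Finset.sum_le_sum fun i _ => ?_)
  rw [map_smul, norm_smul, mul_comm]
  exact mul_le_mul_of_nonneg_left (PiLp.norm_apply_le x i) (norm_nonneg _)

theorem enorm_fderiv_eq_zero {E : Type*} [NormedAddCommGroup E] [NormedSpace ℝ E] {f : Sp d → E}
    {x : Sp d} (h : x ∉ tsupport f) : ‖fderiv ℝ f x‖ₑ = 0 := by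
  have h1 : x ∉ tsupport (fderiv ℝ f) := fun h' => h (tsupport_fderiv_subset ℝ h')
  have h2 : fderiv ℝ f x = 0 := image_eq_zero_of_notMem_tsupport h1
  rw [← ofReal_norm, h2, norm_zero, ENNReal.ofReal_zero]

theorem clm_enorm_sq_le_sum {E : Type*} [NormedAddCommGroup E] [NormedSpace ℝ E]
    (L : Sp d →L[ℝ] E) : ‖L‖ₑ ^ 2 ≤ d * ∑ i, ‖L (EuclideanSpace.single i 1)‖ₑ ^ 2 := by
  simp only [enorm_sq_eq_ofReal]
  rw [← ENNReal.ofReal_sum_of_nonneg (fun _ _ => by positivity), ← ENNReal.ofReal_natCast,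
    ← ENNReal.ofReal_mul (by positivity)]
  refine ENNReal.ofReal_le_ofReal ((pow_le_pow_left₀ (norm_nonneg _) (clm_norm_le_sum L) 2).trans ?_)
  have := sq_sum_le_card_mul_sum_sq (s := Finset.univ)
    (f := fun i => ‖L (EuclideanSpace.single i 1)‖)
  simpa using this

theorem lintegral_enorm_sq_le_of_sub {g f : Sp d → ℝ} {μ : Measure (Sp d)}
    (hf : AEStronglyMeasurable f μ) :
    ∫⁻ x, ‖g x‖ₑ ^ 2 ∂μ ≤ 2 * ∫⁻ x, ‖g x - f x‖ₑ ^ 2 ∂μ + 2 * ∫⁻ x, ‖f x‖ₑ ^ 2 ∂μ := by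
  rw [← lintegral_const_mul' _ _ (by simp), ← lintegral_const_mul' _ _ (by simp),
    ← lintegral_add_right' _ ((hf.enorm.pow_const 2).const_mul 2)]
  refine lintegral_mono fun x => ?_
  have := SimplicialMesh.add_enorm_sq_le (g x - f x) (f x)
  rwa [sub_add_cancel] at this

/-- The function `G₀` with gradient `G` is a limit of smooth functions supported in `U` whose
derivatives of order `m + 1` are bounded. -/
def SmoothApprox (U : Set (Sp d)) (m : ℕ) (G₀ : L2 Ω) (G : Fin d → L2 Ω) (B N : ℝ≥0∞) : Prop :=
  ∀ ε : ℝ≥0∞, ε ≠ 0 → ∃ (g : Sp d → ℝ) (F : Sp d → ℝ≥0∞), ContDiff ℝ 1 g ∧ HasTaylor g F m ∧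
    Measurable F ∧ (∀ x ∉ U, F x = 0) ∧ ∫⁻ x in Ω, ‖g x - G₀ x‖ₑ ^ 2 ≤ ε ∧
    (∀ j, ∫⁻ x in Ω, ‖partialDeriv j g x - G j x‖ₑ ^ 2 ≤ ε) ∧
    ∫⁻ x in Ω, F x ^ 2 ≤ B * (ε + N ^ 2)


theorem lintegral_fderiv_le {g : Sp d → ℝ} (hg : ContDiff ℝ 1 g) (μ : Measure (Sp d)) :
    ∫⁻ x, ‖fderiv ℝ g x‖ₑ ^ 2 ∂μ ≤ d * ∑ j, ∫⁻ x, ‖partialDeriv j g x‖ₑ ^ 2 ∂μ := by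
  rw [← lintegral_finsetSum, ← lintegral_const_mul' _ _ (by simp)]
  · exact lintegral_mono fun x => clm_enorm_sq_le_sum (fderiv ℝ g x)
  · intro j _
    have : Continuous (partialDeriv j g) :=
      (hg.continuous_fderiv (by simp)).clm_apply continuous_const
    exact this.measurable.enorm.pow_const 2

theorem lintegral_fderiv_fderiv_le {g : Sp d → ℝ} (hg : ContDiff ℝ 2 g) (μ : Measure (Sp d)) :
    ∫⁻ x, ‖fderiv ℝ (fderiv ℝ g) x‖ₑ ^ 2 ∂μ ≤
      d * (d * ∑ j, ∑ l, ∫⁻ x, ‖partialDeriv l (partialDeriv j g) x‖ₑ ^ 2 ∂μ) := by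
  have hg' : ContDiff ℝ 1 (fderiv ℝ g) := hg.fderiv_right (by norm_num)
  have hpc : ∀ j, ContDiff ℝ 1 (partialDeriv j g) := fun j => hg'.clm_apply contDiff_const
  have hpc' : ∀ j l, Continuous (partialDeriv l (partialDeriv j g)) := fun j l =>
    ((hpc j).continuous_fderiv (by simp)).clm_apply continuous_const
  have hm : ∀ j l, Measurable fun x => ‖partialDeriv l (partialDeriv j g) x‖ₑ ^ 2 := fun j l =>
    (hpc' j l).measurable.enorm.pow_const 2
  simp_rw [← lintegral_finsetSum _ fun l _ => hm _ l]
  rw [← lintegral_finsetSum _ fun j _ => Finset.measurable_fun_sum _ fun l _ => hm j l,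
    ← lintegral_const_mul' _ _ (by simp), ← lintegral_const_mul' _ _ (by simp)]
  refine lintegral_mono fun x => ?_
  refine (clm_enorm_sq_le_sum (fderiv ℝ (fderiv ℝ g) x)).trans ?_
  refine mul_le_mul_right ?_ _
  rw [Finset.sum_comm, Finset.mul_sum]
  refine Finset.sum_le_sum fun l _ => ?_
  refine (clm_enorm_sq_le_sum _).trans (le_of_eq ?_)
  congr 1
  refine Finset.sum_congr rfl fun j _ => ?_
  have h1 : HasFDerivAt (partialDeriv j g) _ x :=
    ((hg'.differentiable (by simp) x).hasFDerivAt).clm_apply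
      (hasFDerivAt_const (EuclideanSpace.single j (1 : ℝ) : Sp d) x)
  have h2 : partialDeriv l (partialDeriv j g) x =
      fderiv ℝ (fderiv ℝ g) x (EuclideanSpace.single l 1) (EuclideanSpace.single j 1) := by
    rw [partialDeriv, h1.fderiv]
    simp
  rw [h2]

/-- The first derivatives of an element of `H²(Ω)`. -/
def H2.toH1 (w : H2 Ω) : H1 Ω := w.1.fst

/-- The second derivatives of an element of `H²(Ω)`. -/
def H2.hess (w : H2 Ω) (j l : Fin d) : L2 Ω := w.1.snd (j, l)

theorem H2.toL2_toH1 (w : H2 Ω) : H1.toL2 Ω (H2.toH1 w) = H2.toL2 Ω w := rfl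

theorem H2.hess_isWeakPartial (w : H2 Ω) (j l : Fin d) :
    IsWeakPartial Ω l (H1.grad (H2.toH1 w) j) (H2.hess w j l) := w.2 j l

theorem H2.norm_sq (w : H2 Ω) : ‖w‖ ^ 2 = ‖(H2.toH1 w)‖ ^ 2 + ‖w.1.snd‖ ^ 2 :=
  WithLp.prod_norm_sq_eq_of_L2 w.1

theorem H2.norm_toH1_le (w : H2 Ω) : ‖(H2.toH1 w)‖ ≤ ‖w‖ := by
  refine le_of_sq_le_sq ?_ (norm_nonneg _)
  rw [H2.norm_sq]
  nlinarith [sq_nonneg ‖w.1.snd‖]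

theorem H2.norm_hess_le (w : H2 Ω) (j l : Fin d) : ‖H2.hess w j l‖ ≤ ‖w‖ := by
  refine (PiLp.norm_apply_le w.1.snd (j, l)).trans (le_of_sq_le_sq ?_ (norm_nonneg _))
  rw [H2.norm_sq]
  nlinarith [sq_nonneg ‖(H2.toH1 w)‖]

section cutoff

variable {U : Set (Sp d)} {b : Sp d} {τ₀ : ℝ} {χ : Sp d → ℝ}

/-- The gradient of the product of `v` with the cutoff function. -/
def IsTest.cutGrad (hχ : IsTest U χ) (v : H1 Ω) (j : Fin d) : L2 Ω :=
  hχ.mul (H1.grad v j) + (hχ.partialDeriv j).mul (H1.toL2 Ω v)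

/-- The second derivatives of the product of `v` with the cutoff function. -/
def IsTest.cutHess (hχ : IsTest U χ) (w : H2 Ω) (j l : Fin d) : L2 Ω :=
  (hχ.mul (H2.hess w j l) + (hχ.partialDeriv l).mul (H1.grad (H2.toH1 w) j)) +
    (hχ.partialDeriv j).cutGrad (H2.toH1 w) l

theorem IsTest.exists_norm_cutGrad_le (hχ : IsTest U χ) :
    ∃ B, 0 ≤ B ∧ ∀ (v : H1 Ω) j, ‖hχ.cutGrad v j‖ ≤ B * ‖v‖ := by
  obtain ⟨B, hB0, hB⟩ := hχ.exists_norm_mul_le (Ω := Ω)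
  have h : ∀ j, ∃ B, 0 ≤ B ∧ ∀ f : L2 Ω, ‖(hχ.partialDeriv j).mul f‖ ≤ B * ‖f‖ := fun j =>
    (hχ.partialDeriv j).exists_norm_mul_le
  choose B' hB0' hB' using h
  refine ⟨B + ∑ j, B' j, add_nonneg hB0 (Finset.sum_nonneg fun j _ => hB0' j), fun v j => ?_⟩
  rw [IsTest.cutGrad, add_mul]
  refine (norm_add_le _ _).trans (add_le_add ((hB _).trans ?_) ((hB' j _).trans ?_))
  · exact mul_le_mul_of_nonneg_left (H1.norm_grad_le v j) hB0
  · exact mul_le_mul (Finset.single_le_sum (fun j _ => hB0' j) (Finset.mem_univ j))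
      (H1.norm_toL2_le v) (norm_nonneg _) (Finset.sum_nonneg fun j _ => hB0' j)

theorem IsTest.exists_norm_cutHess_le (hχ : IsTest U χ) :
    ∃ B, 0 ≤ B ∧ ∀ (w : H2 Ω) j l, ‖hχ.cutHess w j l‖ ≤ B * ‖w‖ := by
  obtain ⟨B, hB0, hB⟩ := hχ.exists_norm_mul_le (Ω := Ω)
  have h : ∀ j, ∃ B, 0 ≤ B ∧ ∀ f : L2 Ω, ‖(hχ.partialDeriv j).mul f‖ ≤ B * ‖f‖ := fun j =>
    (hχ.partialDeriv j).exists_norm_mul_le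
  have h' : ∀ j, ∃ B, 0 ≤ B ∧ ∀ (v : H1 Ω) l, ‖(hχ.partialDeriv j).cutGrad v l‖ ≤ B * ‖v‖ :=
    fun j => (hχ.partialDeriv j).exists_norm_cutGrad_le
  choose B' hB0' hB' using h
  choose B'' hB0'' hB'' using h'
  have hs' : 0 ≤ ∑ j, B' j := Finset.sum_nonneg fun j _ => hB0' j
  have hs'' : 0 ≤ ∑ j, B'' j := Finset.sum_nonneg fun j _ => hB0'' j
  refine ⟨B + ∑ j, B' j + ∑ j, B'' j, by positivity, fun w j l => ?_⟩
  have h1 := H2.norm_toH1_le w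
  rw [IsTest.cutHess, add_mul, add_mul]
  refine (norm_add_le _ _).trans (add_le_add ((norm_add_le _ _).trans
    (add_le_add ((hB _).trans ?_) ((hB' l _).trans ?_))) ((hB'' j _ _).trans ?_))
  · exact mul_le_mul_of_nonneg_left (H2.norm_hess_le w j l) hB0
  · exact mul_le_mul (Finset.single_le_sum (fun j _ => hB0' j) (Finset.mem_univ l))
      ((H1.norm_grad_le _ j).trans h1) (norm_nonneg _) hs'
  · exact mul_le_mul (Finset.single_le_sum (fun j _ => hB0'' j) (Finset.mem_univ j)) h1
      (norm_nonneg _) hs''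

theorem enorm_sq_le_of_norm_le {E E' : Type*} [NormedAddCommGroup E] [NormedAddCommGroup E']
    {x : E} {y : E'} {B : ℝ} (_hB : 0 ≤ B) (h : ‖x‖ ≤ B * ‖y‖) :
    ‖x‖ₑ ^ 2 ≤ ENNReal.ofReal (B ^ 2) * ‖y‖ₑ ^ 2 := by
  rw [enorm_sq_eq_ofReal, enorm_sq_eq_ofReal, ← ENNReal.ofReal_mul (by positivity), ← mul_pow]
  exact ENNReal.ofReal_le_ofReal (pow_le_pow_left₀ (norm_nonneg _) h 2)

theorem lintegral_le_of_approx {g : Sp d → ℝ} {G : L2 Ω} {ε N B : ℝ≥0∞}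
    (h : ∫⁻ x in Ω, ‖g x - G x‖ₑ ^ 2 ≤ ε) (hN : ‖G‖ₑ ^ 2 ≤ B * N ^ 2) :
    ∫⁻ x in Ω, ‖g x‖ₑ ^ 2 ≤ 2 * (1 + B) * (ε + N ^ 2) := by
  refine (lintegral_enorm_sq_le_of_sub (Lp.aestronglyMeasurable G)).trans ?_
  rw [← enorm_sq_L2]
  refine (add_le_add (mul_le_mul_right h _) (mul_le_mul_right hN _)).trans ?_
  have e : 2 * (1 + B) * (ε + N ^ 2) = (2 * ε + 2 * (B * N ^ 2)) + (2 * N ^ 2 + 2 * B * ε) := by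
    ring
  rw [e]
  exact le_self_add

/-- The function `χ v` (index `none`) and its partial derivatives (index `some j`) are mollified
simultaneously. On `Ω` the mollified derivatives are the derivatives of the mollified function,
hence these are close to `cutGrad` and inherit its bound. -/
theorem IsTest.smoothApprox_zero (hΩ : IsOpen Ω) (hχ : IsTest U χ) (hU : IsOpen U) (hτ : 0 < τ₀)
    (hcone : InwardCone Ω b τ₀ U) : ∃ B : ℝ≥0∞, B ≠ ⊤ ∧ ∀ v : H1 Ω,
      SmoothApprox U 0 (hχ.mul (H1.toL2 Ω v)) (hχ.cutGrad v) B ‖v‖ₑ := by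
  obtain ⟨B, hB0, hB⟩ := hχ.exists_norm_cutGrad_le (Ω := Ω)
  refine ⟨d * (d * (2 * (1 + ENNReal.ofReal (B ^ 2)))), by finiteness, fun v ε hε => ?_⟩
  set G : Option (Fin d) → L2 Ω := fun o => o.elim (hχ.mul (H1.toL2 Ω v)) (hχ.cutGrad v) with hG
  obtain ⟨g, hgc, hgs, hge, hgd⟩ := exists_mollify hΩ (K := tsupport χ) hχ.hasCompactSupport hU
    hχ.tsupport_subset hτ hcone G (by
      rintro (_ | j)
      · exact hχ.suppIn subset_rfl _
      · exact (hχ.suppIn subset_rfl _).add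
          ((hχ.partialDeriv j).suppIn (tsupport_partialDeriv_subset j) _)) hε
  have hpd : ∀ j, ∀ x ∈ Ω, SpaceTime.partialDeriv j (g none) x = g (some j) x := fun j =>
    hgd none (some j) j (hχ.locWeak subset_rfl (H1.grad_isWeakPartial v j))
  have hc1 : ContDiff ℝ 1 (g none) := (hgc none).of_le (by simp)
  have hsub : ∀ j, ∫⁻ x in Ω, ‖SpaceTime.partialDeriv j (g none) x - hχ.cutGrad v j x‖ₑ ^ 2 ≤ ε := by
    intro j
    refine le_trans (le_of_eq ?_) (hge (some j))
    refine setLIntegral_congr_fun hΩ.measurableSet fun x hx => ?_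
    simp only [hpd j x hx]
    rfl
  refine ⟨g none, _, hc1, hasTaylor_zero hc1, (hc1.continuous_fderiv (by simp)).enorm.measurable,
    fun x hx => ?_, hge none, hsub, ?_⟩
  · exact enorm_fderiv_eq_zero fun h => hx (hgs none h)
  · refine (lintegral_fderiv_le hc1 _).trans ?_
    rw [mul_assoc]
    refine mul_le_mul_right ?_ _
    rw [mul_assoc]
    refine (Finset.sum_le_card_nsmul _ _ _ fun j _ =>
      lintegral_le_of_approx (hsub j) (enorm_sq_le_of_norm_le hB0 (hB v j))).trans (le_of_eq ?_)
    simp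

-- As for `smoothApprox_zero`, with the second derivatives in the mollified family as well. Since
-- `Ω` is open, the identity between first derivatives on `Ω` may be differentiated once more.
set_option maxHeartbeats 800000 in
theorem IsTest.smoothApprox_one (hΩ : IsOpen Ω) (hχ : IsTest U χ) (hU : IsOpen U) (hτ : 0 < τ₀)
    (hcone : InwardCone Ω b τ₀ U) : ∃ B : ℝ≥0∞, B ≠ ⊤ ∧ ∀ w : H2 Ω,
      SmoothApprox U 1 (hχ.mul (H2.toL2 Ω w)) (hχ.cutGrad (H2.toH1 w)) B ‖w‖ₑ := by
  obtain ⟨B, hB0, hB⟩ := hχ.exists_norm_cutHess_le (Ω := Ω)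
  refine ⟨d * (d * (d * (d * (2 * (1 + ENNReal.ofReal (B ^ 2)))))), by finiteness,
    fun w ε hε => ?_⟩
  set G : Option (Fin d ⊕ Fin d × Fin d) → L2 Ω := fun o => o.elim (hχ.mul (H2.toL2 Ω w))
    (Sum.elim (hχ.cutGrad (H2.toH1 w)) fun p => hχ.cutHess w p.1 p.2) with hG
  have hsg : ∀ j, SuppIn (tsupport χ) (hχ.cutGrad (H2.toH1 w) j) := fun j =>
    (hχ.suppIn subset_rfl _).add ((hχ.partialDeriv j).suppIn (tsupport_partialDeriv_subset j) _)
  obtain ⟨g, hgc, hgs, hge, hgd⟩ := exists_mollify hΩ (K := tsupport χ) hχ.hasCompactSupport hU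
    hχ.tsupport_subset hτ hcone G (by
      rintro (_ | j | ⟨j, l⟩)
      · exact hχ.suppIn subset_rfl _
      · exact hsg j
      · exact ((hχ.suppIn subset_rfl _).add
          ((hχ.partialDeriv l).suppIn (tsupport_partialDeriv_subset l) _)).add
          (((hχ.partialDeriv j).suppIn (tsupport_partialDeriv_subset j) _).add
            (((hχ.partialDeriv j).partialDeriv l).suppIn ((tsupport_partialDeriv_subset l).trans
              (tsupport_partialDeriv_subset j)) _))) hε
  have hpd : ∀ j, ∀ x ∈ Ω, SpaceTime.partialDeriv j (g none) x = g (some (.inl j)) x := fun j =>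
    hgd none (some (.inl j)) j (hχ.locWeak subset_rfl (H1.grad_isWeakPartial (H2.toH1 w) j))
  have hpd2 : ∀ j l, ∀ x ∈ Ω, SpaceTime.partialDeriv l (g (some (.inl j))) x =
      g (some (.inr (j, l))) x := fun j l =>
    hgd (some (.inl j)) (some (.inr (j, l))) l
      ((hχ.locWeak subset_rfl (H2.hess_isWeakPartial w j l)).add
        ((hχ.partialDeriv j).locWeak (tsupport_partialDeriv_subset j)
          (H1.grad_isWeakPartial (H2.toH1 w) l)))
  have hpd3 : ∀ j l, ∀ x ∈ Ω, SpaceTime.partialDeriv l (SpaceTime.partialDeriv j (g none)) x =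
      g (some (.inr (j, l))) x := by
    intro j l x hx
    rw [← hpd2 j l x hx]
    have : SpaceTime.partialDeriv j (g none) =ᶠ[𝓝 x] g (some (.inl j)) := by
      filter_upwards [hΩ.mem_nhds hx] with y hy
      exact hpd j y hy
    rw [SpaceTime.partialDeriv, SpaceTime.partialDeriv, this.fderiv_eq]
  have hc2 : ContDiff ℝ 2 (g none) := (hgc none).of_le (by norm_cast)
  have hc1 : ContDiff ℝ 1 (g none) := (hgc none).of_le (by simp)
  have hsub : ∀ j, ∫⁻ x in Ω, ‖SpaceTime.partialDeriv j (g none) x - hχ.cutGrad (H2.toH1 w) j x‖ₑ ^ 2 ≤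
      ε := by
    intro j
    refine le_trans (le_of_eq ?_) (hge (some (.inl j)))
    refine setLIntegral_congr_fun hΩ.measurableSet fun x hx => ?_
    simp only [hpd j x hx]
    rfl
  have hsub2 : ∀ j l, ∫⁻ x in Ω, ‖SpaceTime.partialDeriv l (SpaceTime.partialDeriv j (g none)) x -
      hχ.cutHess w j l x‖ₑ ^ 2 ≤ ε := by
    intro j l
    refine le_trans (le_of_eq ?_) (hge (some (.inr (j, l))))
    refine setLIntegral_congr_fun hΩ.measurableSet fun x hx => ?_
    simp only [hpd3 j l x hx]
    rfl
  have hc1' : ContDiff ℝ 1 (fderiv ℝ (g none)) := hc2.fderiv_right (by norm_num)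
  refine ⟨g none, _, hc1, hasTaylor_one hc2,
    (hc1'.continuous_fderiv (by simp)).enorm.measurable,
    fun x hx => ?_, hge none, hsub, ?_⟩
  · exact enorm_fderiv_eq_zero fun h => hx (hgs none (tsupport_fderiv_subset ℝ h))
  · refine (lintegral_fderiv_fderiv_le hc2 _).trans ?_
    have h1 : ∀ j, ∑ l, ∫⁻ x in Ω,
        ‖SpaceTime.partialDeriv l (SpaceTime.partialDeriv j (g none)) x‖ₑ ^ 2 ≤
        d * (2 * (1 + ENNReal.ofReal (B ^ 2)) * (ε + ‖w‖ₑ ^ 2)) := by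
      intro j
      refine (Finset.sum_le_card_nsmul _ _ _ fun l _ =>
        lintegral_le_of_approx (hsub2 j l) (enorm_sq_le_of_norm_le hB0 (hB w j l))).trans
        (le_of_eq ?_)
      simp
    have h2 : ∑ j, ∑ l, ∫⁻ x in Ω,
        ‖SpaceTime.partialDeriv l (SpaceTime.partialDeriv j (g none)) x‖ₑ ^ 2 ≤
        d * (d * (2 * (1 + ENNReal.ofReal (B ^ 2)) * (ε + ‖w‖ₑ ^ 2))) := by
      refine (Finset.sum_le_card_nsmul _ _ _ fun j _ => h1 j).trans (le_of_eq ?_)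
      simp
    refine (mul_le_mul_right (mul_le_mul_right h2 _) _).trans (le_of_eq ?_)
    ring

end cutoff

end SpaceTime
end

noncomputable section
namespace SpaceTime
open Filter Topology
variable {d : ℕ} {Ω : Set (Sp d)}

/-! ## Approximation of Sobolev functions by finite element functions -/

/-- A finite element function as an element of `H¹(Ω)`. -/
def SimplicialMesh.toH1 (M : SimplicialMesh Ω) (hreg : interior (closure Ω) = Ω) (q : M.p1Fun) :
    H1 Ω := (M.isH1Fun hreg q).toH1

theorem SimplicialMesh.toL2_mesh_toH1 (M : SimplicialMesh Ω) (hreg : interior (closure Ω) = Ω)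
    (q : M.p1Fun) : H1.toL2 Ω (M.toH1 hreg q) = M.toL2 q := M.toL2_toH1 hreg q

theorem SimplicialMesh.toH1_sum (M : SimplicialMesh Ω) (hreg : interior (closure Ω) = Ω)
    {ι : Type*} (s : Finset ι) (q : ι → M.p1Fun) :
    M.toH1 hreg (∑ i ∈ s, q i) = ∑ i ∈ s, M.toH1 hreg (q i) := by
  refine H1.toL2_injective (hreg ▸ isOpen_interior) ?_
  rw [map_sum]
  simp only [SimplicialMesh.toL2_mesh_toH1, map_sum]

theorem SimplicialMesh.toH1_zero (M : SimplicialMesh Ω) (hreg : interior (closure Ω) = Ω) :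
    M.toH1 hreg 0 = 0 := by
  simpa using M.toH1_sum hreg (∅ : Finset ℕ) (fun _ => 0)

theorem H1.grad_zero (j : Fin d) : H1.grad (0 : H1 Ω) j = 0 := rfl

theorem H1.grad_sum {ι : Type*} (s : Finset ι) (v : ι → H1 Ω) (j : Fin d) :
    H1.grad (∑ i ∈ s, v i) j = ∑ i ∈ s, H1.grad (v i) j := by
  classical
  induction s using Finset.induction_on with
  | empty => simp [H1.grad_zero]
  | insert a s ha ih => rw [Finset.sum_insert ha, Finset.sum_insert ha, H1.grad_add, ih]

section

variable {U : Set (Sp d)} {b : Sp d} {h κ τ₀ : ℝ} {m : ℕ} {M : SimplicialMesh Ω}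

/-- The smoothing error is made as small as the finite element error itself. The case `N = 0` is
separate, because then this accuracy would be zero. -/
theorem IsUniformMesh.exists_of_smoothApprox (hu : M.IsUniform h κ)
    (hreg : interior (closure Ω) = Ω) (hcone : InwardCone Ω b τ₀ U) (hh : 0 < h) (hhτ : h ≤ τ₀)
    (hh1 : h ≤ 1) (hκ : 0 < κ) {G₀ : L2 Ω} {G : Fin d → L2 Ω} {B N : ℝ≥0∞}
    (hS : SmoothApprox U m G₀ G B N) (hN0 : N = 0 → G₀ = 0 ∧ ∀ j, G j = 0) :
    ∃ q : M.p1Fun, ‖G₀ - M.toL2 q‖ₑ ^ 2 ≤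
        (2 + 4 * ENNReal.ofReal (SimplicialMesh.approxConst d κ ‖b‖ m) * B) *
          (ENNReal.ofReal (h ^ (2 * (m + 1))) * N ^ 2) ∧
      ∀ j, ENNReal.ofReal (h ^ 2) * ‖G j - H1.grad (M.toH1 hreg q) j‖ₑ ^ 2 ≤
        (2 + 4 * ENNReal.ofReal (SimplicialMesh.approxConst d κ ‖b‖ m) * B) *
          (ENNReal.ofReal (h ^ (2 * (m + 1))) * N ^ 2) := by
  by_cases hNz : N = 0
  · obtain ⟨h1, h2⟩ := hN0 hNz
    refine ⟨0, ?_, fun j => ?_⟩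
    · rw [h1, map_zero, sub_zero]
      simp
    · rw [h2, M.toH1_zero, H1.grad_zero, sub_zero]
      simp
  -- As `h ≤ 1`, `ε ≤ N²`, so the derivatives of the smooth function contribute at most `2 B N²`.
  set ε := ENNReal.ofReal (h ^ (2 * (m + 1))) * N ^ 2 with hε
  have hε0 : ε ≠ 0 := by
    rw [hε]
    refine mul_ne_zero ?_ (pow_ne_zero _ hNz)
    rw [ne_eq, ENNReal.ofReal_eq_zero, not_le]
    positivity
  have hεN : ε ≤ N ^ 2 := by
    rw [hε]
    refine mul_le_of_le_one_left' ?_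
    rw [← ENNReal.ofReal_one]
    exact ENNReal.ofReal_le_ofReal (pow_le_one₀ hh.le hh1)
  obtain ⟨g, F, hg, hT, hF, hFU, h0, h1, h2⟩ := hS ε hε0
  obtain ⟨q, hq⟩ := hu.exists_approx hreg hT hg hF hcone hFU hh hhτ hκ
  have hc0 : 0 ≤ SimplicialMesh.approxConst d κ ‖b‖ m := SimplicialMesh.approxConst_nonneg hκ (norm_nonneg _)
  have hE : ∫⁻ x in Ω, errDensity h g q.1 x ≤
      2 * (ENNReal.ofReal (SimplicialMesh.approxConst d κ ‖b‖ m) * B * ε) := by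
    refine hq.trans ((mul_le_mul_right (h2.trans (mul_le_mul_right (add_le_add_left hεN _) B)) _).trans
      (le_of_eq ?_))
    rw [ENNReal.ofReal_mul hc0, hε]
    ring
  have hfin : (2 + 4 * ENNReal.ofReal (SimplicialMesh.approxConst d κ ‖b‖ m) * B) * ε = 2 * ε +
      2 * (2 * (ENNReal.ofReal (SimplicialMesh.approxConst d κ ‖b‖ m) * B * ε)) := by ring
  rw [hfin]
  have hgc : Continuous g := hg.continuous
  refine ⟨q, ?_, fun j => ?_⟩
  · have e : (G₀ - M.toL2 q : L2 Ω) =ᵐ[volume.restrict Ω] fun x => G₀ x - q.1 x := by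
      filter_upwards [Lp.coeFn_sub G₀ (M.toL2 q), (M.memLp q).coeFn_toLp] with x hx hx1
      rw [hx, Pi.sub_apply]
      congr 1
    rw [enorm_sq_L2_of_ae e]
    have hm : AEMeasurable (fun x => 2 * ‖g x - G₀ x‖ₑ ^ 2) (volume.restrict Ω) :=
      ((hgc.aestronglyMeasurable.sub (Lp.aestronglyMeasurable G₀)).enorm.pow_const 2).const_mul 2
    calc ∫⁻ x in Ω, ‖G₀ x - q.1 x‖ₑ ^ 2 ≤
        ∫⁻ x in Ω, (2 * ‖g x - G₀ x‖ₑ ^ 2 + 2 * errDensity h g q.1 x) := by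
          refine lintegral_mono fun x => ?_
          have h3 := SimplicialMesh.add_enorm_sq_le (G₀ x - g x) (g x - q.1 x)
          rw [sub_add_sub_cancel, ← enorm_neg (G₀ x - g x), neg_sub] at h3
          refine h3.trans (add_le_add_right (mul_le_mul_right ?_ _) _)
          exact le_self_add
      _ ≤ _ := by
          rw [lintegral_add_left' hm, lintegral_const_mul' _ _ (by simp),
            lintegral_const_mul' _ _ (by simp)]
          exact add_le_add (mul_le_mul_right h0 _) (mul_le_mul_right hE _)
  · have e : (G j - H1.grad (M.toH1 hreg q) j : L2 Ω) =ᵐ[volume.restrict Ω]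
        fun x => G j x - partialDeriv j q.1 x := by
      filter_upwards [Lp.coeFn_sub (G j) (H1.grad (M.toH1 hreg q) j),
        (M.isH1Fun hreg q).grad_toH1 j] with x hx hx1
      rw [hx, Pi.sub_apply]
      congr 1
    rw [enorm_sq_L2_of_ae e]
    have hpc : Continuous (partialDeriv j g) :=
      (hg.continuous_fderiv (by simp)).clm_apply continuous_const
    have hm : AEMeasurable (fun x => 2 * ‖partialDeriv j g x - G j x‖ₑ ^ 2) (volume.restrict Ω) :=
      ((hpc.aestronglyMeasurable.sub (Lp.aestronglyMeasurable (G j))).enorm.pow_const 2).const_mul 2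
    have hh2 : ENNReal.ofReal (h ^ 2) ≤ 1 := by
      rw [← ENNReal.ofReal_one]
      exact ENNReal.ofReal_le_ofReal (pow_le_one₀ hh.le hh1)
    rw [← lintegral_const_mul' _ _ ENNReal.ofReal_ne_top]
    calc ∫⁻ x in Ω, ENNReal.ofReal (h ^ 2) * ‖G j x - partialDeriv j q.1 x‖ₑ ^ 2 ≤
        ∫⁻ x in Ω, (2 * ‖partialDeriv j g x - G j x‖ₑ ^ 2 + 2 * errDensity h g q.1 x) := by
          refine lintegral_mono fun x => ?_
          have h3 := SimplicialMesh.add_enorm_sq_le (G j x - partialDeriv j g x)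
            (partialDeriv j g x - partialDeriv j q.1 x)
          rw [sub_add_sub_cancel, ← enorm_neg (G j x - partialDeriv j g x), neg_sub] at h3
          have h4 : ‖partialDeriv j g x - partialDeriv j q.1 x‖ₑ ≤
              ‖fderiv ℝ g x - fderiv ℝ q.1 x‖ₑ := by
            have h5 := (fderiv ℝ g x - fderiv ℝ q.1 x).le_opENorm (EuclideanSpace.single j 1)
            rw [← ofReal_norm (EuclideanSpace.single j (1 : ℝ) : Sp d),
              PiLp.norm_single, norm_one, ENNReal.ofReal_one, mul_one] at h5
            exact h5
          refine (mul_le_mul_right h3 _).trans ?_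
          rw [mul_add]
          refine add_le_add (mul_le_of_le_one_left' hh2) ?_
          rw [mul_left_comm]
          refine mul_le_mul_right ((mul_le_mul_right (pow_le_pow_left' h4 2) _).trans ?_) _
          exact le_add_self
      _ ≤ _ := by
          rw [lintegral_add_left' hm, lintegral_const_mul' _ _ (by simp),
            lintegral_const_mul' _ _ (by simp)]
          exact add_le_add (mul_le_mul_right (h1 j) _) (mul_le_mul_right hE _)

/-- A constant `K` in front of squares becomes `K + 1` because `K ≤ (K + 1)²`; this avoids a square
root. -/
theorem norm_le_of_enorm_sq_le {E E' : Type*} [NormedAddCommGroup E] [NormedAddCommGroup E']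
    {x : E} {v : E'} {K : ℝ≥0∞} (hK : K ≠ ⊤) {a : ℝ} (ha : 0 ≤ a)
    (h : ‖x‖ₑ ^ 2 ≤ K * (ENNReal.ofReal (a ^ 2) * ‖v‖ₑ ^ 2)) : ‖x‖ ≤ (K.toReal + 1) * (a * ‖v‖) := by
  rw [enorm_sq_eq_ofReal, enorm_sq_eq_ofReal, ← ENNReal.ofReal_toReal hK,
    ← ENNReal.ofReal_mul (by positivity), ← ENNReal.ofReal_mul ENNReal.toReal_nonneg,
    ENNReal.ofReal_le_ofReal_iff (by positivity)] at h
  have hK0 : 0 ≤ K.toReal := ENNReal.toReal_nonneg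
  refine le_of_sq_le_sq (h.trans ?_) (by positivity)
  have h1 : 0 ≤ a ^ 2 * ‖v‖ ^ 2 := by positivity
  nlinarith [mul_nonneg (sq_nonneg K.toReal) h1, mul_nonneg hK0 h1]

/-- Local approximation of functions in `H¹(Ω)`. -/
theorem IsTest.exists_approx_zero {χ : Sp d → ℝ} (hreg : interior (closure Ω) = Ω)
    (hχ : IsTest U χ) (hU : IsOpen U) (hτ : 0 < τ₀) (hcone : InwardCone Ω b τ₀ U) (hκ : 0 < κ) :
    ∃ C, 0 ≤ C ∧ ∀ (h : ℝ) (M : SimplicialMesh Ω) (v : H1 Ω), 0 < h → h ≤ τ₀ → h ≤ 1 →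
      M.IsUniform h κ → ∃ q : M.p1Fun, ‖hχ.mul (H1.toL2 Ω v) - M.toL2 q‖ ≤ C * (h * ‖v‖) ∧
        ∀ j, ‖hχ.cutGrad v j - H1.grad (M.toH1 hreg q) j‖ ≤ C * ‖v‖ := by
  have hΩ : IsOpen Ω := hreg ▸ isOpen_interior
  obtain ⟨B, hB, hS⟩ := hχ.smoothApprox_zero hΩ hU hτ hcone
  set K := 2 + 4 * ENNReal.ofReal (SimplicialMesh.approxConst d κ ‖b‖ 0) * B with hK
  have hKt : K ≠ ⊤ := by rw [hK]; finiteness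
  refine ⟨K.toReal + 1, by positivity, fun h M v hh hhτ hh1 hu => ?_⟩
  obtain ⟨q, hq1, hq2⟩ := IsUniformMesh.exists_of_smoothApprox hu hreg hcone hh hhτ hh1 hκ
    (hS v) (by
      intro h0
      have hv : v = 0 := by
        rw [← ofReal_norm, ENNReal.ofReal_eq_zero] at h0
        exact norm_le_zero_iff.1 h0
      subst hv
      refine ⟨by rw [map_zero]; exact hχ.mul_zero', fun j => ?_⟩
      rw [IsTest.cutGrad, map_zero, H1.grad_zero, hχ.mul_zero', (hχ.partialDeriv j).mul_zero',
        add_zero])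
  refine ⟨q, norm_le_of_enorm_sq_le hKt hh.le (by simpa using hq1), fun j => ?_⟩
  have h1 : ‖h • (hχ.cutGrad v j - H1.grad (M.toH1 hreg q) j)‖ ≤ (K.toReal + 1) * (h * ‖v‖) := by
    refine norm_le_of_enorm_sq_le hKt hh.le (le_trans (le_of_eq ?_) (by simpa using hq2 j))
    rw [enorm_smul, mul_pow, enorm_sq_eq_ofReal h, Real.norm_eq_abs, sq_abs]
  rw [norm_smul, Real.norm_of_nonneg hh.le] at h1
  have h2 : h * ‖hχ.cutGrad v j - H1.grad (M.toH1 hreg q) j‖ ≤ h * ((K.toReal + 1) * ‖v‖) := by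
    linarith
  exact le_of_mul_le_mul_left h2 hh

/-- Local approximation of functions in `H²(Ω)`. -/
theorem IsTest.exists_approx_one {χ : Sp d → ℝ} (hreg : interior (closure Ω) = Ω)
    (hχ : IsTest U χ) (hU : IsOpen U) (hτ : 0 < τ₀) (hcone : InwardCone Ω b τ₀ U) (hκ : 0 < κ) :
    ∃ C, 0 ≤ C ∧ ∀ (h : ℝ) (M : SimplicialMesh Ω) (w : H2 Ω), 0 < h → h ≤ τ₀ → h ≤ 1 →
      M.IsUniform h κ → ∃ q : M.p1Fun, ‖hχ.mul (H2.toL2 Ω w) - M.toL2 q‖ ≤ C * (h ^ 2 * ‖w‖) ∧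
        ∀ j, ‖hχ.cutGrad (H2.toH1 w) j - H1.grad (M.toH1 hreg q) j‖ ≤ C * (h * ‖w‖) := by
  have hΩ : IsOpen Ω := hreg ▸ isOpen_interior
  obtain ⟨B, hB, hS⟩ := hχ.smoothApprox_one hΩ hU hτ hcone
  set K := 2 + 4 * ENNReal.ofReal (SimplicialMesh.approxConst d κ ‖b‖ 1) * B with hK
  have hKt : K ≠ ⊤ := by rw [hK]; finiteness
  refine ⟨K.toReal + 1, by positivity, fun h M w hh hhτ hh1 hu => ?_⟩
  obtain ⟨q, hq1, hq2⟩ := IsUniformMesh.exists_of_smoothApprox hu hreg hcone hh hhτ hh1 hκ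
    (hS w) (by
      intro h0
      have hw : w = 0 := by
        rw [← ofReal_norm, ENNReal.ofReal_eq_zero] at h0
        exact norm_le_zero_iff.1 h0
      subst hw
      have h1 : H2.toH1 (0 : H2 Ω) = 0 := rfl
      refine ⟨by rw [map_zero]; exact hχ.mul_zero', fun j => ?_⟩
      rw [IsTest.cutGrad, h1, map_zero, H1.grad_zero, hχ.mul_zero', (hχ.partialDeriv j).mul_zero',
        add_zero])
  have e4 : h ^ (2 * (1 + 1)) = (h ^ 2) ^ 2 := by ring
  rw [e4] at hq1 hq2
  refine ⟨q, norm_le_of_enorm_sq_le hKt (sq_nonneg h) hq1, fun j => ?_⟩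
  have h1 : ‖h • (hχ.cutGrad (H2.toH1 w) j - H1.grad (M.toH1 hreg q) j)‖ ≤
      (K.toReal + 1) * (h ^ 2 * ‖w‖) := by
    refine norm_le_of_enorm_sq_le hKt (sq_nonneg h) (le_trans (le_of_eq ?_) (hq2 j))
    rw [enorm_smul, mul_pow, enorm_sq_eq_ofReal h, Real.norm_eq_abs, sq_abs]
  rw [norm_smul, Real.norm_of_nonneg hh.le] at h1
  have h2 : h * ‖hχ.cutGrad (H2.toH1 w) j - H1.grad (M.toH1 hreg q) j‖ ≤
      h * ((K.toReal + 1) * (h * ‖w‖)) := by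
    refine h1.trans (le_of_eq ?_)
    ring
  exact le_of_mul_le_mul_left h2 hh

end

/-! ### Globalization -/

/-- A finite smooth partition of unity on `closure Ω`, subordinate to sets with inward cones. -/
theorem IsBoundedLipschitzDomain.exists_partition (hΩ : IsBoundedLipschitzDomain Ω) :
    ∃ (ι : Type) (_ : Fintype ι) (χ : ι → Sp d → ℝ) (U : ι → Set (Sp d)) (b : ι → Sp d)
      (τ : ι → ℝ), (∀ i, IsOpen (U i)) ∧ (∀ i, IsTest (U i) (χ i)) ∧ (∀ i, 0 < τ i) ∧
      (∀ i, InwardCone Ω (b i) (τ i) (U i)) ∧ ∀ x ∈ closure Ω, ∑ i, χ i x = 1 := by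
  have hc : IsCompact (closure Ω) := hΩ.isBounded.isCompact_closure
  choose! b τ hτ r hr hcone using fun p (hp : p ∈ closure Ω) => hΩ.exists_inwardCone hp
  obtain ⟨t, ht, htc⟩ := hc.elim_nhds_subcover (fun p => Metric.ball p (r p))
    fun p hp => Metric.ball_mem_nhds p (hr p hp)
  obtain ⟨ρ, hρ⟩ := SmoothPartitionOfUnity.exists_isSubordinate (modelWithCornersSelf ℝ (Sp d))
    isClosed_closure (fun p : t => Metric.ball (p : Sp d) (r p)) (fun _ => Metric.isOpen_ball)
    (by simpa [iUnion_subtype] using htc)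
  refine ⟨Fin (Fintype.card t), inferInstance, fun i => ρ ((Fintype.equivFin t).symm i),
    fun i => Metric.ball ((Fintype.equivFin t).symm i : Sp d) (r ((Fintype.equivFin t).symm i)),
    fun i => b ((Fintype.equivFin t).symm i), fun i => τ ((Fintype.equivFin t).symm i),
    fun _ => Metric.isOpen_ball, fun i => ⟨?_, ?_, hρ _⟩, fun i => hτ _ (ht _ (Subtype.coe_prop _)),
    fun i => hcone _ (ht _ (Subtype.coe_prop _)), fun x hx => ?_⟩
  · exact (ρ _).contMDiff.contDiff
  · exact HasCompactSupport.of_support_subset_isCompact (isCompact_closedBall _ _)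
      (((subset_tsupport _).trans (hρ _)).trans Metric.ball_subset_closedBall)
  · have h1 := ρ.sum_eq_one hx
    rw [finsum_eq_sum_of_fintype] at h1
    rw [← h1]
    exact Equiv.sum_comp (Fintype.equivFin t).symm fun p => ρ p x

/-- The local discrete functions are added up. As `∑ χ i = 1` on the closed domain, the sum of the
derivatives of the `χ i` vanishes on `Ω`, so the localized functions and gradients add up to `v` and
its gradient. -/
theorem exists_approx_of_local {M : SimplicialMesh Ω} (hreg : interior (closure Ω) = Ω)
    {ι : Type} [Fintype ι] {χ : ι → Sp d → ℝ} {U : ι → Set (Sp d)}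
    (hχ : ∀ i, IsTest (U i) (χ i)) (hsum : ∀ x ∈ closure Ω, ∑ i, χ i x = 1) (v : H1 Ω)
    {A A' : ι → ℝ}
    (hloc : ∀ i, ∃ q : M.p1Fun, ‖(hχ i).mul (H1.toL2 Ω v) - M.toL2 q‖ ≤ A i ∧
      ∀ j, ‖(hχ i).cutGrad v j - H1.grad (M.toH1 hreg q) j‖ ≤ A' i) :
    ∃ q : M.p1Fun, ‖H1.toL2 Ω v - M.toL2 q‖ ≤ ∑ i, A i ∧
      ‖v - M.toH1 hreg q‖ ≤ ∑ i, A i + d * ∑ i, A' i := by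
  have hΩ : IsOpen Ω := hreg ▸ isOpen_interior
  choose q hq hq' using hloc
  have h1 : H1.toL2 Ω v = ∑ i, (hχ i).mul (H1.toL2 Ω v) := by
    refine Lp.ext ?_
    have h2 : ∀ᵐ x ∂volume.restrict Ω, ∀ i, (hχ i).mul (H1.toL2 Ω v) x = χ i x * H1.toL2 Ω v x :=
      ae_all_iff.2 fun i => (hχ i).coeFn_mul _
    filter_upwards [h2, ae_restrict_mem hΩ.measurableSet,
      Lp.coeFn_finsetSum Finset.univ fun i => (hχ i).mul (H1.toL2 Ω v)] with x hx hxΩ hs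
    rw [hs, Finset.sum_apply]
    simp only [hx]
    rw [← Finset.sum_mul, hsum x (subset_closure hxΩ), one_mul]
  have hsum' : ∀ j, ∀ x ∈ Ω, ∑ i, partialDeriv j (χ i) x = 0 := by
    intro j x hx
    have h2 : HasFDerivAt (fun x => ∑ i, χ i x) (∑ i, fderiv ℝ (χ i) x) x :=
      HasFDerivAt.fun_sum fun i _ => ((hχ i).contDiff.differentiable (by simp) x).hasFDerivAt
    have h3 : HasFDerivAt (fun x => ∑ i, χ i x) (0 : Sp d →L[ℝ] ℝ) x := by
      refine (hasFDerivAt_const (1 : ℝ) x).congr_of_eventuallyEq ?_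
      filter_upwards [hΩ.mem_nhds hx] with y hy
      exact hsum y (subset_closure hy)
    have h4 := congrArg (fun L : Sp d →L[ℝ] ℝ => L (EuclideanSpace.single j 1)) (h2.unique h3)
    simpa [partialDeriv, sum_apply] using h4
  have h2 : ∀ j, H1.grad v j = ∑ i, (hχ i).cutGrad v j := by
    intro j
    refine Lp.ext ?_
    have h2 : ∀ᵐ x ∂volume.restrict Ω, ∀ i, (hχ i).cutGrad v j x =
        χ i x * H1.grad v j x + partialDeriv j (χ i) x * H1.toL2 Ω v x := by
      refine ae_all_iff.2 fun i => ?_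
      filter_upwards [Lp.coeFn_add ((hχ i).mul (H1.grad v j))
        (((hχ i).partialDeriv j).mul (H1.toL2 Ω v)), (hχ i).coeFn_mul (H1.grad v j),
        ((hχ i).partialDeriv j).coeFn_mul (H1.toL2 Ω v)] with x hx hx1 hx2
      rw [IsTest.cutGrad, hx, Pi.add_apply, hx1, hx2]
    filter_upwards [h2, ae_restrict_mem hΩ.measurableSet,
      Lp.coeFn_finsetSum Finset.univ fun i => (hχ i).cutGrad v j] with x hx hxΩ hs
    rw [hs, Finset.sum_apply]
    simp only [hx]
    rw [Finset.sum_add_distrib, ← Finset.sum_mul, ← Finset.sum_mul, hsum x (subset_closure hxΩ),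
      hsum' j x hxΩ, one_mul, zero_mul, add_zero]
  have h3 : ‖H1.toL2 Ω v - M.toL2 (∑ i, q i)‖ ≤ ∑ i, A i := by
    rw [map_sum]
    conv_lhs => rw [h1]
    rw [← Finset.sum_sub_distrib]
    exact (norm_sum_le _ _).trans (Finset.sum_le_sum fun i _ => hq i)
  refine ⟨∑ i, q i, h3, (H1.norm_le _).trans (add_le_add ?_ ?_)⟩
  · rw [map_sub, SimplicialMesh.toL2_mesh_toH1]
    exact h3
  · refine (Finset.sum_le_card_nsmul _ _ (∑ i, A' i) fun j _ => ?_).trans (le_of_eq (by simp))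
    rw [H1.grad_sub, M.toH1_sum, H1.grad_sum]
    conv_lhs => rw [h2]
    rw [← Finset.sum_sub_distrib]
    exact (norm_sum_le _ _).trans (Finset.sum_le_sum fun i _ => hq' i j)

end SpaceTime
end

noncomputable section
namespace SpaceTime
open Filter Topology
variable {d : ℕ} {Ω : Set (Sp d)}

/-! ## Global approximation -/

theorem exists_pos_le_of_fintype {ι : Type*} [Finite ι] {τ : ι → ℝ} (hτ : ∀ i, 0 < τ i) :
    ∃ h₀, 0 < h₀ ∧ h₀ ≤ 1 ∧ ∀ i, h₀ ≤ τ i := by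
  have h1 : ∀ᶠ h₀ in 𝓝[>] (0 : ℝ), ∀ i, h₀ ≤ τ i :=
    eventually_all.2 fun i => nhdsWithin_le_nhds (Iic_mem_nhds (hτ i))
  have h2 : ∀ᶠ h₀ in 𝓝[>] (0 : ℝ), h₀ ≤ 1 := nhdsWithin_le_nhds (Iic_mem_nhds one_pos)
  obtain ⟨h₀, ⟨ha, hb⟩, hc⟩ := (((h1.and h2).and self_mem_nhdsWithin)).exists
  exact ⟨h₀, hc, hb, ha⟩

/-- The local construction needs `h ≤ h₀`, a threshold that depends on the domain only. For larger
`h` the zero function is good enough, since `h₀⁻¹ h ≥ 1`. -/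
theorem IsBoundedLipschitzDomain.exists_approx_zero (hΩ : IsBoundedLipschitzDomain Ω) {κ : ℝ}
    (hκ : 0 < κ) : ∃ C, 0 ≤ C ∧ ∀ (h : ℝ) (M : SimplicialMesh Ω) (v : H1 Ω), 0 < h →
      M.IsUniform h κ → ∃ q : M.p1Fun, ‖H1.toL2 Ω v - M.toL2 q‖ ≤ C * (h * ‖v‖) ∧
        ‖v - M.toH1 hΩ.interior_closure q‖ ≤ C * ‖v‖ := by
  have hreg := hΩ.interior_closure
  obtain ⟨ι, _, χ, U, b, τ, hU, hχ, hτ, hcone, hsum⟩ := hΩ.exists_partition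
  choose C hC hloc using fun i => (hχ i).exists_approx_zero hreg (hU i) (hτ i) (hcone i) hκ
  obtain ⟨h₀, hh₀, hh1, hhτ⟩ := exists_pos_le_of_fintype hτ
  have hS : 0 ≤ ∑ i, C i := Finset.sum_nonneg fun i _ => hC i
  have hi : 1 ≤ h₀⁻¹ := (one_le_inv₀ hh₀).2 hh1
  refine ⟨(1 + d) * ∑ i, C i + h₀⁻¹, by positivity, fun h M v hh hu => ?_⟩
  have hv := norm_nonneg v
  rcases le_or_gt h h₀ with hle | hgt
  · obtain ⟨q, hq1, hq2⟩ := exists_approx_of_local hreg hχ hsum v (M := M) fun i =>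
      hloc i h M v hh (hle.trans (hhτ i)) (hle.trans hh1) hu
    refine ⟨q, hq1.trans ?_, hq2.trans ?_⟩
    · rw [← Finset.sum_mul]
      refine mul_le_mul_of_nonneg_right ?_ (by positivity)
      nlinarith [mul_nonneg (Nat.cast_nonneg (α := ℝ) d) hS]
    · rw [← Finset.sum_mul, ← Finset.sum_mul]
      have h1 : (∑ i, C i) * (h * ‖v‖) ≤ (∑ i, C i) * ‖v‖ :=
        mul_le_mul_of_nonneg_left (mul_le_of_le_one_left hv (hle.trans hh1)) hS
      nlinarith [mul_nonneg (inv_nonneg.2 hh₀.le) hv]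
  · have h1 : 1 ≤ h₀⁻¹ * h := by
      rw [inv_mul_eq_div, one_le_div hh₀]
      exact hgt.le
    refine ⟨0, ?_, ?_⟩
    · rw [map_zero, sub_zero]
      refine (H1.norm_toL2_le v).trans ?_
      have h2 : 0 ≤ ((1 + d) * ∑ i, C i) * (h * ‖v‖) := by positivity
      nlinarith [mul_le_mul_of_nonneg_right h1 hv]
    · rw [M.toH1_zero, sub_zero]
      have h2 : 0 ≤ ((1 + d) * ∑ i, C i) * ‖v‖ := by positivity
      nlinarith

/-- As in `exists_approx_zero`; for `h > h₀` the order `h²` requires the factor `h₀⁻¹ ^ 2`. -/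
theorem IsBoundedLipschitzDomain.exists_approx_one (hΩ : IsBoundedLipschitzDomain Ω) {κ : ℝ}
    (hκ : 0 < κ) : ∃ C, 0 ≤ C ∧ ∀ (h : ℝ) (M : SimplicialMesh Ω) (w : H2 Ω), 0 < h →
      M.IsUniform h κ → ∃ q : M.p1Fun, ‖H2.toL2 Ω w - M.toL2 q‖ ≤ C * (h ^ 2 * ‖w‖) ∧
        ‖H2.toH1 w - M.toH1 hΩ.interior_closure q‖ ≤ C * (h * ‖w‖) := by
  have hreg := hΩ.interior_closure
  obtain ⟨ι, _, χ, U, b, τ, hU, hχ, hτ, hcone, hsum⟩ := hΩ.exists_partition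
  choose C hC hloc using fun i => (hχ i).exists_approx_one hreg (hU i) (hτ i) (hcone i) hκ
  obtain ⟨h₀, hh₀, hh1, hhτ⟩ := exists_pos_le_of_fintype hτ
  have hS : 0 ≤ ∑ i, C i := Finset.sum_nonneg fun i _ => hC i
  have hi : 1 ≤ h₀⁻¹ := (one_le_inv₀ hh₀).2 hh1
  refine ⟨(1 + d) * ∑ i, C i + h₀⁻¹ ^ 2, by positivity, fun h M w hh hu => ?_⟩
  have hw := norm_nonneg w
  rcases le_or_gt h h₀ with hle | hgt
  · obtain ⟨q, hq1, hq2⟩ := exists_approx_of_local hreg hχ hsum (H2.toH1 w) (M := M) fun i => by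
      rw [H2.toL2_toH1]
      exact hloc i h M w hh (hle.trans (hhτ i)) (hle.trans hh1) hu
    rw [H2.toL2_toH1] at hq1
    refine ⟨q, hq1.trans ?_, hq2.trans ?_⟩
    · rw [← Finset.sum_mul]
      refine mul_le_mul_of_nonneg_right ?_ (by positivity)
      nlinarith [mul_nonneg (Nat.cast_nonneg (α := ℝ) d) hS, sq_nonneg h₀⁻¹]
    · clear hq1 hq2
      rw [← Finset.sum_mul, ← Finset.sum_mul]
      generalize ‖w‖ = n at hw ⊢
      have h1 : (∑ i, C i) * (h ^ 2 * n) ≤ (∑ i, C i) * (h * n) := by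
        refine mul_le_mul_of_nonneg_left (mul_le_mul_of_nonneg_right ?_ hw) hS
        rw [pow_two]
        exact mul_le_of_le_one_left hh.le (hle.trans hh1)
      have h2 : 0 ≤ h₀⁻¹ ^ 2 * (h * n) := by positivity
      linarith
  · have h1 : 1 ≤ h₀⁻¹ * h := by
      rw [inv_mul_eq_div, one_le_div hh₀]
      exact hgt.le
    refine ⟨0, ?_, ?_⟩
    · rw [map_zero, sub_zero, ← H2.toL2_toH1]
      refine ((H1.norm_toL2_le _).trans (H2.norm_toH1_le w)).trans ?_
      have h2 : 0 ≤ ((1 + d) * ∑ i, C i) * (h ^ 2 * ‖w‖) := by positivity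
      have h3 : 1 * ‖w‖ ≤ (h₀⁻¹ * h) ^ 2 * ‖w‖ :=
        mul_le_mul_of_nonneg_right (one_le_pow₀ h1) hw
      rw [add_mul]
      refine le_add_of_nonneg_of_le h2 ?_
      linarith
    · rw [M.toH1_zero, sub_zero]
      refine (H2.norm_toH1_le w).trans ?_
      have h2 : 0 ≤ ((1 + d) * ∑ i, C i) * (h * ‖w‖) := by positivity
      have h3 : 1 ≤ h₀⁻¹ * (h₀⁻¹ * h) := one_le_mul_of_one_le_of_one_le hi h1
      have h4 : 1 * ‖w‖ ≤ (h₀⁻¹ * (h₀⁻¹ * h)) * ‖w‖ := mul_le_mul_of_nonneg_right h3 hw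
      rw [add_mul]
      refine le_add_of_nonneg_of_le h2 ?_
      linarith

/-! ## Zero boundary values -/

section

variable {M : SimplicialMesh Ω} {h κ : ℝ}

theorem le_of_enorm_sq_le {E : Type*} [NormedAddCommGroup E] {x : E} {K a b : ℝ} (hK : 0 ≤ K)
    (ha : 0 ≤ a) (hb : 0 ≤ b)
    (h : ‖x‖ₑ ^ 2 ≤ ENNReal.ofReal K * (ENNReal.ofReal (a ^ 2) + ENNReal.ofReal (b ^ 2))) :
    ‖x‖ ≤ (K + 1) * (a + b) := by
  rw [enorm_sq_eq_ofReal, ← ENNReal.ofReal_add (sq_nonneg _) (sq_nonneg _),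
    ← ENNReal.ofReal_mul hK, ENNReal.ofReal_le_ofReal_iff (by positivity)] at h
  refine le_of_sq_le_sq (h.trans ?_) (by positivity)
  have h1 : a ^ 2 + b ^ 2 ≤ (a + b) ^ 2 := by nlinarith
  have h2 : K ≤ (K + 1) ^ 2 := by nlinarith
  rw [mul_pow]
  exact mul_le_mul h2 h1 (by positivity) (by positivity)

theorem SimplicialMesh.aemeasurable_errDensity {φ : Sp d → ℝ} (hφ : ContDiff ℝ 1 φ)
    (q : M.p1Fun) : AEMeasurable (errDensity h φ q.1) (volume.restrict Ω) := by
  have h1 : AEMeasurable (fun x => ‖φ x - q.1 x‖ₑ ^ 2) (volume.restrict Ω) :=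
    ((hφ.continuous.aestronglyMeasurable.sub (M.memLp q).1).enorm).pow_const 2
  have h2 : Measurable fun x => ‖fderiv ℝ φ x - fderiv ℝ q.1 x‖ₑ ^ 2 :=
    (((measurable_fderiv ℝ φ).sub (measurable_fderiv ℝ q.1)).enorm).pow_const 2
  exact h1.add (h2.aemeasurable.const_mul _)

/-- The error density of a test function is controlled by the norms of the error. -/
theorem lintegral_errDensity_le (hreg : interior (closure Ω) = Ω) {φ : Sp d → ℝ}
    (hφ : IsTest Ω φ) {v : H1 Ω} (hv : H1.toL2 Ω v =ᵐ[volume.restrict Ω] φ) (q : M.p1Fun) :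
    ∫⁻ x in Ω, errDensity h φ q.1 x ≤ ‖H1.toL2 Ω v - M.toL2 q‖ₑ ^ 2 +
      ENNReal.ofReal (h ^ 2) * (d * ‖v - M.toH1 hreg q‖ₑ ^ 2) := by
  have hΩ : IsOpen Ω := hreg ▸ isOpen_interior
  have hφ1 : ContDiff ℝ 1 φ := hφ.contDiff.of_le (by simp)
  have hF : IsH1Fun Ω φ := isH1Fun_of_contDiff hφ1 hφ.hasCompactSupport
  have hvF : v = hF.toH1 := H1.toL2_injective hΩ (Lp.ext (hv.trans hF.toL2_toH1.symm))
  have e0 : (H1.toL2 Ω v - M.toL2 q : L2 Ω) =ᵐ[volume.restrict Ω] fun x => φ x - q.1 x := by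
    filter_upwards [Lp.coeFn_sub (H1.toL2 Ω v) (M.toL2 q), (M.memLp q).coeFn_toLp, hv]
      with x hx hx1 hx2
    rw [hx, Pi.sub_apply, hx2]
    congr 1
  have e1 : ∀ j, (H1.grad (v - M.toH1 hreg q) j : L2 Ω) =ᵐ[volume.restrict Ω]
      fun x => (fderiv ℝ φ x - fderiv ℝ q.1 x) (EuclideanSpace.single j 1) := by
    intro j
    rw [H1.grad_sub, hvF]
    filter_upwards [Lp.coeFn_sub (H1.grad hF.toH1 j) (H1.grad (M.toH1 hreg q) j),
      hF.grad_toH1 j, (M.isH1Fun hreg q).grad_toH1 j] with x hx hx1 hx2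
    rw [hx, Pi.sub_apply, hx1]
    congr 1
  have hm : AEMeasurable (fun x => ‖φ x - q.1 x‖ₑ ^ 2) (volume.restrict Ω) :=
    ((hφ.contDiff.continuous.aestronglyMeasurable.sub (M.memLp q).1).enorm).pow_const 2
  have hL : Measurable fun x => fderiv ℝ φ x - fderiv ℝ q.1 x :=
    (measurable_fderiv ℝ φ).sub (measurable_fderiv ℝ q.1)
  unfold errDensity
  rw [lintegral_add_left' hm, lintegral_const_mul' _ _ ENNReal.ofReal_ne_top,
    ← enorm_sq_L2_of_ae e0]
  refine add_le_add_right (mul_le_mul_right ?_ _) _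
  calc ∫⁻ x in Ω, ‖fderiv ℝ φ x - fderiv ℝ q.1 x‖ₑ ^ 2
      ≤ ∫⁻ x in Ω, d * ∑ j, ‖(fderiv ℝ φ x - fderiv ℝ q.1 x) (EuclideanSpace.single j 1)‖ₑ ^ 2 :=
        lintegral_mono fun x => clm_enorm_sq_le_sum _
    _ = d * ∑ j, ‖H1.grad (v - M.toH1 hreg q) j‖ₑ ^ 2 := by
        rw [lintegral_const_mul' _ _ (ENNReal.natCast_ne_top d), lintegral_finsetSum']
        · congr 1
          exact Finset.sum_congr rfl fun j _ => (enorm_sq_L2_of_ae (e1 j)).symm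
        · exact fun j _ => (((ContinuousLinearMap.measurable_apply _).comp hL).enorm.pow_const 2).aemeasurable
    _ ≤ d * ‖v - M.toH1 hreg q‖ₑ ^ 2 := by
        refine mul_le_mul_right ?_ _
        simp only [enorm_sq_eq_ofReal]
        rw [← ENNReal.ofReal_sum_of_nonneg fun j _ => sq_nonneg _, H1.norm_sq (v - _)]
        exact ENNReal.ofReal_le_ofReal (le_add_of_nonneg_left (sq_nonneg _))

/-- For fixed `q` both sides are continuous in `v` with respect to the `H¹` norm, so it suffices to
consider test functions, to which `zeroBoundary_le` applies. -/
theorem IsBoundedLipschitzDomain.exists_zeroBoundary_le (hΩ : IsBoundedLipschitzDomain Ω)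
    (hκ : 0 < κ) : ∃ C, 0 ≤ C ∧ ∀ (h : ℝ) (M : SimplicialMesh Ω) (v : H1 Ω) (q : M.p1Fun),
      0 < h → M.IsUniform h κ → v ∈ H10 Ω → ‖M.toL2 q - M.toL2 (SimplicialMesh.zeroBoundary q)‖ ≤
        C * (‖H1.toL2 Ω v - M.toL2 q‖ + h * ‖v - M.toH1 hΩ.interior_closure q‖) := by
  have hreg := hΩ.interior_closure
  set K₀ : ℝ≥0∞ := ENNReal.ofReal
    ((2 * (2 * κ) * κ) ^ d * ((d + 1) ^ 2 * SimplicialMesh.traceConst d κ)) with hK₀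
  set K : ℝ := (K₀ * (1 + d)).toReal with hK
  have hKt : K₀ * (1 + d) ≠ ⊤ := by
    rw [hK₀]
    exact ENNReal.mul_ne_top ENNReal.ofReal_ne_top (by simp)
  have hK0 : 0 ≤ K := ENNReal.toReal_nonneg
  refine ⟨K + 1, by positivity, fun h M v q hh hu hv => ?_⟩
  have hcl : IsClosed {v : H1 Ω | ‖M.toL2 q - M.toL2 (SimplicialMesh.zeroBoundary q)‖ ≤
      (K + 1) * (‖H1.toL2 Ω v - M.toL2 q‖ + h * ‖v - M.toH1 hreg q‖)} :=
    isClosed_le continuous_const (by fun_prop)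
  have hsub : (testSubmodule Ω : Set (H1 Ω)) ⊆
      {v : H1 Ω | ‖M.toL2 q - M.toL2 (SimplicialMesh.zeroBoundary q)‖ ≤
        (K + 1) * (‖H1.toL2 Ω v - M.toL2 q‖ + h * ‖v - M.toH1 hreg q‖)} := by
    rintro v ⟨φ, hφ, hvφ⟩
    have hφ1 : ContDiff ℝ 1 φ := hφ.contDiff.of_le (by simp)
    have hφ0 : ∀ x ∉ Ω, φ x = 0 := fun x hx =>
      image_eq_zero_of_notMem_tsupport fun h => hx (hφ.tsupport_subset h)
    have h1 := hu.zeroBoundary_le hh hκ hΩ hφ1 hφ0 q (M.aemeasurable_errDensity hφ1 q)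
    have e : (M.toL2 q - M.toL2 (SimplicialMesh.zeroBoundary q) : L2 Ω) =ᵐ[volume.restrict Ω]
        fun x => q.1 x - (SimplicialMesh.zeroBoundary q).1 x := by
      rw [← map_sub]
      exact (M.memLp _).coeFn_toLp
    rw [← enorm_sq_L2_of_ae e] at h1
    refine le_of_enorm_sq_le hK0 (norm_nonneg _) (by positivity) ?_
    refine (h1.trans (mul_le_mul_right (lintegral_errDensity_le hreg hφ hvφ q) _)).trans ?_
    rw [hK, ENNReal.ofReal_toReal hKt, mul_assoc K₀, ← enorm_sq_eq_ofReal, mul_pow h,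
      ENNReal.ofReal_mul (sq_nonneg h), ← enorm_sq_eq_ofReal]
    refine mul_le_mul_right ?_ _
    rw [mul_add]
    refine add_le_add (le_mul_of_one_le_left' le_self_add) ?_
    rw [mul_left_comm]
    exact mul_le_mul_left le_add_self _
  exact closure_minimal hsub hcl hv

end

/-! ## The projections -/

theorem norm_sub_starProjection_le {E : Type*} [NormedAddCommGroup E] [InnerProductSpace ℝ E]
    (K : Submodule ℝ E) [K.HasOrthogonalProjection] (x : E) {y : E} (hy : y ∈ K) :
    ‖x - K.starProjection x‖ ≤ ‖x - y‖ := by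
  rw [Submodule.starProjection_minimal]
  exact ciInf_le ⟨0, by rintro _ ⟨z, rfl⟩; positivity⟩ (⟨y, hy⟩ : K)

namespace SimplicialMesh

variable {M : SimplicialMesh Ω} {h κ : ℝ}

theorem norm_sub_proj_le (f : L2 Ω) (q : M.p1Fun) : ‖f - M.proj f‖ ≤ ‖f - M.toL2 q‖ :=
  norm_sub_starProjection_le _ f ⟨q, trivial, rfl⟩

theorem norm_sub_proj0_le (f : L2 Ω) {q : M.p1Fun} (hq : q ∈ M.p1Fun0) :
    ‖f - M.proj0 f‖ ≤ ‖f - M.toL2 q‖ :=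
  norm_sub_starProjection_le _ f ⟨q, hq, rfl⟩

theorem exists_proj_eq (f : L2 Ω) : ∃ q : M.p1Fun, M.toL2 q = M.proj f := by
  obtain ⟨q, -, hq⟩ := Submodule.starProjection_apply_mem M.S1 f
  exact ⟨q, hq⟩

theorem exists_proj0_eq (f : L2 Ω) : ∃ q ∈ M.p1Fun0, M.toL2 q = M.proj0 f := by
  obtain ⟨q, hq, hq'⟩ := Submodule.starProjection_apply_mem M.S10 f
  exact ⟨q, hq, hq'⟩

theorem toH1_sub (hreg : interior (closure Ω) = Ω) (p q : M.p1Fun) :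
    M.toH1 hreg (p - q) = M.toH1 hreg p - M.toH1 hreg q := by
  refine H1.toL2_injective (hreg ▸ isOpen_interior) ?_
  simp only [toL2_mesh_toH1, map_sub]

theorem toL2_sub_toH1 (hreg : interior (closure Ω) = Ω) (v : H1 Ω) (q : M.p1Fun) :
    H1.toL2 Ω (v - M.toH1 hreg q) = H1.toL2 Ω v - M.toL2 q := by
  rw [map_sub, toL2_mesh_toH1]

theorem IsUniform.norm_grad_le (hu : M.IsUniform h κ) (hreg : interior (closure Ω) = Ω)
    (hh : 0 < h) (hκ : 0 < κ) (q : M.p1Fun) (j : Fin d) :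
    h * ‖H1.grad (M.toH1 hreg q) j‖ ≤ ((4 * κ) ^ 2 * (4 * κ ^ 2) ^ d + 1) * ‖M.toL2 q‖ := by
  have h1 := hu.inverse hreg hh hκ q
  rw [← enorm_sq_L2_of_ae (M.memLp q).coeFn_toLp] at h1
  have h2 : ‖h • H1.grad (M.toH1 hreg q) j‖ₑ ^ 2 ≤
      ENNReal.ofReal ((4 * κ) ^ 2 * (4 * κ ^ 2) ^ d) *
        (ENNReal.ofReal (‖M.toL2 q‖ ^ 2) + ENNReal.ofReal (0 ^ 2)) := by
    rw [← enorm_sq_eq_ofReal, zero_pow two_ne_zero, ENNReal.ofReal_zero, add_zero]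
    refine le_trans ?_ h1
    rw [enorm_smul, mul_pow, enorm_sq_eq_ofReal h, Real.norm_eq_abs, sq_abs,
      enorm_sq_L2_of_ae (f := H1.grad (M.toH1 hreg q) j) ((M.isH1Fun hreg q).grad_toH1 j)]
    refine mul_le_mul_right (lintegral_mono fun x => pow_le_pow_left' ?_ 2) _
    rw [← ofReal_norm, ← ofReal_norm]
    exact ENNReal.ofReal_le_ofReal (abs_partialDeriv_le_norm j q.1 x)
  have h3 := le_of_enorm_sq_le (by positivity) (norm_nonneg _) le_rfl h2
  rwa [norm_smul, Real.norm_of_nonneg hh.le, add_zero] at h3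

/-- The inverse estimate. -/
theorem IsUniform.norm_toH1_le (hu : M.IsUniform h κ) (hreg : interior (closure Ω) = Ω)
    (hh : 0 < h) (hκ : 0 < κ) {T : ℝ} (hT : h ≤ T) (q : M.p1Fun) :
    h * ‖M.toH1 hreg q‖ ≤ (T + d * ((4 * κ) ^ 2 * (4 * κ ^ 2) ^ d + 1)) * ‖M.toL2 q‖ := by
  have h1 := mul_le_mul_of_nonneg_left (H1.norm_le (M.toH1 hreg q)) hh.le
  rw [toL2_mesh_toH1, mul_add, Finset.mul_sum] at h1
  have h2 := Finset.sum_le_card_nsmul Finset.univ _ _ fun j _ => hu.norm_grad_le hreg hh hκ q j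
  rw [Finset.card_univ, Fintype.card_fin, nsmul_eq_mul] at h2
  have h3 := mul_le_mul_of_nonneg_right hT (norm_nonneg (M.toL2 q))
  linarith

end SimplicialMesh

section

variable {κ T : ℝ} (hΩ : IsBoundedLipschitzDomain Ω) (hκ : 0 < κ)
include hΩ hκ

theorem IsBoundedLipschitzDomain.exists_proj_le : ∃ C, 0 ≤ C ∧
    ∀ (h : ℝ) (M : SimplicialMesh Ω) (v : H1 Ω), 0 < h → M.IsUniform h κ →
      ‖H1.toL2 Ω v - M.proj (H1.toL2 Ω v)‖ ≤ C * (h * ‖v‖) := by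
  obtain ⟨C, hC, H⟩ := hΩ.exists_approx_zero hκ
  refine ⟨C, hC, fun h M v hh hu => ?_⟩
  obtain ⟨q, hq, -⟩ := H h M v hh hu
  exact (M.norm_sub_proj_le _ q).trans hq

/-- Finite element functions close to a function in `H²(Ω)` are close in `H¹(Ω)`. -/
theorem IsBoundedLipschitzDomain.exists_norm_toH1_sub_le (hT : 0 < T) : ∃ C, 0 ≤ C ∧
    ∀ (h : ℝ) (M : SimplicialMesh Ω) (w : H2 Ω) (p : M.p1Fun) (B : ℝ), 0 < h → h ≤ T →
      M.IsUniform h κ → ‖H2.toL2 Ω w - M.toL2 p‖ ≤ B * (h ^ 2 * ‖w‖) →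
        ‖H2.toH1 w - M.toH1 hΩ.interior_closure p‖ ≤ C * (1 + B) * (h * ‖w‖) := by
  have hreg := hΩ.interior_closure
  obtain ⟨C, hC, H⟩ := hΩ.exists_approx_one hκ
  set K : ℝ := T + d * ((4 * κ) ^ 2 * (4 * κ ^ 2) ^ d + 1) with hK
  have hK0 : 0 ≤ K := by positivity
  refine ⟨C + K * (C + 1), by positivity, fun h M w p B hh hhT hu hp => ?_⟩
  -- The function `q` is close to `w` in both norms. The difference `q - p` is discrete and of order
  -- `h²` in `L²`, so the inverse estimate makes it of order `h` in `H¹`.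
  obtain ⟨q, hq1, hq2⟩ := H h M w hh hu
  have hw := norm_nonneg w
  have h1 := hu.norm_toH1_le hreg hh hκ hhT (q - p)
  have h2 : ‖M.toL2 (q - p)‖ ≤ (C + B) * (h ^ 2 * ‖w‖) := by
    rw [map_sub, ← sub_sub_sub_cancel_left _ _ (H2.toL2 Ω w)]
    refine (norm_sub_le _ _).trans ?_
    rw [add_mul, add_comm]
    exact add_le_add hq1 hp
  have h3 : h * ‖M.toH1 hreg (q - p)‖ ≤ h * (K * ((C + B) * (h * ‖w‖))) := by
    refine (h1.trans (mul_le_mul_of_nonneg_left h2 hK0)).trans (le_of_eq ?_)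
    ring
  have h4 := le_of_mul_le_mul_left h3 hh
  have h5 : ‖H2.toH1 w - M.toH1 hreg p‖ ≤ C * (h * ‖w‖) + K * ((C + B) * (h * ‖w‖)) := by
    rw [← sub_add_sub_cancel (H2.toH1 w) (M.toH1 hreg q), ← M.toH1_sub hreg]
    exact (norm_add_le _ _).trans (add_le_add hq2 h4)
  -- The sign of `B` is not assumed; for `w ≠ 0` it follows from the hypothesis, and for `w = 0` it
  -- is irrelevant.
  have h6 : 0 ≤ B * (h ^ 2 * ‖w‖) := (norm_nonneg _).trans hp
  rcases (norm_nonneg w).eq_or_lt with h0 | h0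
  · rw [← h0] at h5 ⊢
    simpa using h5
  · have hB : 0 ≤ B := nonneg_of_mul_nonneg_left h6 (by positivity)
    refine h5.trans ?_
    have h7 : 0 ≤ h * ‖w‖ := by positivity
    have h8 : C + K * (C + B) ≤ (C + K * (C + 1)) * (1 + B) := by
      have e : (C + K * (C + 1)) * (1 + B) = C + K * (C + B) + (K + C * B + K * C * B) := by ring
      rw [e]
      exact le_add_of_nonneg_right (by positivity)
    refine le_trans (le_of_eq ?_) (mul_le_mul_of_nonneg_right h8 h7)
    ring

/-- Best approximation gives the order `h²` in `L²`, and `exists_norm_toH1_sub_le` converts it.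
Stability of the projection in `H¹` is not used. -/
theorem IsBoundedLipschitzDomain.exists_proj_H2_le (hT : 0 < T) : ∃ C, 0 ≤ C ∧
    ∀ (h : ℝ) (M : SimplicialMesh Ω) (w : H2 Ω), 0 < h → h ≤ T → M.IsUniform h κ →
      ∃ z : H1 Ω, H1.toL2 Ω z = H2.toL2 Ω w - M.proj (H2.toL2 Ω w) ∧ ‖z‖ ≤ C * (h * ‖w‖) := by
  have hreg := hΩ.interior_closure
  obtain ⟨C, hC, H⟩ := hΩ.exists_approx_one hκ
  obtain ⟨C', hC', H'⟩ := hΩ.exists_norm_toH1_sub_le hκ hT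
  refine ⟨C' * (1 + C), by positivity, fun h M w hh hhT hu => ?_⟩
  obtain ⟨p, hp⟩ := M.exists_proj_eq (H2.toL2 Ω w)
  obtain ⟨q, hq, -⟩ := H h M w hh hu
  refine ⟨H2.toH1 w - M.toH1 hreg p, ?_, H' h M w p C hh hhT hu ?_⟩
  · rw [← hp, ← H2.toL2_toH1]
    exact M.toL2_sub_toH1 hreg _ p
  · rw [hp]
    exact (M.norm_sub_proj_le _ q).trans hq

/-- The competitor in the best approximation is `zeroBoundary q`. The factor `h` in front of the
`H¹` error in `exists_zeroBoundary_le` makes up for the missing rate of that error. -/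
theorem IsBoundedLipschitzDomain.exists_proj0_le : ∃ C, 0 ≤ C ∧
    ∀ (h : ℝ) (M : SimplicialMesh Ω) (v : H1 Ω), 0 < h → M.IsUniform h κ → v ∈ H10 Ω →
      ‖H1.toL2 Ω v - M.proj0 (H1.toL2 Ω v)‖ ≤ C * (h * ‖v‖) := by
  have hreg := hΩ.interior_closure
  obtain ⟨C, hC, H⟩ := hΩ.exists_approx_zero hκ
  obtain ⟨C', hC', H'⟩ := hΩ.exists_zeroBoundary_le hκ
  refine ⟨C + C' * (C + C), by positivity, fun h M v hh hu hv => ?_⟩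
  obtain ⟨q, hq1, hq2⟩ := H h M v hh hu
  have h1 := H' h M v q hh hu hv
  refine (M.norm_sub_proj0_le _ (SimplicialMesh.zeroBoundary_mem hreg q)).trans ?_
  rw [← sub_add_sub_cancel (H1.toL2 Ω v) (M.toL2 q)]
  refine (norm_add_le _ _).trans ?_
  have h2 := mul_le_mul_of_nonneg_left
    (add_le_add hq1 (mul_le_mul_of_nonneg_left hq2 hh.le)) hC'
  linarith

theorem IsBoundedLipschitzDomain.exists_proj0_H2_le : ∃ C, 0 ≤ C ∧
    ∀ (h : ℝ) (M : SimplicialMesh Ω) (w : H2 Ω), 0 < h → M.IsUniform h κ → H2.toH1 w ∈ H10 Ω →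
      ‖H2.toL2 Ω w - M.proj0 (H2.toL2 Ω w)‖ ≤ C * (h ^ 2 * ‖w‖) := by
  have hreg := hΩ.interior_closure
  obtain ⟨C, hC, H⟩ := hΩ.exists_approx_one hκ
  obtain ⟨C', hC', H'⟩ := hΩ.exists_zeroBoundary_le hκ
  refine ⟨C + C' * (C + C), by positivity, fun h M w hh hu hw => ?_⟩
  obtain ⟨q, hq1, hq2⟩ := H h M w hh hu
  have h1 := H' h M _ q hh hu hw
  rw [H2.toL2_toH1] at h1
  refine (M.norm_sub_proj0_le _ (SimplicialMesh.zeroBoundary_mem hreg q)).trans ?_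
  rw [← sub_add_sub_cancel (H2.toL2 Ω w) (M.toL2 q)]
  refine (norm_add_le _ _).trans ?_
  have h2 := mul_le_mul_of_nonneg_left
    (add_le_add hq1 (mul_le_mul_of_nonneg_left hq2 hh.le)) hC'
  linarith

theorem IsBoundedLipschitzDomain.exists_proj0_H10_le (hT : 0 < T) : ∃ C, 0 ≤ C ∧
    ∀ (h : ℝ) (M : SimplicialMesh Ω) (w : H2 Ω), 0 < h → h ≤ T → M.IsUniform h κ →
      H2.toH1 w ∈ H10 Ω →
      ∃ z : H10 Ω, H10.toL2 Ω z = H2.toL2 Ω w - M.proj0 (H2.toL2 Ω w) ∧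
        ‖z‖ ≤ C * (h * ‖w‖) := by
  have hreg := hΩ.interior_closure
  obtain ⟨C, hC, H⟩ := hΩ.exists_proj0_H2_le hκ
  obtain ⟨C', hC', H'⟩ := hΩ.exists_norm_toH1_sub_le hκ hT
  refine ⟨C' * (1 + C), by positivity, fun h M w hh hhT hu hw => ?_⟩
  obtain ⟨p, hp0, hp⟩ := M.exists_proj0_eq (H2.toL2 Ω w)
  refine ⟨⟨H2.toH1 w - M.toH1 hreg p, Submodule.sub_mem _ hw (M.toH1_mem_H10 hreg hp0)⟩, ?_,
    H' h M w p C hh hhT hu ?_⟩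
  · rw [← hp, ← H2.toL2_toH1]
    exact M.toL2_sub_toH1 hreg _ p
  · rw [hp]
    exact H h M w hh hu hw

/-- Duality: the projection error of `w` is orthogonal to the discrete space, so a test function `v`
may be replaced by its own projection error, and each of the two factors contributes one power of
`h`. -/
theorem IsBoundedLipschitzDomain.exists_proj0_Hm1_le : ∃ C, 0 ≤ C ∧
    ∀ (h : ℝ) (M : SimplicialMesh Ω) (w : H10 Ω), 0 < h → M.IsUniform h κ →
      ‖toHm1 (H10.toL2 Ω w - M.proj0 (H10.toL2 Ω w))‖ ≤ C * (h ^ 2 * ‖w‖) := by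
  obtain ⟨C, hC, H⟩ := hΩ.exists_proj0_le hκ
  refine ⟨C * C, by positivity, fun h M w hh hu => ?_⟩
  refine csInf_le ⟨0, fun _ h => h.1⟩ ⟨by positivity, fun v => ?_⟩
  have h1 := H h M w.1 hh hu w.2
  have h2 := H h M v.1 hh hu v.2
  have e : toHm1 (H10.toL2 Ω w - M.proj0 (H10.toL2 Ω w)) v =
      inner ℝ (H10.toL2 Ω w - M.proj0 (H10.toL2 Ω w))
        (H10.toL2 Ω v - M.proj0 (H10.toL2 Ω v)) := by
    rw [inner_sub_right _ (H10.toL2 Ω v), show inner ℝ (H10.toL2 Ω w - M.proj0 (H10.toL2 Ω w))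
      (M.proj0 (H10.toL2 Ω v)) = (0 : ℝ) from Submodule.starProjection_inner_eq_zero _ _
        (Submodule.starProjection_apply_mem _ _), sub_zero]
    rfl
  rw [e]
  refine (norm_inner_le_norm _ _).trans ((mul_le_mul h1 h2 (norm_nonneg _)
    (by positivity)).trans (le_of_eq ?_))
  have key : ∀ a b : ℝ, C * (h * a) * (C * (h * b)) = C * C * (h ^ 2 * a) * b := by
    intro a b
    ring
  exact key _ _

end

end SpaceTime
end

noncomputable section
namespace SpaceTime
open Filter Topology

/-! ## Functions of time -/

section

variable {X : Type*} [NormedAddCommGroup X] [NormedSpace ℝ X] {T h : ℝ}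

instance (T : ℝ) : IsFiniteMeasure (timeMeasure T) := by
  unfold timeMeasure
  infer_instance

theorem timeMeasure_univ (T : ℝ) : timeMeasure T univ = ENNReal.ofReal T := by
  simp [timeMeasure]

theorem ae_mem_timeMeasure (T : ℝ) : ∀ᵐ t ∂timeMeasure T, t ∈ Ioo 0 T :=
  ae_restrict_mem measurableSet_Ioo

theorem eLpNorm_two_sq {E α : Type*} [NormedAddCommGroup E] [MeasurableSpace α] {μ : Measure α}
    (f : α → E) :
    eLpNorm f 2 μ ^ 2 = ∫⁻ x, ‖f x‖ₑ ^ 2 ∂μ := by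
  rw [eLpNorm_eq_lintegral_rpow_enorm_toReal (by simp) (by simp), ← ENNReal.rpow_natCast,
    ← ENNReal.rpow_mul]
  simp

/-- One factor `2 h` in the squared bound is the length of the window, by Cauchy-Schwarz; the other
comes from integrating over the centres, by `lintegral_lintegral_closedBall`. -/
theorem eLpNorm_le_of_window {E F : Type*} [NormedAddCommGroup E] [NormedAddCommGroup F]
    {r : ℝ → F} {w : ℝ → E} (hw : AEStronglyMeasurable w (timeMeasure T))
    (hr : ∀ᵐ t ∂timeMeasure T,
      ‖r t‖ₑ ≤ ∫⁻ s in Metric.closedBall t h, ‖w s‖ₑ ∂timeMeasure T) :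
    eLpNorm r 2 (timeMeasure T) ≤ ENNReal.ofReal (2 * h) * eLpNorm w 2 (timeMeasure T) := by
  refine (ENNReal.pow_right_strictMono two_ne_zero).le_iff_le.1 ?_
  rw [mul_pow, eLpNorm_two_sq, eLpNorm_two_sq]
  set F : ℝ → ℝ≥0∞ := (Ioo 0 T).indicator fun s => ‖w s‖ₑ ^ 2 with hF
  have hFm : AEMeasurable F volume :=
    (aemeasurable_indicator_iff measurableSet_Ioo).2 (hw.enorm.pow_const 2)
  have hvol : ∀ t : ℝ, volume (Metric.closedBall t h) = ENNReal.ofReal (2 * h) := fun t => by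
    rw [Real.volume_closedBall]
  calc ∫⁻ t, ‖r t‖ₑ ^ 2 ∂timeMeasure T
      ≤ ∫⁻ t, ENNReal.ofReal (2 * h) * (∫⁻ s in Metric.closedBall t h, F s) ∂timeMeasure T := by
        refine lintegral_mono_ae ?_
        filter_upwards [hr] with t ht
        refine (pow_le_pow_left' ht 2).trans ((lintegral_sq_le _ hw.enorm.restrict).trans ?_)
        refine mul_le_mul' ?_ ?_
        · rw [Measure.restrict_apply_univ, ← hvol t]
          exact Measure.restrict_apply_le _ _
        · rw [timeMeasure, Measure.restrict_restrict Metric.isClosed_closedBall.measurableSet,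
            hF, setLIntegral_indicator measurableSet_Ioo, inter_comm]
    _ ≤ ∫⁻ t, ENNReal.ofReal (2 * h) * ∫⁻ s in Metric.closedBall t h, F s :=
        lintegral_mono' Measure.restrict_le_self le_rfl
    _ = ENNReal.ofReal (2 * h) ^ 2 * ∫⁻ s, ‖w s‖ₑ ^ 2 ∂timeMeasure T := by
        rw [lintegral_const_mul' _ _ ENNReal.ofReal_ne_top,
          lintegral_lintegral_closedBall volume h hFm, hvol, hF,
          lintegral_indicator measurableSet_Ioo, timeMeasure]
        ring

/-! ### Weak derivatives -/

theorem integral_timeMeasure_eq (hT : 0 ≤ T) (f : ℝ → X) :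
    ∫ t, f t ∂timeMeasure T = ∫ t in (0 : ℝ)..T, f t := by
  rw [intervalIntegral.integral_of_le hT, integral_Ioc_eq_integral_Ioo, timeMeasure]

theorem intervalIntegrable_of_timeMeasure {E : Type*} [NormedAddCommGroup E] {f : ℝ → E} (hf : Integrable f (timeMeasure T))
    {a b : ℝ} (ha : a ∈ Icc 0 T) (hb : b ∈ Icc 0 T) : IntervalIntegrable f volume a b := by
  have h1 : IntegrableOn f (Icc 0 T) := (integrableOn_Icc_iff_integrableOn_Ioo (by simp) (by simp)).2 hf
  exact (h1.mono_set (uIcc_subset_Icc ha hb)).intervalIntegrable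

theorem continuousOn_primitive {g : ℝ → X} (hT : 0 ≤ T) (hg : Integrable g (timeMeasure T)) :
    ContinuousOn (fun t => ∫ s in (0 : ℝ)..t, g s) (Icc 0 T) := by
  have h1 : IntegrableOn g (Icc 0 T) := (integrableOn_Icc_iff_integrableOn_Ioo (by simp) (by simp)).2 hg
  rw [← uIcc_of_le hT] at h1 ⊢
  exact intervalIntegral.continuousOn_primitive_interval h1

theorem IsTest.eq_zero_of_notMem {E : Type*} [NormedAddCommGroup E] [NormedSpace ℝ E] {U : Set E}
    {φ : E → ℝ} (hφ : IsTest U φ) {x : E} (hx : x ∉ U) : φ x = 0 :=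
  image_eq_zero_of_notMem_tsupport fun h => hx (hφ.tsupport_subset h)

theorem IsTest.continuous_deriv {U : Set ℝ} {φ : ℝ → ℝ} (hφ : IsTest U φ) :
    Continuous (deriv φ) := hφ.contDiff.continuous_deriv (by simp)

theorem IsTest.integrable {U : Set ℝ} {φ : ℝ → ℝ} (hφ : IsTest U φ) : Integrable φ :=
  hφ.contDiff.continuous.integrable_of_hasCompactSupport hφ.hasCompactSupport

theorem IsTest.integrable_deriv {U : Set ℝ} {φ : ℝ → ℝ} (hφ : IsTest U φ) :
    Integrable (deriv φ) :=
  hφ.continuous_deriv.integrable_of_hasCompactSupport hφ.hasCompactSupport.deriv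

theorem integrable_smul_of_compact {φ : ℝ → ℝ} (hφ : Continuous φ) (hs : HasCompactSupport φ)
    {G : ℝ → X} {μ : Measure ℝ} (hG : Integrable G μ) : Integrable (fun t => φ t • G t) μ := by
  obtain ⟨B, hB⟩ := hφ.bounded_above_of_compact_support hs
  exact hG.bdd_smul B hφ.aestronglyMeasurable (ae_of_all _ hB)

/-- Fubini on the triangle `s ≤ t`; the inner integral of `deriv φ` over `(s, T)` is `-φ s`, as `φ`
vanishes at `T`. -/
theorem integral_smul_primitive [CompleteSpace X] {g : ℝ → X}
    (hg : Integrable g (timeMeasure T)) {φ : ℝ → ℝ} (hφ : IsTest (Ioo 0 T) φ) :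
    ∫ t, φ t • g t ∂timeMeasure T =
      - ∫ t, deriv φ t • (∫ s in (0 : ℝ)..t, g s) ∂timeMeasure T := by
  have h1 : Integrable (fun p : ℝ × ℝ => deriv φ p.1 • g p.2)
      ((timeMeasure T).prod (timeMeasure T)) := hφ.integrable_deriv.restrict.smul_prod hg
  have h2 : Integrable (Function.uncurry fun t s : ℝ =>
      {p : ℝ × ℝ | p.2 ≤ p.1}.indicator (fun p => deriv φ p.1 • g p.2) (t, s))
      ((timeMeasure T).prod (timeMeasure T)) :=
    h1.indicator (measurableSet_le measurable_snd measurable_fst)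
  have h3 := integral_integral_swap h2
  have h4 : ∀ t ∈ Ioo 0 T, ∫ s, {p : ℝ × ℝ | p.2 ≤ p.1}.indicator
      (fun p => deriv φ p.1 • g p.2) (t, s) ∂timeMeasure T =
        deriv φ t • ∫ s in (0 : ℝ)..t, g s := by
    intro t ht
    have e : (fun s => {p : ℝ × ℝ | p.2 ≤ p.1}.indicator (fun p => deriv φ p.1 • g p.2) (t, s)) =
        (Iic t).indicator fun s => deriv φ t • g s := by
      ext s
      simp [indicator]
    rw [e, integral_indicator measurableSet_Iic, integral_smul, timeMeasure,
      Measure.restrict_restrict measurableSet_Iic, intervalIntegral.integral_of_le ht.1.le]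
    congr 3
    ext s
    exact ⟨fun h => ⟨h.2.1, h.1⟩, fun h => ⟨h.2, h.1, h.2.trans_lt ht.2⟩⟩
  have h5 : ∀ s ∈ Ioo 0 T, ∫ t, {p : ℝ × ℝ | p.2 ≤ p.1}.indicator
      (fun p => deriv φ p.1 • g p.2) (t, s) ∂timeMeasure T = - (φ s • g s) := by
    intro s hs
    have e : (fun t => {p : ℝ × ℝ | p.2 ≤ p.1}.indicator (fun p => deriv φ p.1 • g p.2) (t, s)) =
        (Ici s).indicator fun t => deriv φ t • g s := by
      ext t
      simp [indicator]
    have e2 : Ici s ∩ Ioo 0 T = Ico s T := by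
      ext t
      exact ⟨fun h => ⟨h.1, h.2.2⟩, fun h => ⟨h.1, hs.1.trans_le h.1, h.2⟩⟩
    rw [e, integral_indicator measurableSet_Ici, integral_smul_const, timeMeasure,
      Measure.restrict_restrict measurableSet_Ici, e2, integral_Ico_eq_integral_Ioo,
      ← integral_Ioc_eq_integral_Ioo, ← intervalIntegral.integral_of_le hs.2.le,
      intervalIntegral.integral_deriv_eq_sub
        (fun x _ => hφ.contDiff.differentiable (by simp) x)
        (hφ.continuous_deriv.intervalIntegrable _ _),
      hφ.eq_zero_of_notMem (x := T) (by simp), zero_sub, neg_smul]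
  rw [integral_congr_ae ((ae_mem_timeMeasure T).mono h4),
    integral_congr_ae ((ae_mem_timeMeasure T).mono h5), integral_neg] at h3
  rw [h3, neg_neg]

/-- A test function with vanishing mean is the derivative of a test function. -/
theorem IsTest.exists_deriv_eq {ψ : ℝ → ℝ} (hT : 0 < T) (hψ : IsTest (Ioo 0 T) ψ)
    (h0 : ∫ t, ψ t = 0) : ∃ φ, IsTest (Ioo 0 T) φ ∧ deriv φ = ψ := by
  have hc : Continuous ψ := hψ.contDiff.continuous
  set φ : ℝ → ℝ := fun t => ∫ s in (0 : ℝ)..t, ψ s with hφ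
  have hd : ∀ t, HasDerivAt φ (ψ t) t := fun t =>
    intervalIntegral.integral_hasDerivAt_right (hc.intervalIntegrable _ _)
      (hc.stronglyMeasurableAtFilter _ _) hc.continuousAt
  have hde : deriv φ = ψ := funext fun t => (hd t).deriv
  have hsm : ContDiff ℝ ∞ φ := by
    rw [contDiff_infty_iff_deriv, hde]
    exact ⟨fun t => (hd t).differentiableAt, hψ.contDiff⟩
  obtain ⟨a, b, hab, hsub, habT⟩ : ∃ a b, a ≤ b ∧ tsupport ψ ⊆ Icc a b ∧ Icc a b ⊆ Ioo 0 T := by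
    rcases (tsupport ψ).eq_empty_or_nonempty with he | hne
    · exact ⟨T / 2, T / 2, le_rfl, by simp [he], by
        intro x hx
        constructor <;> linarith [hx.1, hx.2]⟩
    · have hK : IsCompact (tsupport ψ) := hψ.hasCompactSupport
      have h1 := hψ.tsupport_subset (hK.sInf_mem hne)
      have h2 := hψ.tsupport_subset (hK.sSup_mem hne)
      refine ⟨sInf (tsupport ψ), sSup (tsupport ψ), ?_, fun x hx => ⟨csInf_le hK.bddBelow hx,
        le_csSup hK.bddAbove hx⟩, fun x hx => ⟨h1.1.trans_le hx.1, hx.2.trans_lt h2.2⟩⟩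
      obtain ⟨x, hx⟩ := hne
      exact (csInf_le hK.bddBelow hx).trans (le_csSup hK.bddAbove hx)
  have hz : ∀ t, t ∉ Icc a b → ψ t = 0 := fun t ht =>
    image_eq_zero_of_notMem_tsupport fun h => ht (hsub h)
  have ha0 : 0 < a := (habT ⟨le_rfl, hab⟩).1
  -- Before the support nothing has been integrated yet, and after it all of `ψ` has, which gives
  -- the mean value zero.
  have hφz : ∀ t, t ∉ Icc a b → φ t = 0 := by
    intro t ht
    rcases lt_or_ge t a with hta | hta
    · rw [hφ]
      simp only
      rw [intervalIntegral.integral_congr (g := fun _ => (0 : ℝ)), intervalIntegral.integral_zero]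
      intro s hs
      refine hz s fun h => ?_
      have := hs.2
      have h3 : s ≤ max 0 t := hs.2
      rcases le_max_iff.1 h3 with h4 | h4 <;> linarith [h.1]
    · have hbt : b < t := not_le.1 fun h => ht ⟨hta, h⟩
      have h3 : φ t = ∫ s, ψ s := by
        refine intervalIntegral.integral_eq_integral_of_support_subset fun s hs => ?_
        have h4 : s ∈ Icc a b := by_contra fun h => hs (hz s h)
        exact ⟨ha0.trans_le h4.1, h4.2.trans hbt.le⟩
      rw [h3, h0]
  have hts : tsupport φ ⊆ Icc a b := closure_minimal
    (fun t ht => by_contra fun h => ht (hφz t h)) isClosed_Icc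
  exact ⟨φ, ⟨hsm, HasCompactSupport.of_support_subset_isCompact isCompact_Icc
    ((subset_tsupport φ).trans hts), hts.trans habT⟩, hde⟩

theorem exists_test_integral_eq_one (hT : 0 < T) :
    ∃ ψ, IsTest (Ioo 0 T) ψ ∧ ∫ t, ψ t = 1 := by
  let f : ContDiffBump (T / 2) := ⟨T / 8, T / 4, by positivity, by linarith⟩
  refine ⟨f.normed volume, ⟨f.contDiff_normed, f.hasCompactSupport_normed, ?_⟩,
    f.integral_normed⟩
  rw [f.tsupport_normed_eq, Real.closedBall_eq_Icc]
  intro x hx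
  have h1 : T / 2 - T / 4 ≤ x := hx.1
  have h2 : x ≤ T / 2 + T / 4 := hx.2
  constructor <;> linarith

/-- The lemma of du Bois-Reymond. -/
theorem IsWeakTimeDeriv.exists_eq_primitive [CompleteSpace X] {f g : ℝ → X} (hT : 0 < T)
    (hfg : IsWeakTimeDeriv T f g) :
    ∃ c, ∀ᵐ t ∂timeMeasure T, f t = c + ∫ s in (0 : ℝ)..t, g s := by
  have hgi : Integrable g (timeMeasure T) := hfg.memLp_deriv.integrable (by simp)
  have hfi : Integrable f (timeMeasure T) := hfg.memLp.integrable (by simp)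
  set F : ℝ → X := fun t => f t - ∫ s in (0 : ℝ)..t, g s with hF
  have hPi : Integrable (fun t => ∫ s in (0 : ℝ)..t, g s) (timeMeasure T) :=
    ((continuousOn_primitive hT.le hgi).integrableOn_Icc).mono_set Ioo_subset_Icc_self
  have hFi : Integrable F (timeMeasure T) := hfi.sub hPi
  have hbd : ∀ φ : ℝ → ℝ, Continuous φ → HasCompactSupport φ → ∀ G : ℝ → X,
      Integrable G (timeMeasure T) → Integrable (fun t => φ t • G t) (timeMeasure T) :=
    fun φ hφ hs G hG => integrable_smul_of_compact hφ hs hG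
  have h1 : ∀ φ, IsTest (Ioo 0 T) φ → ∫ t, deriv φ t • F t ∂timeMeasure T = 0 := by
    intro φ hφ
    have h2 := hfg.integral_eq φ hφ
    have h3 := integral_smul_primitive hgi hφ
    simp only [hF, smul_sub]
    rw [integral_sub (hbd _ hφ.continuous_deriv hφ.hasCompactSupport.deriv _ hfi)
      (hbd _ hφ.continuous_deriv hφ.hasCompactSupport.deriv _ hPi), sub_eq_zero]
    exact neg_injective (h2.symm.trans h3)
  obtain ⟨ψ₀, hψ₀, hone⟩ := exists_test_integral_eq_one hT
  set c := ∫ t, ψ₀ t • F t ∂timeMeasure T with hc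
  -- Subtracting `(∫ ψ) ψ₀` from `ψ` gives mean zero, hence the derivative of a test function; so
  -- `F` is tested to zero up to the constant `c`.
  have h2 : ∀ ψ, IsTest (Ioo 0 T) ψ → ∫ t, ψ t • (F t - c) ∂timeMeasure T = 0 := by
    intro ψ hψ
    have hm : IsTest (Ioo 0 T) (ψ - (∫ t, ψ t) • ψ₀) :=
      ⟨hψ.contDiff.sub (contDiff_const.smul hψ₀.contDiff), hψ.hasCompactSupport.sub
        (hψ₀.hasCompactSupport.smul_left (f := fun _ => ∫ t, ψ t)),
        (tsupport_sub _ _).trans (union_subset hψ.tsupport_subset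
          ((tsupport_smul_subset_right (fun _ => ∫ t, ψ t) ψ₀).trans hψ₀.tsupport_subset))⟩
    have hm0 : ∫ t, (ψ - (∫ t, ψ t) • ψ₀) t = 0 := by
      simp only [Pi.sub_apply, Pi.smul_apply, smul_eq_mul]
      rw [integral_sub hψ.integrable (hψ₀.integrable.const_mul _), integral_const_mul, hone,
        mul_one, sub_self]
    obtain ⟨φ, hφ, hφψ⟩ := hm.exists_deriv_eq hT hm0
    have h3 := h1 φ hφ
    rw [hφψ] at h3
    simp only [Pi.sub_apply, Pi.smul_apply, smul_eq_mul, sub_smul, mul_smul] at h3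
    have hi1 := hbd ψ hψ.contDiff.continuous hψ.hasCompactSupport F hFi
    have hi2 := hbd ψ₀ hψ₀.contDiff.continuous hψ₀.hasCompactSupport F hFi
    have hi3 : Integrable (fun t => (∫ t, ψ t) • ψ₀ t • F t) (timeMeasure T) := hi2.smul _
    rw [integral_sub hi1 hi3, integral_smul, ← hc] at h3
    have hψi : Integrable ψ (timeMeasure T) := hψ.integrable.restrict
    have e : ∫ t, ψ t ∂timeMeasure T = ∫ t, ψ t :=
      setIntegral_eq_integral_of_forall_compl_eq_zero fun t ht => hψ.eq_zero_of_notMem ht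
    simp only [smul_sub]
    rw [integral_sub hi1 (hψi.smul_const c), integral_smul_const, e]
    exact h3
  have hFc : Integrable (fun t => F t - c) (timeMeasure T) := hFi.sub (integrable_const c)
  have h3 := isOpen_Ioo.ae_eq_zero_of_integral_contDiff_smul_eq_zero (μ := timeMeasure T)
    (f := fun t => F t - c) (U := Ioo 0 T) (hFc.locallyIntegrable.locallyIntegrableOn _)
    fun ψ h1 h4 h5 => h2 ψ ⟨h1, h4, h5⟩
  refine ⟨c, ?_⟩
  filter_upwards [h3, ae_mem_timeMeasure T] with t ht htT
  have h6 : f t - (∫ s in (0 : ℝ)..t, g s) - c = 0 := ht htT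
  rw [sub_sub, sub_eq_zero, add_comm] at h6
  exact h6

end

end SpaceTime
end

noncomputable section
namespace SpaceTime
open Filter Topology

/-! ## Interpolation in time -/

section

variable {X Y : Type*} [NormedAddCommGroup X] [NormedSpace ℝ X] [NormedAddCommGroup Y]
  [NormedSpace ℝ Y] {T h : ℝ} {N : ℕ}

/-- The slope of the piecewise affine interpolant in time. -/
def timeSlope (h : ℝ) (u : ℝ → X) (t : ℝ) : X :=
  h⁻¹ • (u ((⌊t / h⌋₊ + 1) * h) - u (⌊t / h⌋₊ * h))

theorem timeSlope_sub (u p : ℝ → X) (t : ℝ) :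
    timeSlope h (fun t => u t - p t) t = timeSlope h u t - timeSlope h p t := by
  simp only [timeSlope, smul_sub]
  abel

theorem map_timeInterp (L : X →L[ℝ] Y) (u : ℝ → X) (t : ℝ) :
    L (timeInterp h u t) = timeInterp h (fun t => L (u t)) t := by
  simp only [timeInterp, map_add, map_smul]

theorem floor_mul_le (hh : 0 < h) {t : ℝ} (ht : 0 ≤ t) : (⌊t / h⌋₊ : ℝ) * h ≤ t :=
  (le_div_iff₀ hh).1 (Nat.floor_le (by positivity))

theorem lt_floor_add_one_mul (hh : 0 < h) (t : ℝ) : t < ((⌊t / h⌋₊ : ℝ) + 1) * h :=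
  (div_lt_iff₀ hh).1 (Nat.lt_floor_add_one _)

theorem floor_add_one_mul_le (hh : 0 < h) (hN : N * h = T) {t : ℝ} (ht : t ∈ Ico 0 T) :
    ((⌊t / h⌋₊ : ℝ) + 1) * h ≤ T := by
  have h1 : ⌊t / h⌋₊ < N := by
    rw [Nat.floor_lt (div_nonneg ht.1 hh.le), div_lt_iff₀ hh, hN]
    exact ht.2
  rw [← hN]
  exact mul_le_mul_of_nonneg_right (by exact_mod_cast h1) hh.le

theorem floor_eq_of_mem (hh : 0 < h) {k : ℕ} {t : ℝ} (ht : t ∈ Ico (k * h) ((k + 1) * h)) :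
    ⌊t / h⌋₊ = k := by
  rw [Nat.floor_eq_iff (div_nonneg ((by positivity : (0 : ℝ) ≤ k * h).trans ht.1) hh.le),
    le_div_iff₀ hh, div_lt_iff₀ hh]
  exact ht

/-- The interpolant on the closed cells. -/
theorem timeInterp_eq (hh : 0 < h) (u : ℝ → X) {k : ℕ} {t : ℝ}
    (ht : t ∈ Icc (k * h) ((k + 1) * h)) : timeInterp h u t =
      (((k + 1) * h - t) / h) • u (k * h) + ((t - k * h) / h) • u ((k + 1) * h) := by
  rcases ht.2.lt_or_eq with h1 | h1
  · rw [timeInterp, floor_eq_of_mem hh ⟨ht.1, h1⟩]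
  -- At the right end point the floor already selects the next cell; its left node has weight one
  -- and the node after it weight zero. So the final time is harmless, although a node beyond `T`
  -- appears in the formula.
  · have h2 : ⌊t / h⌋₊ = k + 1 := by
      rw [h1, mul_div_cancel_right₀ _ hh.ne']
      exact_mod_cast Nat.floor_natCast (k + 1)
    have e1 : (((k : ℝ) + 1 + 1) * h - (k + 1) * h) / h = 1 := by
      rw [← sub_mul, mul_div_cancel_right₀ _ hh.ne']
      ring
    have e2 : (((k : ℝ) + 1) * h - k * h) / h = 1 := by
      rw [← sub_mul, mul_div_cancel_right₀ _ hh.ne']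
      ring
    rw [timeInterp, h2, h1]
    push_cast
    rw [e1, e2]
    simp

theorem exists_cell (hh : 0 < h) (hN0 : 0 < N) {t : ℝ} (ht : t ∈ Icc 0 (N * h)) :
    ∃ k < N, t ∈ Icc (k * h) ((k + 1) * h) := by
  rcases ht.2.lt_or_eq with h1 | h1
  · refine ⟨⌊t / h⌋₊, ?_, floor_mul_le hh ht.1, (lt_floor_add_one_mul hh t).le⟩
    rw [Nat.floor_lt (div_nonneg ht.1 hh.le), div_lt_iff₀ hh]
    exact h1
  · refine ⟨N - 1, by omega, ?_⟩
    have e : ((N - 1 : ℕ) : ℝ) = N - 1 := by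
      rw [Nat.cast_sub hN0, Nat.cast_one]
    rw [e, h1, sub_add_cancel]
    exact ⟨mul_le_mul_of_nonneg_right (by linarith) hh.le, le_rfl⟩

theorem timeInterp_mem {u : ℝ → X} {V : Submodule ℝ X}
    (hV : ∀ t, u t ∈ V) (t : ℝ) : timeInterp h u t ∈ V :=
  V.add_mem (V.smul_mem _ (hV _)) (V.smul_mem _ (hV _))

theorem continuousOn_timeInterp (hh : 0 < h) (hN0 : 0 < N) (u : ℝ → X) :
    ContinuousOn (timeInterp h u) (Icc 0 (N * h)) := by
  have h1 : ContinuousOn (timeInterp h u) (⋃ k : Fin N, Icc ((k : ℕ) * h) (((k : ℕ) + 1) * h)) := by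
    refine (locallyFinite_of_finite _).continuousOn_iUnion (fun _ => isClosed_Icc) fun k => ?_
    have h2 : ContinuousOn (fun t : ℝ => ((((k : ℕ) + 1) * h - t) / h) • u ((k : ℕ) * h) +
        ((t - (k : ℕ) * h) / h) • u (((k : ℕ) + 1) * h)) (Icc ((k : ℕ) * h) (((k : ℕ) + 1) * h)) := by
      fun_prop
    exact h2.congr fun t ht => timeInterp_eq hh u ht
  refine h1.mono fun t ht => ?_
  obtain ⟨k, hk, hkt⟩ := exists_cell hh hN0 ht
  exact mem_iUnion.2 ⟨⟨k, hk⟩, hkt⟩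

theorem timeInterp_mem_timeP1 (hh : 0 < h) (hN0 : 0 < N) {u : ℝ → X} {V : Submodule ℝ X}
    (hV : ∀ t, u t ∈ V) : timeInterp h u ∈ timeP1 h N V := by
  refine ⟨continuousOn_timeInterp hh hN0 u, fun t _ => timeInterp_mem hV t, fun k _ => ?_⟩
  refine ⟨(k + 1 : ℝ) • u (k * h) - (k : ℝ) • u ((k + 1) * h),
    h⁻¹ • (u ((k + 1) * h) - u (k * h)), fun t ht => ?_⟩
  rw [timeInterp_eq hh u ht]
  have e1 : ((k + 1) * h - t) / h = (k + 1 : ℝ) - t * h⁻¹ := by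
    field_simp
  have e2 : (t - k * h) / h = t * h⁻¹ - (k : ℝ) := by
    field_simp
  rw [e1, e2]
  module

theorem stronglyMeasurable_timeInterp (h : ℝ) (u : ℝ → X) : StronglyMeasurable (timeInterp h u) := by
  have hf : Measurable fun t : ℝ => ⌊t / h⌋₊ := Nat.measurable_floor.comp (by fun_prop)
  have hfc : Measurable fun t : ℝ => (⌊t / h⌋₊ : ℝ) := measurable_from_nat.comp hf
  have h1 : StronglyMeasurable fun t : ℝ => u (⌊t / h⌋₊ * h) :=
    (StronglyMeasurable.of_discrete (f := fun k : ℕ => u (k * h))).comp_measurable hf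
  have h2 : StronglyMeasurable fun t : ℝ => u ((⌊t / h⌋₊ + 1) * h) :=
    (StronglyMeasurable.of_discrete (f := fun k : ℕ => u ((k + 1) * h))).comp_measurable hf
  have c1 : Measurable fun t : ℝ => ((⌊t / h⌋₊ + 1) * h - t) / h := by fun_prop
  have c2 : Measurable fun t : ℝ => (t - ⌊t / h⌋₊ * h) / h := by fun_prop
  exact (c1.stronglyMeasurable.smul h1).add (c2.stronglyMeasurable.smul h2)

theorem stronglyMeasurable_timeSlope (h : ℝ) (u : ℝ → X) : StronglyMeasurable (timeSlope h u) := by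
  have hf : Measurable fun t : ℝ => ⌊t / h⌋₊ := Nat.measurable_floor.comp (by fun_prop)
  have h1 : StronglyMeasurable fun t : ℝ => u (⌊t / h⌋₊ * h) :=
    (StronglyMeasurable.of_discrete (f := fun k : ℕ => u (k * h))).comp_measurable hf
  have h2 : StronglyMeasurable fun t : ℝ => u ((⌊t / h⌋₊ + 1) * h) :=
    (StronglyMeasurable.of_discrete (f := fun k : ℕ => u ((k + 1) * h))).comp_measurable hf
  exact (h2.sub h1).const_smul _

/-- The nodes next to a point of the time interval. -/
theorem node_mem (hh : 0 < h) (hN : N * h = T) {t : ℝ} (ht : t ∈ Ico 0 T) :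
    ((⌊t / h⌋₊ : ℝ) * h) ∈ Icc 0 T ∧ ((⌊t / h⌋₊ : ℝ) + 1) * h ∈ Icc 0 T :=
  ⟨⟨by positivity, (floor_mul_le hh ht.1).trans ht.2.le⟩, by positivity,
    floor_add_one_mul_le hh hN ht⟩

/-- The interpolant is a convex combination of nodal values. -/
theorem norm_sub_timeInterp_le (hh : 0 < h) {u : ℝ → X} {t R : ℝ} (ht : 0 ≤ t) {x : X}
    (ha : ‖x - u (⌊t / h⌋₊ * h)‖ ≤ R) (hb : ‖x - u ((⌊t / h⌋₊ + 1) * h)‖ ≤ R) :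
    ‖x - timeInterp h u t‖ ≤ R := by
  set a : ℝ := ⌊t / h⌋₊ * h with hadef
  set b : ℝ := (⌊t / h⌋₊ + 1) * h with hbdef
  have e : (b - t) / h + (t - a) / h = 1 := by
    rw [← add_div, hadef, hbdef, div_eq_one_iff_eq hh.ne']
    ring
  have h1 : 0 ≤ (b - t) / h := div_nonneg (sub_nonneg.2 (lt_floor_add_one_mul hh t).le) hh.le
  have h2 : 0 ≤ (t - a) / h := div_nonneg (sub_nonneg.2 (floor_mul_le hh ht)) hh.le
  have e1 : x - timeInterp h u t = ((b - t) / h) • (x - u a) + ((t - a) / h) • (x - u b) := by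
    rw [smul_sub, smul_sub, sub_add_sub_comm, ← add_smul, e, one_smul]
    rfl
  rw [e1]
  refine (norm_add_le _ _).trans ?_
  rw [norm_smul, norm_smul, Real.norm_of_nonneg h1, Real.norm_of_nonneg h2]
  calc _ ≤ (b - t) / h * R + (t - a) / h * R :=
        add_le_add (mul_le_mul_of_nonneg_left ha h1) (mul_le_mul_of_nonneg_left hb h2)
    _ = R := by rw [← add_mul, e, one_mul]

theorem norm_timeInterp_le (hh : 0 < h) (hN : N * h = T) {z : ℝ → X} {B : ℝ}
    (hz : ∀ t ∈ Icc 0 T, ‖z t‖ ≤ B) {t : ℝ} (ht : t ∈ Ico 0 T) : ‖timeInterp h z t‖ ≤ B := by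
  obtain ⟨ha, hb⟩ := node_mem hh hN ht
  have := norm_sub_timeInterp_le (x := (0 : X)) (u := z) (R := B) hh ht.1
    (by simpa using hz _ ha) (by simpa using hz _ hb)
  simpa using this

theorem norm_timeSlope_le (hh : 0 < h) (hN : N * h = T) {z : ℝ → X} {B : ℝ}
    (hz : ∀ t ∈ Icc 0 T, ‖z t‖ ≤ B) {t : ℝ} (ht : t ∈ Ico 0 T) :
    ‖timeSlope h z t‖ ≤ 2 * B / h := by
  obtain ⟨ha, hb⟩ := node_mem hh hN ht
  rw [timeSlope, norm_smul, norm_inv, Real.norm_of_nonneg hh.le, inv_mul_eq_div]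
  gcongr
  exact (norm_sub_le _ _).trans (by linarith [hz _ ha, hz _ hb])

/-! ### The derivative of the interpolant -/

/-- At the nodes there is only a one-sided derivative. Together with continuity, this is enough for
the integration by parts in `isWeakTimeDeriv_timeInterp`. -/
theorem hasDerivWithinAt_timeInterp (hh : 0 < h) (u : ℝ → X) {t : ℝ} (ht : 0 ≤ t) :
    HasDerivWithinAt (timeInterp h u) (timeSlope h u t) (Ioi t) t := by
  set k := ⌊t / h⌋₊ with hk
  have h1 : HasDerivAt (fun t : ℝ => (((k + 1) * h - t) / h) • u (k * h) +
      ((t - k * h) / h) • u ((k + 1) * h)) (timeSlope h u t) t := by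
    have h2 : HasDerivAt (fun t : ℝ => (((k : ℝ) + 1) * h - t) / h) (-1 / h) t :=
      ((hasDerivAt_id t).const_sub _).div_const h
    have h3 : HasDerivAt (fun t : ℝ => (t - (k : ℝ) * h) / h) (1 / h) t :=
      ((hasDerivAt_id t).sub_const _).div_const h
    have e : timeSlope h u t = (-1 / h) • u (k * h) + (1 / h) • u ((k + 1) * h) := by
      rw [neg_div, one_div]
      change h⁻¹ • (u ((k + 1) * h) - u (k * h)) = _
      module
    rw [e]
    exact (h2.smul_const (u (k * h))).add (h3.smul_const (u ((k + 1) * h)))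
  have h4 : timeInterp h u =ᶠ[𝓝[Ioi t] t] fun t : ℝ => (((k + 1) * h - t) / h) • u (k * h) +
      ((t - k * h) / h) • u ((k + 1) * h) := by
    filter_upwards [self_mem_nhdsWithin,
      nhdsWithin_le_nhds (Iio_mem_nhds (lt_floor_add_one_mul hh t))] with s hs1 hs2
    exact timeInterp_eq hh u ⟨(floor_mul_le hh ht).trans (le_of_lt hs1), le_of_lt hs2⟩
  exact h1.hasDerivWithinAt.congr_of_eventuallyEq h4
    (timeInterp_eq hh u ⟨floor_mul_le hh ht, (lt_floor_add_one_mul hh t).le⟩)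

theorem exists_node_bound {E : Type*} [NormedAddCommGroup E] (u : ℝ → E) (h : ℝ) (N : ℕ) :
    ∃ B, ∀ k : ℕ, k ≤ N → ‖u (k * h)‖ ≤ B := by
  obtain ⟨B, hB⟩ := ((Finset.range (N + 1)).image fun k : ℕ => ‖u (k * h)‖).exists_le
  exact ⟨B, fun k hk => hB _ (Finset.mem_image_of_mem _ (Finset.mem_range.2 (by omega)))⟩

theorem memLp_timeSlope (hh : 0 < h) (hN : N * h = T) (u : ℝ → X) (p : ℝ≥0∞) :
    MemLp (timeSlope h u) p (timeMeasure T) := by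
  obtain ⟨B, hB⟩ := exists_node_bound u h N
  refine MemLp.of_bound (stronglyMeasurable_timeSlope h u).aestronglyMeasurable (2 * B / h) ?_
  filter_upwards [ae_mem_timeMeasure T] with t ht
  have h1 : ⌊t / h⌋₊ < N := by
    rw [Nat.floor_lt (div_nonneg ht.1.le hh.le), div_lt_iff₀ hh, hN]
    exact ht.2
  rw [timeSlope, norm_smul, norm_inv, Real.norm_of_nonneg hh.le, inv_mul_eq_div]
  gcongr
  have h2 := hB _ h1.le
  have h3 := hB (⌊t / h⌋₊ + 1) h1
  push_cast at h3
  exact (norm_sub_le _ _).trans (by linarith)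

theorem isWeakTimeDeriv_timeInterp [CompleteSpace X] (hh : 0 < h) (hN0 : 0 < N) (hN : N * h = T)
    (u : ℝ → X) : IsWeakTimeDeriv T (timeInterp h u) (timeSlope h u) := by
  have hT : 0 ≤ T := by rw [← hN]; positivity
  have hc : ContinuousOn (timeInterp h u) (uIcc 0 T) := by
    rw [uIcc_of_le hT, ← hN]
    exact continuousOn_timeInterp hh hN0 u
  have hm := memLp_timeSlope hh hN u 2
  refine ⟨?_, hm, fun φ hφ => ?_⟩
  · obtain ⟨B, hB⟩ := isCompact_uIcc.exists_bound_of_continuousOn hc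
    refine MemLp.of_bound (stronglyMeasurable_timeInterp h u).aestronglyMeasurable B ?_
    filter_upwards [ae_mem_timeMeasure T] with t ht
    refine hB t ?_
    rw [uIcc_of_le hT]
    exact Ioo_subset_Icc_self ht
  · rw [integral_timeMeasure_eq hT, integral_timeMeasure_eq hT]
    have h1 := intervalIntegral.integral_smul_deriv_eq_deriv_smul_of_hasDeriv_right
      (u := φ) (u' := deriv φ) hφ.contDiff.continuous.continuousOn hc
      (fun x _ => ((hφ.contDiff.differentiable (by simp) x).hasDerivAt).hasDerivWithinAt)
      (fun x hx => hasDerivWithinAt_timeInterp hh u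
        (by rw [min_eq_left hT] at hx; exact hx.1.le))
      (hφ.continuous_deriv.intervalIntegrable _ _)
      (intervalIntegrable_of_timeMeasure (hm.integrable (by simp)) ⟨le_rfl, hT⟩ ⟨hT, le_rfl⟩)
    rw [h1, hφ.eq_zero_of_notMem (x := T) (by simp), hφ.eq_zero_of_notMem (x := 0) (by simp)]
    simp

/-! ### Errors -/

/-- The oscillation of a primitive. -/
theorem norm_primitive_sub_le {g : ℝ → X} (hg : Integrable g (timeMeasure T)) (c : X)
    {t s : ℝ} (ht : t ∈ Icc 0 T) (hs : s ∈ Icc 0 T) (hts : |s - t| ≤ h) :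
    ‖(c + ∫ r in (0 : ℝ)..t, g r) - (c + ∫ r in (0 : ℝ)..s, g r)‖ ≤
      ∫ r in Metric.closedBall t h, ‖g r‖ ∂timeMeasure T := by
  have h0 : (0 : ℝ) ∈ Icc 0 T := ⟨le_rfl, ht.1.trans ht.2⟩
  rw [add_sub_add_left_eq_sub, intervalIntegral.integral_interval_sub_left
    (intervalIntegrable_of_timeMeasure hg h0 ht) (intervalIntegrable_of_timeMeasure hg h0 hs)]
  refine intervalIntegral.norm_integral_le_integral_norm_uIoc.trans ?_
  have h1 : uIoc s t ⊆ Icc 0 T ∩ Metric.closedBall t h := by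
    intro r hr
    have hr' := uIoc_subset_uIcc hr
    refine ⟨uIcc_subset_Icc hs ht hr', ?_⟩
    rw [Metric.mem_closedBall, Real.dist_eq]
    rw [abs_sub_comm]
    refine (abs_sub_right_of_mem_uIcc hr').trans ?_
    rwa [abs_sub_comm]
  have h2 : IntegrableOn (fun r => ‖g r‖) (Icc 0 T) :=
    (integrableOn_Icc_iff_integrableOn_Ioo (by simp) (by simp)).2 hg.norm
  rw [timeMeasure, Measure.restrict_restrict Metric.isClosed_closedBall.measurableSet]
  refine (setIntegral_mono_set (h2.mono_set inter_subset_left) (ae_of_all _ fun r => norm_nonneg _)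
    h1.eventuallyLE).trans (le_of_eq ?_)
  refine setIntegral_congr_set ?_
  rw [inter_comm]
  exact (ae_eq_refl _).inter Ioo_ae_eq_Icc.symm

theorem enorm_le_of_norm_le_integral {E F : Type*} [NormedAddCommGroup E]
    [NormedAddCommGroup F] {g : ℝ → E} (hg : Integrable g (timeMeasure T)) {y : F}
    {A : Set ℝ} (h : ‖y‖ ≤ ∫ r in A, ‖g r‖ ∂timeMeasure T) :
    ‖y‖ₑ ≤ ∫⁻ r in A, ‖g r‖ₑ ∂timeMeasure T := by
  rw [← ofReal_integral_norm_eq_lintegral_enorm hg.restrict, ← ofReal_norm]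
  exact ENNReal.ofReal_le_ofReal h

theorem abs_node_sub_le (hh : 0 < h) {t : ℝ} (ht : 0 ≤ t) :
    |(⌊t / h⌋₊ : ℝ) * h - t| ≤ h ∧ |((⌊t / h⌋₊ : ℝ) + 1) * h - t| ≤ h := by
  have h1 := floor_mul_le hh ht
  have h2 := lt_floor_add_one_mul hh t
  constructor <;> rw [abs_le] <;> constructor <;> linarith

/-- The interpolant is a convex combination of values at two nodes within distance `h` of `t`, so
the error is bounded by the oscillation of `W` on that window. -/
theorem eLpNorm_sub_timeInterp_le (hh : 0 < h) (hN : N * h = T) {g : ℝ → X} (c : X)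
    (hg : MemLp g 2 (timeMeasure T)) {W : ℝ → X}
    (hW : ∀ t ∈ Icc 0 T, W t = c + ∫ s in (0 : ℝ)..t, g s) :
    eLpNorm (fun t => W t - timeInterp h W t) 2 (timeMeasure T) ≤
      ENNReal.ofReal (2 * h) * eLpNorm g 2 (timeMeasure T) := by
  have hgi : Integrable g (timeMeasure T) := hg.integrable (by simp)
  refine eLpNorm_le_of_window hg.1 ?_
  filter_upwards [ae_mem_timeMeasure T] with t ht
  have ht' := Ioo_subset_Ico_self ht
  have ht'' := Ioo_subset_Icc_self ht
  obtain ⟨ha, hb⟩ := node_mem hh hN ht'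
  obtain ⟨ha', hb'⟩ := abs_node_sub_le hh ht.1.le
  refine enorm_le_of_norm_le_integral hgi (norm_sub_timeInterp_le hh ht.1.le ?_ ?_)
  · rw [hW t ht'', hW _ ha]
    exact norm_primitive_sub_le hgi c ht'' ha ha'
  · rw [hW t ht'', hW _ hb]
    exact norm_primitive_sub_le hgi c ht'' hb hb'

/-- The slope is the mean of `W` over the time step, and all of the step is within distance `h` of
`t`. -/
theorem eLpNorm_sub_timeSlope_le [CompleteSpace X] (hh : 0 < h) (hN : N * h = T) {g : ℝ → X}
    (c c' : X) (hg : MemLp g 2 (timeMeasure T)) {V W : ℝ → X}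
    (hW : ∀ t ∈ Icc 0 T, W t = c + ∫ s in (0 : ℝ)..t, g s)
    (hV : ∀ t ∈ Icc 0 T, V t = c' + ∫ s in (0 : ℝ)..t, W s) :
    eLpNorm (fun t => W t - timeSlope h V t) 2 (timeMeasure T) ≤
      ENNReal.ofReal (2 * h) * eLpNorm g 2 (timeMeasure T) := by
  have hgi : Integrable g (timeMeasure T) := hg.integrable (by simp)
  refine eLpNorm_le_of_window hg.1 ?_
  filter_upwards [ae_mem_timeMeasure T] with t ht
  have hT : 0 ≤ T := ht.1.le.trans ht.2.le
  have ht' := Ioo_subset_Ico_self ht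
  have ht'' := Ioo_subset_Icc_self ht
  have hWc : ContinuousOn W (Icc 0 T) :=
    (continuousOn_const.add (continuousOn_primitive hT hgi)).congr hW
  have hWi : ∀ a ∈ Icc 0 T, ∀ b ∈ Icc 0 T, IntervalIntegrable W volume a b := fun a ha b hb =>
    (hWc.mono (uIcc_subset_Icc ha hb)).intervalIntegrable
  obtain ⟨ha, hb⟩ := node_mem hh hN ht'
  have hat := floor_mul_le hh ht.1.le
  have htb := (lt_floor_add_one_mul hh t).le
  refine enorm_le_of_norm_le_integral hgi ?_
  rw [timeSlope, hV _ ha, hV _ hb]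
  have h0 : (0 : ℝ) ∈ Icc 0 T := ⟨le_rfl, hT⟩
  set a : ℝ := (⌊t / h⌋₊ : ℝ) * h with hadef
  set b : ℝ := ((⌊t / h⌋₊ : ℝ) + 1) * h with hbdef
  have hba : b - a = h := by
    rw [hadef, hbdef]
    ring
  rw [add_sub_add_left_eq_sub, intervalIntegral.integral_interval_sub_left (hWi 0 h0 b hb)
    (hWi 0 h0 a ha)]
  have e : W t - h⁻¹ • ∫ s in a..b, W s = h⁻¹ • ∫ s in a..b, (W t - W s) := by
    rw [intervalIntegral.integral_sub (by simp) (hWi a ha b hb), intervalIntegral.integral_const,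
      hba, smul_sub, smul_smul, inv_mul_cancel₀ hh.ne', one_smul]
  rw [e, norm_smul, norm_inv, Real.norm_of_nonneg hh.le, inv_mul_le_iff₀ hh, mul_comm]
  have h1 := intervalIntegral.norm_integral_le_of_norm_le_const (a := a) (b := b)
    (f := fun s => W t - W s) (C := ∫ r in Metric.closedBall t h, ‖g r‖ ∂timeMeasure T) ?_
  · rwa [hba, abs_of_pos hh] at h1
  · intro s hs
    rw [uIoc_of_le (hat.trans htb)] at hs
    have hsT : s ∈ Icc 0 T := ⟨ha.1.trans hs.1.le, hs.2.trans hb.2⟩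
    rw [hW t ht'', hW s hsT]
    refine norm_primitive_sub_le hgi c ht'' hsT ?_
    rw [abs_le]
    constructor <;> linarith [hs.1, hs.2]

end

end SpaceTime
end

noncomputable section
namespace SpaceTime
open Filter Topology

/-! ## Space-time errors -/

section

variable {X Y Z : Type*} {T h : ℝ} {N : ℕ}

/-- Interpolation evaluates at the nodes, which form a null set. A property that holds almost
everywhere holds on a dense set of times, so by continuity every value is a limit of values that
have it. -/
theorem exists_seq_of_ae [TopologicalSpace Y] (hT : 0 < T) {e : ℝ → Y}
    (he : ContinuousOn e (Icc 0 T)) {P : Y → Prop} (hP : ∀ᵐ t ∂timeMeasure T, P (e t)) {t : ℝ}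
    (ht : t ∈ Icc 0 T) : ∃ x : ℕ → Y, (∀ n, P (x n)) ∧ Tendsto x atTop (𝓝 (e t)) := by
  have h1 : ∀ᵐ t : ℝ, t ∈ Ioo 0 T → P (e t) := (ae_restrict_iff' measurableSet_Ioo).1 hP
  have h2 : Dense {t : ℝ | t ∈ Ioo 0 T → P (e t)} := Measure.dense_of_ae h1
  have h3 : t ∈ closure (Ioo 0 T ∩ {t : ℝ | t ∈ Ioo 0 T → P (e t)}) := by
    rw [← closure_Ioo hT.ne] at ht
    exact closure_minimal (h2.open_subset_closure_inter isOpen_Ioo) isClosed_closure ht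
  obtain ⟨s, hs, hst⟩ := mem_closure_iff_seq_limit.1 h3
  refine ⟨fun n => e (s n), fun n => (hs n).2 (hs n).1, (he t ht).tendsto.comp ?_⟩
  exact tendsto_nhdsWithin_iff.2 ⟨hst, Eventually.of_forall fun n => Ioo_subset_Icc_self (hs n).1⟩

variable [NormedAddCommGroup X] [NormedAddCommGroup Y] [NormedAddCommGroup Z]

theorem eqOn_of_ae (hT : 0 < T) {f g : ℝ → Y} (hf : ContinuousOn f (Icc 0 T))
    (hg : ContinuousOn g (Icc 0 T)) (hfg : ∀ᵐ t ∂timeMeasure T, f t = g t) :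
    ∀ t ∈ Icc 0 T, f t = g t := by
  intro t ht
  obtain ⟨x, hx, hxt⟩ := exists_seq_of_ae hT (hf.sub hg) (P := fun y => y = 0)
    (hfg.mono fun t ht => sub_eq_zero.2 ht) ht
  have h1 : x = fun _ => 0 := funext hx
  rw [h1] at hxt
  exact sub_eq_zero.1 (tendsto_nhds_unique hxt tendsto_const_nhds)

theorem norm_le_of_ae (hT : 0 < T) {e : ℝ → Y} (he : ContinuousOn e (Icc 0 T)) {B : ℝ}
    (hB : ∀ᵐ t ∂timeMeasure T, ‖e t‖ ≤ B) : ∀ t ∈ Icc 0 T, ‖e t‖ ≤ B := by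
  intro t ht
  obtain ⟨x, hx, hxt⟩ := exists_seq_of_ae hT he (P := fun y => ‖y‖ ≤ B) hB ht
  exact le_of_tendsto hxt.norm (Eventually.of_forall hx)

variable [NormedSpace ℝ X] [NormedSpace ℝ Y]

theorem IsWeakTimeDeriv.sub {f g f' g' : ℝ → X} (hf : IsWeakTimeDeriv T f f')
    (hg : IsWeakTimeDeriv T g g') :
    IsWeakTimeDeriv T (fun t => f t - g t) (fun t => f' t - g' t) := by
  refine ⟨hf.memLp.sub hg.memLp, hf.memLp_deriv.sub hg.memLp_deriv, fun φ hφ => ?_⟩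
  have hi : ∀ {k : ℝ → X}, MemLp k 2 (timeMeasure T) →
      Integrable (fun t => φ t • k t) (timeMeasure T) ∧
        Integrable (fun t => deriv φ t • k t) (timeMeasure T) := fun hk =>
    ⟨integrable_smul_of_compact hφ.contDiff.continuous hφ.hasCompactSupport
      (hk.integrable (by simp)),
      integrable_smul_of_compact hφ.continuous_deriv hφ.hasCompactSupport.deriv
        (hk.integrable (by simp))⟩
  simp only [smul_sub]
  rw [integral_sub (hi hf.memLp_deriv).1 (hi hg.memLp_deriv).1,
    integral_sub (hi hf.memLp).2 (hi hg.memLp).2, hf.integral_eq φ hφ, hg.integral_eq φ hφ]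
  abel

theorem IsWeakTimeDeriv.congr_left {f f₁ g : ℝ → X} (hf : IsWeakTimeDeriv T f g)
    (h : ∀ᵐ t ∂timeMeasure T, f t = f₁ t) : IsWeakTimeDeriv T f₁ g := by
  refine ⟨hf.memLp.ae_eq h, hf.memLp_deriv, fun φ hφ => ?_⟩
  rw [hf.integral_eq φ hφ]
  congr 1
  exact integral_congr_ae (h.mono fun t ht => by simp only [ht])

theorem bochnerNorm_le {E Y₁ : Type*} [NormedAddCommGroup E] {ι : E → Y₁} {p : ℝ≥0∞}
    {u : ℝ → Y₁} {w : ℝ → E}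
    (hw : MemLp w p (timeMeasure T)) (hwu : ∀ᵐ t ∂timeMeasure T, ι (w t) = u t) :
    bochnerNorm T p ι u ≤ eLpNorm w p (timeMeasure T) :=
  iInf_le_of_le w (iInf_le_of_le hw (iInf_le _ hwu))

theorem timeDerivNorm_le {u g : ℝ → X} (h : IsWeakTimeDeriv T u g) :
    timeDerivNorm T u ≤ eLpNorm g 2 (timeMeasure T) :=
  iInf_le_of_le g (iInf_le _ h)

/-- The error of the interpolation in time of an approximation `p` of `u`. -/
theorem bochnerNorm_sub_timeInterp_le [CompleteSpace X] (ι : X →L[ℝ] Y) (hT : 0 < T) (hh : 0 < h)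
    (hN0 : 0 < N) (hN : N * h = T) {u p : ℝ → Y} (hu : ContinuousOn u (Icc 0 T)) {w w' : ℝ → X}
    (hw : IsWeakTimeDeriv T w w') (hwu : ∀ᵐ t ∂timeMeasure T, ι (w t) = u t) {B : ℝ}
    (he : ∀ t ∈ Icc 0 T, ∃ z : X, ι z = u t - p t ∧ ‖z‖ ≤ B) :
    bochnerNorm T 2 ι (fun t => u t - timeInterp h p t) ≤
      ENNReal.ofReal (2 * h) * eLpNorm w' 2 (timeMeasure T) +
        timeMeasure T univ ^ (2 : ℝ≥0∞).toReal⁻¹ * ENNReal.ofReal B := by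
  obtain ⟨c, hc⟩ := hw.exists_eq_primitive hT
  -- No measurability of `z` in time is required: only its nodal values are used, through
  -- `timeInterp`.
  choose! z hz hzB using he
  -- The lift `w` is known almost everywhere only. Its continuous representative has well-defined
  -- nodal values, and by continuity it lifts `u` at every time.
  set W : ℝ → X := fun t => c + ∫ s in (0 : ℝ)..t, w' s with hW
  have hWc : ContinuousOn W (Icc 0 T) :=
    continuousOn_const.add (continuousOn_primitive hT.le (hw.memLp_deriv.integrable (by simp)))
  have hWu : ∀ t ∈ Icc 0 T, ι (W t) = u t := by
    refine eqOn_of_ae hT (ι.continuous.comp_continuousOn hWc) hu ?_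
    filter_upwards [hc, hwu] with t h1 h2
    rw [← h2, h1]
  have m1 : MemLp (fun t => W t - timeInterp h W t) 2 (timeMeasure T) :=
    (hw.memLp.ae_eq hc).sub (isWeakTimeDeriv_timeInterp hh hN0 hN W).memLp
  have m2 : MemLp (timeInterp h z) 2 (timeMeasure T) :=
    (isWeakTimeDeriv_timeInterp hh hN0 hN z).memLp
  -- The splitting `u - Ip = (u - Iu) + I(u - p)`, lifted to `X`.
  have e1 : ∀ᵐ t ∂timeMeasure T,
      ι (W t - timeInterp h W t + timeInterp h z t) = u t - timeInterp h p t := by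
    filter_upwards [ae_mem_timeMeasure T] with t ht
    obtain ⟨ha, hb⟩ := node_mem hh hN (Ioo_subset_Ico_self ht)
    simp only [timeInterp, map_add, map_sub, map_smul]
    rw [hWu t (Ioo_subset_Icc_self ht), hWu _ ha, hWu _ hb, hz _ ha, hz _ hb]
    module
  refine (bochnerNorm_le (m1.add m2) e1).trans ?_
  refine (eLpNorm_add_le m1.1 m2.1 (by simp)).trans (add_le_add ?_ ?_)
  · exact eLpNorm_sub_timeInterp_le hh hN c hw.memLp_deriv fun t _ => rfl
  · refine eLpNorm_le_of_ae_bound ?_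
    filter_upwards [ae_mem_timeMeasure T] with t ht
    exact norm_timeInterp_le hh hN hzB (Ioo_subset_Ico_self ht)

/-- The derivative of the error is `(v' - slope of v) + slope of (v - p)`. The second term is a
difference quotient, which is why `B` enters divided by `h`. -/
theorem timeDerivNorm_sub_timeInterp_le [CompleteSpace Y] (hT : 0 < T) (hh : 0 < h)
    (hN0 : 0 < N) (hN : N * h = T) {v p : ℝ → Y} (hv : ContinuousOn v (Icc 0 T))
    {w w' w'' : ℝ → Y} (hw : IsWeakTimeDeriv T w w') (hw' : IsWeakTimeDeriv T w' w'')
    (hwv : ∀ᵐ t ∂timeMeasure T, w t = v t) {B : ℝ} (he : ∀ t ∈ Icc 0 T, ‖v t - p t‖ ≤ B) :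
    timeDerivNorm T (fun t => v t - timeInterp h p t) ≤
      ENNReal.ofReal (2 * h) * eLpNorm w'' 2 (timeMeasure T) +
        timeMeasure T univ ^ (2 : ℝ≥0∞).toReal⁻¹ * ENNReal.ofReal (2 * B / h) := by
  obtain ⟨c, hc⟩ := hw.exists_eq_primitive hT
  obtain ⟨c', hc'⟩ := hw'.exists_eq_primitive hT
  have hi' : Integrable w' (timeMeasure T) := hw.memLp_deriv.integrable (by simp)
  set W : ℝ → Y := fun t => c' + ∫ s in (0 : ℝ)..t, w'' s with hW
  have hv' : ∀ t ∈ Icc 0 T, v t = c + ∫ s in (0 : ℝ)..t, w' s := by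
    refine eqOn_of_ae hT hv (continuousOn_const.add (continuousOn_primitive hT.le hi')) ?_
    filter_upwards [hc, hwv] with t h1 h2
    rw [← h2, h1]
  -- The derivative `w'` is replaced by its continuous representative `W`, whose oscillation is
  -- controlled by `w''`.
  have hvW : ∀ t ∈ Icc 0 T, v t = c + ∫ s in (0 : ℝ)..t, W s := by
    intro t ht
    rw [hv' t ht]
    congr 1
    have h1 : ∀ᵐ s : ℝ, s ∈ Ioo 0 T → w' s = W s := (ae_restrict_iff' measurableSet_Ioo).1 hc'
    refine intervalIntegral.integral_congr_ae ?_
    filter_upwards [h1, Measure.ae_ne volume T] with s hs hsT hst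
    rw [uIoc_of_le ht.1] at hst
    exact hs ⟨hst.1, lt_of_le_of_ne (hst.2.trans ht.2) hsT⟩
  have hd := (hw.congr_left hwv).sub (isWeakTimeDeriv_timeInterp hh hN0 hN p)
  refine (timeDerivNorm_le hd).trans ?_
  have e1 : (fun t => w' t - timeSlope h p t) =ᵐ[timeMeasure T]
      fun t => (W t - timeSlope h v t) + timeSlope h (fun t => v t - p t) t := by
    filter_upwards [hc'] with t ht
    have ht' : w' t = W t := ht
    rw [timeSlope_sub, ht']
    abel
  rw [eLpNorm_congr_ae e1]
  have m1 : AEStronglyMeasurable (fun t => W t - timeSlope h v t) (timeMeasure T) :=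
    (hw.memLp_deriv.1.congr hc').sub (stronglyMeasurable_timeSlope h v).aestronglyMeasurable
  refine (eLpNorm_add_le m1 (stronglyMeasurable_timeSlope h _).aestronglyMeasurable
    (by simp)).trans (add_le_add ?_ ?_)
  · exact eLpNorm_sub_timeSlope_le hh hN c' c hw'.memLp_deriv (fun t _ => rfl) hvW
  · refine eLpNorm_le_of_ae_bound ?_
    filter_upwards [ae_mem_timeMeasure T] with t ht
    exact norm_timeSlope_le hh hN he (Ioo_subset_Ico_self ht)

/-! ### Infima over lifts -/

/-- A bound for all pairs of lifts yields the bound by the sum of the two infima: dividing by `K`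
and subtracting isolates one infimum at a time. If there are no lifts, the infimum is `∞` and
nothing is claimed. -/
theorem le_mul_norm_add_norm {X₁ Y₁ : Type*} [NormedAddCommGroup X₁] [NormedSpace ℝ X₁]
    [NormedAddCommGroup Y₁] {x K : ℝ≥0∞} (hK0 : K ≠ 0) (hKt : K ≠ ⊤) {k : ℕ} {p : ℝ≥0∞}
    {ι₁ : X₁ → Y₁} {u₁ : ℝ → Y₁} {Y₂ : Type*} {ι₂ : Z → Y₂} {u₂ : ℝ → Y₂}
    (H : ∀ w : ℕ → ℝ → X₁, (∀ j < k, IsWeakTimeDeriv T (w j) (w (j + 1))) →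
      (∀ᵐ t ∂timeMeasure T, ι₁ (w 0 t) = u₁ t) → ∀ b : ℝ → Z, MemLp b p (timeMeasure T) →
      (∀ᵐ t ∂timeMeasure T, ι₂ (b t) = u₂ t) →
      x ≤ K * (eLpNorm (w k) 2 (timeMeasure T) + eLpNorm b p (timeMeasure T))) :
    x ≤ K * (sobolevBochnerNorm T k ι₁ u₁ + bochnerNorm T p ι₂ u₂) := by
  rw [← ENNReal.div_le_iff' hK0 hKt, ← tsub_le_iff_left]
  refine le_iInf fun b => le_iInf fun hb => le_iInf fun hbu => ?_
  rw [tsub_le_iff_left, ← tsub_le_iff_right]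
  refine le_iInf fun w => le_iInf fun _ => le_iInf fun hw => le_iInf fun hwu => ?_
  rw [tsub_le_iff_right, ENNReal.div_le_iff' hK0 hKt]
  refine (H w hw hwu b hb hbu).trans (mul_le_mul_right (add_le_add_left ?_ _) _)
  calc eLpNorm (w k) 2 (timeMeasure T)
      = (eLpNorm (w k) 2 (timeMeasure T) ^ 2) ^ (1 / 2 : ℝ) := by
        rw [← ENNReal.rpow_natCast, ← ENNReal.rpow_mul]
        simp
    _ ≤ _ := ENNReal.rpow_le_rpow (Finset.single_le_sum
        (f := fun j => eLpNorm (w j) 2 (timeMeasure T) ^ 2) (fun j _ => zero_le)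
        (Finset.self_mem_range_succ k)) (by norm_num)

theorem ae_norm_le_eLpNorm_top {b : ℝ → Z} (hb : MemLp b ⊤ (timeMeasure T)) :
    ∀ᵐ t ∂timeMeasure T, ‖b t‖ ≤ (eLpNorm b ⊤ (timeMeasure T)).toReal := by
  rw [eLpNorm_exponent_top]
  have ht : eLpNormEssSup b (timeMeasure T) ≠ ⊤ := by
    rw [← eLpNorm_exponent_top]
    exact hb.2.ne
  filter_upwards [ae_le_eLpNormEssSup (f := b) (μ := timeMeasure T)] with t h1
  rw [← toReal_enorm]
  exact ENNReal.toReal_mono ht h1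

end

section

variable {X Y Z : Type*} [NormedAddCommGroup X] [NormedSpace ℝ X] [CompleteSpace X]
  [NormedAddCommGroup Y] [NormedSpace ℝ Y] [NormedAddCommGroup Z] {T h : ℝ} {N : ℕ}

/-- The constant in the space-time error estimates. -/
def errorConst (T K : ℝ) : ℝ≥0∞ :=
  2 + timeMeasure T univ ^ (2 : ℝ≥0∞).toReal⁻¹ * ENNReal.ofReal (2 * K)

theorem errorConst_ne_top (T K : ℝ) : errorConst T K ≠ ⊤ := by
  rw [errorConst, timeMeasure_univ]
  refine ENNReal.add_ne_top.2 ⟨by simp, ENNReal.mul_ne_top (ENNReal.rpow_ne_top_of_nonneg ?_ ?_) ?_⟩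
  · positivity
  · simp
  · exact ENNReal.ofReal_ne_top

/-- The form `2 K h L` of the bound covers both uses: `K h L` for the error itself, and `2 B / h`
with `B = K h² L` for its time derivative. -/
theorem errorConst_le {K : ℝ} (hK : 0 ≤ K) (hh : 0 ≤ h) {S L : ℝ≥0∞} (hL : L ≠ ⊤) {B : ℝ}
    (hB : B ≤ 2 * K * (h * L.toReal)) :
    ENNReal.ofReal (2 * h) * S + timeMeasure T univ ^ (2 : ℝ≥0∞).toReal⁻¹ * ENNReal.ofReal B ≤
      errorConst T K * ENNReal.ofReal h * (S + L) := by
  have h1 : ENNReal.ofReal B ≤ ENNReal.ofReal (2 * K) * (ENNReal.ofReal h * L) := by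
    refine (ENNReal.ofReal_le_ofReal hB).trans (le_of_eq ?_)
    rw [ENNReal.ofReal_mul (by positivity), ENNReal.ofReal_mul hh, ENNReal.ofReal_toReal hL]
  have h2 : ENNReal.ofReal (2 * h) = 2 * ENNReal.ofReal h := by
    rw [ENNReal.ofReal_mul (by norm_num)]
    simp
  rw [h2, errorConst]
  set A := timeMeasure T univ ^ (2 : ℝ≥0∞).toReal⁻¹
  calc 2 * ENNReal.ofReal h * S + A * ENNReal.ofReal B
      ≤ 2 * ENNReal.ofReal h * S + A * (ENNReal.ofReal (2 * K) * (ENNReal.ofReal h * L)) :=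
        add_le_add_right (mul_le_mul_right h1 _) _
    _ ≤ 2 * ENNReal.ofReal h * S + A * (ENNReal.ofReal (2 * K) * (ENNReal.ofReal h * L)) +
        (2 * ENNReal.ofReal h * L + A * ENNReal.ofReal (2 * K) * ENNReal.ofReal h * S) :=
        le_self_add
    _ = _ := by ring

/-- The lift of `u` to `X` shows that `u t` is in the range of `ι` for almost every `t`. For `X =
H¹₀` this is how the zero boundary values needed in `hP` are obtained. The hypothesis `hclosed`
carries the projection estimate from almost every time to every time. -/
theorem bochnerNorm_error_le (ι : X → Y) (hadd : ∀ x y, ι (x + y) = ι x + ι y)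
    (hsmul : ∀ (c : ℝ) x, ι (c • x) = c • ι x) (hcont : Continuous ι)
    (hclosed : ∀ (B : ℝ) (x : ℕ → X) (y : Y), (∀ n, ‖x n‖ ≤ B) →
      Tendsto (fun n => ι (x n)) atTop (𝓝 y) → ∃ z, ‖z‖ ≤ B ∧ ι z = y)
    (ι₂ : Z → Y) (P : Y →L[ℝ] Y) {K : ℝ} (hK : 0 ≤ K)
    (hT : 0 < T) (hh : 0 < h) (hN0 : 0 < N) (hN : N * h = T)
    (hP : ∀ b : Z, ι₂ b ∈ range ι → ∃ z : X, ι z = ι₂ b - P (ι₂ b) ∧ ‖z‖ ≤ K * (h * ‖b‖))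
    {u : ℝ → Y} (hu : ContinuousOn u (Icc 0 T)) :
    bochnerNorm T 2 ι (fun t => u t - timeInterp h (fun t => P (u t)) t) ≤
      errorConst T K * ENNReal.ofReal h *
        (sobolevBochnerNorm T 1 ι u + bochnerNorm T ⊤ ι₂ u) := by
  refine le_mul_norm_add_norm (mul_ne_zero ?_ ?_)
    (ENNReal.mul_ne_top (errorConst_ne_top T K) ENNReal.ofReal_ne_top) fun w hw hwu b hb hbu => ?_
  · simp [errorConst]
  · simpa using hh
  have he : ContinuousOn (fun t => u t - P (u t)) (Icc 0 T) :=
    hu.sub (P.continuous.comp_continuousOn hu)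
  have h1 : ∀ t ∈ Icc 0 T, ∃ z : X, ι z = u t - P (u t) ∧
      ‖z‖ ≤ K * (h * (eLpNorm b ⊤ (timeMeasure T)).toReal) := by
    intro t ht
    -- At almost every time near `t`, the projection error has a lift of bounded norm. These errors
    -- converge in `Y` only, and `hclosed` provides a lift of the limit with the same bound.
    obtain ⟨x, hx, hxt⟩ := exists_seq_of_ae hT he (P := fun y => ∃ z : X, ι z = y ∧
      ‖z‖ ≤ K * (h * (eLpNorm b ⊤ (timeMeasure T)).toReal)) (by
        filter_upwards [hwu, hbu, ae_norm_le_eLpNorm_top hb] with t h1 h2 h3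
        obtain ⟨z, hz, hzb⟩ := hP (b t) ⟨w 0 t, h1.trans h2.symm⟩
        rw [h2] at hz
        exact ⟨z, hz, hzb.trans (by gcongr)⟩) ht
    choose z hz hzb using hx
    obtain ⟨y, hy, hy'⟩ := hclosed _ z _ hzb (by simpa only [hz] using hxt)
    exact ⟨y, hy', hy⟩
  let L : X →L[ℝ] Y := ⟨⟨⟨ι, hadd⟩, hsmul⟩, hcont⟩
  refine (bochnerNorm_sub_timeInterp_le L hT hh hN0 hN hu (hw 0 one_pos) hwu h1).trans ?_
  refine errorConst_le hK hh.le hb.2.ne ?_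
  have : 0 ≤ K * (h * (eLpNorm b ⊤ (timeMeasure T)).toReal) := by positivity
  linarith

/-- The derivative norm needs no lift, so boundary values cannot be deduced from it; the predicate
`Q` supplies them where required. In `Y` itself a norm bound passes to all times by continuity. -/
theorem timeDerivNorm_error_le (ι : Y → X) (hadd : ∀ x y, ι (x + y) = ι x + ι y)
    (hsmul : ∀ (c : ℝ) x, ι (c • x) = c • ι x) (hcont : Continuous ι)
    (ι₂ : Z → Y) (P : Y →L[ℝ] Y) {K : ℝ} (hK : 0 ≤ K)
    (hT : 0 < T) (hh : 0 < h) (hN0 : 0 < N) (hN : N * h = T) {Q : Y → Prop}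
    (hP : ∀ b : Z, Q (ι₂ b) → ‖ι (ι₂ b - P (ι₂ b))‖ ≤ K * (h ^ 2 * ‖b‖))
    {u : ℝ → Y} (hu : ContinuousOn u (Icc 0 T)) (hQ : ∀ᵐ t ∂timeMeasure T, Q (u t)) :
    timeDerivNorm T (fun t => ι (u t - timeInterp h (fun t => P (u t)) t)) ≤
      errorConst T K * ENNReal.ofReal h *
        (sobolevBochnerNorm T 2 id (fun t => ι (u t)) + bochnerNorm T ⊤ ι₂ u) := by
  obtain ⟨L, rfl⟩ : ∃ L : Y →L[ℝ] X, ⇑L = ι := ⟨⟨⟨⟨ι, hadd⟩, hsmul⟩, hcont⟩, rfl⟩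
  refine le_mul_norm_add_norm (mul_ne_zero ?_ ?_)
    (ENNReal.mul_ne_top (errorConst_ne_top T K) ENNReal.ofReal_ne_top) fun w hw hwu b hb hbu => ?_
  · simp [errorConst]
  · simpa using hh
  have he : ContinuousOn (fun t => L (u t) - L (P (u t))) (Icc 0 T) :=
    (L.continuous.comp_continuousOn hu).sub
      (L.continuous.comp_continuousOn (P.continuous.comp_continuousOn hu))
  have h1 := norm_le_of_ae hT he
    (B := K * (h ^ 2 * (eLpNorm b ⊤ (timeMeasure T)).toReal)) (by
      filter_upwards [hQ, hbu, ae_norm_le_eLpNorm_top hb] with t h1 h2 h3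
      have h4 := hP (b t) (by rwa [h2])
      rw [h2, map_sub] at h4
      exact h4.trans (by gcongr))
  simp only [map_sub, map_timeInterp]
  refine (timeDerivNorm_sub_timeInterp_le hT hh hN0 hN (L.continuous.comp_continuousOn hu)
    (hw 0 two_pos) (hw 1 one_lt_two) hwu h1).trans ?_
  refine errorConst_le hK hh.le hb.2.ne (le_of_eq ?_)
  field_simp

end

end SpaceTime
end

/-! ### The five estimates. -/

noncomputable section
namespace SpaceTime
open Filter Topology
variable {d : ℕ} {Ω : Set (Sp d)}

/-- The embedding of `L²(Ω)` into `H⁻¹(Ω)` as a continuous linear map. -/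
def toHm1L (Ω : Set (Sp d)) : L2 Ω →L[ℝ] Hm1 Ω :=
  (ContinuousLinearMap.precomp ℝ (H10.toL2 Ω)).comp (innerSL ℝ)

/-- An `L²` function determines its gradient, so the two `H¹` functions with the same image in
`L²(Ω)` coincide. -/
theorem H2.toH1_mem_H10 (hΩ : IsOpen Ω) {w : H2 Ω} (h : H2.toL2 Ω w ∈ range (H10.toL2 Ω)) :
    H2.toH1 w ∈ H10 Ω := by
  obtain ⟨v, hv⟩ := h
  have h1 : H1.toL2 Ω v.1 = H1.toL2 Ω (H2.toH1 w) := hv.trans (H2.toL2_toH1 w).symm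
  exact H1.toL2_injective hΩ h1 ▸ v.2

theorem H10.toL2_add (x y : H10 Ω) :
    H10.toL2 Ω (x + y) = H10.toL2 Ω x + H10.toL2 Ω y := map_add _ x y

theorem H10.toL2_smul (c : ℝ) (x : H10 Ω) :
    H10.toL2 Ω (c • x) = c • H10.toL2 Ω x := map_smul _ c x

theorem H10.norm_le_of_tendsto (B : ℝ) (x : ℕ → H10 Ω) (y : L2 Ω) (hx : ∀ n, ‖x n‖ ≤ B)
    (hy : Tendsto (fun n => H10.toL2 Ω (x n)) atTop (𝓝 y)) :
    ∃ z : H10 Ω, ‖z‖ ≤ B ∧ H10.toL2 Ω z = y := by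
  obtain ⟨z, hz, hzB, hzy⟩ :=
    H1.mem_H10_of_tendsto (w := fun n => (x n : H1 Ω)) hx (fun n => (x n).2) hy
  exact ⟨⟨z, hz⟩, hzB, hzy⟩

theorem toHm1_add (f g : L2 Ω) : toHm1 (f + g) = toHm1 f + toHm1 g :=
  map_add (toHm1L Ω) f g

theorem toHm1_smul (c : ℝ) (f : L2 Ω) : toHm1 (c • f) = c • toHm1 f :=
  map_smul (toHm1L Ω) c f

theorem continuous_toHm1 : Continuous (toHm1 : L2 Ω → Hm1 Ω) := (toHm1L Ω).continuous

theorem errorConst_mono (T : ℝ) {K K' : ℝ} (h : K ≤ K') : errorConst T K ≤ errorConst T K' := by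
  unfold errorConst
  gcongr

section

variable {T κ : ℝ} (hΩ : IsBoundedLipschitzDomain Ω) (hκ : 0 < κ) (hT : 0 < T)
include hΩ hκ hT

theorem exists_error_le_L2 : ∃ C, 0 ≤ C ∧ ∀ (N : ℕ) (_ : 0 < N) (h : ℝ) (_ : 0 < h)
    (_ : N * h = T) (M : SimplicialMesh Ω) (_ : M.IsUniform h κ) (u : ℝ → L2 Ω)
    (_ : ContinuousOn u (Icc 0 T)),
    bochnerNorm T 2 id (fun t => u t - M.tensorInterp h u t) ≤
      errorConst T C * ENNReal.ofReal h *
        (sobolevBochnerNorm T 1 id u + bochnerNorm T ⊤ (H1.toL2 Ω) u) := by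
  obtain ⟨C, hC, H⟩ := hΩ.exists_proj_le hκ
  refine ⟨C, hC, fun N hN0 h hh hN M hu u huc => ?_⟩
  exact bochnerNorm_error_le id (fun _ _ => rfl) (fun _ _ => rfl) continuous_id
    (fun _ _ y hx hy => ⟨y, le_of_tendsto hy.norm (Eventually.of_forall hx), rfl⟩) (H1.toL2 Ω)
    M.proj hC hT hh hN0 hN (fun b _ => ⟨_, rfl, H h M b hh hu⟩) huc

theorem exists_error_le_H1 : ∃ C, 0 ≤ C ∧ ∀ (N : ℕ) (_ : 0 < N) (h : ℝ) (_ : 0 < h)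
    (_ : N * h = T) (M : SimplicialMesh Ω) (_ : M.IsUniform h κ) (u : ℝ → L2 Ω)
    (_ : ContinuousOn u (Icc 0 T)),
    bochnerNorm T 2 (H1.toL2 Ω) (fun t => u t - M.tensorInterp h u t) ≤
      errorConst T C * ENNReal.ofReal h *
        (sobolevBochnerNorm T 1 (H1.toL2 Ω) u + bochnerNorm T ⊤ (H2.toL2 Ω) u) := by
  obtain ⟨C, hC, H⟩ := hΩ.exists_proj_H2_le hκ hT
  refine ⟨C, hC, fun N hN0 h hh hN M hu u huc => ?_⟩
  have hhT : h ≤ T := by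
    rw [← hN]
    exact le_mul_of_one_le_left hh.le (by exact_mod_cast hN0)
  exact @bochnerNorm_error_le (H1 Ω) (L2 Ω) (H2 Ω) _ _ _ _ _ _ T h N (H1.toL2 Ω)
    (fun x y => map_add _ x y) (fun c x => map_smul _ c x) (H1.toL2 Ω).continuous
    (fun _ _ _ hx hy => H1.norm_le_of_tendsto hx hy) (H2.toL2 Ω) M.proj C hC hT hh hN0 hN
    (fun b _ => H h M b hh hhT hu) u huc

theorem exists_error_le_H10 : ∃ C, 0 ≤ C ∧ ∀ (N : ℕ) (_ : 0 < N) (h : ℝ) (_ : 0 < h)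
    (_ : N * h = T) (M : SimplicialMesh Ω) (_ : M.IsUniform h κ) (u : ℝ → L2 Ω)
    (_ : ContinuousOn u (Icc 0 T)),
    bochnerNorm T 2 (H10.toL2 Ω) (fun t => u t - M.tensorInterp0 h u t) ≤
      errorConst T C * ENNReal.ofReal h *
        (sobolevBochnerNorm T 1 (H10.toL2 Ω) u + bochnerNorm T ⊤ (H2.toL2 Ω) u) := by
  obtain ⟨C, hC, H⟩ := hΩ.exists_proj0_H10_le hκ hT
  refine ⟨C, hC, fun N hN0 h hh hN M hu u huc => ?_⟩
  have hhT : h ≤ T := by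
    rw [← hN]
    exact le_mul_of_one_le_left hh.le (by exact_mod_cast hN0)
  refine @bochnerNorm_error_le (H10 Ω) (L2 Ω) (H2 Ω) _ _ _ _ _ _ T h N (H10.toL2 Ω) ?_ ?_ ?_ ?_
    (H2.toL2 Ω) M.proj0 C hC hT hh hN0 hN ?_ u huc
  · exact H10.toL2_add
  · exact H10.toL2_smul
  · exact (H10.toL2 Ω).continuous
  · exact H10.norm_le_of_tendsto
  · exact fun b hb => H h M b hh hhT hu (H2.toH1_mem_H10 hΩ.isOpen hb)

/-- The lift in `L^∞(H¹₀)` already carries the boundary values, so `Q` is trivial here. -/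
theorem exists_deriv_error_le_Hm1 : ∃ C, 0 ≤ C ∧ ∀ (N : ℕ) (_ : 0 < N) (h : ℝ) (_ : 0 < h)
    (_ : N * h = T) (M : SimplicialMesh Ω) (_ : M.IsUniform h κ) (u : ℝ → L2 Ω)
    (_ : ContinuousOn u (Icc 0 T)),
    timeDerivNorm T (fun t => toHm1 (u t - M.tensorInterp0 h u t)) ≤
      errorConst T C * ENNReal.ofReal h *
        (sobolevBochnerNorm T 2 id (fun t => toHm1 (u t)) + bochnerNorm T ⊤ (H10.toL2 Ω) u) := by
  obtain ⟨C, hC, H⟩ := hΩ.exists_proj0_Hm1_le hκ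
  refine ⟨C, hC, fun N hN0 h hh hN M hu u huc => ?_⟩
  exact @timeDerivNorm_error_le (Hm1 Ω) (L2 Ω) (H10 Ω) _ _ _ _ _ _ T h N toHm1 toHm1_add
    toHm1_smul continuous_toHm1 (H10.toL2 Ω) M.proj0 C hC hT hh hN0 hN (fun _ => True)
    (fun b _ => H h M b hh hu) u huc (ae_of_all _ fun _ => trivial)

theorem exists_deriv_error_le_L2 : ∃ C, 0 ≤ C ∧ ∀ (N : ℕ) (_ : 0 < N) (h : ℝ) (_ : 0 < h)
    (_ : N * h = T) (M : SimplicialMesh Ω) (_ : M.IsUniform h κ) (u : ℝ → L2 Ω)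
    (_ : ContinuousOn u (Icc 0 T)), (∀ᵐ t ∂timeMeasure T, u t ∈ range (H10.toL2 Ω)) →
    timeDerivNorm T (fun t => u t - M.tensorInterp0 h u t) ≤
      errorConst T C * ENNReal.ofReal h *
        (sobolevBochnerNorm T 2 id u + bochnerNorm T ⊤ (H2.toL2 Ω) u) := by
  obtain ⟨C, hC, H⟩ := hΩ.exists_proj0_H2_le hκ
  refine ⟨C, hC, fun N hN0 h hh hN M hu u huc hQ => ?_⟩
  exact timeDerivNorm_error_le id (fun _ _ => rfl) (fun _ _ => rfl) continuous_id (H2.toL2 Ω)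
    M.proj0 hC hT hh hN0 hN (Q := fun f => f ∈ range (H10.toL2 Ω))
    (fun b hb => H h M b hh hu (H2.toH1_mem_H10 hΩ.isOpen hb)) huc hQ

end

end SpaceTime
end

set_option maxHeartbeats 800000 in
theorem mainTheorem2 {d : ℕ} (hd : 0 < d) {Ω : Set (SpaceTime.Sp d)}
    (hΩ : SpaceTime.IsBoundedLipschitzDomain Ω) {T : ℝ} (hT : 0 < T) {κ : ℝ} (hκ : 0 < κ) :
    ∃ C : ℝ≥0, ∀ (N : ℕ) (_ : 0 < N) (h : ℝ) (_ : N * h = T)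
      (M : SpaceTime.SimplicialMesh Ω) (_ : M.IsUniform h κ)
      (u : ℝ → SpaceTime.L2 Ω) (_ : ContinuousOn u (Set.Icc 0 T)),
      -- the operators map into the discrete spaces
      M.tensorInterp h u ∈ SpaceTime.timeP1 h N M.S1 ∧
      M.tensorInterp0 h u ∈ SpaceTime.timeP1 h N M.S10 ∧
      -- the error in `L²(L²)`
      SpaceTime.bochnerNorm T 2 id (fun t => u t - M.tensorInterp h u t) ≤
        C * ENNReal.ofReal h *
          (SpaceTime.sobolevBochnerNorm T 1 id u +
            SpaceTime.bochnerNorm T ⊤ (SpaceTime.H1.toL2 Ω) u) ∧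
      -- the error in `L²(H¹)`
      SpaceTime.bochnerNorm T 2 (SpaceTime.H1.toL2 Ω)
          (fun t => u t - M.tensorInterp h u t) ≤
        C * ENNReal.ofReal h *
          (SpaceTime.sobolevBochnerNorm T 1 (SpaceTime.H1.toL2 Ω) u +
            SpaceTime.bochnerNorm T ⊤ (SpaceTime.H2.toL2 Ω) u) ∧
      -- the error in `L²(H¹₀)`
      SpaceTime.bochnerNorm T 2 (SpaceTime.H10.toL2 Ω)
          (fun t => u t - M.tensorInterp0 h u t) ≤
        C * ENNReal.ofReal h *
          (SpaceTime.sobolevBochnerNorm T 1 (SpaceTime.H10.toL2 Ω) u +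
            SpaceTime.bochnerNorm T ⊤ (SpaceTime.H2.toL2 Ω) u) ∧
      -- the error of the time derivative in `L²(H⁻¹)`
      SpaceTime.timeDerivNorm T (fun t => SpaceTime.toHm1 (u t - M.tensorInterp0 h u t)) ≤
        C * ENNReal.ofReal h *
          (SpaceTime.sobolevBochnerNorm T 2 id (fun t => SpaceTime.toHm1 (u t)) +
            SpaceTime.bochnerNorm T ⊤ (SpaceTime.H10.toL2 Ω) u) ∧
      -- the error of the time derivative in `L²(L²)`, for `u` with zero boundary values
      ((∀ᵐ t ∂SpaceTime.timeMeasure T, u t ∈ Set.range (SpaceTime.H10.toL2 Ω)) →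
        SpaceTime.timeDerivNorm T (fun t => u t - M.tensorInterp0 h u t) ≤
          C * ENNReal.ofReal h *
            (SpaceTime.sobolevBochnerNorm T 2 id u +
              SpaceTime.bochnerNorm T ⊤ (SpaceTime.H2.toL2 Ω) u)) := by
  obtain ⟨C₁, -, H₁⟩ := SpaceTime.exists_error_le_L2 hΩ hκ hT
  obtain ⟨C₂, -, H₂⟩ := SpaceTime.exists_error_le_H1 hΩ hκ hT
  obtain ⟨C₃, -, H₃⟩ := SpaceTime.exists_error_le_H10 hΩ hκ hT
  obtain ⟨C₄, -, H₄⟩ := SpaceTime.exists_deriv_error_le_Hm1 hΩ hκ hT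
  obtain ⟨C₅, -, H₅⟩ := SpaceTime.exists_deriv_error_le_L2 hΩ hκ hT
  -- `errorConst` is monotone in its second argument, so one bound for the five constants serves all
  -- estimates.
  obtain ⟨C, hC⟩ := Finset.exists_le ({C₁, C₂, C₃, C₄, C₅} : Finset ℝ)
  have hK : ((SpaceTime.errorConst T C).toNNReal : ENNReal) = SpaceTime.errorConst T C :=
    ENNReal.coe_toNNReal (SpaceTime.errorConst_ne_top T C)
  have key : ∀ {C' : ℝ} (a b : ENNReal), C' ≤ C → SpaceTime.errorConst T C' * a * b ≤
      (SpaceTime.errorConst T C).toNNReal * a * b := fun a b h => by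
    rw [hK]
    exact mul_le_mul' (mul_le_mul' (SpaceTime.errorConst_mono T h) le_rfl) le_rfl
  refine ⟨(SpaceTime.errorConst T C).toNNReal, fun N hN0 h hN M hu u huc => ?_⟩
  have hh : 0 < h := by
    have hN' : (0 : ℝ) < N := by exact_mod_cast hN0
    rw [← hN] at hT
    exact pos_of_mul_pos_right hT hN'.le
  refine ⟨SpaceTime.timeInterp_mem_timeP1 hh hN0 fun t => Submodule.starProjection_apply_mem _ _,
    SpaceTime.timeInterp_mem_timeP1 hh hN0 fun t => Submodule.starProjection_apply_mem _ _,
    ?_, ?_, ?_, ?_, fun hQ => ?_⟩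
  · exact (H₁ N hN0 h hh hN M hu u huc).trans (key _ _ (hC _ (by simp)))
  · exact (H₂ N hN0 h hh hN M hu u huc).trans (key _ _ (hC _ (by simp)))
  · exact (H₃ N hN0 h hh hN M hu u huc).trans (key _ _ (hC _ (by simp)))
  · exact (H₄ N hN0 h hh hN M hu u huc).trans (key _ _ (hC _ (by simp)))
  · exact (H₅ N hN0 h hh hN M hu u huc hQ).trans (key _ _ (hC _ (by simp)))
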